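/- Let $\psi(c)=\alpha c+\beta c^2+\int_{(0,\infty)}(e^{-cx}-1+cx\mathbf 1_{\{x<1\}})\,\Pi(dx)$, $c\ge 0$, with $\alpha\in\mathbb R$, $\beta\ge 0$ and $\int_{(0,\infty)}(1\wedge x^2)\,\Pi(dx)<\infty$, be a branching mechanism such that $\psi(c)>0$ for some $c>0$ and such that the right derivative $\psi'(0+)$ is finite. For $x\ge 0$ let $\psi^{-1}(x)$ be the largest root $c\ge 0$ of $\psi(c)=x$ (so $\psi^{-1}(0)$ is the largest root of $\psi$); derivatives of $\psi$ at $0$ are right derivatives. Let $a\ge 0$. *Trees.* A real tree is a metric space in which any two points $s,t$ are joined by a unique isometric path, whose range is denoted $[\![s,t]\!]$, and in which the range of every injective path is the segment between its end points. Let $\mathbb T$ be the set of root-preserving isometry classes $\overline T$ of complete locally compact rooted real trees, with the metric $\delta(T_1,T_2)=\sum_{k\ge1}2^{-k}\delta_{\rm cpct}(B_{T_1}(\rho_1,k),B_{T_2}(\rho_2,k))$, where $B$ denotes closed balls and $\delta_{\rm cpct}$ is the pointed Gromov–Hausdorff distance, and with its Borel $\sigma$-field. The degree $n(\sigma,T)$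 is the number of connected components of $T\setminus\{\sigma\}$; points $\sigma\ne\rho$ with $n(\sigma,T)=1$ are leaves (${\rm Lf}(T)$), those with $n(\sigma,T)\ge3$ are branching points (${\rm Br}(T)$); $\ell_T$ is the length measure, which does not charge the leaves. A discrete tree with edge lengths is a complete locally compact rooted real tree with all degrees finite and finitely many branching points in each ball. A GW$(\xi,q)$-real tree is the real tree of a Galton–Watson tree with offspring law $\xi$ in which every vertex (the ancestor included) carries an edge of length exponential with parameter $q$, all these lengths being independent. *Grafting.* Let $(T,d,\rho)$ be a discrete tree with edge lengths such that, for each $\sigma\in{\rm Br}(T)$ and with $l=n(\sigma,T)-1$, the limit of $\psi^{(l)}(c)$ as $c\downarrow\psi^{-1}(0)$ exists, is finite and is nonzero. For $0\le\mu<\lambda$ put $x_\lambda=\psi^{-1}(\lambda)$, $b=x_\lambda-x_\mu$, and $$\xi_{\mu,\lambda}(0)=\frac{\lambda-\mu}{b\,\psi'(x_\lambda)},\quad \xi_{\mu,\lambda}(1)=0,\quad \xi_{\mu,\lambda}(k)=\frac{|\psi^{(k)}(x_\lambda)|}{\psi'(x_\lambda)}\frac{b^{k-1}}{k!}\ (k\ge2),$$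 $$\nu^{\mu,\lambda}_l(k)=\frac{|\psi^{(l+k)}(x_\lambda)|}{|\psi^{(l)}(x_\mu)|}\frac{b^k}{k!}\ (l\ge2,\ k\ge0),\quad \nu^{\mu,\lambda}_1(0)=0,\quad \nu^{\mu,\lambda}_1(k)=\frac{|\psi^{(1+k)}(x_\lambda)|}{\psi'(x_\lambda)-\psi'(x_\mu)}\frac{b^k}{k!}\ (k\ge1).$$ Let $\mathcal P$ be a Poisson point process on $T$ with intensity $(\psi'(x_\lambda)-\psi'(x_\mu))\,\ell_T$. On each $\sigma\in\mathcal P\cup{\rm Br}(T)$ graft $N_\sigma$ independent GW$(\xi_{\mu,\lambda},\psi'(x_\lambda))$-real trees, where $N_\sigma$ has law $\nu^{\mu,\lambda}_l$, $l=n(\sigma,T)-1$; on $\rho$ graft a Poisson number, with parameter $a(x_\lambda-x_\mu)$, of such trees; all these choices are independent given $\mathcal P$. The resulting tree is $Q^a_{\mu,\lambda}(T)$. For $\lambda>0$ let $\mathcal F(\lambda)=Q^a_{0,\lambda}(T)$ and, for $0\le\mu\le\lambda$, $$\mathcal F_\mu(\lambda)=T\cup\bigcup\{[\![\rho,\sigma]\!]:\sigma\in{\rm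 Lf}(\mathcal F(\lambda))\setminus{\rm Lf}(T),\ U_\sigma\le\mu/\lambda\},$$ with the metric of $\mathcal F(\lambda)$, where given $\mathcal F(\lambda)$ the $U_\sigma$ are i.i.d. uniform on $[0,1]$. *Claim.* There is a family of random complete locally compact rooted real trees $(\mathcal F_\lambda,d_\lambda,r)$, $\lambda\in[0,\infty)$, defined on one probability space and with a common root $r$, such that each $\overline{\mathcal F}_\lambda$ is a $\mathbb T$-valued random variable and almost surely: (i) for all $0\le\mu\le\lambda$, $\mathcal F_\mu\subset\mathcal F_\lambda$ and $d_\mu=d_\lambda|_{\mathcal F_\mu\times\mathcal F_\mu}$; (ii) the map $\lambda\mapsto\overline{\mathcal F}_\lambda$ is càdlàg in $(\mathbb T,\delta)$; and such that for every $\lambda>0$ the $\mathbb T$-valued processes $(\overline{\mathcal F}_\mu,\ 0\le\mu\le\lambda)$ and $(\overline{\mathcal F}_\mu(\lambda),\ 0\le\mu\le\lambda)$ have the same law (on the product $\sigma$-field). -/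

import Mathlib

open MeasureTheory ProbabilityTheory Filter Topology Set
open scoped NNReal ENNReal

namespace LevyForest

/-! ### Rooted real trees -/

section RealTrees

variable {X : Type} [MetricSpace X]

/-- The segment `⟦s, t⟧`: the points lying metrically between `s` and `t`. In a real tree this is
the range of the unique isometric path from `s` to `t`. -/
def segment (s t : X) : Set X := {x | dist s x + dist x t = dist s t}

/-- `X` is a real tree: any two points are joined by a unique isometric path, and the range of every
injective path is the segment between its end points. -/
structure IsRealTree (X : Type) [MetricSpace X] : Prop where
  geodesic : ∀ s t : X, ∃! f : Icc (0 : ℝ) (dist s t) → X,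
    Isometry f ∧ f ⟨0, le_rfl, dist_nonneg⟩ = s ∧ f ⟨dist s t, dist_nonneg, le_rfl⟩ = t
  arc : ∀ q : unitInterval → X, Continuous q → Function.Injective q →
    range q = segment (q 0) (q 1)

/-- The degree of `s`: the number (possibly infinite) of connected components of `X \ {s}`. -/
noncomputable def degree (s : X) : ℕ∞ := ENat.card (ConnectedComponents {x : X // x ≠ s})

/-- The leaves of a tree with root `ρ`. -/
def leaves (ρ : X) : Set X := {s | s ≠ ρ ∧ degree s = 1}

/-- The branching points of a tree with root `ρ`. -/
def branchPoints (ρ : X) : Set X := {s | s ≠ ρ ∧ 3 ≤ degree s}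

/-- The length measure: it does not charge the leaves, and a segment contained in the
complement of the set of leaves has mass equal to its length. -/
noncomputable def lengthMeasure [MeasurableSpace X] [BorelSpace X] (ρ : X) : Measure X :=
  (Measure.hausdorffMeasure 1).restrict (leaves ρ)ᶜ

/-- A discrete tree with edge lengths, rooted at `ρ`: a locally compact real tree (`ProperSpace`
says that closed balls are compact, i.e. that the tree is complete and locally compact) with
finitely many branching points in each ball and with finite degrees. -/
structure IsDiscreteTree (X : Type) [MetricSpace X] (ρ : X) : Prop where
  isRealTree : IsRealTree X
  proper : ProperSpace X
  finite_branchPoints : ∀ r : ℝ, (Metric.closedBall ρ r ∩ branchPoints ρ).Finite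
  finite_degree : ∀ s : X, degree s ≠ ⊤

end RealTrees

/-! ### The space of isometry classes of locally compact rooted real trees -/

/-- A (complete) locally compact rooted real tree. -/
structure RootedTree : Type 1 where
  carrier : Type
  metric : MetricSpace carrier
  root : carrier
  isRealTree : IsRealTree carrier
  proper : ProperSpace carrier

instance (X : RootedTree) : MetricSpace X.carrier := X.metric

/-- Equivalence of rooted trees: root preserving isometry. -/
instance RootedTree.setoid : Setoid RootedTree where
  r X Y := ∃ e : X.carrier ≃ᵢ Y.carrier, e X.root = Y.root
  iseqv :=
    { refl := fun X => ⟨IsometryEquiv.refl _, rfl⟩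
      symm := by
        rintro X Y ⟨e, he⟩
        exact ⟨e.symm, by rw [← he]; exact e.symm_apply_apply _⟩
      trans := by
        rintro X Y Z ⟨e, he⟩ ⟨f, hf⟩
        exact ⟨e.trans f, by simp [he, hf]⟩ }

/-- The set `𝕋` of isometry classes of locally compact rooted real trees. -/
def TreeClass : Type 1 := Quotient RootedTree.setoid

/-- The Gromov-Hausdorff distance of two pointed compact metric spaces. -/
noncomputable def ghDist (X Y : Type) [MetricSpace X] [MetricSpace Y] (x : X) (y : Y) : ℝ :=
  sInf {r | ∃ (E : Type) (_ : MetricSpace E) (f : X → E) (g : Y → E),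
    Isometry f ∧ Isometry g ∧
      r = max (Metric.hausdorffDist (range f) (range g)) (dist (f x) (g y))}

theorem ghDist_congr {X Y X' Y' : Type} [MetricSpace X] [MetricSpace Y] [MetricSpace X']
    [MetricSpace Y'] {x : X} {y : Y} {x' : X'} {y' : Y'} (e : X ≃ᵢ X') (e' : Y ≃ᵢ Y')
    (he : e x = x') (he' : e' y = y') : ghDist X Y x y = ghDist X' Y' x' y' := by
  subst he he'
  unfold ghDist
  congr 1
  ext r
  constructor
  · rintro ⟨E, mE, f, g, hf, hg, rfl⟩
    refine ⟨E, mE, f ∘ e.symm, g ∘ e'.symm, hf.comp e.symm.isometry, hg.comp e'.symm.isometry, ?_⟩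
    simp [range_comp, e.symm.range_eq_univ, e'.symm.range_eq_univ, image_univ]
  · rintro ⟨E, mE, f, g, hf, hg, rfl⟩
    refine ⟨E, mE, f ∘ e, g ∘ e', hf.comp e.isometry, hg.comp e'.isometry, ?_⟩
    simp [range_comp, e.range_eq_univ, e'.range_eq_univ, image_univ]

/-- The closed ball of radius `k` centred at the root, as a subspace. -/
abbrev RootedTree.Ball (X : RootedTree) (k : ℕ) : Type :=
  Metric.closedBall X.root (k : ℝ)

/-- The root of `X`, as a point of the ball. -/
def RootedTree.ballRoot (X : RootedTree) (k : ℕ) : X.Ball k :=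
  ⟨X.root, Metric.mem_closedBall_self k.cast_nonneg⟩

/-- The restriction of a root preserving isometry to the balls. -/
def ballEquiv {X Y : RootedTree} (e : X.carrier ≃ᵢ Y.carrier) (he : e X.root = Y.root) (k : ℕ) :
    X.Ball k ≃ᵢ Y.Ball k where
  toFun x := ⟨e x.1, by
    have := x.2
    simp only [Metric.mem_closedBall] at this ⊢
    rwa [← he, e.dist_eq]⟩
  invFun y := ⟨e.symm y.1, by
    have := y.2
    simp only [Metric.mem_closedBall] at this ⊢
    rwa [← e.dist_eq, e.apply_symm_apply, he]⟩
  left_inv x := by ext; simp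
  right_inv y := by ext; simp
  isometry_toFun := Isometry.of_dist_eq fun x y => e.dist_eq x.1 y.1

/-- The pointed Gromov-Hausdorff distance of two locally compact rooted trees:
`∑ 2⁻ᵏ δ_cpct(B_X(ρ, k), B_Y(ρ, k))`, the sum running over `k ≥ 1`. -/
noncomputable def RootedTree.delta (X Y : RootedTree) : ℝ :=
  ∑' k : ℕ, (1 / 2 : ℝ) ^ (k + 1) *
    ghDist (X.Ball (k + 1)) (Y.Ball (k + 1)) (X.ballRoot (k + 1)) (Y.ballRoot (k + 1))

namespace TreeClass

/-- The isometry class of a rooted tree. -/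
def mk (X : RootedTree) : TreeClass := Quotient.mk _ X

/-- The pointed Gromov-Hausdorff metric `δ` on `𝕋`. -/
noncomputable def delta : TreeClass → TreeClass → ℝ :=
  Quotient.lift₂ RootedTree.delta (by
    rintro X Y X' Y' ⟨e, he⟩ ⟨e', he'⟩
    unfold RootedTree.delta
    congr 1
    ext k
    congr 1
    exact ghDist_congr (ballEquiv e he (k + 1)) (ballEquiv e' he' (k + 1))
      (Subtype.ext he) (Subtype.ext he'))

/-- The topology of the metric `δ`: a set is open iff it contains a `δ`-ball around each of its
points. -/
instance : TopologicalSpace TreeClass where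
  IsOpen U := ∀ x ∈ U, ∃ ε > 0, ∀ y, delta x y < ε → y ∈ U
  isOpen_univ := fun _ _ => ⟨1, one_pos, fun _ _ => mem_univ _⟩
  isOpen_inter := by
    rintro U V hU hV x ⟨hxU, hxV⟩
    obtain ⟨ε, hε, h⟩ := hU x hxU
    obtain ⟨ε', hε', h'⟩ := hV x hxV
    exact ⟨min ε ε', lt_min hε hε', fun y hy =>
      ⟨h y (hy.trans_le (min_le_left _ _)), h' y (hy.trans_le (min_le_right _ _))⟩⟩
  isOpen_sUnion := by
    rintro S hS x ⟨U, hU, hx⟩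
    obtain ⟨ε, hε, h⟩ := hS U hU x hx
    exact ⟨ε, hε, fun y hy => ⟨U, hU, h y hy⟩⟩

/-- `𝕋` carries its Borel σ-algebra. -/
instance : MeasurableSpace TreeClass := borel _

instance : BorelSpace TreeClass := ⟨rfl⟩

end TreeClass

/-- A locally compact rooted real tree whose points are elements of `E`, with a metric of its
own. -/
structure TreeIn (E : Type) where
  carrier : Set E
  metric : MetricSpace carrier
  root : carrier
  isRealTree : IsRealTree carrier
  proper : ProperSpace carrier

/-- The metric of a tree in `E`. -/
def TreeIn.treeDist {E : Type} (F : TreeIn E) (x y : F.carrier) : ℝ :=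
  @dist _ F.metric.toDist x y

/-- The isometry class of a tree in `E`. -/
def TreeIn.toClass {E : Type} (F : TreeIn E) : TreeClass :=
  TreeClass.mk ⟨F.carrier, F.metric, F.root, F.isRealTree, F.proper⟩

/-- The tree reduced to its root. -/
def pointTree : RootedTree where
  carrier := Unit
  metric := inferInstance
  root := ()
  isRealTree :=
    { geodesic := fun s t => by
        refine ⟨fun _ => (), ⟨Isometry.of_dist_eq ?_, rfl, rfl⟩, fun _ _ => rfl⟩
        rintro ⟨x, hx⟩ ⟨y, hy⟩
        rw [dist_self] at hx hy
        have h1 : x = 0 := le_antisymm hx.2 hx.1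
        have h2 : y = 0 := le_antisymm hy.2 hy.1
        subst h1 h2
        simp
      arc := fun q _ hq => absurd (hq (Subsingleton.elim (q 0) (q 1))) zero_ne_one }
  proper := inferInstance

open Classical in
/-- The isometry class of a pointed metric space that is a locally compact real tree. (The
value on other spaces, the class of the point tree, is a convention.) -/
noncomputable def classOf (X : Type) [m : MetricSpace X] (ρ : X) : TreeClass :=
  if h : IsRealTree X ∧ ProperSpace X then TreeClass.mk ⟨X, m, ρ, h.1, h.2⟩
  else TreeClass.mk pointTree

/-! ### The real tree of a marked discrete tree -/

/-- Vertices are words; the word `u` is a vertex of the ordered tree in which each vertex `v` has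
`k v` children `v ++ [0], …, v ++ [k v - 1]`. -/
def IsVertex (k : List ℕ → ℕ) (u : List ℕ) : Prop :=
  ∀ (v : List ℕ) (j : ℕ), (v ++ [j]) <+: u → j < k v

/-- The points of the real tree of the discrete tree with offspring numbers `k` and edge
lengths `l`: the root `(∅, 0)` and the points `(u, s)`, `0 < s ≤ l u`, of the edge below the
vertex `u`. -/
@[ext]
structure TreePoint (k : List ℕ → ℕ) (l : List ℕ → ℝ≥0) where
  word : List ℕ
  pos : ℝ
  mem : (word = [] ∧ pos = 0) ∨ (IsVertex k word ∧ 0 < pos ∧ pos ≤ l word)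

/-- The total length of the edges of the strict ancestors of `u`. -/
noncomputable def lengthBelow (l : List ℕ → ℝ≥0) (u : List ℕ) : ℝ :=
  ∑ i ∈ Finset.range u.length, (l (u.take i) : ℝ)

/-- The last common ancestor (longest common prefix) of two words. -/
def meet : List ℕ → List ℕ → List ℕ
  | a :: u, b :: v => if a = b then a :: meet u v else []
  | _, _ => []

/-- The distance to the root of the point at distance `s` above the lower end of the edge `u`. -/
noncomputable def height (l : List ℕ → ℝ≥0) (u : List ℕ) (s : ℝ) : ℝ := s + lengthBelow l u

open Classical in
/-- The distance of the points `(u, s)` and `(v, t)`. -/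
noncomputable def pointDist (l : List ℕ → ℝ≥0) (u : List ℕ) (s : ℝ) (v : List ℕ) (t : ℝ) : ℝ :=
  if meet u v ≠ u ∧ meet u v ≠ v then
    height l u s + height l v t - 2 * (lengthBelow l (meet u v) + l (meet u v))
  else |height l u s - height l v t|

section PointDist

/-- Height of the meeting point, recursively (auxiliary). -/
noncomputable def meetHeight : (List ℕ → ℝ≥0) → List ℕ → ℝ → List ℕ → ℝ → ℝ
  | l, a :: u, s, b :: v, t =>
      l [] + if a = b then meetHeight (fun w => l (a :: w)) u s v t else 0
  | l, u, s, v, t => min (height l u s) (height l v t)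

theorem height_nil (l : List ℕ → ℝ≥0) (s : ℝ) : height l [] s = s := by
  simp [height, lengthBelow]

theorem lengthBelow_cons (l : List ℕ → ℝ≥0) (a : ℕ) (u : List ℕ) :
    lengthBelow l (a :: u) = l [] + lengthBelow (fun w => l (a :: w)) u := by
  simp [lengthBelow, Finset.sum_range_succ', add_comm]

theorem height_cons (l : List ℕ → ℝ≥0) (a : ℕ) (u : List ℕ) (s : ℝ) :
    height l (a :: u) s = l [] + height (fun w => l (a :: w)) u s := by
  simp only [height, lengthBelow_cons]; ring

theorem lengthBelow_nonneg (l : List ℕ → ℝ≥0) (u : List ℕ) : 0 ≤ lengthBelow l u :=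
  Finset.sum_nonneg fun _ _ => NNReal.coe_nonneg _

theorem meetHeight_nil_left (l : List ℕ → ℝ≥0) (s : ℝ) (v : List ℕ) (t : ℝ) :
    meetHeight l [] s v t = min s (height l v t) := by
  cases v <;> simp [meetHeight, height_nil]

theorem meetHeight_nil_right (l : List ℕ → ℝ≥0) (s : ℝ) (u : List ℕ) (t : ℝ) :
    meetHeight l u s [] t = min (height l u s) t := by
  cases u <;> simp [meetHeight, height_nil]

theorem pointDist_eq (l : List ℕ → ℝ≥0) (u : List ℕ) (s : ℝ) (v : List ℕ) (t : ℝ) :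
    pointDist l u s v t = height l u s + height l v t - 2 * meetHeight l u s v t := by
  have habs : ∀ x y : ℝ, |x - y| = x + y - 2 * min x y := by
    intro x y
    rcases le_total x y with h | h
    · rw [min_eq_left h, abs_of_nonpos (by linarith)]; ring
    · rw [min_eq_right h, abs_of_nonneg (by linarith)]; ring
  induction u generalizing l v with
  | nil => simp [pointDist, meet, meetHeight_nil_left, habs, height_nil]
  | cons a u ih =>
    cases v with
    | nil => simp [pointDist, meet, meetHeight_nil_right, habs, height_nil]
    | cons b v =>
      by_cases hab : a = b
      · subst hab
        have h := ih (fun w => l (a :: w)) v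
        simp only [pointDist, meet, meetHeight, if_true, height_cons, ne_eq, List.cons.injEq,
          true_and, lengthBelow_cons] at h ⊢
        split_ifs at h ⊢ with h1
        · linarith
        · rw [show (l [] : ℝ) + height (fun w => l (a :: w)) u s -
            (l [] + height (fun w => l (a :: w)) v t) = height (fun w => l (a :: w)) u s -
              height (fun w => l (a :: w)) v t by ring, h]
          ring
      · simp [pointDist, meet, meetHeight, hab, lengthBelow]

theorem meetHeight_comm (l : List ℕ → ℝ≥0) (u : List ℕ) (s : ℝ) (v : List ℕ) (t : ℝ) :
    meetHeight l u s v t = meetHeight l v t u s := by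
  induction u generalizing l v with
  | nil => rw [meetHeight_nil_left, meetHeight_nil_right, min_comm]
  | cons a u ih =>
    cases v with
    | nil => rw [meetHeight_nil_left, meetHeight_nil_right, min_comm]
    | cons b v =>
      by_cases hab : a = b
      · subst hab; simp [meetHeight, ih]
      · simp [meetHeight, hab, Ne.symm hab]

theorem meetHeight_self (l : List ℕ → ℝ≥0) (u : List ℕ) (s : ℝ) :
    meetHeight l u s u s = height l u s := by
  induction u generalizing l with
  | nil => simp [meetHeight, height_nil]
  | cons a u ih => simp [meetHeight, ih, height_cons]

theorem meetHeight_le (l : List ℕ → ℝ≥0) (u : List ℕ) {s : ℝ} (hs : 0 ≤ s) (v : List ℕ) (t : ℝ) :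
    meetHeight l u s v t ≤ height l u s := by
  induction u generalizing l v with
  | nil => rw [meetHeight_nil_left, height_nil]; exact min_le_left _ _
  | cons a u ih =>
    cases v with
    | nil => rw [meetHeight_nil_right]; exact min_le_left _ _
    | cons b v =>
      rw [height_cons]
      have hn : 0 ≤ height (fun w => l (a :: w)) u s := add_nonneg hs (lengthBelow_nonneg _ _)
      by_cases hab : a = b
      · simp only [meetHeight, hab, if_true]
        simpa [hab] using ih (fun w => l (a :: w)) v
      · simpa [meetHeight, hab] using hn

theorem height_nonneg (l : List ℕ → ℝ≥0) (u : List ℕ) {s : ℝ} (hs : 0 ≤ s) : 0 ≤ height l u s :=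
  add_nonneg hs (lengthBelow_nonneg _ _)

theorem meetHeight_nonneg (l : List ℕ → ℝ≥0) (u : List ℕ) {s : ℝ} (hs : 0 ≤ s) (w : List ℕ)
    {r : ℝ} (hr : 0 ≤ r) : 0 ≤ meetHeight l u s w r := by
  induction u generalizing l w with
  | nil => rw [meetHeight_nil_left]; exact le_min hs (height_nonneg _ _ hr)
  | cons b u ih =>
    cases w with
    | nil => rw [meetHeight_nil_right]; exact le_min (height_nonneg _ _ hs) hr
    | cons d w =>
      simp only [meetHeight]
      split_ifs
      · exact add_nonneg (NNReal.coe_nonneg _) (ih _ _)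
      · simp

theorem meetHeight_ultra (l : List ℕ → ℝ≥0) (u v w : List ℕ) {s t r : ℝ}
    (hs : 0 ≤ s) (hr : 0 ≤ r) (hs' : s ≤ l u) (ht' : t ≤ l v) (hr' : r ≤ l w) :
    min (meetHeight l u s v t) (meetHeight l v t w r) ≤ meetHeight l u s w r := by
  induction u generalizing l v w with
  | nil =>
    rw [meetHeight_nil_left, meetHeight_nil_left]
    refine le_min ((min_le_left _ _).trans (min_le_left _ _)) ((min_le_right _ _).trans ?_)
    rw [meetHeight_comm]
    exact meetHeight_le _ _ hr _ _
  | cons a u ih =>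
    cases w with
    | nil =>
      rw [meetHeight_nil_right, meetHeight_nil_right]
      exact le_min ((min_le_left _ _).trans (meetHeight_le _ _ hs _ _))
        ((min_le_right _ _).trans (min_le_right _ _))
    | cons c w =>
      cases v with
      | nil =>
        have hge : (l [] : ℝ) ≤ meetHeight l (a :: u) s (c :: w) r := by
          by_cases hac : a = c
          · subst hac
            simp only [meetHeight, if_true, le_add_iff_nonneg_right]
            exact meetHeight_nonneg _ _ hs _ hr
          · simp [meetHeight, hac]
        rw [meetHeight_nil_right]
        exact ((min_le_left _ _).trans (min_le_right _ _)).trans (ht'.trans hge)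
      | cons b v =>
        have ih' := ih (fun x => l (a :: x)) v w hs'
        by_cases hab : a = b
        · subst hab
          by_cases hac : a = c
          · subst hac
            have := ih' ht' hr'
            simp only [meetHeight, if_true]
            rw [min_add_add_left]
            linarith
          · simp [meetHeight, hac]
        · by_cases hac : a = c
          · subst hac
            have hnn := meetHeight_nonneg (fun x => l (a :: x)) u hs w hr
            simp [meetHeight, hab, Ne.symm hab, hnn]
          · simp only [meetHeight, hab, hac, if_false]
            exact min_le_left _ _

theorem eq_of_meetHeight (l : List ℕ → ℝ≥0) (u v : List ℕ) {s t : ℝ}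
    (hu : (u = [] ∧ s = 0) ∨ (0 < s ∧ s ≤ l u)) (hv : (v = [] ∧ t = 0) ∨ (0 < t ∧ t ≤ l v))
    (h : height l u s + height l v t - 2 * meetHeight l u s v t = 0) : u = v ∧ s = t := by
  induction u generalizing l v with
  | nil =>
    cases v with
    | nil =>
      rw [meetHeight_nil_left, height_nil, height_nil] at h
      refine ⟨rfl, ?_⟩
      rcases le_total s t with h' | h'
      · rw [min_eq_left h'] at h; linarith
      · rw [min_eq_right h'] at h; linarith
    | cons b v =>
      exfalso
      simp only [reduceCtorEq, false_and, false_or] at hv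
      have hs : s ≤ l [] := by
        rcases hu with ⟨_, rfl⟩ | hu
        · exact NNReal.coe_nonneg _
        · exact hu.2
      have := lengthBelow_nonneg (fun x => l (b :: x)) v
      rw [meetHeight_nil_left, height_nil, height_cons, height] at h
      have := min_le_left s ((l [] : ℝ) + (t + lengthBelow (fun x => l (b :: x)) v))
      linarith [hv.1]
  | cons a u ih =>
    simp only [reduceCtorEq, false_and, false_or] at hu
    have hA := lengthBelow_nonneg (fun x => l (a :: x)) u
    cases v with
    | nil =>
      exfalso
      have ht : t ≤ l [] := by
        rcases hv with ⟨_, rfl⟩ | hv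
        · exact NNReal.coe_nonneg _
        · exact hv.2
      rw [meetHeight_nil_right, height_nil, height_cons, height] at h
      have := min_le_right ((l [] : ℝ) + (s + lengthBelow (fun x => l (a :: x)) u)) t
      linarith [hu.1]
    | cons b v =>
      simp only [reduceCtorEq, false_and, false_or] at hv
      have hB := lengthBelow_nonneg (fun x => l (b :: x)) v
      by_cases hab : a = b
      · subst hab
        simp only [meetHeight, if_true, height_cons] at h
        obtain ⟨rfl, rfl⟩ := ih (fun x => l (a :: x)) v (Or.inr hu) (Or.inr hv) (by linarith)
        exact ⟨rfl, rfl⟩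
      · exfalso
        simp only [meetHeight, hab, if_false, height, lengthBelow_cons] at h
        linarith [hu.1, hv.1]

end PointDist

namespace TreePoint

variable {k : List ℕ → ℕ} {l : List ℕ → ℝ≥0}

theorem pos_nonneg (x : TreePoint k l) : 0 ≤ x.pos := by
  rcases x.mem with h | h
  · exact h.2.ge
  · exact h.2.1.le

theorem pos_le (x : TreePoint k l) : x.pos ≤ l x.word := by
  rcases x.mem with h | h
  · rw [h.2]; exact NNReal.coe_nonneg _
  · exact h.2.2

noncomputable instance : MetricSpace (TreePoint k l) where
  dist x y := pointDist l x.word x.pos y.word y.pos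
  dist_self x := by
    rw [pointDist_eq, meetHeight_self]; ring
  dist_comm x y := by
    rw [pointDist_eq, pointDist_eq, meetHeight_comm]; ring
  dist_triangle x y z := by
    simp only [pointDist_eq]
    have h := meetHeight_ultra l x.word y.word z.word x.pos_nonneg z.pos_nonneg
      x.pos_le y.pos_le z.pos_le
    have h1 := meetHeight_le l y.word y.pos_nonneg x.word x.pos
    have h2 := meetHeight_le l y.word y.pos_nonneg z.word z.pos
    rw [meetHeight_comm] at h1
    rcases min_le_iff.1 h with h | h <;> linarith
  eq_of_dist_eq_zero {x y} h := by
    change pointDist _ _ _ _ _ = 0 at h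
    rw [pointDist_eq] at h
    have := eq_of_meetHeight l x.word y.word (x.mem.imp id fun h => h.2)
      (y.mem.imp id fun h => h.2) h
    exact TreePoint.ext this.1 this.2

/-- The root `(∅, 0)`. -/
def root : TreePoint k l := ⟨[], 0, Or.inl ⟨rfl, rfl⟩⟩

end TreePoint

/-! ### Grafting -/

/-- The points of the space obtained from `X` by grafting, for each `i`, the space `Y i` with root
`r i` on the point `s i` of `X`: the disjoint union of `X` and of the sets `Y i \ {r i}`. -/
inductive Graft {X ι : Type} {Y : ι → Type} (s : ι → X) (r : ∀ i, Y i) : Type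
  | base (x : X) : Graft s r
  | piece (i : ι) (y : Y i) (h : y ≠ r i) : Graft s r

namespace Graft

variable {X ι : Type} {Y : ι → Type} [MetricSpace X] [∀ i, MetricSpace (Y i)]
  {s : ι → X} {r : ∀ i, Y i}

open Classical in
/-- The distance of the grafted space. -/
noncomputable def graftDist : Graft s r → Graft s r → ℝ
  | base x, base x' => dist x x'
  | base x, piece i y _ => dist y (r i) + dist (s i) x
  | piece i y _, base x => dist y (r i) + dist (s i) x
  | piece i y _, piece j y' _ =>
      if h : i = j then dist (h ▸ y) y' else dist y (r i) + dist (s i) (s j) + dist y' (r j)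

theorem graftDist_same (i : ι) (y y' : Y i) (h : y ≠ r i) (h' : y' ≠ r i) :
    graftDist (piece i y h : Graft s r) (piece i y' h') = dist y y' := by
  simp [graftDist]

theorem graftDist_ne {i j : ι} (hij : i ≠ j) (y : Y i) (y' : Y j) (h : y ≠ r i) (h' : y' ≠ r j) :
    graftDist (piece i y h : Graft s r) (piece j y' h') =
      dist y (r i) + dist (s i) (s j) + dist y' (r j) := by
  simp [graftDist, hij]

noncomputable instance : MetricSpace (Graft s r) where
  dist := graftDist
  dist_self x := by
    cases x with
    | base x => exact dist_self x
    | piece i y h => exact (graftDist_same i y y h h).trans (dist_self y)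
  dist_comm x y := by
    cases x with
    | base x =>
      cases y with
      | base y => exact dist_comm x y
      | piece j y h => rfl
    | piece i x h =>
      cases y with
      | base y => rfl
      | piece j y h' =>
        by_cases hij : i = j
        · subst hij
          rw [graftDist_same, graftDist_same, dist_comm]
        · rw [graftDist_ne hij, graftDist_ne (Ne.symm hij), dist_comm (s i)]
          ring
  dist_triangle x y z := by
    cases x with
    | base x =>
      cases y with
      | base y =>
        cases z with
        | base z => exact dist_triangle x y z
        | piece k z hz =>
          simp only [graftDist]
          linarith [dist_triangle (s k) y x, dist_comm x y]
      | piece j y hy =>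
        cases z with
        | base z =>
          simp only [graftDist]
          linarith [dist_triangle x (s j) z, dist_comm x (s j), dist_nonneg (x := y) (y := r j)]
        | piece k z hz =>
          by_cases hjk : j = k
          · subst hjk
            rw [graftDist_same]
            simp only [graftDist]
            linarith [dist_triangle z y (r j), dist_comm y z]
          · rw [graftDist_ne hjk]
            simp only [graftDist]
            linarith [dist_triangle (s k) (s j) x, dist_comm (s k) (s j),
              dist_nonneg (x := y) (y := r j)]
    | piece i x hx =>
      cases y with
      | base y =>
        cases z with
        | base z =>
          simp only [graftDist]
          linarith [dist_triangle (s i) y z]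
        | piece k z hz =>
          by_cases hik : i = k
          · subst hik
            rw [graftDist_same]
            simp only [graftDist]
            linarith [dist_triangle_right x z (r i), dist_nonneg (x := s i) (y := y)]
          · rw [graftDist_ne hik]
            simp only [graftDist]
            linarith [dist_triangle_right (s i) (s k) y]
      | piece j y hy =>
        cases z with
        | base z =>
          by_cases hij : i = j
          · subst hij
            rw [graftDist_same]
            simp only [graftDist]
            linarith [dist_triangle x y (r i)]
          · rw [graftDist_ne hij]
            simp only [graftDist]
            linarith [dist_triangle (s i) (s j) z, dist_nonneg (x := y) (y := r j)]
        | piece k z hz =>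
          by_cases hij : i = j
          · subst hij
            by_cases hik : i = k
            · subst hik
              simp only [graftDist_same]
              exact dist_triangle _ _ _
            · rw [graftDist_same, graftDist_ne hik, graftDist_ne hik]
              linarith [dist_triangle x y (r i)]
          · by_cases hik : i = k
            · subst hik
              rw [graftDist_same, graftDist_ne hij, graftDist_ne (Ne.symm hij)]
              linarith [dist_triangle_right x z (r i), dist_nonneg (x := s i) (y := s j),
                dist_nonneg (x := s j) (y := s i), dist_nonneg (x := y) (y := r j)]
            · by_cases hjk : j = k
              · subst hjk
                rw [graftDist_same, graftDist_ne hij, graftDist_ne hik]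
                linarith [dist_triangle z y (r j), dist_comm y z]
              · rw [graftDist_ne hij, graftDist_ne hik, graftDist_ne hjk]
                linarith [dist_triangle (s i) (s j) (s k), dist_nonneg (x := y) (y := r j)]
  eq_of_dist_eq_zero {x y} h := by
    change graftDist x y = 0 at h
    cases x with
    | base x =>
      cases y with
      | base y => rw [eq_of_dist_eq_zero (x := x) (y := y) h]
      | piece j y hy =>
        simp only [graftDist] at h
        exact absurd h (by have := dist_pos.2 hy; have := dist_nonneg (x := s j) (y := x); linarith)
    | piece i x hx =>
      have hx' := dist_pos.2 hx
      cases y with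
      | base y =>
        simp only [graftDist] at h
        exact absurd h (by have := dist_nonneg (x := s i) (y := y); linarith)
      | piece j y hy =>
        have hy' := dist_pos.2 hy
        by_cases hij : i = j
        · subst hij
          rw [graftDist_same] at h
          have := eq_of_dist_eq_zero h
          subst this
          rfl
        · rw [graftDist_ne hij] at h
          exact absurd h (by have := dist_nonneg (x := s i) (y := s j); linarith)

end Graft

/-! ### Branching mechanisms and the associated laws -/

/-- The characteristics of a branching mechanism; only the restriction of `levy` to
`(0, ∞)` matters. -/
structure BranchingMechanism where
  α : ℝ
  β : ℝ
  levy : Measure ℝ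
  β_nonneg : 0 ≤ β
  levy_finite : ∫⁻ x in Ioi (0 : ℝ), ENNReal.ofReal (min 1 (x ^ 2)) ∂levy < ∞

namespace BranchingMechanism

/-- `ψ(c) = α c + β c² + ∫ (e^{-cx} - 1 + c x 1_{x < 1}) Π(dx)`. -/
noncomputable def psi (ψ : BranchingMechanism) (c : ℝ) : ℝ :=
  ψ.α * c + ψ.β * c ^ 2 +
    ∫ x in Ioi (0 : ℝ), (Real.exp (-c * x) - 1 + c * x * (if x < 1 then 1 else 0)) ∂ψ.levy

noncomputable instance : CoeFun BranchingMechanism fun _ => ℝ → ℝ := ⟨psi⟩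

variable (ψ : BranchingMechanism)

/-- The `k`-th derivative of `ψ` on `[0, ∞)` (the right derivative at `0`). -/
noncomputable def der (k : ℕ) (c : ℝ) : ℝ := iteratedDerivWithin k ψ (Ici 0) c

/-- `ψ⁻¹(x)`, the largest root `c` of `ψ(c) = x`; in particular `ψ⁻¹(0) = γ` is the largest root
of `ψ`. -/
noncomputable def inv (x : ℝ) : ℝ := sSup {c | 0 ≤ c ∧ ψ c = x}

/-- The offspring distribution `ξ_{μ,λ}`. -/
noncomputable def xi (μ lam : ℝ) : ℕ → ℝ
  | 0 => (lam - μ) / ((ψ.inv lam - ψ.inv μ) * ψ.der 1 (ψ.inv lam))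
  | 1 => 0
  | k + 2 => |ψ.der (k + 2) (ψ.inv lam)| / ψ.der 1 (ψ.inv lam) *
      ((ψ.inv lam - ψ.inv μ) ^ (k + 1) / (k + 2).factorial)

/-- The distribution `ν_l^{μ,λ}` of the number of trees grafted on a point of degree `l + 1`. -/
noncomputable def nu (μ lam : ℝ) (l k : ℕ) : ℝ :=
  if l = 1 then
    if k = 0 then 0
    else |ψ.der (1 + k) (ψ.inv lam)| / (ψ.der 1 (ψ.inv lam) - ψ.der 1 (ψ.inv μ)) *
      ((ψ.inv lam - ψ.inv μ) ^ k / k.factorial)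
  else |ψ.der (l + k) (ψ.inv lam)| / |ψ.der l (ψ.inv μ)| *
      ((ψ.inv lam - ψ.inv μ) ^ k / k.factorial)

end BranchingMechanism

open Classical in
/-- The law on `ℕ` with the weights `w`. (The value for weights that do not sum to `1` is a
convention.) -/
noncomputable def lawOfWeights (w : ℕ → ℝ) : Measure ℕ :=
  if ∑' k, ENNReal.ofReal (w k) = 1 then Measure.sum fun k => ENNReal.ofReal (w k) • Measure.dirac k
  else Measure.dirac 0

/-! ### The grafting procedure and the leaf colouring -/

/-- The sites of a tree at which other trees may be grafted: the `i`-th point of the Poisson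
process in the annulus `{n ≤ d(ρ, ·) < n + 1}`, the branching points, and the root. -/
inductive Site {T : Type} [MetricSpace T] (ρ : T) : Type
  | poisson (n i : ℕ) : Site ρ
  | branch (σ : branchPoints ρ) : Site ρ
  | root : Site ρ

/-- The randomness used for the grafting procedure and for the colouring: the numbers of points of
the Poisson process in the annuli; their positions; the numbers of trees grafted on the
sites; and, for the vertex `u` of the `j`-th tree grafted on the site `σ`, its number of
children, the length of its edge, and the colouring variable of its leaf. -/
abbrev GraftData {T : Type} [MetricSpace T] (ρ : T) : Type :=
  (ℕ → ℕ) × (ℕ × ℕ → T) × (Site ρ → ℕ) × (Site ρ × ℕ × List ℕ → ℕ × ℝ≥0 × unitInterval)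

section Law

variable {T : Type} [MetricSpace T] [MeasurableSpace T] [BorelSpace T]

/-- The annulus `{n ≤ d(ρ, ·) < n + 1}`. -/
def annulus (ρ : T) (n : ℕ) : Set T := {x | (n : ℝ) ≤ dist ρ x ∧ dist ρ x < n + 1}

/-- The intensity `(ψ'(ψ⁻¹(λ)) - ψ'(ψ⁻¹(μ))) ℓ_T` of the Poisson point process. -/
noncomputable def intensity (ψ : BranchingMechanism) (μ lam : ℝ) (ρ : T) : Measure T :=
  ENNReal.ofReal (ψ.der 1 (ψ.inv lam) - ψ.der 1 (ψ.inv μ)) • lengthMeasure ρ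

open Classical in
/-- The law of one point of the Poisson process in an annulus: the normalized intensity. (In an
annulus without mass there are no points and the law is irrelevant.) -/
noncomputable def pointLaw (ψ : BranchingMechanism) (μ lam : ℝ) (ρ : T) (n : ℕ) : Measure T :=
  if intensity ψ μ lam ρ (annulus ρ n) = 0 then Measure.dirac ρ
  else ProbabilityTheory.cond (intensity ψ μ lam ρ) (annulus ρ n)

/-- The law of the number of trees grafted on a site: `ν_1` on the points of the Poisson process
(which have degree `2` almost surely), `ν_l` with `l = n(σ, T) - 1` on the branching point
`σ`, and the Poisson law of parameter `a (ψ⁻¹(λ) - ψ⁻¹(μ))` at the root. -/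
noncomputable def siteLaw (ψ : BranchingMechanism) (a : ℝ≥0) (μ lam : ℝ) (ρ : T) :
    Site ρ → Measure ℕ
  | .poisson _ _ => lawOfWeights (ψ.nu μ lam 1)
  | .branch σ => lawOfWeights (ψ.nu μ lam ((degree σ.1).toNat - 1))
  | .root => poissonMeasure (a * (ψ.inv lam - ψ.inv μ).toNNReal)

/-- The law of the triple of a vertex of a grafted tree: its offspring number, with law
`ξ_{μ,λ}`, the length of its edge, exponential with parameter `ψ'(ψ⁻¹(λ))`, and an independent
uniform variable. -/
noncomputable def vertexLaw (ψ : BranchingMechanism) (μ lam : ℝ) :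
    Measure (ℕ × ℝ≥0 × unitInterval) :=
  (lawOfWeights (ψ.xi μ lam)).prod
    (((expMeasure (ψ.der 1 (ψ.inv lam))).map Real.toNNReal).prod volume)

/-- The joint law of the randomness: all coordinates are independent. In particular, the number of
points in the annulus `n` is Poisson, with the intensity of the annulus as its parameter, and
given this number the points are i.i.d., so that they form a Poisson point process. -/
noncomputable def graftLaw (ψ : BranchingMechanism) (a : ℝ≥0) (μ lam : ℝ) (ρ : T) :
    Measure (GraftData ρ) :=
  (Measure.infinitePi fun n : ℕ =>
      poissonMeasure (intensity ψ μ lam ρ (annulus ρ n)).toNNReal).prod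
    ((Measure.infinitePi fun p : ℕ × ℕ => pointLaw ψ μ lam ρ p.1).prod
      ((Measure.infinitePi (siteLaw ψ a μ lam ρ)).prod
        (Measure.infinitePi fun _ : Site ρ × ℕ × List ℕ => vertexLaw ψ μ lam)))

end Law

namespace GraftData

variable {T : Type} [MetricSpace T] {ρ : T} (D : GraftData ρ)

/-- The number of trees grafted on a site; in the annulus `n` only the sites `i < K_n`, with `K_n`
the number of points of the Poisson process, are present. -/
def count : Site ρ → ℕ
  | .poisson n i => if i < D.1 n then D.2.2.1 (.poisson n i) else 0
  | σ => D.2.2.1 σ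

/-- The position of a site in the tree. -/
def position : Site ρ → T
  | .poisson n i => D.2.1 (n, i)
  | .branch σ => σ.1
  | .root => ρ

/-- The labels `(σ, j)` of the grafted trees. -/
abbrev Index : Type := {p : Site ρ × ℕ // p.2 < count D p.1}

/-- The grafted tree with label `p`; under `graftLaw` a Galton-Watson real tree with parameters
`(ξ_{μ,λ}, ψ'(ψ⁻¹(λ)))`. -/
abbrev Piece (p : Index D) : Type :=
  TreePoint (fun u => (D.2.2.2 (p.1.1, p.1.2, u)).1) (fun u => (D.2.2.2 (p.1.1, p.1.2, u)).2.1)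

/-- The tree `Q^a_{μ,λ}(T)`, with root `Graft.base ρ`. -/
abbrev Grafted : Type :=
  Graft (fun p : Index D => position D p.1.1) (fun p => (TreePoint.root : Piece D p))

/-- The black tree: the union of `T` and of the segments `⟦ρ, σ⟧`, where `σ` runs over the leaves
of `Q^a_{μ,λ}(T)` that are not leaves of `T` and whose colouring variable `U_σ` is at most
`t`. These leaves lie in the grafted trees, for a point of `T` that is not a leaf of `T` is not a
leaf of the larger tree. -/
def black (t : ℝ) : Set (Grafted D) :=
  range Graft.base ∪
    {x | ∃ (p : Index D) (y : Piece D p) (h : y ≠ TreePoint.root),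
      (Graft.piece p y h : Grafted D) ∈ leaves (Graft.base ρ : Grafted D) ∧
      ((D.2.2.2 (p.1.1, p.1.2, y.word)).2.2 : ℝ) ≤ t ∧
      x ∈ segment (Graft.base ρ : Grafted D) (Graft.piece p y h)}

/-- The isometry class of the black tree `F_μ(λ)`, `t = μ / λ`, with the metric restricted from `Q^a_{μ,λ}(T)`. -/
noncomputable def blackClass (t : ℝ) : TreeClass :=
  classOf (black D t) ⟨Graft.base ρ, Or.inl ⟨ρ, rfl⟩⟩

end GraftData

end LevyForest

/-! The theorem rests on a consistency property. Give the new leaves of F(λ) the colours λU and keep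
only what lies below a leaf of colour at most μ; the result, with the retained colours, has the law
of F(μ) with its own colours. Granting this, the levels 1, 2, 3, … can be coupled so that each
realization is the pruning of the next, and F_μ is read off any level above μ.

Consistency. Put x_λ = ψ⁻¹(λ) and b_λ = x_λ - x_0 (`gap`). Apart from leaves and the Poisson law at
the root, the weights have the form (derivative of ψ at x_λ) · b_λ^k / k!. Keeping each tree
independently with probability b_μ / b_λ replaces b_λ by b_μ and the derivative at x_λ by its Taylor
series towards x_μ, that is, by the derivative at x_μ (`thinWeights_eq`). The derivatives of ψ
alternate in sign, so all these series have nonnegative terms and nothing about convergence is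
needed. The ratio b_μ / b_λ is indeed the probability that a Galton-Watson tree of level λ keeps a
leaf, and a surviving tree is pruned to a Galton-Watson tree of level μ. A vertex left with one
child disappears and two edges merge; the random sum of exponential lengths that arises is
exponential with the smaller parameter (`lintegral_expLaw_mixture`). `treeLaw_prune` proves only
upper bounds, by induction on the height; they become equalities because the mixtures on both sides
are probability measures (`mix_map_thin_eq`). `map_skeleton_prune` puts together the root, the
branching points and the Poisson points of each annulus.

Geometry. To obtain true inclusions instead of isometric embeddings, all trees are placed in one
space, the ℓ¹ product of T and of the finitely supported functions of a label. A point is recorded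
by its grafting site and by the length that the path to it spends on edges of each label, where the
label of an edge is the smallest colour above it. Distinct colours make this isometric
(`Fine.separates`, `Separates.isometry_embed`), and pruning changes neither the labels nor the
lengths below a retained leaf (`treeSet_pruneAll`). Real trees are handled through the four-point
condition.

Regularity. Only finitely many grafted vertices occur within a given distance of the root, and
colours matter only through which leaves are black. Hence the black class is a continuous function
of discrete data and lengths, which yields its measurability, its right continuity in μ and its left
limits.

The coupling is a Markov chain whose transition kernels are conditional laws
(`exists_chain_coupling`), and the laws up to level λ are compared by `map_blackClass_eq`. -/

namespace LevyForest

/-! ### The four-point condition -/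

section TreeLike

/-- A metric space with the four-point condition in which any two points are joined by a
geodesic. -/
structure TreeLike (X : Type) [MetricSpace X] : Prop where
  four : ∀ x y z u : X, dist x y + dist z u ≤ max (dist x z + dist y u) (dist x u + dist y z)
  mid : ∀ (a b : X) (t : ℝ), 0 ≤ t → t ≤ dist a b → ∃ y, dist a y = t ∧ dist y b = dist a b - t

variable {X : Type} [MetricSpace X]

/-- Twice the Gromov product of `x` and `y` with base point `v`. -/
noncomputable def gromov (v x y : X) : ℝ := dist v x + dist v y - dist x y

theorem gromov_nonneg (v x y : X) : 0 ≤ gromov v x y := by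
  have := dist_triangle_left x y v
  unfold gromov; linarith

theorem gromov_comm (v x y : X) : gromov v x y = gromov v y x := by
  unfold gromov; rw [dist_comm x y]; ring

theorem mem_segment_iff_gromov {v x y : X} : v ∈ segment x y ↔ gromov v x y = 0 := by
  simp only [segment, Set.mem_ofPred_eq, gromov, dist_comm x v]
  constructor <;> intro h <;> linarith

/-- The based form of the four-point condition. -/
theorem four_of_gromov (w : X) (h : ∀ x y z : X, min (gromov w x y) (gromov w y z) ≤ gromov w x z)
    (x y z u : X) : dist x y + dist z u ≤ max (dist x z + dist y u) (dist x u + dist y z) := by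
  -- In Gromov products the claim reads (x|y) + (z|u) ≥ min((x|z) + (y|u), (x|u) + (y|z)). The four
  -- instances bound (x|y) and (z|u) from below, passing through z or u and through x or y.
  have h1 := h x z y
  have h2 := h z x u
  have h3 := h x u y
  have h4 := h z y u
  have hc := fun a b => gromov_comm w a b
  rw [hc z y] at h1
  rw [hc z x] at h2
  rw [hc u y] at h3
  rw [hc z y] at h4
  simp only [gromov] at h1 h2 h3 h4
  rw [le_max_iff]
  rcases min_le_iff.1 h1 with h1 | h1 <;> rcases min_le_iff.1 h2 with h2 | h2 <;>
  rcases min_le_iff.1 h3 with h3 | h3 <;> rcases min_le_iff.1 h4 with h4 | h4 <;>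
  first
    | (left; linarith)
    | (right; linarith)
    | (rcases le_total (dist w x + dist w z - dist x z) (dist w y + dist w z - dist y z) with h5 | h5 <;>
       rcases le_total (dist w x + dist w u - dist x u) (dist w y + dist w u - dist y u) with h6 | h6 <;>
       first
        | (left; linarith)
        | (right; linarith))


theorem gromov_le_left (w x y : X) : gromov w x y ≤ 2 * dist w x := by
  have := dist_triangle w x y
  unfold gromov; linarith

theorem continuous_gromov (v a : X) : Continuous fun y => gromov v a y := by
  unfold gromov; fun_prop

/-- The four-point condition and the existence of geodesics need only be checked from one base
point. -/
theorem treeLike_of_based (w : X)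
    (h : ∀ x y z : X, min (gromov w x y) (gromov w y z) ≤ gromov w x z)
    (hd : ∀ (x : X) (t : ℝ), 0 ≤ t → t ≤ dist w x → ∃ y, dist w y = t ∧ dist y x = dist w x - t) :
    TreeLike X where
  four := four_of_gromov w h
  mid := by
    -- The part of the geodesic from a to b that descends to the branching point of a and b lies on
    -- the segment from w to a. The remaining part is obtained by exchanging a and b.
    have key : ∀ (a b : X) (t : ℝ), 0 ≤ t → t ≤ dist w a - gromov w a b / 2 →
        ∃ y, dist a y = t ∧ dist y b = dist a b - t := by
      intro a b t ht ht'
      have hg := gromov_nonneg w a b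
      obtain ⟨y, hy, hya⟩ := hd a (dist w a - t) (by linarith) (by linarith)
      refine ⟨y, by rw [dist_comm]; linarith, ?_⟩
      have h1 := h y a b
      have h2 := h a y b
      have h3 := gromov_le_left w y b
      simp only [gromov] at h1 h2 h3 ht' hg
      rw [dist_comm a y] at h2
      have : dist y b = dist a b - t := by
        rcases min_le_iff.1 h1 with h1 | h1 <;> rcases min_le_iff.1 h2 with h2 | h2 <;> linarith
      exact this
    intro a b t ht ht'
    rcases le_total t (dist w a - gromov w a b / 2) with h1 | h1
    · exact key a b t ht h1
    · obtain ⟨y, hy, hy'⟩ := key b a (dist a b - t) (by linarith) (by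
        rw [gromov_comm]; unfold gromov at *; linarith)
      rw [dist_comm b a] at hy'
      exact ⟨y, by rw [dist_comm]; linarith, by rw [dist_comm]; linarith⟩

theorem right_mem_segment (a b : X) : b ∈ segment a b := by simp [segment]

theorem left_mem_segment (a b : X) : a ∈ segment a b := by simp [segment]

theorem segment_comm (a b : X) : segment a b = segment b a := by
  ext x
  simp only [segment, Set.mem_ofPred_eq]
  rw [dist_comm b x, dist_comm x a, dist_comm b a, add_comm]

theorem isClosed_segment (a b : X) : IsClosed (segment a b) :=
  isClosed_eq (by fun_prop) continuous_const

namespace TreeLike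

theorem gromov_min (hX : TreeLike X) (w x y z : X) :
    min (gromov w x y) (gromov w y z) ≤ gromov w x z := by
  have h := hX.four x z y w
  simp only [gromov]
  rw [min_le_iff]
  rw [dist_comm w x, dist_comm w y, dist_comm w z]
  rw [le_max_iff, dist_comm z y] at h
  rcases h with h | h
  · left; linarith
  · right; linarith [dist_comm x w]

/-- Having a positive Gromov product at v is an equivalence relation on the complement of v, by the
ultrametric inequality. Its classes are open: the ball about z of radius d(v, z) lies in the class
of z. A connected set cannot meet two of them. -/
theorem gromov_pos_of_isPreconnected (hX : TreeLike X) {S : Set X} (hS : IsPreconnected S) {v : X}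
    (hv : v ∉ S) {a b : X} (ha : a ∈ S) (hb : b ∈ S) : 0 < gromov v a b := by
  by_contra hab
  have hab : gromov v a b = 0 := le_antisymm (not_lt.1 hab) (gromov_nonneg _ _ _)
  have hva : ∀ y ∈ S, 0 < dist v y := fun y hy => dist_pos.2 fun h => hv (h ▸ hy)
  obtain ⟨y, -, hyU, hyV⟩ := hS {y | 0 < gromov v a y}
    (⋃ z ∈ {z | z ∈ S ∧ gromov v a z = 0}, Metric.ball z (dist v z))
    (isOpen_lt continuous_const (continuous_gromov v a))
    (isOpen_biUnion fun _ _ => Metric.isOpen_ball)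
    (fun y hy => by
      rcases (gromov_nonneg v a y).lt_or_eq with h | h
      · exact Or.inl h
      · refine Or.inr (mem_biUnion (x := y) ⟨hy, h.symm⟩ ?_)
        exact Metric.mem_ball_self (hva y hy))
    ⟨a, ha, by
      have := hva a ha
      simp only [gromov, dist_self, Set.mem_ofPred_eq]; linarith⟩
    ⟨b, hb, mem_biUnion (x := b) ⟨hb, hab⟩ (Metric.mem_ball_self (hva b hb))⟩
  simp only [mem_iUnion, Metric.mem_ball] at hyV
  obtain ⟨z, ⟨hzS, hz⟩, hyz⟩ := hyV
  have h1 := hX.gromov_min v a y z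
  have h2 : 0 < gromov v y z := by
    have := dist_nonneg (x := v) (y := y)
    unfold gromov; linarith
  rw [hz] at h1
  exact absurd h1 (not_le.2 (lt_min hyU h2))

theorem dist_of_mem_segment (hX : TreeLike X) {s t y z : X} (hy : y ∈ segment s t)
    (hz : z ∈ segment s t) : dist y z = |dist s y - dist s z| := by
  have h1 := hX.gromov_min s y t z
  simp only [segment, Set.mem_ofPred_eq] at hy hz
  have h2 := dist_triangle s y z
  have h3 := dist_triangle s z y
  rw [dist_comm z y] at h3
  simp only [gromov] at h1
  rw [dist_comm t z] at h1
  rcases min_le_iff.1 h1 with h1 | h1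
  · rw [abs_of_nonpos] <;> linarith
  · rw [abs_of_nonneg] <;> linarith

/-- The median is the point of the segment from a to b at distance (b|c), based at a, from a. -/
theorem exists_median (hX : TreeLike X) (a b c : X) :
    ∃ m, m ∈ segment a b ∧ m ∈ segment a c ∧ m ∈ segment b c := by
  have hg := gromov_le_left a b c
  obtain ⟨m, h1, h2⟩ := hX.mid a b (gromov a b c / 2)
    (by have := gromov_nonneg a b c; linarith) (by linarith)
  have h3 := hX.gromov_min a m b c
  have h4 := dist_triangle a m c
  have h5 := dist_triangle b m c
  simp only [segment, Set.mem_ofPred_eq]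
  simp only [gromov] at *
  rw [dist_comm b m] at *
  rcases min_le_iff.1 h3 with h3 | h3 <;> refine ⟨m, ?_, ?_, ?_⟩ <;> linarith [dist_comm b m]

/-- A point of a segment is determined by its distance to one end, whence the uniqueness of
geodesics. An injective path covers the segment, since a connected set missing a point v cannot
contain two points separated by v. It does not leave the segment: the median of q s and the two ends
is visited both before and after time s, so by injectivity it is q s itself. -/
theorem isRealTree (hX : TreeLike X) : IsRealTree X where
  geodesic := by
    intro s t
    have hmid : ∀ t' : ℝ, ∃ y, 0 ≤ t' → t' ≤ dist s t → dist s y = t' ∧ dist y t = dist s t - t' := by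
      intro t'
      by_cases h : 0 ≤ t' ∧ t' ≤ dist s t
      · obtain ⟨y, hy⟩ := hX.mid s t t' h.1 h.2
        exact ⟨y, fun _ _ => hy⟩
      · exact ⟨s, fun h1 h2 => absurd ⟨h1, h2⟩ h⟩
    choose y hyy using hmid
    have hy := fun u h1 h2 => (hyy u h1 h2).1
    have hy' := fun u h1 h2 => (hyy u h1 h2).2
    have hseg : ∀ u ∈ Icc (0 : ℝ) (dist s t), y u ∈ segment s t := fun u hu => by
      simp only [segment, Set.mem_ofPred_eq, hy u hu.1 hu.2, hy' u hu.1 hu.2]; ring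
    refine ⟨fun u => y u, ⟨Isometry.of_dist_eq fun u v => ?_, ?_, ?_⟩, ?_⟩
    · rw [hX.dist_of_mem_segment (hseg u u.2) (hseg v v.2), hy u u.2.1 u.2.2, hy v v.2.1 v.2.2]
      rfl
    · exact (dist_eq_zero.1 (hy 0 le_rfl dist_nonneg)).symm
    · refine dist_eq_zero.1 ((hy' _ dist_nonneg le_rfl).trans (sub_self _))
    · rintro f ⟨hf, hf0, hf1⟩
      funext u
      have h0 : dist s (f u) = u := by
        conv_lhs => rw [← hf0]
        rw [hf.dist_eq, Subtype.dist_eq, Real.dist_eq, zero_sub, abs_neg, abs_of_nonneg u.2.1]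
      have h1 : dist (f u) t = dist s t - u := by
        conv_lhs => rw [← hf1]
        rw [hf.dist_eq, Subtype.dist_eq, Real.dist_eq, abs_sub_comm, abs_of_nonneg]
        linarith [u.2.2]
      have hfu : f u ∈ segment s t := by
        simp only [segment, Set.mem_ofPred_eq, h0, h1]; ring
      have := hX.dist_of_mem_segment hfu (hseg u u.2)
      rw [h0, hy u u.2.1 u.2.2, sub_self, abs_zero] at this
      exact dist_eq_zero.1 this
  arc := by
    intro q hq hinj
    have key : ∀ (s t : unitInterval) (v : X), s ≤ t → v ∈ segment (q s) (q t) →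
        ∃ u ∈ Icc s t, q u = v := by
      intro s t v hst hv
      by_contra hcon
      refine (hX.gromov_pos_of_isPreconnected (S := q '' Icc s t) (v := v)
        (isPreconnected_Icc.image _ hq.continuousOn) ?_ (mem_image_of_mem _ ⟨le_rfl, hst⟩)
        (mem_image_of_mem _ ⟨hst, le_rfl⟩)).ne' (mem_segment_iff_gromov.1 hv)
      rintro ⟨u, hu, h⟩
      exact hcon ⟨u, hu, h⟩
    apply Subset.antisymm
    · rintro _ ⟨s, rfl⟩
      obtain ⟨m, h1, h2, h3⟩ := hX.exists_median (q s) (q 0) (q 1)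
      rw [segment_comm] at h1
      obtain ⟨u, hu, hu'⟩ := key 0 s m s.2.1 h1
      obtain ⟨u', hu1, hu1'⟩ := key s 1 m s.2.2 h2
      have : u = u' := hinj (hu'.trans hu1'.symm)
      subst this
      have : u = s := le_antisymm hu.2 hu1.1
      subst this
      rw [hu']; exact h3
    · intro v hv
      obtain ⟨u, -, hu⟩ := key 0 1 v unitInterval.nonneg' hv
      exact ⟨u, hu⟩

/-- In a rooted real tree the leaves are the points other than the root without points above
them. -/
theorem mem_leaves_iff (hX : TreeLike X) {ρ y : X} :
    y ∈ leaves ρ ↔ y ≠ ρ ∧ ∀ z, y ∈ segment ρ z → z = y := by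
  refine and_congr_right fun hy => ?_
  constructor
  · intro hdeg z hz
    by_contra hzy
    have hsub : Subsingleton (ConnectedComponents {x : X // x ≠ y}) :=
      (ENat.card_le_one_iff_subsingleton _).1 hdeg.le
    let a : {x : X // x ≠ y} := ⟨ρ, hy.symm⟩
    let b : {x : X // x ≠ y} := ⟨z, hzy⟩
    have hab : a ∈ connectedComponent b :=
      ConnectedComponents.coe_eq_coe'.1 (hsub.elim (ConnectedComponents.mk a) (ConnectedComponents.mk b))
    refine (hX.gromov_pos_of_isPreconnected (S := Subtype.val '' connectedComponent b) (v := y)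
      (isPreconnected_connectedComponent.image _ continuous_subtype_val.continuousOn)
      ?_ ⟨a, hab, rfl⟩ ⟨b, mem_connectedComponent, rfl⟩).ne' (mem_segment_iff_gromov.1 hz)
    rintro ⟨x, -, hx⟩
    exact x.2 hx
  · intro h
    have hreal := hX.isRealTree
    refine (ENat.card_eq_one_iff_unique).2 ?_
    have hconn : ∀ x : {x : X // x ≠ y}, x ∈ connectedComponent (⟨ρ, hy.symm⟩ : {x : X // x ≠ y}) := by
      intro x
      obtain ⟨f, ⟨hf, hf0, hf1⟩, -⟩ := hreal.geodesic ρ x.1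
      -- No point other than y lies above y, so the geodesic from the root to x avoids y and joins
      -- them in the complement.
      have hfy : ∀ u, f u ≠ y := by
        intro u hu
        have h0 : dist ρ (f u) = u := by
          conv_lhs => rw [← hf0]
          rw [hf.dist_eq, Subtype.dist_eq, Real.dist_eq, zero_sub, abs_neg, abs_of_nonneg u.2.1]
        have h1 : dist (f u) x = dist ρ x.1 - u := by
          conv_lhs => rw [← hf1]
          rw [hf.dist_eq, Subtype.dist_eq, Real.dist_eq, abs_sub_comm, abs_of_nonneg]
          linarith [u.2.2]
        refine x.2 (h x.1 ?_)
        rw [hu] at h0 h1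
        simp only [segment, Set.mem_ofPred_eq, h0, h1]; ring
      have hc : IsPreconnected (range fun u => (⟨f u, hfy u⟩ : {x : X // x ≠ y})) := by
        have : PreconnectedSpace (Icc (0 : ℝ) (dist ρ x.1)) :=
          Subtype.preconnectedSpace isPreconnected_Icc
        exact isPreconnected_range (hf.continuous.subtype_mk _)
      refine hc.subset_connectedComponent ⟨⟨0, le_rfl, dist_nonneg⟩, Subtype.ext hf0⟩
        ⟨⟨_, dist_nonneg, le_rfl⟩, Subtype.ext hf1⟩
    refine ⟨⟨ConnectedComponents.mk (⟨ρ, hy.symm⟩ : {x : X // x ≠ y})⟩, fun a => ?_⟩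
    induction a using Quotient.inductionOn
    rename_i a
    exact ConnectedComponents.coe_eq_coe'.2 (hconn a)

end TreeLike

end TreeLike

end LevyForest

namespace LevyForest

/-! ### Geodesics, medians and the four-point condition in a real tree -/

section RealTree

variable {X : Type} [MetricSpace X]

theorem segment_trans {ρ x y z : X} (h : x ∈ segment ρ y) (h' : y ∈ segment ρ z) :
    x ∈ segment ρ z := by
  simp only [segment, Set.mem_ofPred_eq] at *
  have h1 := dist_triangle x y z
  have h2 := dist_triangle ρ x z
  linarith

namespace IsRealTree

theorem exists_geodesic (hX : IsRealTree X) (a b : X) : ∃ f : ℝ → X, Continuous f ∧ f 0 = a ∧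
    f (dist a b) = b ∧ ∀ u ∈ Icc 0 (dist a b), ∀ v ∈ Icc 0 (dist a b), dist (f u) (f v) = |u - v| := by
  obtain ⟨f, ⟨hf, hf0, hf1⟩, -⟩ := hX.geodesic a b
  refine ⟨fun u => f (projIcc 0 (dist a b) dist_nonneg u), hf.continuous.comp continuous_projIcc,
    ?_, ?_, fun u hu v hv => ?_⟩
  · simp only [projIcc_left]; exact hf0
  · simp only [projIcc_right]; exact hf1
  · rw [hf.dist_eq, projIcc_of_mem _ hu, projIcc_of_mem _ hv]; rfl

/-- Rescaled to the unit interval, the geodesic is an injective path, so `arc` makes it onto the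
segment. -/
theorem eq_of_mem_segment (hX : IsRealTree X) {a b : X} {f : ℝ → X} (hf : Continuous f)
    (h0 : f 0 = a) (h1 : f (dist a b) = b)
    (hd : ∀ u ∈ Icc 0 (dist a b), ∀ v ∈ Icc 0 (dist a b), dist (f u) (f v) = |u - v|) {x : X}
    (hx : x ∈ segment a b) : f (dist a x) = x := by
  have hnn := dist_nonneg (x := a) (y := b)
  rcases hnn.eq_or_lt with h | h
  · simp only [segment, Set.mem_ofPred_eq, ← h] at hx
    have h2 := dist_nonneg (x := a) (y := x)
    have h3 := dist_nonneg (x := x) (y := b)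
    have h4 : dist a x = 0 := by linarith
    rw [h4, h0, dist_eq_zero.1 h4]
  · have hI : ∀ θ : unitInterval, (θ : ℝ) * dist a b ∈ Icc 0 (dist a b) := fun θ =>
      ⟨mul_nonneg θ.2.1 hnn, mul_le_of_le_one_left hnn θ.2.2⟩
    have hr := hX.arc (fun θ => f (θ * dist a b)) (by fun_prop) (fun θ θ' hθ => by
      have := hd _ (hI θ) _ (hI θ')
      simp only at hθ
      rw [hθ, dist_self, eq_comm, abs_eq_zero, ← sub_mul] at this
      exact Subtype.ext (by nlinarith [mul_eq_zero.1 this |>.resolve_right h.ne']))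
    simp only [Icc.coe_zero, zero_mul, Icc.coe_one, one_mul, h0, h1] at hr
    rw [← hr] at hx
    obtain ⟨θ, rfl⟩ := hx
    have := hd 0 ⟨le_rfl, hnn⟩ _ (hI θ)
    rw [h0, zero_sub, abs_neg, abs_of_nonneg (hI θ).1] at this
    simp only [this]

/-- Follow the geodesic from a to b up to the last time t at which it lies on the segment from a to
c. Going from b back to f t and from there to c is an injective path, so by `arc` the point f t also
lies between b and c. -/
theorem exists_median (hX : IsRealTree X) (a b c : X) :
    ∃ m, m ∈ segment a b ∧ m ∈ segment a c ∧ m ∈ segment b c := by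
  obtain ⟨f, hf, hf0, hf1, hfd⟩ := hX.exists_geodesic a b
  obtain ⟨g, hg, hg0, hg1, hgd⟩ := hX.exists_geodesic a c
  have hnn := dist_nonneg (x := a) (y := b)
  obtain ⟨t, ⟨ht, htc⟩, hmax⟩ := (isCompact_Icc.inter_right ((isClosed_segment a c).preimage hf)
    : IsCompact (Icc 0 (dist a b) ∩ f ⁻¹' segment a c)).exists_isMaxOn
    ⟨0, ⟨le_rfl, hnn⟩, by simp only [mem_preimage, hf0]; exact left_mem_segment a c⟩
    (f := fun t => t) continuousOn_id
  have hmax' : ∀ u ∈ Icc 0 (dist a b), f u ∈ segment a c → u ≤ t := fun u hu hu' => hmax ⟨hu, hu'⟩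
  have hat : dist a (f t) = t := by
    have := hfd 0 ⟨le_rfl, hnn⟩ t ht
    rwa [hf0, zero_sub, abs_neg, abs_of_nonneg ht.1] at this
  have htb : dist (f t) b = dist a b - t := by
    have := hfd t ht _ ⟨hnn, le_rfl⟩
    rwa [hf1, abs_sub_comm, abs_of_nonneg (by linarith [ht.2])] at this
  have hm : g t = f t := by
    have := hX.eq_of_mem_segment hg hg0 hg1 hgd htc
    rwa [hat] at this
  refine ⟨f t, ?_, htc, ?_⟩
  · simp only [segment, Set.mem_ofPred_eq, hat, htb]; ring
  rcases ht.2.eq_or_lt with hlt | hlt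
  · rw [hlt, hf1]; exact left_mem_segment b c
  have hc : t + dist (f t) c = dist a c := by
    have : dist a (f t) + dist (f t) c = dist a c := htc
    rwa [hat] at this
  have hLc := dist_nonneg (x := f t) (y := c)
  set L1 := dist a b - t with hL1
  set L := L1 + dist (f t) c with hL
  have hLpos : 0 < L := by linarith
  -- The path from b down the first geodesic to f t, followed by the rest of the second geodesic up
  -- to c; L1 is the time at f t.
  let Q : ℝ → X := fun u => if u ≤ L1 then f (dist a b - u) else g (t + (u - L1))
  have hQ : Continuous Q := by
    refine Continuous.if_le (by fun_prop) (by fun_prop) continuous_id continuous_const ?_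
    rintro u rfl
    rw [sub_self, add_zero, hm, hL1]; congr 1; ring
  -- A coincidence between the two halves would put a point f (d(a, b) - u) on the segment from a to
  -- c, hence not later than t; this forces both times to be L1.
  have hQinj : ∀ u v, 0 ≤ u → u ≤ v → v ≤ L → Q u = Q v → u = v := by
    intro u v hu huv hv h
    by_cases h1 : u ≤ L1
    · by_cases h2 : v ≤ L1
      · simp only [Q, h1, h2, if_true] at h
        have := hfd (dist a b - u) ⟨by linarith [ht.1], by linarith⟩ (dist a b - v)
          ⟨by linarith [ht.1], by linarith⟩
        rw [h, dist_self, eq_comm, abs_eq_zero] at this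
        linarith
      · simp only [Q, h1, h2, if_true, if_false] at h
        push Not at h2
        have hI : t + (v - L1) ∈ Icc 0 (dist a c) := ⟨by linarith [ht.1], by linarith⟩
        have hI0 : (0 : ℝ) ∈ Icc 0 (dist a c) := ⟨le_rfl, dist_nonneg⟩
        have hI1 : dist a c ∈ Icc 0 (dist a c) := ⟨dist_nonneg, le_rfl⟩
        have hseg : f (dist a b - u) ∈ segment a c := by
          rw [h]
          have e1 := hgd 0 hI0 _ hI
          have e2 := hgd _ hI _ hI1
          rw [hg0, zero_sub, abs_neg, abs_of_nonneg hI.1] at e1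
          rw [hg1, abs_sub_comm, abs_of_nonneg (by linarith [hI.2])] at e2
          simp only [segment, Set.mem_ofPred_eq, e1, e2]; ring
        have h3 := hmax' _ ⟨by linarith [ht.1], by linarith⟩ hseg
        have h4 : u = L1 := by linarith
        have h5 : dist a b - u = t := by rw [h4, hL1]; ring
        rw [h5, ← hm] at h
        have := hgd t ⟨ht.1, by linarith⟩ _ hI
        rw [h, dist_self, eq_comm, abs_eq_zero] at this
        linarith
    · have h2 : ¬ v ≤ L1 := fun h2 => h1 (huv.trans h2)
      simp only [Q, h1, h2, if_false] at h
      push Not at h1 h2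
      have := hgd (t + (u - L1)) ⟨by linarith [ht.1], by linarith⟩ (t + (v - L1))
        ⟨by linarith [ht.1], by linarith⟩
      rw [h, dist_self, eq_comm, abs_eq_zero] at this
      linarith
  have hr := hX.arc (fun θ => Q (θ * L)) (by fun_prop) (fun θ θ' hθ => by
    have hI : ∀ θ : unitInterval, 0 ≤ (θ : ℝ) * L ∧ (θ : ℝ) * L ≤ L := fun θ =>
      ⟨mul_nonneg θ.2.1 hLpos.le, mul_le_of_le_one_left hLpos.le θ.2.2⟩
    have : (θ : ℝ) * L = θ' * L := by
      rcases le_total ((θ : ℝ) * L) (θ' * L) with h | h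
      · exact hQinj _ _ (hI θ).1 h (hI θ').2 hθ
      · exact (hQinj _ _ (hI θ').1 h (hI θ).2 hθ.symm).symm
    exact Subtype.ext (mul_right_cancel₀ hLpos.ne' this))
  have e0 : Q 0 = b := by
    have : (0 : ℝ) ≤ L1 := by linarith
    simp only [Q, this, if_true, sub_zero, hf1]
  have e1 : Q L = c := by
    by_cases h : L ≤ L1
    · have h0 : dist (f t) c = 0 := by linarith
      have : dist a b - L = t := by rw [hL, h0, hL1]; ring
      simp only [Q, h, if_true, this]
      exact dist_eq_zero.1 h0
    · have : t + (L - L1) = dist a c := by rw [← hc, hL]; ring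
      simp only [Q, h, if_false, this, hg1]
  have e2 : Q L1 = f t := by
    have : dist a b - L1 = t := by rw [hL1]; ring
    simp only [Q, le_refl, if_true, this]
  simp only [Icc.coe_zero, zero_mul, Icc.coe_one, one_mul, e0, e1] at hr
  rw [← hr]
  refine ⟨⟨L1 / L, div_nonneg (by linarith) hLpos.le, (div_le_one hLpos).2 (by linarith)⟩, ?_⟩
  simp only [div_mul_cancel₀ _ hLpos.ne', e2]

/-- The medians m of w, x, y and n of w, y, z both lie on the geodesic from w to y, so their
distance is the difference of their heights. The triangle inequality along x, m, n, z gives the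
bound. -/
theorem gromov_min (hX : IsRealTree X) (w x y z : X) :
    min (gromov w x y) (gromov w y z) ≤ gromov w x z := by
  obtain ⟨m, h1, h2, h3⟩ := hX.exists_median w x y
  obtain ⟨n, h4, h5, h6⟩ := hX.exists_median w y z
  obtain ⟨f, hf, hf0, hf1, hfd⟩ := hX.exists_geodesic w y
  have hmn : dist m n = |dist w m - dist w n| := by
    have hm := hX.eq_of_mem_segment hf hf0 hf1 hfd h2
    have hn := hX.eq_of_mem_segment hf hf0 hf1 hfd h4
    have := hfd (dist w m) ⟨dist_nonneg, by
      have : dist w m + dist m y = dist w y := h2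
      linarith [dist_nonneg (x := m) (y := y)]⟩ (dist w n) ⟨dist_nonneg, by
      have : dist w n + dist n y = dist w y := h4
      linarith [dist_nonneg (x := n) (y := y)]⟩
    rwa [hm, hn] at this
  simp only [segment, Set.mem_ofPred_eq] at h1 h2 h3 h4 h5 h6
  have t1 := dist_triangle x m z
  have t2 := dist_triangle m n z
  have t3 := dist_triangle x n z
  have t4 := dist_triangle x m n
  rw [dist_comm y n] at h6
  rw [dist_comm x m] at h3 t1 t4
  unfold gromov
  rcases le_total (dist w m) (dist w n) with h | h
  · rw [abs_of_nonpos (by linarith)] at hmn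
    exact (min_le_left _ _).trans (by linarith)
  · rw [abs_of_nonneg (by linarith)] at hmn
    exact (min_le_right _ _).trans (by linarith)

theorem treeLike (hX : IsRealTree X) : TreeLike X where
  four x y z u := four_of_gromov x (hX.gromov_min x) x y z u
  mid := fun a b t ht ht' => by
    obtain ⟨f, hf, hf0, hf1, hfd⟩ := hX.exists_geodesic a b
    have hnn := dist_nonneg (x := a) (y := b)
    refine ⟨f t, ?_, ?_⟩
    · have := hfd 0 ⟨le_rfl, hnn⟩ t ⟨ht, ht'⟩
      rwa [hf0, zero_sub, abs_neg, abs_of_nonneg ht] at this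
    · have := hfd t ⟨ht, ht'⟩ _ ⟨hnn, le_rfl⟩
      rwa [hf1, abs_sub_comm, abs_of_nonneg (by linarith)] at this

end IsRealTree

/-! ### The length of a discrete tree -/

theorem TreeLike.gromov_pos_of_connectedComponents_eq (hX : TreeLike X) {v : X}
    {x y : {x : X // x ≠ v}} (h : ConnectedComponents.mk x = ConnectedComponents.mk y) :
    0 < gromov v (x : X) y := by
  have hxy : x ∈ connectedComponent y := ConnectedComponents.coe_eq_coe'.1 h
  refine hX.gromov_pos_of_isPreconnected (S := Subtype.val '' connectedComponent y)
    (isPreconnected_connectedComponent.image _ continuous_subtype_val.continuousOn)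
    ?_ ⟨x, hxy, rfl⟩ ⟨y, mem_connectedComponent, rfl⟩
  rintro ⟨z, -, hz⟩
  exact z.2 hz

/-- Points of one component of the complement of m have positive Gromov product at m, while the
products of x, y, z vanish pairwise. -/
theorem TreeLike.three_le_degree (hX : TreeLike X) {m x y z : X} (hx : x ≠ m) (hy : y ≠ m)
    (hz : z ≠ m) (hxy : m ∈ segment x y) (hxz : m ∈ segment x z) (hyz : m ∈ segment y z) :
    3 ≤ degree m := by
  rw [mem_segment_iff_gromov] at hxy hxz hyz
  let p : Fin 3 → {x : X // x ≠ m} := ![⟨x, hx⟩, ⟨y, hy⟩, ⟨z, hz⟩]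
  have hinj : Function.Injective fun i => ConnectedComponents.mk (p i) := by
    intro i j hij
    by_contra hne
    have := hX.gromov_pos_of_connectedComponents_eq hij
    fin_cases i <;> fin_cases j <;> simp [p, gromov_comm m y x, gromov_comm m z x,
      gromov_comm m z y, hxy, hxz, hyz] at this hne
  have := ENat.card_le_card_of_injective hinj
  simpa [degree] using this

/-- The maximal points of a ball. -/
def ballEnds (ρ : X) (R : ℝ) : Set X :=
  {x | x ∈ Metric.closedBall ρ R ∧ ∀ z ∈ Metric.closedBall ρ R, x ∈ segment ρ z → z = x}

/-- By compactness some point of the ball above x is farthest from the root, and such a point is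
maximal. -/
theorem exists_mem_ballEnds [ProperSpace X] {ρ x : X} {R : ℝ} (hx : x ∈ Metric.closedBall ρ R) :
    ∃ a ∈ ballEnds ρ R, x ∈ segment ρ a := by
  have hcl : IsClosed {y | x ∈ segment ρ y} := by
    simp only [segment, Set.mem_ofPred_eq]
    exact isClosed_eq (by fun_prop) (by fun_prop)
  obtain ⟨a, ⟨ha, hxa⟩, hmax⟩ := ((isCompact_closedBall ρ R).inter_right hcl).exists_isMaxOn
    ⟨x, hx, right_mem_segment ρ x⟩ (f := fun y => dist ρ y) (by fun_prop)
  refine ⟨a, ⟨ha, fun z hz haz => ?_⟩, hxa⟩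
  have h1 : dist ρ z ≤ dist ρ a := hmax ⟨hz, segment_trans hxa haz⟩
  have h2 : dist ρ a + dist a z = dist ρ z := haz
  have h3 := dist_nonneg (x := a) (y := z)
  exact (dist_eq_zero.1 (by linarith : dist a z = 0)).symm

/-- Assign to an end other than the root the highest point v strictly below it among the root and
the branching points of the ball. Two ends with the same v lie in different components of the
complement of v: otherwise they would separate at a branching point above v. There are finitely many
v, each of finite degree. -/
theorem IsDiscreteTree.finite_ballEnds {ρ : X} (hT : IsDiscreteTree X ρ) (R : ℝ) :
    (ballEnds ρ R).Finite := by
  have hX := hT.isRealTree.treeLike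
  let V : Set X := insert ρ (Metric.closedBall ρ R ∩ branchPoints ρ)
  have hV : V.Finite := (hT.finite_branchPoints R).insert ρ
  let A : X → Set X := fun v => {x | x ∈ ballEnds ρ R ∧ x ≠ v ∧ v ∈ segment ρ x ∧
    ∀ v' ∈ V, v' ∈ segment ρ x → v' ≠ x → dist ρ v' ≤ dist ρ v}
  have hA : ∀ v, (A v).Finite := by
    intro v
    have hfin : Finite (ConnectedComponents {x : X // x ≠ v}) := by
      by_contra h
      rw [not_finite_iff_infinite] at h
      exact hT.finite_degree v (by rw [degree, ENat.card_eq_top]; exact h)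
    have hinj : Function.Injective fun x : A v =>
        ConnectedComponents.mk (⟨x, x.2.2.1⟩ : {x : X // x ≠ v}) := by
      rintro ⟨x, hx⟩ ⟨y, hy⟩ hxy
      have hpos := hX.gromov_pos_of_connectedComponents_eq hxy
      simp only at hpos
      by_contra hne
      have hne : x ≠ y := fun h => hne (Subtype.ext h)
      obtain ⟨m, h1, h2, h3⟩ := hX.exists_median ρ x y
      have hmx : m ≠ x := by
        rintro rfl
        exact hne (hx.1.2 y hy.1.1 h2).symm
      have hmy : m ≠ y := by
        rintro rfl
        exact hne (hy.1.2 x hx.1.1 h1)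
      have hvx : dist ρ v + dist v x = dist ρ x := hx.2.2.1
      have hvy : dist ρ v + dist v y = dist ρ y := hy.2.2.1
      have h1' : dist ρ m + dist m x = dist ρ x := h1
      have h2' : dist ρ m + dist m y = dist ρ y := h2
      have h3' : dist x m + dist m y = dist x y := h3
      have hlt : dist ρ v < dist ρ m := by
        unfold gromov at hpos
        linarith [dist_comm x m]
      have hmρ : ρ ≠ m := dist_pos.1 (dist_nonneg.trans_lt hlt)
      have hmB : m ∈ Metric.closedBall ρ R := by
        have := hx.1.1
        rw [Metric.mem_closedBall, dist_comm] at this ⊢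
        linarith [dist_nonneg (x := m) (y := x)]
      have hmV : m ∈ V := Or.inr ⟨hmB, hmρ.symm,
        hX.three_le_degree hmρ hmx.symm hmy.symm h1 h2 h3⟩
      exact absurd (hx.2.2.2 m hmV h1 hmx) (not_le.2 hlt)
    exact Set.finite_coe_iff.1 (Finite.of_injective _ hinj)
  refine ((finite_singleton ρ).union (hV.biUnion fun v _ => hA v)).subset fun x hx => ?_
  by_cases hxρ : x = ρ
  · exact Or.inl hxρ
  right
  obtain ⟨v, ⟨hvV, hvx, hne⟩, hmax⟩ := ((hV.subset (sep_subset V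
    fun v => v ∈ segment ρ x ∧ v ≠ x))).exists_maximalFor (fun v => dist ρ v) _
    ⟨ρ, mem_insert _ _, left_mem_segment ρ x, Ne.symm hxρ⟩
  refine mem_biUnion hvV ⟨hx, hne.symm, hvx, fun v' h1 h2 h3 => ?_⟩
  rcases le_total (dist ρ v') (dist ρ v) with h | h
  · exact h
  · exact hmax ⟨h1, h2, h3⟩ h

theorem IsRealTree.hausdorffMeasure_segment [MeasurableSpace X] [BorelSpace X] (hX : IsRealTree X)
    (a b : X) : Measure.hausdorffMeasure 1 (segment a b) < ∞ := by
  obtain ⟨f, ⟨hf, hf0, hf1⟩, -⟩ := hX.geodesic a b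
  obtain ⟨g, hg, hg0, hg1, hgd⟩ := hX.exists_geodesic a b
  have hsub : segment a b ⊆ f '' univ := by
    intro x hx
    have hfg : ∀ u ∈ Icc 0 (dist a b), ∀ v ∈ Icc 0 (dist a b),
        dist (f (projIcc 0 (dist a b) dist_nonneg u)) (f (projIcc 0 (dist a b) dist_nonneg v)) =
          |u - v| := fun u hu v hv => by
      rw [hf.dist_eq, projIcc_of_mem _ hu, projIcc_of_mem _ hv]; rfl
    have := hX.eq_of_mem_segment (f := fun u => f (projIcc 0 (dist a b) dist_nonneg u))
      (hf.continuous.comp continuous_projIcc) (by simp only [projIcc_left, hf0])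
      (by simp only [projIcc_right, hf1]) hfg hx
    exact ⟨_, mem_univ _, this⟩
  refine (measure_mono hsub).trans_lt ?_
  rw [hf.hausdorffMeasure_image (Or.inl zero_le_one),
    ← (isometry_subtype_coe (s := Icc 0 (dist a b))).hausdorffMeasure_image (Or.inl zero_le_one),
    image_univ, Subtype.range_coe, hausdorffMeasure_real, Real.volume_Icc]
  exact ENNReal.ofReal_lt_top

/-- The ball is covered by the segments from the root to its finitely many ends. Finiteness makes
the normalized intensity of an annulus a probability measure. -/
theorem IsDiscreteTree.lengthMeasure_closedBall_lt_top [MeasurableSpace X] [BorelSpace X] {ρ : X}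
    (hT : IsDiscreteTree X ρ) (R : ℝ) : lengthMeasure ρ (Metric.closedBall ρ R) < ∞ := by
  have := hT.proper
  refine (Measure.restrict_apply_le _ _).trans_lt ?_
  refine (measure_mono (t := ⋃ a ∈ ballEnds ρ R, segment ρ a) fun x hx => ?_).trans_lt ?_
  · obtain ⟨a, ha, hxa⟩ := exists_mem_ballEnds hx
    exact mem_biUnion ha hxa
  · exact measure_biUnion_lt_top (hT.finite_ballEnds R) fun a _ =>
      hT.isRealTree.hausdorffMeasure_segment ρ a

end RealTree

end LevyForest

namespace LevyForest

/-! ### The real tree of a marked discrete tree is a real tree -/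

theorem IsVertex.of_prefix {k : List ℕ → ℕ} {u v : List ℕ} (h : IsVertex k v) (huv : u <+: v) :
    IsVertex k u := fun w j hw => h w j (hw.trans huv)

theorem isVertex_nil (k : List ℕ → ℕ) : IsVertex k [] := fun v j h => by simp at h

theorem isVertex_append_singleton {k : List ℕ → ℕ} {u : List ℕ} (h : IsVertex k u) {a : ℕ}
    (ha : a < k u) : IsVertex k (u ++ [a]) := by
  intro v j hv
  rcases List.prefix_concat_iff.1 hv with h1 | h1
  · obtain ⟨rfl, h2⟩ := List.append_inj' h1 rfl
    simp only [List.cons.injEq, and_true] at h2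
    rwa [h2]
  · exact h v j h1

theorem isVertex_cons {k : List ℕ → ℕ} {a : ℕ} {u : List ℕ} :
    IsVertex k (a :: u) ↔ a < k [] ∧ IsVertex (fun w => k (a :: w)) u := by
  constructor
  · intro h
    refine ⟨h [] a (by simp), fun v j hv => h (a :: v) j ?_⟩
    simpa using hv
  · rintro ⟨h1, h2⟩ v j hv
    cases v with
    | nil =>
      have : j = a := by simpa using hv
      rwa [this]
    | cons b v =>
      simp only [List.cons_append, List.cons_prefix_cons] at hv
      obtain ⟨rfl, hv⟩ := hv
      exact h2 v j hv

/-- The left side expresses that (u, s) lies on the segment from the root to (v, t); it is used for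
`TreePoint.mem_segment_root_iff`. -/
theorem meetHeight_eq_height_iff (l : List ℕ → ℝ≥0) (u v : List ℕ) {s t : ℝ}
    (hu : (u = [] ∧ s = 0) ∨ (0 < s ∧ s ≤ l u)) (ht : 0 ≤ t) (ht' : t ≤ l v) :
    meetHeight l u s v t = height l u s ↔ (u = [] ∧ s = 0) ∨ (u <+: v ∧ (u = v → s ≤ t)) := by
  induction u generalizing l v with
  | nil =>
    rw [meetHeight_nil_left, height_nil, min_eq_left_iff]
    cases v with
    | nil =>
      simp only [height_nil, List.prefix_refl, true_and, forall_const]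
      constructor
      · exact Or.inr
      · rintro (h | h)
        · rwa [h]
        · exact h
    | cons b v =>
      simp only [List.nil_prefix, true_and, reduceCtorEq, IsEmpty.forall_iff, or_true, iff_true]
      rw [height_cons]
      have := height_nonneg (fun w => l (b :: w)) v ht
      rcases hu with ⟨-, rfl⟩ | hu
      · positivity
      · linarith [hu.2]
  | cons a u ih =>
    simp only [reduceCtorEq, false_and, false_or] at hu ⊢
    have hn : 0 < height (fun w => l (a :: w)) u s := by
      have := lengthBelow_nonneg (fun w => l (a :: w)) u
      unfold height; linarith [hu.1]
    cases v with
    | nil =>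
      have := height_cons l a u s
      simp only [List.prefix_nil, reduceCtorEq, false_and, iff_false]
      rw [meetHeight_nil_right]
      intro h
      have := min_le_right (height l (a :: u) s) t
      linarith
    | cons b v =>
      rw [height_cons]
      by_cases hab : a = b
      · subst hab
        simp only [meetHeight, if_true, add_right_inj, ih (fun w => l (a :: w)) v (Or.inr hu) ht',
          List.cons_prefix_cons, true_and, List.cons.injEq, or_iff_right_iff_imp]
        rintro ⟨rfl, rfl⟩
        exact absurd hu.1 (lt_irrefl _)
      · simp only [meetHeight, hab, if_false, List.cons_prefix_cons, false_and, iff_false]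
        linarith

/-- The ancestor of (u, s) at height t: these points form the geodesic from the root that
`treeLike_of_based` asks for. -/
theorem exists_meetHeight_eq (l : List ℕ → ℝ≥0) (u : List ℕ) {s t : ℝ}
    (hs' : s ≤ l u) (ht : 0 ≤ t) (ht' : t ≤ height l u s) :
    ∃ (v : List ℕ) (r : ℝ), v <+: u ∧ ((v = [] ∧ r = 0) ∨ (0 < r ∧ r ≤ l v)) ∧ height l v r = t ∧
      meetHeight l v r u s = t := by
  induction u generalizing l t with
  | nil =>
    rw [height_nil] at ht'
    refine ⟨[], t, List.prefix_rfl, ?_, height_nil _ _, by rw [meetHeight_nil_left, height_nil, min_eq_left ht']⟩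
    rcases ht.eq_or_lt with h | h
    · exact Or.inl ⟨rfl, h.symm⟩
    · exact Or.inr ⟨h, ht'.trans hs'⟩
  | cons a u ih =>
    rcases le_or_gt t (l []) with h | h
    · refine ⟨[], t, List.nil_prefix, ?_, height_nil _ _, by rw [meetHeight_nil_left, min_eq_left ht']⟩
      rcases ht.eq_or_lt with h' | h'
      · exact Or.inl ⟨rfl, h'.symm⟩
      · exact Or.inr ⟨h', h⟩
    · rw [height_cons] at ht'
      obtain ⟨v, r, hv, hr, h1, h2⟩ := ih (fun w => l (a :: w)) hs' (t := t - l []) (by linarith)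
        (by linarith)
      refine ⟨a :: v, r, by simpa using hv, ?_, by rw [height_cons, h1]; ring,
        by simp [meetHeight, h2]⟩
      rcases hr with ⟨rfl, rfl⟩ | hr
      · rw [height_nil] at h1; linarith
      · exact Or.inr hr

namespace TreePoint

variable {k : List ℕ → ℕ} {l : List ℕ → ℝ≥0}

theorem dist_def (x y : TreePoint k l) : dist x y =
    height l x.word x.pos + height l y.word y.pos - 2 * meetHeight l x.word x.pos y.word y.pos :=
  pointDist_eq _ _ _ _ _

theorem dist_root (x : TreePoint k l) : dist root x = height l x.word x.pos := by
  rw [dist_def]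
  simp only [root, height_nil, meetHeight_nil_left]
  rw [min_eq_left (height_nonneg _ _ x.pos_nonneg)]; ring

theorem gromov_root (x y : TreePoint k l) :
    gromov root x y = 2 * meetHeight l x.word x.pos y.word y.pos := by
  rw [gromov, dist_root, dist_root, dist_def]; ring

theorem isVertex (x : TreePoint k l) : IsVertex k x.word := by
  rcases x.mem with h | h
  · rw [h.1]; exact isVertex_nil k
  · exact h.1

theorem treeLike : TreeLike (TreePoint k l) := by
  refine treeLike_of_based root (fun x y z => ?_) (fun x t ht ht' => ?_)
  · simp only [gromov_root]
    have := meetHeight_ultra l x.word y.word z.word x.pos_nonneg z.pos_nonneg x.pos_le y.pos_le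
      z.pos_le
    rw [← mul_min_of_nonneg _ _ (by norm_num : (0 : ℝ) ≤ 2)]
    linarith
  · rw [dist_root] at ht'
    obtain ⟨v, r, hv, hr, h1, h2⟩ := exists_meetHeight_eq l x.word x.pos_le ht ht'
    refine ⟨⟨v, r, hr.imp id fun h => ⟨x.isVertex.of_prefix hv, h⟩⟩, ?_, ?_⟩
    · rw [dist_root, h1]
    · rw [dist_def, dist_root, h1, h2]; ring

theorem mem_segment_root_iff {x y : TreePoint k l} : x ∈ segment root y ↔
    x = root ∨ (x.word <+: y.word ∧ (x.word = y.word → x.pos ≤ y.pos)) := by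
  have h := meetHeight_eq_height_iff l x.word y.word (x.mem.imp id fun h => h.2) y.pos_nonneg y.pos_le
  have hr : x = root ↔ (x.word = [] ∧ x.pos = 0) := by
    rw [TreePoint.ext_iff]; rfl
  rw [hr, ← h, segment, Set.mem_ofPred_eq, dist_root, dist_root, dist_def]
  constructor <;> intro h <;> linarith

end TreePoint

/-! ### Grafting real trees -/

namespace Graft

variable {X ι : Type} {Y : ι → Type} [MetricSpace X] [∀ i, MetricSpace (Y i)]
  {s : ι → X} {r : ∀ i, Y i}

theorem dist_base_base (x y : X) : dist (base x : Graft s r) (base y) = dist x y := rfl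

theorem dist_base_piece (x : X) (i : ι) (y : Y i) (h : y ≠ r i) :
    dist (base x : Graft s r) (piece i y h) = dist y (r i) + dist (s i) x := rfl

theorem dist_piece_base (x : X) (i : ι) (y : Y i) (h : y ≠ r i) :
    dist (piece i y h : Graft s r) (base x) = dist y (r i) + dist (s i) x := rfl

theorem dist_piece_self (i : ι) (y y' : Y i) (h : y ≠ r i) (h' : y' ≠ r i) :
    dist (piece i y h : Graft s r) (piece i y' h') = dist y y' := graftDist_same i y y' h h'

theorem dist_piece_of_ne {i j : ι} (hij : i ≠ j) (y : Y i) (y' : Y j) (h : y ≠ r i)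
    (h' : y' ≠ r j) : dist (piece i y h : Graft s r) (piece j y' h') =
      dist y (r i) + dist (s i) (s j) + dist y' (r j) := graftDist_ne hij y y' h h'

theorem isometry_base : Isometry (base : X → Graft s r) := Isometry.of_dist_eq fun _ _ => rfl

theorem gromov_base_base (w x y : X) :
    gromov (base w : Graft s r) (base x) (base y) = gromov w x y := rfl

theorem gromov_base_piece (w x : X) (i : ι) (y : Y i) (h : y ≠ r i) :
    gromov (base w : Graft s r) (base x) (piece i y h) = gromov w x (s i) := by
  simp only [gromov, dist_base_base, dist_base_piece, dist_comm (s i)]; ring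

theorem gromov_piece_self (w : X) (i : ι) (y y' : Y i) (h : y ≠ r i) (h' : y' ≠ r i) :
    gromov (base w : Graft s r) (piece i y h) (piece i y' h') =
      2 * dist w (s i) + gromov (r i) y y' := by
  simp only [gromov, dist_piece_self, dist_base_piece, dist_comm (s i), dist_comm (r i)]; ring

theorem gromov_piece_of_ne (w : X) {i j : ι} (hij : i ≠ j) (y : Y i) (y' : Y j) (h : y ≠ r i)
    (h' : y' ≠ r j) : gromov (base w : Graft s r) (piece i y h) (piece j y' h') =
      gromov w (s i) (s j) := by
  simp only [gromov, dist_piece_of_ne hij, dist_base_piece, dist_comm _ w]; ring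

/-- Seen from a base point in X, the Gromov product of points of different pieces is that of their
grafting points. Within one piece it is the product in the piece increased by twice the height of
the grafting point, which exceeds every product with a point outside the piece. The based inequality
follows case by case. -/
theorem treeLike (hX : TreeLike X) (hY : ∀ i, TreeLike (Y i)) (w : X) :
    TreeLike (Graft s r) := by
  refine treeLike_of_based (base w) (fun x y z => ?_) (fun x t ht ht' => ?_)
  · have H := hX.gromov_min w
    have hnn := fun i (y y' : Y i) => gromov_nonneg (r i) y y'
    have hle := gromov_le_left w
    cases x with
    | base x =>
      cases y with
      | base y =>
        cases z with
        | base z => exact H x y z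
        | piece k z hz => simpa only [gromov_base_base, gromov_base_piece] using H x y (s k)
      | piece j y hy =>
        rw [gromov_comm _ (piece j y hy) z]
        cases z with
        | base z =>
          simp only [gromov_base_base, gromov_base_piece]
          rw [gromov_comm w z]; exact H x (s j) z
        | piece k z hz =>
          simp only [gromov_base_piece]
          by_cases hkj : k = j
          · subst hkj; exact min_le_left _ _
          · rw [gromov_piece_of_ne w hkj, gromov_comm w (s k)]; exact H x (s j) (s k)
    | piece i x hx =>
      cases z with
      | base z =>
        rw [gromov_comm _ (piece i x hx) (base z)]
        cases y with
        | base y =>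
          rw [gromov_comm _ (piece i x hx) (base y), gromov_comm _ (base y) (base z)]
          simp only [gromov_base_base, gromov_base_piece]
          rw [min_comm]; exact H z y (s i)
        | piece j y hy =>
          rw [gromov_comm _ _ (base z)]
          simp only [gromov_base_piece]
          by_cases hij : i = j
          · subst hij; exact min_le_right _ _
          · rw [gromov_piece_of_ne w hij, gromov_comm w (s i), min_comm]; exact H z (s j) (s i)
      | piece k z hz =>
        by_cases hik : i = k
        · subst hik
          rw [gromov_piece_self w i x z]
          cases y with
          | base y =>
            rw [gromov_base_piece]
            refine (min_le_right _ _).trans ?_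
            rw [gromov_comm]
            linarith [hle (s i) y, hnn i x z]
          | piece j y hy =>
            by_cases hij : i = j
            · subst hij
              rw [gromov_piece_self, gromov_piece_self, min_add_add_left]
              linarith [(hY i).gromov_min (r i) x y z]
            · rw [gromov_piece_of_ne w hij]
              exact (min_le_left _ _).trans (by linarith [hle (s i) (s j), hnn i x z])
        · rw [gromov_piece_of_ne w hik]
          cases y with
          | base y =>
            rw [gromov_comm _ (piece i x hx), gromov_base_piece, gromov_base_piece,
              gromov_comm w y (s i)]
            exact H (s i) y (s k)
          | piece j y hy =>
            by_cases hij : i = j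
            · subst hij
              rw [gromov_piece_of_ne w hik]; exact min_le_right _ _
            · rw [gromov_piece_of_ne w hij]
              by_cases hjk : j = k
              · subst hjk; exact min_le_left _ _
              · rw [gromov_piece_of_ne w hjk]; exact H (s i) (s j) (s k)
  · cases x with
    | base x =>
      obtain ⟨y, h1, h2⟩ := hX.mid w x t ht ht'
      exact ⟨base y, h1, h2⟩
    | piece i x hx =>
      rw [dist_base_piece] at ht' ⊢
      rcases le_or_gt t (dist w (s i)) with h | h
      · obtain ⟨y, h1, h2⟩ := hX.mid w (s i) t ht h
        refine ⟨base y, h1, ?_⟩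
        rw [dist_base_piece, dist_comm (s i), h2, dist_comm (s i) w]; ring
      · rw [dist_comm (s i)] at ht'
        obtain ⟨y, h1, h2⟩ := (hY i).mid (r i) x (t - dist w (s i)) (by linarith)
          (by rw [dist_comm (r i)]; linarith)
        have hy : y ≠ r i := by
          rintro rfl
          rw [dist_self] at h1; linarith
        refine ⟨piece i y hy, ?_, ?_⟩
        · rw [dist_base_piece, dist_comm y, h1, dist_comm (s i)]; ring
        · rw [dist_piece_self, h2, dist_comm x, dist_comm (s i)]; ring

theorem piece_mem_segment_iff {w : X} {i : ι} {y : Y i} {h : y ≠ r i} {z : Graft s r} :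
    piece i y h ∈ segment (base w : Graft s r) z ↔
      ∃ (y' : Y i) (h' : y' ≠ r i), z = piece i y' h' ∧ y ∈ segment (r i) y' := by
  have hpos := dist_pos.2 h
  simp only [segment, Set.mem_ofPred_eq, dist_base_piece]
  cases z with
  | base z =>
    simp only [reduceCtorEq, false_and, exists_false, iff_false, dist_piece_base, dist_base_base]
    have := dist_triangle_left w z (s i)
    intro h; linarith
  | piece j z hz =>
    by_cases hij : i = j
    · subst hij
      simp only [dist_piece_self, dist_base_piece, piece.injEq, heq_eq_eq, true_and]
      constructor
      · intro h1
        refine ⟨z, hz, rfl, ?_⟩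
        rw [dist_comm (r i), dist_comm (r i)]; linarith
      · rintro ⟨y', h', rfl, h1⟩
        rw [dist_comm (r i), dist_comm (r i)] at h1; linarith
    · simp only [dist_piece_of_ne hij, dist_base_piece, piece.injEq, Ne.symm hij, false_and,
        exists_false, iff_false]
      have := dist_triangle_left w (s j) (s i)
      intro h
      linarith [dist_comm (s j) w]

end Graft

/-- A subset of a real tree that contains the segments from the base point to its points is a real
tree. -/
theorem TreeLike.subtype {X : Type} [MetricSpace X] (hX : TreeLike X) {B : Set X} (w : B)
    (hB : ∀ x ∈ B, segment (w : X) x ⊆ B) : TreeLike B := by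
  refine treeLike_of_based w (fun x y z => hX.gromov_min (w : X) x y z) (fun x t ht ht' => ?_)
  obtain ⟨y, h1, h2⟩ := hX.mid (w : X) x t ht ht'
  exact ⟨⟨y, hB x x.2 (by simp only [segment, Set.mem_ofPred_eq, h1, h2]; ring)⟩, h1, h2⟩

theorem IsRealTree.isCompact_segment {X : Type} [MetricSpace X] (hX : IsRealTree X) (a b : X) :
    IsCompact (segment a b) := by
  obtain ⟨f, hf, hf0, hf1, hfd⟩ := hX.exists_geodesic a b
  refine (isCompact_Icc.image hf : IsCompact (f '' Icc 0 (dist a b))).of_isClosed_subset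
    (isClosed_segment a b) fun x hx => ⟨dist a x, ⟨dist_nonneg, ?_⟩,
      hX.eq_of_mem_segment hf hf0 hf1 hfd hx⟩
  have : dist a x + dist x b = dist a b := hx
  linarith [dist_nonneg (x := x) (y := b)]

end LevyForest

namespace LevyForest

/-! ### The black tree -/

namespace GraftData

variable {T : Type} [MetricSpace T] {ρ : T}

/-- The offspring numbers of the `j`-th tree grafted on `σ`. -/
abbrev offspring (D : GraftData ρ) (σ : Site ρ) (j : ℕ) : List ℕ → ℕ :=
  fun u => (D.2.2.2 (σ, j, u)).1

/-- The edge lengths of the `j`-th tree grafted on `σ`. -/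
abbrev length (D : GraftData ρ) (σ : Site ρ) (j : ℕ) : List ℕ → ℝ≥0 :=
  fun u => (D.2.2.2 (σ, j, u)).2.1

/-- The colours of the `j`-th tree grafted on `σ`. -/
abbrev color (D : GraftData ρ) (σ : Site ρ) (j : ℕ) : List ℕ → unitInterval :=
  fun u => (D.2.2.2 (σ, j, u)).2.2

/-- The typical realizations of the randomness. -/
structure Good (D : GraftData ρ) : Prop where
  finite_vertices : ∀ σ j, {u | IsVertex (D.offspring σ j) u}.Finite
  length_pos : ∀ q, 0 < (D.2.2.2 q).2.1
  color_inj : Function.Injective fun q => (D.2.2.2 q).2.2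
  position_mem : ∀ n i, i < D.1 n → D.2.1 (n, i) ∈ annulus ρ n

/-- The vertex `u` of the piece `p` is a leaf and its colouring variable is at most `t`. -/
def IsBlackLeaf (D : GraftData ρ) (t : ℝ) (p : Site ρ × ℕ) (u : List ℕ) : Prop :=
  IsVertex (D.offspring p.1 p.2) u ∧ D.offspring p.1 p.2 u = 0 ∧ (D.color p.1 p.2 u : ℝ) ≤ t

theorem treeLike_grafted (hT : TreeLike T) (D : GraftData ρ) : TreeLike (Grafted D) :=
  Graft.treeLike hT (fun _ => TreePoint.treeLike) ρ

variable {D : GraftData ρ}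

/-- The upper end of the edge of the vertex `u`. -/
def Good.top (hD : D.Good) (p : Index D) {u : List ℕ} (hu : IsVertex (D.offspring p.1.1 p.1.2) u) :
    Piece D p :=
  ⟨u, D.length p.1.1 p.1.2 u, Or.inr ⟨hu, by exact_mod_cast hD.length_pos _, le_rfl⟩⟩

theorem Good.top_ne_root (hD : D.Good) (p : Index D) {u : List ℕ}
    (hu : IsVertex (D.offspring p.1.1 p.1.2) u) : hD.top p hu ≠ TreePoint.root := by
  intro h
  have := congrArg TreePoint.pos h
  simp only [Good.top, TreePoint.root, NNReal.coe_eq_zero] at this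
  exact (hD.length_pos _).ne' this

theorem TreePoint_eq_root_of_pos {k : List ℕ → ℕ} {l : List ℕ → ℝ≥0} {y : TreePoint k l}
    (h : y.pos = 0) : y = TreePoint.root := by
  rcases y.mem with h' | h'
  · exact TreePoint.ext h'.1 h'.2
  · exact absurd h h'.2.1.ne'

theorem Good.mem_segment_top_iff (hD : D.Good) (p : Index D) {y : Piece D p} {u : List ℕ}
    (hu : IsVertex (D.offspring p.1.1 p.1.2) u) (hy : y ≠ TreePoint.root) :
    y ∈ segment TreePoint.root (hD.top p hu) ↔ y.word <+: u := by
  rw [TreePoint.mem_segment_root_iff]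
  simp only [hy, false_or, Good.top, and_iff_left_iff_imp]
  rintro - rfl
  exact y.pos_le

/-- The top of an edge lies above all points of its own edge and of those of its ancestors. Hence a
point with nothing above it is the top of its edge and has no children. -/
theorem Good.piece_mem_leaves_iff (hT : TreeLike T) (hD : D.Good) (p : Index D) (y : Piece D p)
    (hy : y ≠ TreePoint.root) :
    (Graft.piece p y hy : Grafted D) ∈ leaves (Graft.base ρ : Grafted D) ↔
      D.offspring p.1.1 p.1.2 y.word = 0 ∧ y.pos = D.length p.1.1 p.1.2 y.word := by
  rw [(treeLike_grafted hT D).mem_leaves_iff]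
  simp only [ne_eq, reduceCtorEq, not_false_eq_true, true_and]
  constructor
  · intro h
    have key : ∀ (u : List ℕ) (hu : IsVertex (D.offspring p.1.1 p.1.2) u), y.word <+: u →
        y = hD.top p hu := by
      intro u hu hyu
      have := h (Graft.piece p (hD.top p hu) (hD.top_ne_root p hu))
        (Graft.piece_mem_segment_iff.2 ⟨_, hD.top_ne_root p hu, rfl,
          (hD.mem_segment_top_iff p hu hy).2 hyu⟩)
      simp only [Graft.piece.injEq, heq_eq_eq, true_and] at this
      exact this.symm
    constructor
    · by_contra hk
      have hu := isVertex_append_singleton y.isVertex (Nat.pos_of_ne_zero hk)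
      have := congrArg (fun y => y.word.length) (key _ hu (List.prefix_append _ _))
      simp [Good.top] at this
    · exact congrArg TreePoint.pos (key _ y.isVertex List.prefix_rfl)
  · rintro ⟨hk, hpos⟩ z hz
    obtain ⟨y', h', rfl, hyy⟩ := Graft.piece_mem_segment_iff.1 hz
    rw [TreePoint.mem_segment_root_iff] at hyy
    obtain ⟨⟨w, hw⟩, h2⟩ := hyy.resolve_left hy
    have : y = y' := by
      cases w with
      | nil =>
        rw [List.append_nil] at hw
        refine TreePoint.ext hw (le_antisymm (h2 hw) ?_)
        rw [hpos, hw]; exact y'.pos_le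
      | cons a w =>
        exfalso
        have := y'.isVertex y.word a (by rw [← hw]; exact ⟨w, by simp⟩)
        simp only [hk] at this
        omega
    subst this
    rfl

/-- Makes the black tree combinatorial: whether a point of a grafted tree is black depends only on
the word of its edge. -/
theorem Good.mem_black_iff (hT : TreeLike T) (hD : D.Good) {t : ℝ} (p : Index D) (y : Piece D p)
    (hy : y ≠ TreePoint.root) : (Graft.piece p y hy : Grafted D) ∈ D.black t ↔
      ∃ u, y.word <+: u ∧ D.IsBlackLeaf t p.1 u := by
  simp only [black, mem_union, mem_range, reduceCtorEq, exists_false, false_or, Set.mem_ofPred_eq]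
  constructor
  · rintro ⟨q, z, hz, h1, h2, h3⟩
    obtain ⟨z', hz', h4, h5⟩ := Graft.piece_mem_segment_iff.1 h3
    simp only [Graft.piece.injEq] at h4
    obtain ⟨rfl, h4⟩ := h4
    obtain rfl := eq_of_heq h4
    rw [hD.piece_mem_leaves_iff hT] at h1
    refine ⟨z.word, ?_, z.isVertex, h1.1, h2⟩
    exact ((TreePoint.mem_segment_root_iff.1 h5).resolve_left hy).1
  · rintro ⟨u, hu, h1, h2, h3⟩
    refine ⟨p, hD.top p h1, hD.top_ne_root p h1, ?_, h3, ?_⟩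
    · exact (hD.piece_mem_leaves_iff hT p _ (hD.top_ne_root p h1)).2 ⟨h2, rfl⟩
    · exact Graft.piece_mem_segment_iff.2 ⟨_, hD.top_ne_root p h1, rfl,
        (hD.mem_segment_top_iff p h1 hy).2 hu⟩

theorem base_mem_black (D : GraftData ρ) (t : ℝ) (x : T) :
    (Graft.base x : Grafted D) ∈ D.black t := Or.inl ⟨x, rfl⟩

theorem Good.treeLike_black (hT : TreeLike T) (hD : D.Good) (t : ℝ) : TreeLike (D.black t) := by
  refine (treeLike_grafted hT D).subtype ⟨Graft.base ρ, base_mem_black D t ρ⟩ ?_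
  intro x hx z hz
  cases z with
  | base z => exact base_mem_black D t z
  | piece p y hy =>
    obtain ⟨y', h', rfl, h2⟩ := Graft.piece_mem_segment_iff.1 hz
    rw [hD.mem_black_iff hT] at hx ⊢
    obtain ⟨u, hu, h3⟩ := hx
    exact ⟨u, ((TreePoint.mem_segment_root_iff.1 h2).resolve_left hy).1.trans hu, h3⟩

theorem Good.finite_sites (hT : IsDiscreteTree T ρ) (hD : D.Good) (R : ℝ) :
    {σ | 0 < count D σ ∧ dist ρ (position D σ) ≤ R}.Finite := by
  have h1 : {q : ℕ × ℕ | q.1 ≤ ⌊R⌋₊ ∧ q.2 < D.1 q.1}.Finite := by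
    refine ((Set.finite_le_nat ⌊R⌋₊).biUnion (t := fun n => (fun i => (n, i)) '' Iio (D.1 n))
      fun n _ => (finite_Iio _).image _).subset ?_
    rintro ⟨n, i⟩ ⟨h, h'⟩
    exact mem_biUnion (x := n) h ⟨i, h', rfl⟩
  have h2 : {σ : branchPoints ρ | σ.1 ∈ Metric.closedBall ρ R}.Finite := by
    refine Finite.of_finite_image ((hT.finite_branchPoints R).subset ?_)
      (Subtype.val_injective.injOn)
    rintro _ ⟨σ, hσ, rfl⟩
    exact ⟨hσ, σ.2⟩
  refine ((h1.image fun q => Site.poisson q.1 q.2).union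
    ((h2.image Site.branch).union (finite_singleton Site.root))).subset ?_
  rintro (⟨n, i⟩ | σ | _) ⟨h, h'⟩
  · left
    have hi : i < D.1 n := by
      by_contra hi
      simp [count, hi] at h
    refine ⟨(n, i), ⟨Nat.le_floor ?_, hi⟩, rfl⟩
    exact (hD.position_mem n i hi).1.trans h'
  · right; left
    exact ⟨σ, by rwa [Set.mem_ofPred_eq, Metric.mem_closedBall, dist_comm], rfl⟩
  · right; right; rfl

theorem Good.finite_index (hT : IsDiscreteTree T ρ) (hD : D.Good) (R : ℝ) :
    {p : Index D | dist ρ (position D p.1.1) ≤ R}.Finite := by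
  refine Finite.of_finite_image (f := Subtype.val) (((hD.finite_sites hT R).biUnion
    (t := fun σ => (fun j => (σ, j)) '' Iio (count D σ)) fun σ _ => (finite_Iio _).image _).subset
    ?_) Subtype.val_injective.injOn
  rintro _ ⟨⟨⟨σ, j⟩, hj⟩, hp, rfl⟩
  exact mem_biUnion (x := σ) ⟨Nat.zero_lt_of_lt hj, hp⟩ ⟨j, hj, rfl⟩

/-- A ball of the black tree is contained in a ball of T together with the segments to the black
leaves of finitely many finite trees, a finite union of compact sets that is itself black. -/
theorem Good.properSpace_black (hT : IsDiscreteTree T ρ) (hD : D.Good) (t : ℝ) :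
    ProperSpace (D.black t) := by
  have hprop := hT.proper
  have hTT := hT.isRealTree.treeLike
  have hG := (treeLike_grafted hTT D).isRealTree
  let o : D.black t := ⟨Graft.base ρ, base_mem_black D t ρ⟩
  suffices h : ∀ R, IsCompact (Metric.closedBall o R) from
    ⟨fun x r => (h (r + dist x o)).of_isClosed_subset Metric.isClosed_closedBall
      (Metric.closedBall_subset_closedBall' le_rfl)⟩
  intro R
  let S : Set (Grafted D) := Graft.base '' Metric.closedBall ρ R ∪
    ⋃ p ∈ {p : Index D | dist ρ (position D p.1.1) ≤ R},
      ⋃ u ∈ {u | IsVertex (D.offspring p.1.1 p.1.2) u}, ⋃ (h : D.IsBlackLeaf t p.1 u),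
        segment (Graft.base ρ) (Graft.piece p (hD.top p h.1) (hD.top_ne_root p h.1))
  have hS : IsCompact S := by
    refine ((isCompact_closedBall ρ R).image Graft.isometry_base.continuous).union ?_
    refine (hD.finite_index hT R).isCompact_biUnion fun p _ =>
      (hD.finite_vertices _ _).isCompact_biUnion fun u _ => ?_
    by_cases h : D.IsBlackLeaf t p.1 u
    · simp only [h, iUnion_true]; exact hG.isCompact_segment _ _
    · simp only [h, iUnion_of_empty]; exact isCompact_empty
  rw [Subtype.isCompact_iff]
  convert! hS.inter_right (Metric.isClosed_closedBall (x := (Graft.base ρ : Grafted D)) (ε := R)) using 1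
  ext x
  constructor
  · rintro ⟨⟨x, hx⟩, hxR, rfl⟩
    have hxR : dist x (Graft.base ρ : Grafted D) ≤ R := hxR
    refine ⟨?_, hxR⟩
    cases x with
    | base x => exact Or.inl ⟨x, hxR, rfl⟩
    | piece p y hy =>
      right
      obtain ⟨u, hu, h⟩ := (hD.mem_black_iff hTT p y hy).1 hx
      have hp : dist ρ (position D p.1.1) ≤ R := by
        rw [Graft.dist_piece_base] at hxR
        rw [dist_comm]
        linarith [dist_nonneg (x := y) (y := TreePoint.root)]
      refine mem_biUnion hp (mem_biUnion h.1 (mem_iUnion.2 ⟨h, ?_⟩))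
      exact Graft.piece_mem_segment_iff.2 ⟨_, hD.top_ne_root p h.1, rfl,
        (hD.mem_segment_top_iff p h.1 hy).2 hu⟩
  · rintro ⟨hxS, hxR⟩
    refine ⟨⟨x, ?_⟩, hxR, rfl⟩
    rcases hxS with ⟨x, -, rfl⟩ | hxS
    · exact base_mem_black D t x
    · simp only [mem_iUnion] at hxS
      obtain ⟨p, -, u, -, h, hx⟩ := hxS
      cases x with
      | base x => exact base_mem_black D t x
      | piece q y hy =>
        obtain ⟨z', hz', h4, h5⟩ := Graft.piece_mem_segment_iff.1 hx
        simp only [Graft.piece.injEq] at h4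
        obtain ⟨rfl, h4⟩ := h4
        obtain rfl := eq_of_heq h4
        exact (hD.mem_black_iff hTT p y hy).2 ⟨u, (hD.mem_segment_top_iff p h.1 hy).1 h5, h⟩

/-- The black tree as a rooted tree. -/
noncomputable def Good.blackTree (hT : IsDiscreteTree T ρ) (hD : D.Good) (t : ℝ) : RootedTree where
  carrier := D.black t
  metric := inferInstance
  root := ⟨Graft.base ρ, base_mem_black D t ρ⟩
  isRealTree := (hD.treeLike_black hT.isRealTree.treeLike t).isRealTree
  proper := hD.properSpace_black hT t

theorem Good.blackClass_eq (hT : IsDiscreteTree T ρ) (hD : D.Good) (t : ℝ) :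
    D.blackClass t = TreeClass.mk (hD.blackTree hT t) :=
  dif_pos ⟨(hD.treeLike_black hT.isRealTree.treeLike t).isRealTree, hD.properSpace_black hT t⟩

end GraftData

end LevyForest

namespace LevyForest

/-! ### An ambient space for grafted trees -/

section Ambient

variable {Λ : Type}

/-- The `ℓ¹` norm of a finitely supported function. -/
noncomputable def mass (c : Λ →₀ ℝ) : ℝ := c.sum fun _ a => |a|

theorem mass_eq_sum (c : Λ →₀ ℝ) {s : Finset Λ} (hs : c.support ⊆ s) :
    mass c = ∑ e ∈ s, |c e| := Finsupp.sum_of_support_subset c hs _ fun _ _ => abs_zero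

theorem mass_nonneg (c : Λ →₀ ℝ) : 0 ≤ mass c := Finset.sum_nonneg fun _ _ => abs_nonneg _

theorem mass_zero : mass (0 : Λ →₀ ℝ) = 0 := Finsupp.sum_zero_index

theorem mass_neg (c : Λ →₀ ℝ) : mass (-c) = mass c := by
  rw [mass_eq_sum (-c) (s := c.support) (by simp), mass_eq_sum c le_rfl]; simp

theorem mass_single (e : Λ) (a : ℝ) : mass (Finsupp.single e a) = |a| :=
  Finsupp.sum_single_index abs_zero

theorem mass_add_le (c d : Λ →₀ ℝ) : mass (c + d) ≤ mass c + mass d := by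
  classical
  rw [mass_eq_sum (c + d) Finsupp.support_add, mass_eq_sum c Finset.subset_union_left,
    mass_eq_sum d Finset.subset_union_right, ← Finset.sum_add_distrib]
  exact Finset.sum_le_sum fun e _ => abs_add_le _ _

theorem mass_add (c d : Λ →₀ ℝ) (h : ∀ e, |c e + d e| = |c e| + |d e|) :
    mass (c + d) = mass c + mass d := by
  classical
  rw [mass_eq_sum (c + d) Finsupp.support_add, mass_eq_sum c Finset.subset_union_left,
    mass_eq_sum d Finset.subset_union_right, ← Finset.sum_add_distrib]
  exact Finset.sum_congr rfl fun e _ => h e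

theorem mass_add_of_nonneg (c d : Λ →₀ ℝ) (hc : 0 ≤ c) (hd : 0 ≤ d) :
    mass (c + d) = mass c + mass d :=
  mass_add c d fun e => by
    rw [abs_of_nonneg (hc e), abs_of_nonneg (hd e), abs_of_nonneg (add_nonneg (hc e) (hd e))]

theorem mass_sub_of_disjoint (c d : Λ →₀ ℝ) (h : ∀ e, c e = 0 ∨ d e = 0) :
    mass (c - d) = mass c + mass d := by
  rw [sub_eq_add_neg, ← mass_neg d]
  refine mass_add c (-d) fun e => ?_
  rcases h e with h | h <;> simp [h]

theorem mass_eq_zero {c : Λ →₀ ℝ} (h : mass c = 0) : c = 0 := by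
  ext e
  by_cases he : e ∈ c.support
  · exact abs_eq_zero.1 ((Finset.sum_eq_zero_iff_of_nonneg fun _ _ => abs_nonneg _).1 h e he)
  · simpa using he

/-- The points of the `ℓ¹` product of `T` and of the space of finitely supported functions on
`Λ`. -/
@[ext]
structure Ambient (T Λ : Type) : Type where
  point : T
  path : Λ →₀ ℝ

noncomputable instance {T : Type} [MetricSpace T] : MetricSpace (Ambient T Λ) where
  dist x y := dist x.point y.point + mass (x.path - y.path)
  dist_self x := by simp [mass_zero]
  dist_comm x y := by rw [dist_comm, ← mass_neg, neg_sub]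
  dist_triangle x y z := by
    have := mass_add_le (x.path - y.path) (y.path - z.path)
    rw [sub_add_sub_cancel] at this
    linarith [dist_triangle x.point y.point z.point]
  eq_of_dist_eq_zero {x y} h := by
    have h1 := dist_nonneg (x := x.point) (y := y.point)
    have h2 := mass_nonneg (x.path - y.path)
    exact Ambient.ext (dist_eq_zero.1 (by linarith)) (sub_eq_zero.1 (mass_eq_zero (by linarith)))

theorem Ambient.dist_def {T : Type} [MetricSpace T] (x y : Ambient T Λ) :
    dist x y = dist x.point y.point + mass (x.path - y.path) := rfl

/-- The lengths that the path to the point `(u, s)` spends on edges with the various labels. -/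
noncomputable def code : (List ℕ → Λ) → (List ℕ → ℝ≥0) → List ℕ → ℝ → (Λ →₀ ℝ)
  | lab, _, [], s => Finsupp.single (lab []) s
  | lab, l, a :: u, s => Finsupp.single (lab []) (l [] : ℝ) +
      code (fun w => lab (a :: w)) (fun w => l (a :: w)) u s

theorem code_nonneg (lab : List ℕ → Λ) (l : List ℕ → ℝ≥0) (u : List ℕ) {s : ℝ} (hs : 0 ≤ s) :
    0 ≤ code lab l u s := by
  induction u generalizing lab l with
  | nil => exact Finsupp.single_nonneg.2 hs
  | cons a u ih => exact add_nonneg (Finsupp.single_nonneg.2 (NNReal.coe_nonneg _)) (ih _ _)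

theorem mass_code (lab : List ℕ → Λ) (l : List ℕ → ℝ≥0) (u : List ℕ) {s : ℝ} (hs : 0 ≤ s) :
    mass (code lab l u s) = height l u s := by
  induction u generalizing lab l with
  | nil => rw [code, mass_single, height_nil, abs_of_nonneg hs]
  | cons a u ih =>
    rw [code, mass_add_of_nonneg _ _ (Finsupp.single_nonneg.2 (NNReal.coe_nonneg _))
      (code_nonneg _ _ _ hs), ih, mass_single, height_cons, abs_of_nonneg (NNReal.coe_nonneg _)]

theorem exists_of_code_ne_zero (lab : List ℕ → Λ) (l : List ℕ → ℝ≥0) (u : List ℕ) {s : ℝ} {e : Λ}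
    (h : code lab l u s e ≠ 0) : ∃ v, v <+: u ∧ lab v = e := by
  classical
  induction u generalizing lab l with
  | nil =>
    rw [code, Finsupp.single_apply] at h
    exact ⟨[], List.prefix_rfl, by by_contra h'; simp [h'] at h⟩
  | cons a u ih =>
    by_cases h0 : lab [] = e
    · exact ⟨[], List.nil_prefix, h0⟩
    · rw [code, Finsupp.add_apply, Finsupp.single_apply, if_neg h0, zero_add] at h
      obtain ⟨v, hv, hv'⟩ := ih _ _ h
      exact ⟨a :: v, by simpa using hv, hv'⟩

/-- Beyond the last common vertex the two codes have disjoint supports, because edges that are not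
on a common path carry different labels; so the ℓ¹ distance adds up the two branches. Equal labels
along one path do no harm, since there all contributions have the same sign. The labelling by
smallest colours needs exactly this freedom. -/
theorem mass_code_sub (lab : List ℕ → Λ) (l : List ℕ → ℝ≥0) (u v : List ℕ) {s t : ℝ}
    (hs : 0 ≤ s) (ht : 0 ≤ t) (hs' : s ≤ l u) (ht' : t ≤ l v)
    (hlab : ∀ u' v', u' <+: u → v' <+: v → lab u' = lab v' → u' <+: v' ∨ v' <+: u') :
    mass (code lab l u s - code lab l v t) =
      height l u s + height l v t - 2 * meetHeight l u s v t := by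
  have key : ∀ (lab : List ℕ → Λ) (l : List ℕ → ℝ≥0) (b : ℕ) (v : List ℕ) (s t : ℝ), s ≤ l [] →
      0 ≤ t → mass (code lab l (b :: v) t - code lab l [] s) = height l (b :: v) t - s := by
    intro lab l b v s t hs' ht
    rw [code, code, add_sub_right_comm, ← Finsupp.single_sub, mass_add_of_nonneg, mass_single,
      mass_code _ _ _ ht, height_cons, abs_of_nonneg (by linarith)]
    · ring
    · exact Finsupp.single_nonneg.2 (by linarith)
    · exact code_nonneg _ _ _ ht
  induction u generalizing lab l v with
  | nil =>
    cases v with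
    | nil =>
      rw [code, code, ← Finsupp.single_sub, mass_single, meetHeight_nil_left, height_nil, height_nil]
      rcases le_total s t with h | h
      · rw [min_eq_left h, abs_of_nonpos (by linarith)]; ring
      · rw [min_eq_right h, abs_of_nonneg (by linarith)]; ring
    | cons b v =>
      have := height_nonneg (fun w => l (b :: w)) v ht
      rw [← mass_neg, neg_sub, key _ _ _ _ _ _ hs' ht, meetHeight_nil_left, height_nil,
        min_eq_left (by rw [height_cons]; linarith)]
      ring
  | cons a u ih =>
    cases v with
    | nil =>
      have := height_nonneg (fun w => l (a :: w)) u hs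
      rw [key _ _ _ _ _ _ ht' hs, meetHeight_nil_right, height_nil,
        min_eq_right (by rw [height_cons]; linarith)]
      ring
    | cons b v =>
      by_cases hab : a = b
      · subst hab
        have h := ih (fun w => lab (a :: w)) (fun w => l (a :: w)) v hs' ht' (fun u' v' hu hv huv => by
          simpa using hlab (a :: u') (a :: v') (by simpa using hu) (by simpa using hv) huv)
        rw [code, code, add_sub_add_left_eq_sub, h, height_cons, height_cons]
        simp only [meetHeight, if_true]
        ring
      · rw [code, code, add_sub_add_left_eq_sub, mass_sub_of_disjoint, mass_code _ _ _ hs,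
          mass_code _ _ _ ht, height_cons, height_cons]
        · simp only [meetHeight, hab, if_false]; ring
        · intro e
          by_contra hcon
          push Not at hcon
          obtain ⟨u', hu', rfl⟩ := exists_of_code_ne_zero _ _ _ hcon.1
          obtain ⟨v', hv', hv''⟩ := exists_of_code_ne_zero _ _ _ hcon.2
          have := hlab (a :: u') (b :: v') (by simpa using hu') (by simpa using hv') hv''.symm
          simp [hab, Ne.symm hab] at this

namespace GraftData

variable {T : Type} [MetricSpace T] {ρ : T}

/-- The labels `lab` separate the edges of the grafted trees that do not lie on a common path from
the root. -/
structure Separates (D : GraftData ρ) (lab : Site ρ × ℕ → List ℕ → Λ) : Prop where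
  comparable : ∀ (p : Index D) (u v : List ℕ), IsVertex (D.offspring p.1.1 p.1.2) u →
    IsVertex (D.offspring p.1.1 p.1.2) v → lab p.1 u = lab p.1 v → u <+: v ∨ v <+: u
  ne : ∀ (p q : Index D) (u v : List ℕ), p ≠ q → IsVertex (D.offspring p.1.1 p.1.2) u →
    IsVertex (D.offspring q.1.1 q.1.2) v → lab p.1 u ≠ lab q.1 v

/-- The embedding of the grafted tree into the ambient space. -/
noncomputable def embed (D : GraftData ρ) (lab : Site ρ × ℕ → List ℕ → Λ) :
    Grafted D → Ambient T Λ
  | .base x => ⟨x, 0⟩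
  | .piece p y _ => ⟨position D p.1.1, code (lab p.1) (D.length p.1.1 p.1.2) y.word y.pos⟩

/-- Points of one piece share the T-coordinate and are compared by `mass_code_sub`; for different
pieces the label supports are disjoint, so the two heights and the distance of the sites add up. -/
theorem Separates.isometry_embed {D : GraftData ρ} {lab : Site ρ × ℕ → List ℕ → Λ}
    (h : D.Separates lab) : Isometry (D.embed lab) := by
  refine Isometry.of_dist_eq fun x y => ?_
  have hr : ∀ (p : Index D) (y : Piece D p), dist y TreePoint.root =
      mass (code (lab p.1) (D.length p.1.1 p.1.2) y.word y.pos) := fun p y => by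
    rw [dist_comm, TreePoint.dist_root, mass_code _ _ _ y.pos_nonneg]
  cases x with
  | base x =>
    cases y with
    | base y => simp [Ambient.dist_def, embed, mass_zero, Graft.dist_base_base]
    | piece q y hy =>
      simp only [Ambient.dist_def, embed, Graft.dist_base_piece, zero_sub, mass_neg, hr, dist_comm x]
      ring
  | piece p x hx =>
    cases y with
    | base y =>
      simp only [Ambient.dist_def, embed, Graft.dist_piece_base, sub_zero, hr]
      ring
    | piece q y hy =>
      by_cases hpq : p = q
      · subst hpq
        simp only [Ambient.dist_def, embed, Graft.dist_piece_self, dist_self, zero_add]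
        rw [TreePoint.dist_def]
        refine mass_code_sub _ _ _ _ x.pos_nonneg y.pos_nonneg x.pos_le y.pos_le ?_
        intro u v hu hv huv
        exact h.comparable p u v (x.isVertex.of_prefix hu) (y.isVertex.of_prefix hv) huv
      · simp only [Ambient.dist_def, embed, Graft.dist_piece_of_ne hpq, hr]
        rw [mass_sub_of_disjoint]
        · ring
        · intro e
          by_contra hcon
          push Not at hcon
          obtain ⟨u', hu', rfl⟩ := exists_of_code_ne_zero _ _ _ hcon.1
          obtain ⟨v', hv', hv''⟩ := exists_of_code_ne_zero _ _ _ hcon.2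
          exact h.ne p q u' v' hpq (x.isVertex.of_prefix hu') (y.isVertex.of_prefix hv') hv''.symm

end GraftData

end Ambient

/-! ### Estimates for the Gromov-Hausdorff distance -/

theorem bddBelow_ghDist_set (X Y : Type) [MetricSpace X] [MetricSpace Y] (x : X) (y : Y) :
    BddBelow {r : ℝ | ∃ (E : Type) (_ : MetricSpace E) (f : X → E) (g : Y → E),
      Isometry f ∧ Isometry g ∧
        r = max (Metric.hausdorffDist (range f) (range g)) (dist (f x) (g y))} :=
  ⟨0, by
    rintro r ⟨E, _, f, g, -, -, rfl⟩
    exact le_max_of_le_right dist_nonneg⟩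

theorem ghDist_nonneg {X Y : Type} [MetricSpace X] [MetricSpace Y] (x : X) (y : Y) :
    0 ≤ ghDist X Y x y :=
  Real.sInf_nonneg (by
    rintro r ⟨E, _, f, g, -, -, rfl⟩
    exact le_max_of_le_right dist_nonneg)

theorem ghDist_le {X Y E : Type} [MetricSpace X] [MetricSpace Y] [MetricSpace E] {x : X} {y : Y}
    {f : X → E} {g : Y → E} (hf : Isometry f) (hg : Isometry g) (hfg : f x = g y) {ε : ℝ}
    (hε : 0 ≤ ε) (h1 : ∀ a, ∃ b, dist (f a) (g b) ≤ ε) (h2 : ∀ b, ∃ a, dist (g b) (f a) ≤ ε) :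
    ghDist X Y x y ≤ ε := by
  refine (csInf_le (bddBelow_ghDist_set X Y x y) ⟨E, _, f, g, hf, hg, rfl⟩).trans ?_
  refine max_le (Metric.hausdorffDist_le_of_mem_dist hε ?_ ?_) (by rw [hfg, dist_self]; exact hε)
  · rintro _ ⟨a, rfl⟩
    obtain ⟨b, hb⟩ := h1 a
    exact ⟨g b, mem_range_self b, hb⟩
  · rintro _ ⟨b, rfl⟩
    obtain ⟨a, ha⟩ := h2 b
    exact ⟨f a, mem_range_self a, ha⟩

/-- Glue the two balls at their roots: every point is within k of the common root. This bound
dominates the series defining `delta`. -/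
theorem ghDist_ball_le (X Y : RootedTree) (k : ℕ) :
    ghDist (X.Ball k) (Y.Ball k) (X.ballRoot k) (Y.ballRoot k) ≤ k := by
  classical
  let f : X.Ball k → Graft (fun _ : Unit => X.ballRoot k) (fun _ : Unit => Y.ballRoot k) :=
    Graft.base
  let g : Y.Ball k → Graft (fun _ : Unit => X.ballRoot k) (fun _ : Unit => Y.ballRoot k) := fun y =>
    if h : y = Y.ballRoot k then Graft.base (X.ballRoot k) else Graft.piece () y h
  have hg : Isometry g := by
    refine Isometry.of_dist_eq fun y z => ?_
    by_cases hy : y = Y.ballRoot k <;> by_cases hz : z = Y.ballRoot k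
    · simp only [g, hy, hz, dif_pos, dist_self]
    · simp only [g, hy, hz, dif_pos, dif_neg, not_false_eq_true, Graft.dist_base_piece, dist_self,
        add_zero, dist_comm]
    · simp only [g, hy, hz, dif_pos, dif_neg, not_false_eq_true, Graft.dist_piece_base, dist_self,
        add_zero]
    · simp only [g, hy, hz, dif_neg, not_false_eq_true, Graft.dist_piece_self]
  have hroot : f (X.ballRoot k) = g (Y.ballRoot k) := by simp only [f, g, dif_pos]
  refine ghDist_le (f := f) (g := g) Graft.isometry_base hg hroot k.cast_nonneg (fun a => ?_)
    (fun b => ?_)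
  · refine ⟨Y.ballRoot k, ?_⟩
    rw [← hroot, Graft.isometry_base.dist_eq]
    exact a.2
  · refine ⟨X.ballRoot k, ?_⟩
    rw [hroot, hg.dist_eq]
    exact b.2

theorem RootedTree.exists_dist_le (X : RootedTree) {r ε : ℝ} (hr : 0 ≤ r) (x : X.carrier)
    (hx : dist X.root x ≤ r + ε) : ∃ y, dist X.root y ≤ r ∧ dist y x ≤ max ε 0 := by
  rcases le_total (dist X.root x) r with h | h
  · exact ⟨x, h, by rw [dist_self]; exact le_max_right _ _⟩
  · obtain ⟨y, h1, h2⟩ := X.isRealTree.treeLike.mid X.root x r hr h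
    exact ⟨y, h1.le, le_max_of_le_left (by linarith)⟩

/-- The nearby point of the other tree may lie outside its ball, by at most ε. Moving it back
towards the root costs another ε, whence the factor 2. -/
theorem RootedTree.ghDist_ball_le_of_embedding {X Y : RootedTree} {E : Type} [MetricSpace E]
    {f : X.carrier → E} {g : Y.carrier → E} (hf : Isometry f) (hg : Isometry g)
    (hfg : f X.root = g Y.root) {k : ℕ} {ε : ℝ} (hε : 0 ≤ ε)
    (h1 : ∀ x, dist X.root x ≤ k → ∃ y, dist (f x) (g y) ≤ ε)
    (h2 : ∀ y, dist Y.root y ≤ k → ∃ x, dist (g y) (f x) ≤ ε) :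
    ghDist (X.Ball k) (Y.Ball k) (X.ballRoot k) (Y.ballRoot k) ≤ 2 * ε := by
  have key : ∀ {X Y : RootedTree} {f : X.carrier → E} {g : Y.carrier → E} (_ : Isometry f)
      (_ : Isometry g) (_ : f X.root = g Y.root)
      (_ : ∀ x, dist X.root x ≤ k → ∃ y, dist (f x) (g y) ≤ ε) (a : X.Ball k),
      ∃ b : Y.Ball k, dist (f a.1) (g b.1) ≤ 2 * ε := by
    intro X Y f g hf hg hfg h1 a
    have ha : dist X.root a.1 ≤ k := by rw [dist_comm]; exact a.2
    obtain ⟨y, hy⟩ := h1 a.1 ha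
    obtain ⟨z, hz, hzy⟩ := Y.exists_dist_le (ε := ε) k.cast_nonneg y (by
      rw [← hg.dist_eq, ← hfg]
      rw [← hf.dist_eq] at ha
      linarith [dist_triangle (f X.root) (f a.1) (g y)])
    refine ⟨⟨z, by rw [Metric.mem_closedBall, dist_comm]; exact hz⟩, ?_⟩
    rw [max_eq_left hε, ← hg.dist_eq, dist_comm] at hzy
    linarith [dist_triangle (f a.1) (g y) (g z)]
  exact ghDist_le (f := fun x : X.Ball k => f x.1) (g := fun y : Y.Ball k => g y.1)
    (hf.comp isometry_subtype_coe) (hg.comp isometry_subtype_coe) hfg (by linarith)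
    (key hf hg hfg h1) (key hg hf hfg.symm h2)

/-- The k-th term of the series is at most k 2⁻ᵏ, uniformly in the trees, so only finitely many
radii have to be controlled. -/
theorem RootedTree.exists_delta_lt {ε : ℝ} (hε : 0 < ε) : ∃ (K : ℕ) (η : ℝ), 0 < η ∧
    ∀ X Y : RootedTree, (∀ k ≤ K, ghDist (X.Ball k) (Y.Ball k) (X.ballRoot k) (Y.ballRoot k) ≤ η) →
      RootedTree.delta X Y < ε := by
  let w : ℕ → ℝ := fun k => (1 / 2 : ℝ) ^ (k + 1) * (k + 1)
  have hw : Summable w := by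
    have h1 := summable_pow_mul_geometric_of_norm_lt_one 1 (r := (1 / 2 : ℝ)) (by norm_num)
    have h2 := (summable_nat_add_iff 1).2 h1
    refine h2.congr fun k => ?_
    simp only [w]; push_cast; ring
  have hw0 : ∀ k, 0 ≤ w k := fun k => by positivity
  obtain ⟨K, hK⟩ := ((tendsto_order.1 (tendsto_sum_nat_add w)).2 (ε / 2) (by linarith)).exists
  refine ⟨K, ε / 4, by linarith, fun X Y h => ?_⟩
  unfold RootedTree.delta
  set g : ℕ → ℝ := fun k => (1 / 2 : ℝ) ^ (k + 1) *
    ghDist (X.Ball (k + 1)) (Y.Ball (k + 1)) (X.ballRoot (k + 1)) (Y.ballRoot (k + 1)) with hg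
  have hgw : ∀ k, g k ≤ w k := fun k => by
    have := ghDist_ball_le X Y (k + 1)
    push_cast at this
    exact mul_le_mul_of_nonneg_left this (by positivity)
  have hg0 : ∀ k, 0 ≤ g k := fun k => mul_nonneg (by positivity) (ghDist_nonneg _ _)
  have hgs : Summable g := hw.of_nonneg_of_le hg0 hgw
  rw [← hgs.sum_add_tsum_nat_add K]
  have h1 : ∑' k, g (k + K) ≤ ∑' k, w (k + K) :=
    ((summable_nat_add_iff K).2 hgs).tsum_le_tsum (fun k => hgw _) ((summable_nat_add_iff K).2 hw)
  have h2 : ∑ k ∈ Finset.range K, g k ≤ ε / 4 := by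
    calc ∑ k ∈ Finset.range K, g k ≤ ∑ k ∈ Finset.range K, (1 / 2 : ℝ) ^ (k + 1) * (ε / 4) :=
          Finset.sum_le_sum fun k hk => mul_le_mul_of_nonneg_left
            (h (k + 1) (Finset.mem_range.1 hk)) (by positivity)
      _ ≤ ε / 4 := by
          rw [← Finset.sum_mul]
          refine mul_le_of_le_one_left (by linarith) ?_
          have h3 := (summable_geometric_of_lt_one (r := (1 / 2 : ℝ)) (by norm_num)
            (by norm_num)).sum_le_tsum (Finset.range K) (fun _ _ => by positivity)
          rw [tsum_geometric_of_lt_one (by norm_num) (by norm_num)] at h3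
          simp_rw [pow_succ, ← Finset.sum_mul]
          norm_num at h3 ⊢
          linarith
  linarith

end LevyForest

namespace LevyForest

/-! ### Measurability of the class of the black tree -/

section

variable {T : Type} [MetricSpace T] {ρ : T}

theorem IsDiscreteTree.countable_branchPoints (hT : IsDiscreteTree T ρ) :
    (branchPoints ρ).Countable := by
  refine (countable_iUnion fun n : ℕ => (hT.finite_branchPoints n).countable).mono fun x hx => ?_
  obtain ⟨n, hn⟩ := exists_nat_ge (dist x ρ)
  exact mem_iUnion.2 ⟨n, hn, hx⟩

theorem IsDiscreteTree.countable_site (hT : IsDiscreteTree T ρ) : Countable (Site ρ) := by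
  have := hT.countable_branchPoints.to_subtype
  refine Function.Injective.countable (β := (ℕ × ℕ) ⊕ (branchPoints ρ) ⊕ Unit) (f := fun
    | .poisson n i => Sum.inl (n, i)
    | .branch σ => Sum.inr (Sum.inl σ)
    | .root => Sum.inr (Sum.inr ())) ?_
  rintro (⟨n, i⟩ | σ | _) (⟨m, j⟩ | τ | _) h <;> simp_all

end

theorem mass_code_sub_le {Λ : Type} (lab : List ℕ → Λ) (l l' : List ℕ → ℝ≥0) (u : List ℕ)
    {s s' η : ℝ} (h : ∀ v, v <+: u → |(l v : ℝ) - l' v| ≤ η) (hs : |s - s'| ≤ η) :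
    mass (code lab l u s - code lab l' u s') ≤ (u.length + 1) * η := by
  induction u generalizing lab l l' with
  | nil => simpa [code, ← Finsupp.single_sub, mass_single] using hs
  | cons a u ih =>
    rw [code, code, add_sub_add_comm, ← Finsupp.single_sub]
    have h1 := ih (fun w => lab (a :: w)) (fun w => l (a :: w)) (fun w => l' (a :: w))
      (fun v hv => h (a :: v) (by simpa using hv))
    have h2 := h [] List.nil_prefix
    refine (mass_add_le _ _).trans ?_
    rw [mass_single, List.length_cons]
    push_cast
    linarith

/-- Whether a word is a vertex is decided by the offspring numbers of its strict prefixes, so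
agreement on the vertices of k suffices. -/
theorem isVertex_congr {k k' : List ℕ → ℕ} (h : ∀ u, IsVertex k u → k' u = k u) (u : List ℕ) :
    IsVertex k' u ↔ IsVertex k u := by
  constructor
  · intro hu
    induction u using List.reverseRecOn with
    | nil => exact isVertex_nil k
    | append_singleton v a ih =>
      have hv := ih (hu.of_prefix (List.prefix_append _ _))
      exact isVertex_append_singleton hv ((hu v a List.prefix_rfl).trans_eq (h v hv))
  · intro hu v j hv
    rw [h v (hu.of_prefix ((List.prefix_append _ _).trans hv))]
    exact hu v j hv

namespace GraftData

variable {T : Type} [MetricSpace T] {ρ : T}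

/-- The label of an edge is its address. -/
def address (p : Site ρ × ℕ) (u : List ℕ) : Site ρ × ℕ × List ℕ := (p.1, p.2, u)

/-- Addresses do not depend on the realization, so grafted trees built from different data sit in
one ambient space and can be compared there. -/
theorem separates_address (D : GraftData ρ) : D.Separates address where
  comparable p u v _ _ h := by
    simp only [address, Prod.mk.injEq, true_and] at h
    exact Or.inl (h ▸ List.prefix_rfl)
  ne p q u v hpq _ _ h := by
    simp only [address, Prod.mk.injEq] at h
    exact hpq (Subtype.ext (Prod.ext h.1 h.2.1))

/-- The information about the randomness that determines the black tree. -/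
abbrev Code (ρ : T) : Type :=
  (ℕ → ℕ) × (ℕ × ℕ → T) × (Site ρ → ℕ) × (Site ρ × ℕ × List ℕ → ℕ × ℝ≥0 × Bool)

open Classical in
/-- The information about the randomness that determines the black tree at level `t`. -/
noncomputable def toCode (t : ℝ) (D : GraftData ρ) : Code ρ :=
  (D.1, D.2.1, D.2.2.1, fun q => ((D.2.2.2 q).1, (D.2.2.2 q).2.1,
    decide (((D.2.2.2 q).2.2 : ℝ) ≤ t)))

/-- The sites that may lie in the ball of radius `R`. -/
def NearSite (K : ℕ → ℕ) (R : ℕ) : Site ρ → Prop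
  | .poisson n i => n ≤ R ∧ i < K n
  | .branch σ => dist ρ σ.1 ≤ R
  | .root => True

/-- Up to distance `R` the discrete data of `c` and `c'` agree and the continuous ones are close. -/
structure Close (R : ℕ) (η : ℝ) (c c' : Code ρ) : Prop where
  number : ∀ n ≤ R, c'.1 n = c.1 n
  position : ∀ n ≤ R, ∀ i < c.1 n, dist (c'.2.1 (n, i)) (c.2.1 (n, i)) ≤ η
  count : ∀ σ, NearSite c.1 R σ → c'.2.2.1 σ = c.2.2.1 σ
  vertex : ∀ σ, NearSite c.1 R σ → ∀ j < c.2.2.1 σ, ∀ u,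
    IsVertex (fun u => (c.2.2.2 (σ, j, u)).1) u →
      (c'.2.2.2 (σ, j, u)).1 = (c.2.2.2 (σ, j, u)).1 ∧
      |((c'.2.2.2 (σ, j, u)).2.1 : ℝ) - (c.2.2.2 (σ, j, u)).2.1| ≤ η ∧
      (c'.2.2.2 (σ, j, u)).2.2 = (c.2.2.2 (σ, j, u)).2.2

theorem Close.nearSite {R : ℕ} {η : ℝ} {c c' : Code ρ} (h : Close R η c c') (σ : Site ρ) :
    NearSite c'.1 R σ ↔ NearSite c.1 R σ := by
  cases σ with
  | poisson n i => exact and_congr_right fun hn => by rw [h.number n hn]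
  | branch σ => exact Iff.rfl
  | root => exact Iff.rfl

theorem Close.isVertex_iff {R : ℕ} {η : ℝ} {c c' : Code ρ} (h : Close R η c c') {σ : Site ρ}
    (hσ : NearSite c.1 R σ) {j : ℕ} (hj : j < c.2.2.1 σ) (u : List ℕ) :
    IsVertex (fun u => (c'.2.2.2 (σ, j, u)).1) u ↔ IsVertex (fun u => (c.2.2.2 (σ, j, u)).1) u :=
  isVertex_congr (fun u hu => (h.vertex σ hσ j hj u hu).1) u

theorem Close.symm {R : ℕ} {η : ℝ} {c c' : Code ρ} (h : Close R η c c') : Close R η c' c where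
  number n hn := (h.number n hn).symm
  position n hn i hi := by
    rw [dist_comm]
    exact h.position n hn i (by rwa [← h.number n hn])
  count σ hσ := (h.count σ ((h.nearSite σ).1 hσ)).symm
  vertex σ hσ j hj u hu := by
    have hσ := (h.nearSite σ).1 hσ
    rw [h.count σ hσ] at hj
    obtain ⟨h1, h2, h3⟩ := h.vertex σ hσ j hj u ((h.isVertex_iff hσ hj u).1 hu)
    exact ⟨h1.symm, by rwa [abs_sub_comm], h3.symm⟩

theorem Good.nearSite {D : GraftData ρ} (hD : D.Good) {R : ℕ} (p : Index D)
    (hp : dist ρ (position D p.1.1) ≤ R) : NearSite D.1 R p.1.1 ∧ p.1.2 < D.2.2.1 p.1.1 := by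
  obtain ⟨⟨σ, j⟩, hj⟩ := p
  cases σ with
  | poisson n i =>
    simp only [GraftData.count] at hj
    split_ifs at hj with hi
    · refine ⟨⟨?_, hi⟩, hj⟩
      exact_mod_cast (hD.position_mem n i hi).1.trans hp
    · simp at hj
  | branch σ => exact ⟨hp, hj⟩
  | root => exact ⟨trivial, hj⟩

theorem count_of_nearSite {D : GraftData ρ} {R : ℕ} {σ : Site ρ} (h : NearSite D.1 R σ) :
    count D σ = D.2.2.1 σ := by
  cases σ with
  | poisson n i => exact if_pos h.2
  | branch σ => rfl
  | root => rfl

theorem Close.isBlackLeaf {t t' : ℝ} {R : ℕ} {η : ℝ} {D D' : GraftData ρ}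
    (h : Close R η (toCode t D) (toCode t' D')) {σ : Site ρ} (hσ : NearSite D.1 R σ) {j : ℕ}
    (hj : j < D.2.2.1 σ) {u : List ℕ} (hu : D.IsBlackLeaf t (σ, j) u) :
    D'.IsBlackLeaf t' (σ, j) u := by
  obtain ⟨h1, h2, h3⟩ := h.vertex σ hσ j hj u hu.1
  refine ⟨(h.isVertex_iff hσ hj u).2 hu.1, h1.trans hu.2.1, ?_⟩
  simp only [toCode, decide_eq_decide] at h3
  exact h3.2 hu.2.2

/-- The counterpart of a point has the same site and word. The site moves by at most η, and each of
the at most H + 1 edges on the path contributes at most η. -/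
theorem Close.exists_dist_le (hT : TreeLike T) {t t' : ℝ} {R : ℕ} {η : ℝ} (hη : 0 ≤ η)
    {D D' : GraftData ρ} (hD : D.Good) (hD' : D'.Good) (h : Close R η (toCode t D) (toCode t' D'))
    {H : ℕ} (hH : ∀ σ, NearSite D.1 R σ → ∀ j < D.2.2.1 σ, ∀ u, IsVertex (D.offspring σ j) u →
      u.length ≤ H) (x : Grafted D) (hx : x ∈ D.black t)
    (hxR : dist (Graft.base ρ : Grafted D) x ≤ R) :
    ∃ x' ∈ D'.black t', dist (D.embed address x) (D'.embed address x') ≤ (H + 2) * η := by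
  cases x with
  | base x =>
    refine ⟨_, base_mem_black D' t' x, ?_⟩
    simp only [embed, dist_self]
    positivity
  | piece p y hy =>
    rw [Graft.dist_base_piece] at hxR
    obtain ⟨hσ, hj⟩ := hD.nearSite (R := R) p (by
      rw [dist_comm]; linarith [dist_nonneg (x := y) (y := TreePoint.root)])
    obtain ⟨v, hv, hbl⟩ := (hD.mem_black_iff hT p y hy).1 hx
    have hbl' := h.isBlackLeaf hσ hj hbl
    have hσ' : NearSite D'.1 R p.1.1 := (h.nearSite p.1.1).2 hσ
    let p' : Index D' := ⟨p.1, by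
      rw [count_of_nearSite hσ']
      exact hj.trans_eq (h.count p.1.1 hσ).symm⟩
    have hypos : 0 < y.pos := by
      rcases y.mem with h | h
      · exact absurd (TreePoint_eq_root_of_pos h.2) hy
      · exact h.2.1
    have hlpos : 0 < (D'.length p.1.1 p.1.2 y.word : ℝ) := by exact_mod_cast hD'.length_pos _
    have hvert : ∀ w, w <+: y.word → |(D.length p.1.1 p.1.2 w : ℝ) - D'.length p.1.1 p.1.2 w| ≤ η :=
      fun w hw => by
        rw [abs_sub_comm]
        exact (h.vertex p.1.1 hσ p.1.2 hj w (y.isVertex.of_prefix hw)).2.1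
    -- The position is cut off at the new edge length, which may be smaller; the cut is at most η.
    let y' : Piece D' p' := ⟨y.word, min y.pos (D'.length p.1.1 p.1.2 y.word),
      Or.inr ⟨hbl'.1.of_prefix hv, lt_min hypos hlpos, min_le_right _ _⟩⟩
    have hy' : y' ≠ TreePoint.root := fun h => by
      have := congrArg TreePoint.pos h
      exact (lt_min hypos hlpos).ne' this
    refine ⟨Graft.piece p' y' hy', (hD'.mem_black_iff hT p' y' hy').2 ⟨v, hv, hbl'⟩, ?_⟩
    have hpos : dist (GraftData.position D p.1.1) (GraftData.position D' p.1.1) ≤ η := by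
      cases hp : p.1.1 with
      | poisson n i =>
        rw [hp] at hσ
        rw [dist_comm]
        exact h.position n hσ.1 i hσ.2
      | branch σ => simpa [GraftData.position] using hη
      | root => simpa [GraftData.position] using hη
    have hs : |y.pos - y'.pos| ≤ η := by
      have h1 := abs_le.1 (hvert y.word List.prefix_rfl)
      have h2 := y.pos_le
      simp only [y']
      rcases le_total y.pos (D'.length p.1.1 p.1.2 y.word) with h3 | h3
      · rwa [min_eq_left h3, sub_self, abs_zero]
      · rw [min_eq_right h3, abs_of_nonneg (by linarith)]
        linarith [h1.2]
    have hm := mass_code_sub_le (address p.1) (D.length p.1.1 p.1.2) (D'.length p.1.1 p.1.2) y.word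
      hvert hs
    have hlen : (y.word.length : ℝ) ≤ H := by exact_mod_cast hH _ hσ _ hj _ y.isVertex
    have : ((y.word.length : ℝ) + 1) * η ≤ (H + 1) * η := by gcongr
    simp only [embed, Ambient.dist_def]
    change dist (GraftData.position D p.1.1) (GraftData.position D' p.1.1) +
      mass (code (address p.1) (D.length p.1.1 p.1.2) y.word y.pos -
        code (address p.1) (D'.length p.1.1 p.1.2) y.word y'.pos) ≤ _
    linarith

theorem finite_nearSite (hT : IsDiscreteTree T ρ) (K : ℕ → ℕ) (R : ℕ) :
    {σ : Site ρ | NearSite K R σ}.Finite := by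
  have h1 : {q : ℕ × ℕ | q.1 ≤ R ∧ q.2 < K q.1}.Finite := by
    refine ((Set.finite_le_nat R).biUnion (t := fun n => (fun i => (n, i)) '' Iio (K n))
      fun n _ => (finite_Iio _).image _).subset ?_
    rintro ⟨n, i⟩ ⟨h, h'⟩
    exact mem_biUnion (x := n) h ⟨i, h', rfl⟩
  have h2 : {σ : branchPoints ρ | σ.1 ∈ Metric.closedBall ρ R}.Finite := by
    refine Finite.of_finite_image ((hT.finite_branchPoints R).subset ?_)
      (Subtype.val_injective.injOn)
    rintro _ ⟨σ, hσ, rfl⟩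
    exact ⟨hσ, σ.2⟩
  refine ((h1.image fun q => Site.poisson q.1 q.2).union
    ((h2.image Site.branch).union (finite_singleton Site.root))).subset ?_
  rintro (⟨n, i⟩ | σ | _) h
  · exact Or.inl ⟨(n, i), h, rfl⟩
  · exact Or.inr (Or.inl ⟨σ, by rwa [Set.mem_ofPred_eq, Metric.mem_closedBall, dist_comm], rfl⟩)
  · exact Or.inr (Or.inr rfl)

/-- Continuity of the black class in the code at a good realization: up to radius K only finitely
many sites and vertices matter, and their words have bounded length. -/
theorem Good.exists_delta_lt (hT : IsDiscreteTree T ρ) (t : ℝ) {D : GraftData ρ} (hD : D.Good)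
    {ε : ℝ} (hε : 0 < ε) : ∃ (R : ℕ) (η : ℝ), 0 < η ∧ ∀ (D' : GraftData ρ) (t' : ℝ), D'.Good →
      Close R η (toCode t D) (toCode t' D') →
        TreeClass.delta (D.blackClass t) (D'.blackClass t') < ε := by
  have hTT := hT.isRealTree.treeLike
  obtain ⟨K, η, hη, hK⟩ := RootedTree.exists_delta_lt hε
  have hfin : (⋃ σ ∈ {σ : Site ρ | NearSite D.1 K σ}, ⋃ j ∈ Iio (D.2.2.1 σ),
      {u | IsVertex (D.offspring σ j) u}).Finite :=
    (finite_nearSite hT D.1 K).biUnion fun σ _ => (finite_Iio _).biUnion fun j _ =>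
      hD.finite_vertices σ j
  obtain ⟨H, hH⟩ := (hfin.image List.length).bddAbove
  have hH : ∀ σ, NearSite D.1 K σ → ∀ j < D.2.2.1 σ, ∀ u, IsVertex (D.offspring σ j) u →
      u.length ≤ H := fun σ hσ j hj u hu =>
    hH ⟨u, mem_biUnion hσ (mem_biUnion (x := j) hj hu), rfl⟩
  have hpos : (0 : ℝ) < 2 * (H + 2) := by positivity
  -- The factor H + 2 comes from `Close.exists_dist_le`, the factor 2 from
  -- `RootedTree.ghDist_ball_le_of_embedding`.
  refine ⟨K, η / (2 * (H + 2)), by positivity, fun D' t' hD' hc => ?_⟩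
  have hH' : ∀ σ, NearSite D'.1 K σ → ∀ j < D'.2.2.1 σ, ∀ u, IsVertex (D'.offspring σ j) u →
      u.length ≤ H := fun σ hσ j hj u hu => by
    have hσ := (hc.nearSite σ).1 hσ
    have hj : j < D.2.2.1 σ := hj.trans_eq (hc.count σ hσ)
    exact hH σ hσ j hj u ((hc.isVertex_iff hσ hj u).1 hu)
  rw [hD.blackClass_eq hT, hD'.blackClass_eq hT]
  refine hK (hD.blackTree hT t) (hD'.blackTree hT t') fun k hk => ?_
  have hk' : (k : ℝ) ≤ K := by exact_mod_cast hk
  have e : η = 2 * ((H + 2) * (η / (2 * (H + 2)))) := by field_simp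
  conv_rhs => rw [e]
  refine RootedTree.ghDist_ball_le_of_embedding (X := hD.blackTree hT t) (Y := hD'.blackTree hT t')
    (f := fun x : D.black t => D.embed address x.1)
    (g := fun x : D'.black t' => D'.embed address x.1)
    ((D.separates_address).isometry_embed.comp isometry_subtype_coe)
    ((D'.separates_address).isometry_embed.comp isometry_subtype_coe) rfl (by positivity)
    (fun x hx => ?_) (fun x hx => ?_)
  · obtain ⟨x', h1, h2⟩ := hc.exists_dist_le hTT (by positivity) hD hD' hH x.1 x.2 (hx.trans hk')
    exact ⟨⟨x', h1⟩, h2⟩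
  · obtain ⟨x', h1, h2⟩ := hc.symm.exists_dist_le hTT (by positivity) hD' hD hH' x.1 x.2
      (hx.trans hk')
    exact ⟨⟨x', h1⟩, h2⟩

/-- Closeness constrains finitely many coordinates, with discrete values or up to η, so it defines a
neighbourhood in the product topology. -/
theorem eventually_close (hT : IsDiscreteTree T ρ) {D : GraftData ρ} (hD : D.Good) (t : ℝ) (R : ℕ)
    {η : ℝ} (hη : 0 < η) : ∀ᶠ c in 𝓝 (toCode t D), Close R η (toCode t D) c := by
  have c1 : ∀ n : ℕ, ∀ᶠ c : Code ρ in 𝓝 (toCode t D), c.1 n = (toCode t D).1 n := fun n =>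
    (((continuous_apply n).comp continuous_fst).tendsto _).eventually
      ((isOpen_discrete {(toCode t D).1 n}).mem_nhds rfl)
  have c2 : ∀ q : ℕ × ℕ, ∀ᶠ c : Code ρ in 𝓝 (toCode t D),
      dist (c.2.1 q) ((toCode t D).2.1 q) ≤ η := fun q =>
    (((continuous_apply q).comp (continuous_fst.comp continuous_snd)).tendsto
      (toCode t D)).eventually (p := fun x : T => dist x ((toCode t D).2.1 q) ≤ η)
      (Metric.closedBall_mem_nhds ((toCode t D).2.1 q) hη)
  have c3 : ∀ σ : Site ρ, ∀ᶠ c : Code ρ in 𝓝 (toCode t D), c.2.2.1 σ = (toCode t D).2.2.1 σ :=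
    fun σ => (((continuous_apply σ).comp (continuous_fst.comp
      (continuous_snd.comp continuous_snd))).tendsto _).eventually
      ((isOpen_discrete {(toCode t D).2.2.1 σ}).mem_nhds rfl)
  have c4 : ∀ q : Site ρ × ℕ × List ℕ, Continuous fun c : Code ρ => c.2.2.2 q := fun q =>
    (continuous_apply q).comp (continuous_snd.comp (continuous_snd.comp continuous_snd))
  have c5 : ∀ q : Site ρ × ℕ × List ℕ, ∀ᶠ c : Code ρ in 𝓝 (toCode t D),
      (c.2.2.2 q).1 = ((toCode t D).2.2.2 q).1 ∧
      |((c.2.2.2 q).2.1 : ℝ) - ((toCode t D).2.2.2 q).2.1| ≤ η ∧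
      (c.2.2.2 q).2.2 = ((toCode t D).2.2.2 q).2.2 := fun q =>
    ((((continuous_fst.comp (c4 q)).tendsto _).eventually
      ((isOpen_discrete {((toCode t D).2.2.2 q).1}).mem_nhds rfl))).and
    ((((NNReal.continuous_coe.comp (continuous_fst.comp (continuous_snd.comp (c4 q)))).tendsto
      _).eventually (Metric.closedBall_mem_nhds _ hη)).and
    (((continuous_snd.comp (continuous_snd.comp (c4 q))).tendsto _).eventually
      ((isOpen_discrete {((toCode t D).2.2.2 q).2.2}).mem_nhds rfl)))
  have hS := finite_nearSite hT D.1 R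
  filter_upwards [(eventually_all_finite (Set.finite_le_nat R)).2 fun n _ => c1 n,
    (eventually_all_finite (Set.finite_le_nat R)).2 fun n _ =>
      (eventually_all_finite (finite_Iio (D.1 n))).2 fun i _ => c2 (n, i),
    (eventually_all_finite hS).2 fun σ _ => c3 σ,
    (eventually_all_finite hS).2 fun σ _ => (eventually_all_finite (finite_Iio (D.2.2.1 σ))).2
      fun j _ => (eventually_all_finite (hD.finite_vertices σ j)).2 fun u _ => c5 (σ, j, u)]
    with c h1 h2 h3 h4
  exact ⟨h1, h2, h3, h4⟩

theorem measurable_toCode [MeasurableSpace T] (t : ℝ) :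
    Measurable (toCode t : GraftData ρ → Code ρ) := by
  refine measurable_fst.prodMk ((measurable_fst.comp measurable_snd).prodMk
    ((measurable_fst.comp (measurable_snd.comp measurable_snd)).prodMk ?_))
  refine measurable_pi_lambda _ fun q => ?_
  have hq : Measurable fun D : GraftData ρ => D.2.2.2 q :=
    (measurable_pi_apply q).comp (measurable_snd.comp (measurable_snd.comp measurable_snd))
  refine (measurable_fst.comp hq).prodMk ((measurable_fst.comp (measurable_snd.comp hq)).prodMk ?_)
  refine measurable_to_bool ?_
  have : MeasurableSet {x : unitInterval | (x : ℝ) ≤ t} :=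
    measurableSet_le measurable_subtype_coe measurable_const
  convert (measurable_snd.comp (measurable_snd.comp hq)) this using 1
  ext D; simp

/-- On good realizations the class is a continuous function of the code, and the code is a
measurable function of the data. The colours enter through a measurable Boolean only, so no
continuity in them is required. -/
theorem measurable_blackClass [MeasurableSpace T] [BorelSpace T] (hT : IsDiscreteTree T ρ) (t : ℝ)
    {G : Set (GraftData ρ)} (hG : ∀ D ∈ G, D.Good) :
    Measurable fun D : G => D.1.blackClass t := by
  have := hT.proper
  have := hT.countable_site
  refine measurable_of_isOpen fun U hU => ?_
  -- Continuity is available only at codes of good realizations, so the open set is assembled from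
  -- interiors; its preimage is nevertheless the whole preimage of U.
  let V : Set (Code ρ) := ⋃ D : G, ⋃ (_ : D.1.blackClass t ∈ U),
    interior {c | ∀ D' ∈ G, toCode t D' = c → D'.blackClass t ∈ U}
  have hV : IsOpen V := isOpen_iUnion fun D => isOpen_iUnion fun _ => isOpen_interior
  have : (fun D : G => D.1.blackClass t) ⁻¹' U = (fun D : G => toCode t D.1) ⁻¹' V := by
    ext D
    simp only [mem_preimage, V, mem_iUnion]
    constructor
    · intro h
      refine ⟨D, h, ?_⟩
      rw [mem_interior_iff_mem_nhds]
      obtain ⟨ε, hε, hεU⟩ := hU _ h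
      obtain ⟨R, η, hη, h'⟩ := (hG D.1 D.2).exists_delta_lt hT t hε
      filter_upwards [eventually_close hT (hG D.1 D.2) t R hη] with c hc D' hD' hcD'
      exact hεU _ (h' D' t (hG D' hD') (hcD' ▸ hc))
    · rintro ⟨-, -, h⟩
      exact interior_subset h D.1 D.2 rfl
  rw [this]
  have : BorelSpace (ℕ × ℝ≥0 × Bool) := inferInstance
  have : BorelSpace (Site ρ × ℕ × List ℕ → ℕ × ℝ≥0 × Bool) := inferInstance
  have : BorelSpace (Site ρ → ℕ) := inferInstance
  have : SecondCountableTopology T := inferInstance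
  have : BorelSpace (ℕ × ℕ → T) := inferInstance
  have : BorelSpace (ℕ → ℕ) := inferInstance
  have : BorelSpace ((Site ρ → ℕ) × (Site ρ × ℕ × List ℕ → ℕ × ℝ≥0 × Bool)) := Prod.borelSpace
  have : BorelSpace ((ℕ × ℕ → T) × (Site ρ → ℕ) × (Site ρ × ℕ × List ℕ → ℕ × ℝ≥0 × Bool)) :=
    Prod.borelSpace
  have : BorelSpace (Code ρ) := Prod.borelSpace
  exact ((measurable_toCode t).comp measurable_subtype_coe) hV.measurableSet

end GraftData

end LevyForest

namespace LevyForest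

/-! ### Blocks of independent variables -/

section Independence

/-- For each index the rectangles form a π-system generating the σ-algebra of the pair, and on
rectangles the product measure factorizes. -/
theorem iIndepFun_prodMk {ι Ω Ω' : Type*} {A B : ι → Type*} [MeasurableSpace Ω]
    [MeasurableSpace Ω'] [∀ i, MeasurableSpace (A i)] [∀ i, MeasurableSpace (B i)]
    {P : Measure Ω} {P' : Measure Ω'} [IsProbabilityMeasure P] [IsProbabilityMeasure P']
    {X : ∀ i, Ω → A i} {Y : ∀ i, Ω' → B i} (mX : ∀ i, Measurable (X i))
    (mY : ∀ i, Measurable (Y i)) (hX : iIndepFun X P) (hY : iIndepFun Y P') :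
    iIndepFun (fun i (ω : Ω × Ω') => (X i ω.1, Y i ω.2)) (P.prod P') := by
  have hm : ∀ i, Measurable fun ω : Ω × Ω' => (X i ω.1, Y i ω.2) := fun i =>
    ((mX i).comp measurable_fst).prodMk ((mY i).comp measurable_snd)
  rw [iIndepFun_iff_iIndep]
  refine iIndepSets.iIndep (fun i => (hm i).comap_le)
    (fun i => {s | ∃ a b, MeasurableSet a ∧ MeasurableSet b ∧ s = (X i ⁻¹' a) ×ˢ (Y i ⁻¹' b)})
    (fun i => ?_) (fun i => ?_) ?_
  · rintro _ ⟨a, b, ha, hb, rfl⟩ _ ⟨a', b', ha', hb', rfl⟩ -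
    refine ⟨a ∩ a', b ∩ b', ha.inter ha', hb.inter hb', ?_⟩
    rw [prod_inter_prod, preimage_inter, preimage_inter]
  · rw [← generateFrom_prod, MeasurableSpace.comap_generateFrom]
    congr 1
    ext s
    constructor
    · rintro ⟨_, ⟨a, ha, b, hb, rfl⟩, rfl⟩
      exact ⟨a, b, ha, hb, rfl⟩
    · rintro ⟨a, b, ha, hb, rfl⟩
      exact ⟨a ×ˢ b, ⟨a, ha, b, hb, rfl⟩, rfl⟩
  · rw [iIndepSets_iff]
    intro s f hf
    have hf' : ∀ i, ∃ a b, i ∈ s → MeasurableSet a ∧ MeasurableSet b ∧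
        f i = (X i ⁻¹' a) ×ˢ (Y i ⁻¹' b) := fun i => by
      by_cases hi : i ∈ s
      · obtain ⟨a, b, h⟩ := hf i hi
        exact ⟨a, b, fun _ => h⟩
      · exact ⟨∅, ∅, fun h => absurd h hi⟩
    choose a b hab using hf'
    have h1 : (⋂ i ∈ s, f i) = (⋂ i ∈ s, X i ⁻¹' a i) ×ˢ (⋂ i ∈ s, Y i ⁻¹' b i) := by
      ext ω
      simp only [mem_iInter, mem_prod]
      constructor
      · intro h
        exact ⟨fun i hi => by have := h i hi; rw [(hab i hi).2.2] at this; exact this.1,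
          fun i hi => by have := h i hi; rw [(hab i hi).2.2] at this; exact this.2⟩
      · intro h i hi
        rw [(hab i hi).2.2]
        exact ⟨h.1 i hi, h.2 i hi⟩
    rw [h1, Measure.prod_prod, hX.measure_inter_preimage_eq_mul s (fun i hi => (hab i hi).1),
      hY.measure_inter_preimage_eq_mul s (fun i hi => (hab i hi).2.1), ← Finset.prod_mul_distrib]
    refine Finset.prod_congr rfl fun i hi => ?_
    rw [(hab i hi).2.2, Measure.prod_prod]

/-- Grouping the coordinates by the fibres of f turns the product measure into a product, over C, of
product measures. -/
theorem iIndepFun_fiber {J C X : Type*} [MeasurableSpace X] (μ : J → Measure X)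
    [∀ j, IsProbabilityMeasure (μ j)] (f : J → C) :
    iIndepFun (fun c (ω : J → X) (j : {j // f j = c}) => ω j) (Measure.infinitePi μ) := by
  let e : (Σ c, {j // f j = c}) ≃ J := Equiv.sigmaFiberEquiv f
  have h1 := Measure.infinitePi_map_piCongrLeft μ e
  have h2 := Measure.infinitePi_map_piCurry_symm
    (fun (c : C) (j : {j // f j = c}) => μ j)
  have hm : Measurable fun (ω : J → X) (c : C) (j : {j // f j = c}) => ω j := by fun_prop
  rw [iIndepFun_iff_map_fun_eq_infinitePi_map (by fun_prop)]
  have h3 : ∀ c, (Measure.infinitePi μ).map (fun ω (j : {j // f j = c}) => ω j) =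
      Measure.infinitePi fun j : {j // f j = c} => μ j := fun c =>
    Measure.map_infinitePi_infinitePi_of_inj Subtype.val_injective
  simp_rw [h3]
  rw [← h1]
  change Measure.map _ (Measure.map _ (Measure.infinitePi fun p : (Σ c, {j // f j = c}) =>
    μ p.2)) = _
  rw [← h2, Measure.map_map hm (by fun_prop), Measure.map_map (hm.comp (by fun_prop)) (by fun_prop)]
  convert! Measure.map_id
  ext ω c j
  obtain ⟨j, rfl⟩ := j
  have := (MeasurableEquiv.piCongrLeft_apply_apply (β := fun _ : J => X) e
    ((MeasurableEquiv.piCurry (fun (c : C) (_ : {j // f j = c}) => X)).symm ω) ⟨f j, j, rfl⟩)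
  exact this

theorem infinitePi_map_prod {J K X : Type*} [MeasurableSpace X] (μ : J → Measure X)
    [∀ j, IsProbabilityMeasure (μ j)] (i : J) {f : K → J} (hf : Function.Injective f)
    (hi : ∀ k, f k ≠ i) : (Measure.infinitePi μ).map (fun ω => (ω i, fun k => ω (f k))) =
      (μ i).prod (Measure.infinitePi fun k => μ (f k)) := by
  classical
  have h := (iIndepFun_fiber μ (fun j => decide (j = i))).indepFun
    (i := true) (j := false) (by simp)
  have hφ : Measurable fun x : {j // decide (j = i) = true} → X => x ⟨i, by simp⟩ :=
    measurable_pi_apply _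
  have h' := h.comp (φ := fun x => x ⟨i, by simp⟩)
    (ψ := fun (x : {j // decide (j = i) = false} → X) (k : K) => x ⟨f k, by simpa using hi k⟩)
    hφ (by fun_prop)
  have := (indepFun_iff_map_prod_eq_prod_map_map (Measurable.aemeasurable (by fun_prop))
    (Measurable.aemeasurable (by fun_prop))).1 h'
  rw [← Measure.infinitePi_map_eval μ i, ← Measure.map_infinitePi_infinitePi_of_inj hf]
  exact this

theorem infinitePi_nat_map_prod {X : Type*} [MeasurableSpace X] (R : Measure X)
    [IsProbabilityMeasure R] : (Measure.infinitePi fun _ : ℕ => R).map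
      (fun ω => (ω 0, fun k => ω (k + 1))) = R.prod (Measure.infinitePi fun _ : ℕ => R) :=
  infinitePi_map_prod _ 0 (add_left_injective 1) fun k => k.succ_ne_zero

/-- The independence behind the branching property: the data of the root and those of the subtrees
above the words of length one are independent, and each subtree is distributed like the whole. -/
theorem infinitePi_list_map_prod {X : Type*} [MeasurableSpace X] (Q : Measure X)
    [IsProbabilityMeasure Q] : (Measure.infinitePi fun _ : List ℕ => Q).map
      (fun ω => (ω [], fun (j : ℕ) (u : List ℕ) => ω (j :: u))) =
        Q.prod (Measure.infinitePi fun _ : ℕ => Measure.infinitePi fun _ : List ℕ => Q) := by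
  have h := infinitePi_map_prod (fun _ : List ℕ => Q) [] (f := fun p : ℕ × List ℕ => p.1 :: p.2)
    (fun p q h => by simpa [Prod.ext_iff] using h) (fun k => by simp)
  rw [← Measure.infinitePi_map_curry (fun (_ : ℕ) (_ : List ℕ) => Q)]
  have h' := Measure.map_prod_map Q (Measure.infinitePi fun _ : ℕ × List ℕ => Q) measurable_id
    (MeasurableEquiv.curry ℕ (List ℕ) X).measurable
  rw [Measure.map_id] at h'
  rw [h', ← h, Measure.map_map (by fun_prop) (by fun_prop)]
  rfl

end Independence

end LevyForest

namespace LevyForest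

/-! ### Forests -/

/-- Finite ordered forests with labelled vertices: the empty forest, and the forest whose first tree
has a root with label `a` and the forest `ch` of subtrees, followed by the trees of `rest`. -/
inductive Forest (A : Type) : Type
  | nil : Forest A
  | cons (a : A) (ch rest : Forest A) : Forest A

namespace Forest

variable {A : Type}

section Measurability

variable [Nonempty A]

/-- The coordinate of a forest at an address: whether there is a vertex, and its label. -/
noncomputable def coord : Forest A → List Bool → Bool × A
  | nil, _ => (false, Classical.arbitrary A)
  | cons a _ _, [] => (true, a)
  | cons _ c _, true :: p => coord c p
  | cons _ _ r, false :: p => coord r p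

theorem coord_injective : Function.Injective (coord : Forest A → List Bool → Bool × A) := by
  intro f
  induction f with
  | nil =>
    rintro (_ | ⟨b, d, s⟩) h
    · rfl
    · have := congrFun h []
      simp [coord] at this
  | cons a c r ihc ihr =>
    rintro (_ | ⟨b, d, s⟩) h
    · have := congrFun h []
      simp [coord] at this
    · have h1 := congrFun h []
      simp only [coord, Prod.mk.injEq, true_and] at h1
      rw [h1, ihc (funext fun p => congrFun h (true :: p)),
        ihr (funext fun p => congrFun h (false :: p))]

variable [MeasurableSpace A]

noncomputable instance : MeasurableSpace (Forest A) := MeasurableSpace.comap coord inferInstance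

theorem measurable_coord (p : List Bool) : Measurable fun f : Forest A => coord f p :=
  (measurable_pi_apply p).comp (comap_measurable _)

theorem measurable_of_coord {X : Type*} [MeasurableSpace X] {f : X → Forest A}
    (h : ∀ p, Measurable fun x => coord (f x) p) : Measurable f :=
  measurable_comap_iff.2 (measurable_pi_lambda _ h)

theorem measurable_cons : Measurable fun x : A × Forest A × Forest A => cons x.1 x.2.1 x.2.2 := by
  refine measurable_of_coord fun p => ?_
  rcases p with _ | ⟨_ | _, p⟩
  · exact measurable_const.prodMk measurable_fst
  · exact (measurable_coord p).comp (measurable_snd.comp measurable_snd)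
  · exact (measurable_coord p).comp (measurable_fst.comp measurable_snd)

theorem measurableSet_nil : MeasurableSet {f : Forest A | f = nil} := by
  have : {f : Forest A | f = nil} = (fun f => (coord f []).1) ⁻¹' {false} := by
    ext f
    cases f <;> simp [coord]
  rw [this]
  exact (measurable_fst.comp (measurable_coord [])) (measurableSet_singleton _)

/-- The label of the first root. -/
noncomputable def label : Forest A → A
  | nil => Classical.arbitrary A
  | cons a _ _ => a

/-- The subtrees of the first root. -/
def children : Forest A → Forest A
  | nil => nil
  | cons _ c _ => c

/-- All trees but the first. -/
def rest : Forest A → Forest A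
  | nil => nil
  | cons _ _ r => r

theorem measurable_label : Measurable (label : Forest A → A) := by
  have : (label : Forest A → A) = fun f => (coord f []).2 := by
    ext f
    cases f <;> simp [coord, label]
  rw [this]
  exact measurable_snd.comp (measurable_coord [])

theorem measurable_children : Measurable (children : Forest A → Forest A) := by
  refine measurable_of_coord fun p => ?_
  have : (fun f : Forest A => coord (children f) p) = fun f => coord f (true :: p) := by
    ext f : 1
    cases f <;> simp [coord, children]
  rw [this]
  exact measurable_coord _

theorem measurable_rest : Measurable (rest : Forest A → Forest A) := by
  refine measurable_of_coord fun p => ?_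
  have : (fun f : Forest A => coord (rest f) p) = fun f => coord f (false :: p) := by
    ext f : 1
    cases f <;> simp [coord, rest]
  rw [this]
  exact measurable_coord _

/-- The depth of a forest, as a binary tree. -/
def depth : Forest A → ℕ
  | nil => 0
  | cons _ c r => max (depth c) (depth r) + 1

theorem measurableSet_depth_le (n : ℕ) : MeasurableSet {f : Forest A | depth f ≤ n} := by
  induction n with
  | zero =>
    convert! measurableSet_nil (A := A) using 1
    ext f
    cases f <;> simp [depth]
  | succ n ih =>
    have : {f : Forest A | depth f ≤ n + 1} =
        children ⁻¹' {f | depth f ≤ n} ∩ rest ⁻¹' {f | depth f ≤ n} := by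
      ext f
      cases f <;> simp [depth, children, rest]
    rw [this]
    exact (measurable_children ih).inter (measurable_rest ih)

/-- Forests are the countable union of the measurable sets of depth at most n, on each of which F
coincides with a measurable function built by induction on n. -/
theorem measurable_of_rec {Y : Type*} [MeasurableSpace Y] {F : Forest A → Y}
    {G : A × (Forest A × Forest A) × Y × Y → Y} (hG : Measurable G)
    (h : ∀ a c r, F (cons a c r) = G (a, (c, r), F c, F r)) : Measurable F := by
  classical
  have key : ∀ n, ∃ Fn : Forest A → Y, Measurable Fn ∧ ∀ f, depth f ≤ n → F f = Fn f := by
    intro n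
    induction n with
    | zero =>
      refine ⟨fun _ => F nil, measurable_const, fun f hf => ?_⟩
      cases f
      · rfl
      · simp [depth] at hf
    | succ n ih =>
      obtain ⟨Fn, hm, hF⟩ := ih
      refine ⟨fun f => if f = nil then F nil else
        G (label f, (children f, rest f), Fn (children f), Fn (rest f)),
        Measurable.ite measurableSet_nil measurable_const
          (hG.comp (measurable_label.prodMk ((measurable_children.prodMk measurable_rest).prodMk
            ((hm.comp measurable_children).prodMk (hm.comp measurable_rest))))), fun f hf => ?_⟩
      cases f with
      | nil => simp
      | cons a c r =>
        simp only [depth, Nat.add_le_add_iff_right, sup_le_iff] at hf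
        simp [label, children, rest, h, hF c hf.1, hF r hf.2]
  intro s hs
  choose Fn hm hF using key
  have : F ⁻¹' s = ⋃ n, {f | depth f ≤ n} ∩ Fn n ⁻¹' s := by
    ext f
    simp only [mem_preimage, mem_iUnion, mem_inter_iff, Set.mem_ofPred_eq]
    constructor
    · intro hf
      exact ⟨depth f, le_rfl, by rwa [← hF _ f le_rfl]⟩
    · rintro ⟨n, h1, h2⟩
      rwa [hF n f h1]
  rw [this]
  exact MeasurableSet.iUnion fun n => (measurableSet_depth_le n).inter (hm n hs)

theorem measurableSet_eq_fun {X : Type*} [MeasurableSpace X] [MeasurableEq A]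
    {f g : X → Forest A} (hf : Measurable f) (hg : Measurable g) :
    MeasurableSet {x | f x = g x} := by
  have : {x | f x = g x} = ⋂ p, {x | (coord (f x) p).1 = (coord (g x) p).1} ∩
      {x | (coord (f x) p).2 = (coord (g x) p).2} := by
    ext x
    simp only [mem_iInter, mem_inter_iff, Set.mem_ofPred_eq, ← Prod.ext_iff]
    rw [← coord_injective.eq_iff, funext_iff]
  rw [this]
  have hf' := fun p => (measurable_coord p).comp hf
  have hg' := fun p => (measurable_coord p).comp hg
  exact MeasurableSet.iInter fun p =>
    (_root_.measurableSet_eq_fun (measurable_fst.comp (hf' p)) (measurable_fst.comp (hg' p))).inter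
      (_root_.measurableSet_eq_fun (measurable_snd.comp (hf' p)) (measurable_snd.comp (hg' p)))

end Measurability

/-! ### Independent trees and thinning -/

/-- Adjoin a tree in front of a forest. -/
def adjoin (x : (A × Forest A) × Forest A) : Forest A := cons x.1.1 x.1.2 x.2

/-- The forest of the first `k` trees of a sequence. -/
def ofSeq : ℕ → (ℕ → A × Forest A) → Forest A
  | 0, _ => nil
  | k + 1, f => adjoin (f 0, ofSeq k fun n => f (n + 1))

open Classical in
/-- Keep the trees in `K`, and replace them by their images under `g`. -/
noncomputable def thin (K : Set (A × Forest A)) (g : A × Forest A → A × Forest A) :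
    Forest A → Forest A
  | nil => nil
  | cons a c r => if (a, c) ∈ K then adjoin (g (a, c), thin K g r) else thin K g r

variable [Nonempty A] [MeasurableSpace A]

theorem measurable_adjoin : Measurable (adjoin : (A × Forest A) × Forest A → Forest A) :=
  measurable_cons.comp ((measurable_fst.comp measurable_fst).prodMk
    ((measurable_snd.comp measurable_fst).prodMk measurable_snd))

theorem measurable_ofSeq (k : ℕ) : Measurable (ofSeq k : (ℕ → A × Forest A) → Forest A) := by
  induction k with
  | zero => exact measurable_const
  | succ k ih =>
    exact measurable_adjoin.comp ((measurable_pi_apply 0).prodMk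
      (ih.comp (measurable_pi_lambda _ fun n => measurable_pi_apply (n + 1))))

theorem measurable_thin {K : Set (A × Forest A)} {g : A × Forest A → A × Forest A}
    (hK : MeasurableSet K) (hg : Measurable g) : Measurable (thin K g) := by
  classical
  have h1 : Measurable fun x : A × (Forest A × Forest A) × Forest A × Forest A => (x.1, x.2.1.1) :=
    measurable_fst.prodMk (measurable_fst.comp (measurable_fst.comp measurable_snd))
  have h2 : Measurable fun x : A × (Forest A × Forest A) × Forest A × Forest A => x.2.2.2 :=
    measurable_snd.comp (measurable_snd.comp measurable_snd)
  refine measurable_of_rec (G := fun x => if (x.1, x.2.1.1) ∈ K then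
    adjoin (g (x.1, x.2.1.1), x.2.2.2) else x.2.2.2) ?_ fun a c r => rfl
  exact Measurable.ite (h1 hK) (measurable_adjoin.comp ((hg.comp h1).prodMk h2)) h2

/-- The law of the forest of `k` independent trees with law `Q`. -/
noncomputable def iid (Q : Measure (A × Forest A)) : ℕ → Measure (Forest A)
  | 0 => Measure.dirac nil
  | k + 1 => (Q.prod (iid Q k)).map adjoin

instance (Q : Measure (A × Forest A)) [IsFiniteMeasure Q] (k : ℕ) : IsFiniteMeasure (iid Q k) := by
  induction k with
  | zero => exact inferInstanceAs (IsFiniteMeasure (Measure.dirac _))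
  | succ k ih => exact inferInstanceAs (IsFiniteMeasure (Measure.map _ _))

theorem iid_univ (Q : Measure (A × Forest A)) [IsFiniteMeasure Q] (k : ℕ) :
    iid Q k univ = Q univ ^ k := by
  induction k with
  | zero => simp [iid]
  | succ k ih =>
    rw [iid, Measure.map_apply measurable_adjoin .univ, preimage_univ, ← univ_prod_univ,
      Measure.prod_prod, ih, pow_succ']

/-- Restricting to an event B for each term leaves independent factors of total mass below one. This
serves for trees of bounded height, where B bounds the heights of the subtrees. -/
theorem map_ofSeq_infinitePi {X : Type*} [MeasurableSpace X] (R : Measure X)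
    [IsProbabilityMeasure R] {g : X → A × Forest A} (hg : Measurable g) {B : Set X}
    (hB : MeasurableSet B) (k : ℕ) :
    ((Measure.infinitePi fun _ : ℕ => R).restrict {ω | ∀ j < k, ω j ∈ B}).map
      (fun ω => ofSeq k fun n => g (ω n)) = iid ((R.restrict B).map g) k := by
  have hmeas : ∀ k, MeasurableSet {ω : ℕ → X | ∀ j < k, ω j ∈ B} := fun k => by
    simp only [Set.ofPred_forall]
    exact MeasurableSet.iInter fun j => MeasurableSet.iInter fun _ => measurable_pi_apply j hB
  have hm : ∀ k, Measurable fun ω : ℕ → X => ofSeq k fun n => g (ω n) := fun k =>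
    (measurable_ofSeq k).comp (measurable_pi_lambda _ fun n => hg.comp (measurable_pi_apply n))
  induction k with
  | zero => simp [iid, ofSeq, Measure.map_const]
  | succ k ih =>
    have hs : Measurable fun ω : ℕ → X => (ω 0, fun k => ω (k + 1)) := by fun_prop
    have e1 : {ω : ℕ → X | ∀ j < k + 1, ω j ∈ B} =
        (fun ω : ℕ → X => (ω 0, fun k => ω (k + 1))) ⁻¹' (B ×ˢ {ω | ∀ j < k, ω j ∈ B}) := by
      ext ω
      simp only [Set.mem_ofPred_eq, mem_preimage, mem_prod]
      constructor
      · intro h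
        exact ⟨h 0 k.succ_pos, fun j hj => h (j + 1) (by omega)⟩
      · rintro ⟨h0, h1⟩ (_ | j) hj
        · exact h0
        · exact h1 j (by omega)
    rw [iid, ← ih, Measure.map_prod_map _ _ hg (hm k), Measure.prod_restrict,
      ← infinitePi_nat_map_prod, Measure.restrict_map hs (hB.prod (hmeas k)), ← e1,
      Measure.map_map measurable_adjoin (by fun_prop),
      Measure.map_map (measurable_adjoin.comp (by fun_prop)) hs]
    rfl

theorem smul_measure_le_smul {X : Type*} [MeasurableSpace X] {c d : ℝ≥0∞} {μ ν : Measure X}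
    (hcd : c ≤ d) (h : μ ≤ ν) : c • μ ≤ d • ν := by
  refine Measure.le_iff.2 fun s _ => ?_
  simp only [Measure.smul_apply, smul_eq_mul]
  exact mul_le_mul' hcd (h s)

theorem prod_finsetSum {X Y ι : Type*} [MeasurableSpace X] [MeasurableSpace Y] (μ : Measure X)
    [SFinite μ] (s : Finset ι) (c : ι → ℝ≥0∞) (ν : ι → Measure Y) [∀ i, SFinite (ν i)] :
    μ.prod (∑ i ∈ s, c i • ν i) = ∑ i ∈ s, c i • μ.prod (ν i) := by
  classical
  have h : ∀ t : Finset ι, SFinite (∑ i ∈ t, c i • ν i) := fun t => by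
    induction t using Finset.induction_on with
    | empty => rw [Finset.sum_empty]; infer_instance
    | insert i t hi ih => rw [Finset.sum_insert hi]; infer_instance
  induction s using Finset.induction_on with
  | empty => simp
  | insert i s hi ih =>
    have := h s
    rw [Finset.sum_insert hi, Finset.sum_insert hi, Measure.prod_add, ih, Measure.prod_smul_right]

theorem map_adjoin_thin {Q : Measure (A × Forest A)} {I : Measure (Forest A)} [SFinite Q]
    [SFinite I] {K : Set (A × Forest A)} {g : A × Forest A → A × Forest A} (hK : MeasurableSet K)
    (hg : Measurable g) : ((Q.prod I).map adjoin).map (thin K g) =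
      ((((Q.restrict K).map g).prod (I.map (thin K g))).map adjoin) +
        Q Kᶜ • I.map (thin K g) := by
  classical
  have ht := measurable_thin hK hg
  have e : thin K g ∘ adjoin = fun x : (A × Forest A) × Forest A =>
      if x.1 ∈ K then adjoin (g x.1, thin K g x.2) else thin K g x.2 := rfl
  rw [Measure.map_map ht measurable_adjoin, e]
  have h0 : Q.prod I = (Q.restrict K).prod I + (Q.restrict Kᶜ).prod I := by
    rw [← Measure.add_prod, Measure.restrict_add_restrict_compl hK]
  have hm1 : Measurable fun x : (A × Forest A) × Forest A =>
      adjoin (g x.1, thin K g x.2) := measurable_adjoin.comp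
    ((hg.comp measurable_fst).prodMk (ht.comp measurable_snd))
  have hm2 : Measurable fun x : (A × Forest A) × Forest A => thin K g x.2 :=
    ht.comp measurable_snd
  rw [h0, Measure.map_add _ _ (Measurable.ite (measurable_fst hK) hm1 hm2)]
  congr 1
  · rw [Measure.map_prod_map _ _ hg ht, Measure.map_map measurable_adjoin (by fun_prop)]
    refine Measure.map_congr ?_
    have : ∀ᵐ x ∂((Q.restrict K).prod I), x.1 ∈ K :=
      (Measure.quasiMeasurePreserving_fst).ae (ae_restrict_mem hK)
    filter_upwards [this] with x hx
    simp [hx, Prod.map]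
  · have : (fun x : (A × Forest A) × Forest A =>
        if x.1 ∈ K then adjoin (g x.1, thin K g x.2) else thin K g x.2)
        =ᵐ[(Q.restrict Kᶜ).prod I] fun x => thin K g x.2 := by
      have : ∀ᵐ x ∂((Q.restrict Kᶜ).prod I), x.1 ∈ Kᶜ :=
        (Measure.quasiMeasurePreserving_fst).ae (ae_restrict_mem hK.compl)
      filter_upwards [this] with x hx
      exact if_neg hx
    rw [Measure.map_congr this]
    change Measure.map (thin K g ∘ Prod.snd) _ = _
    rw [← Measure.map_map ht measurable_snd, Measure.map_snd_prod, Measure.map_smul]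
    simp

/-- The binomial formula: each tree is either kept, contributing at most p times Q', or dropped,
contributing at most p'. Only inequalities are assumed, because in the induction on the height the
laws do not yet have full mass. -/
theorem iid_map_thin_le {Q Q' : Measure (A × Forest A)} [IsFiniteMeasure Q] [IsFiniteMeasure Q']
    {K : Set (A × Forest A)} {g : A × Forest A → A × Forest A} (hK : MeasurableSet K)
    (hg : Measurable g) {p p' : ℝ≥0∞} (h1 : (Q.restrict K).map g ≤ p • Q') (h2 : Q Kᶜ ≤ p')
    (k : ℕ) : (iid Q k).map (thin K g) ≤ ∑ ij ∈ Finset.HasAntidiagonal.antidiagonal k,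
      k.choose ij.1 • ((p ^ ij.1 * p' ^ ij.2) • iid Q' ij.1) := by
  have ht := measurable_thin hK hg
  induction k with
  | zero =>
    rw [iid, Measure.map_dirac' ht]
    simp [thin, iid]
  | succ k ih =>
    rw [iid, map_adjoin_thin hK hg, Finset.sum_antidiagonal_choose_succ_nsmul
      (fun i j => (p ^ i * p' ^ j) • iid Q' i), add_comm]
    simp_rw [← Nat.cast_smul_eq_nsmul ℝ≥0∞, smul_smul] at ih ⊢
    have hS : SFinite (∑ ij ∈ Finset.HasAntidiagonal.antidiagonal k,
        ((k.choose ij.1 : ℝ≥0∞) * (p ^ ij.1 * p' ^ ij.2)) • iid Q' ij.1) := by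
      rw [← Measure.sum_coe_finset]
      infer_instance
    refine add_le_add ?_ ?_
    · refine (smul_measure_le_smul h2 ih).trans_eq ?_
      rw [Finset.smul_sum]
      refine Finset.sum_congr rfl fun ij _ => ?_
      rw [smul_smul, pow_succ]
      congr 1
      ring
    · refine (Measure.map_mono (Measure.prod_mono h1 ih) measurable_adjoin).trans_eq ?_
      rw [prod_finsetSum, ← Measure.mapₗ_apply_of_measurable measurable_adjoin, map_sum]
      refine Finset.sum_congr rfl fun ij hij => ?_
      rw [map_smul, Measure.mapₗ_apply_of_measurable measurable_adjoin, Measure.prod_smul_left,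
        Measure.map_smul, smul_smul, iid, pow_succ]
      rw [Finset.HasAntidiagonal.mem_antidiagonal] at hij
      rw [← Nat.choose_symm_of_eq_add (a := ij.1) (b := ij.2) hij.symm]
      congr 1
      ring

/-- The law of a forest of independent trees with law `Q`, whose number has the weights `w`. -/
noncomputable def mix (w : ℕ → ℝ≥0∞) (Q : Measure (A × Forest A)) : Measure (Forest A) :=
  Measure.sum fun k => w k • iid Q k

theorem mix_univ (w : ℕ → ℝ≥0∞) (Q : Measure (A × Forest A)) [IsFiniteMeasure Q] :
    mix w Q univ = ∑' k, w k * Q univ ^ k := by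
  rw [mix, Measure.sum_apply _ .univ]
  simp [iid_univ]

/-- The weights of the number of points that are kept, if each one is kept with probability `p` and
dropped with probability `p'`. -/
noncomputable def thinWeights (w : ℕ → ℝ≥0∞) (p p' : ℝ≥0∞) (i : ℕ) : ℝ≥0∞ :=
  ∑' j, w (i + j) * ((i + j).choose i * (p ^ i * p' ^ j))

/-- The sum over the original number of trees is rearranged into one over the numbers i kept and j
dropped. -/
theorem mix_map_thin_le {Q Q' : Measure (A × Forest A)} [IsFiniteMeasure Q] [IsFiniteMeasure Q']
    {K : Set (A × Forest A)} {g : A × Forest A → A × Forest A} (hK : MeasurableSet K)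
    (hg : Measurable g) {p p' : ℝ≥0∞} (h1 : (Q.restrict K).map g ≤ p • Q') (h2 : Q Kᶜ ≤ p')
    (w : ℕ → ℝ≥0∞) : (mix w Q).map (thin K g) ≤ mix (thinWeights w p p') Q' := by
  refine Measure.le_iff.2 fun s hs => ?_
  rw [mix, Measure.map_sum (measurable_thin hK hg).aemeasurable, mix, Measure.sum_apply _ hs,
    Measure.sum_apply _ hs]
  calc _ ≤ ∑' k, ∑ ij ∈ Finset.HasAntidiagonal.antidiagonal k,
        w (ij.1 + ij.2) * ((ij.1 + ij.2).choose ij.1 * (p ^ ij.1 * p' ^ ij.2)) * iid Q' ij.1 s := by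
        refine ENNReal.tsum_le_tsum fun k => ?_
        rw [Measure.map_smul, Measure.smul_apply, smul_eq_mul]
        refine (mul_le_mul_right (iid_map_thin_le hK hg h1 h2 k s) _).trans_eq ?_
        rw [Measure.finsetSum_apply, Finset.mul_sum]
        refine Finset.sum_congr rfl fun ij hij => ?_
        rw [Finset.HasAntidiagonal.mem_antidiagonal] at hij
        rw [hij, ← Nat.cast_smul_eq_nsmul ℝ≥0∞]
        simp only [Measure.smul_apply, smul_eq_mul]
        ring
    _ = ∑' x : ℕ × ℕ, w (x.1 + x.2) * ((x.1 + x.2).choose x.1 * (p ^ x.1 * p' ^ x.2)) *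
          iid Q' x.1 s := by
        rw [← Finset.HasAntidiagonal.sigmaAntidiagonalEquivProd.tsum_eq, ENNReal.tsum_sigma']
        refine tsum_congr fun k => ?_
        rw [tsum_fintype, ← Finset.sum_coe_sort]
        rfl
    _ = _ := by
        rw [ENNReal.tsum_prod (f := fun i j => w (i + j) * ((i + j).choose i * (p ^ i * p' ^ j)) *
          iid Q' i s)]
        refine tsum_congr fun i => ?_
        rw [Measure.smul_apply, smul_eq_mul, thinWeights, ENNReal.tsum_mul_right]

end Forest

end LevyForest

namespace LevyForest

namespace BranchingMechanism

variable (ψ : BranchingMechanism)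

/-! ### Derivatives of a branching mechanism -/

/-- The Lévy measure, as a measure concentrated on `(0, ∞)`. -/
noncomputable abbrev jumps : Measure ℝ := ψ.levy.restrict (Ioi 0)

theorem ae_jumps {p : ℝ → Prop} (h : ∀ x, 0 < x → p x) : ∀ᵐ x ∂ψ.jumps, p x :=
  (ae_restrict_mem measurableSet_Ioi).mono fun x hx => h x hx

theorem integrable_min : Integrable (fun x : ℝ => min 1 (x ^ 2)) ψ.jumps := by
  refine ⟨by fun_prop, ?_⟩
  rw [hasFiniteIntegral_iff_ofReal (Eventually.of_forall fun x => by positivity)]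
  exact ψ.levy_finite

theorem integrable_of_le {f : ℝ → ℝ} (hf : AEStronglyMeasurable f ψ.jumps) (C : ℝ)
    (h : ∀ x, 0 < x → |f x| ≤ C * min 1 (x ^ 2)) : Integrable f ψ.jumps :=
  (ψ.integrable_min.const_mul C).mono' hf (ψ.ae_jumps fun x hx => by simpa using h x hx)

theorem min_of_lt {x : ℝ} (hx : 0 < x) (h : x < 1) : min 1 (x ^ 2) = x ^ 2 :=
  min_eq_right (pow_le_one₀ hx.le h.le)

theorem min_of_ge {x : ℝ} (h : 1 ≤ x) : min 1 (x ^ 2) = 1 :=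
  min_eq_left (one_le_pow₀ h)

/-- This bound and the next two compare with min(1, x²), which the Lévy measure integrates. Below 1
one uses x^m ≤ x², above 1 the inequality (cx)^m / m! ≤ e^{cx}. -/
theorem pow_mul_exp_le {c x : ℝ} (hc : 0 < c) (hx : 0 < x) {m : ℕ} (hm : 2 ≤ m) :
    x ^ m * Real.exp (-c * x) ≤ (1 + m.factorial / c ^ m) * min 1 (x ^ 2) := by
  have h0 : 0 ≤ (m.factorial : ℝ) / c ^ m := by positivity
  have h1 : Real.exp (-c * x) ≤ 1 := Real.exp_le_one_iff.2 (by nlinarith)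
  rcases lt_or_ge x 1 with h | h
  · rw [min_of_lt hx h]
    calc x ^ m * Real.exp (-c * x) ≤ x ^ 2 * 1 :=
          mul_le_mul (pow_le_pow_of_le_one hx.le h.le hm) h1 (by positivity) (by positivity)
      _ ≤ _ := by nlinarith [sq_nonneg x]
  · rw [min_of_ge h, mul_one]
    have h2 := Real.pow_div_factorial_le_exp (c * x) (by positivity) m
    have h3 : x ^ m * Real.exp (-c * x) ≤ m.factorial / c ^ m := by
      rw [le_div_iff₀ (by positivity), neg_mul, Real.exp_neg]
      rw [div_le_iff₀ (by positivity), mul_pow] at h2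
      have h4 := Real.exp_pos (c * x)
      rw [mul_right_comm, ← div_eq_mul_inv, div_le_iff₀ h4]
      nlinarith
    linarith

theorem abs_compensated_le {c x : ℝ} (hc : 0 < c) (hx : 0 < x) :
    |x * (if x < 1 then 1 else 0) - x * Real.exp (-c * x)| ≤ (c + 1 / c) * min 1 (x ^ 2) := by
  have h1 : Real.exp (-c * x) ≤ 1 := Real.exp_le_one_iff.2 (by nlinarith)
  have h2 : 1 - c * x ≤ Real.exp (-c * x) := by
    have := Real.add_one_le_exp (-c * x)
    linarith
  have h3 : 0 < 1 / c := by positivity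
  rcases lt_or_ge x 1 with h | h
  · rw [min_of_lt hx h, if_pos h, abs_of_nonneg (by nlinarith)]
    nlinarith [sq_nonneg x]
  · rw [min_of_ge h, if_neg h.not_gt, mul_zero, zero_sub, abs_neg, abs_of_nonneg (by positivity)]
    have h4 : x * Real.exp (-c * x) ≤ 1 / c := by
      have := Real.add_one_le_exp (c * x)
      rw [le_div_iff₀ hc, neg_mul, Real.exp_neg, mul_right_comm, ← div_eq_mul_inv,
        div_le_iff₀ (Real.exp_pos _)]
      linarith
    linarith

theorem abs_psi_integrand_le {c x : ℝ} (hc : 0 ≤ c) (hx : 0 < x) :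
    |Real.exp (-c * x) - 1 + c * x * (if x < 1 then 1 else 0)| ≤ (c ^ 2 + 1) * min 1 (x ^ 2) := by
  have h0 : 0 ≤ c * x := by positivity
  have h1 : Real.exp (-c * x) ≤ 1 := Real.exp_le_one_iff.2 (by nlinarith)
  have h2 := Real.add_one_le_exp (-c * x)
  rcases lt_or_ge x 1 with h | h
  · rw [min_of_lt hx h, if_pos h, abs_of_nonneg (by linarith)]
    have h3 : Real.exp (-c * x) ≤ 1 - c * x + (c * x) ^ 2 := by
      have := Real.add_one_le_exp (c * x)
      rw [neg_mul, Real.exp_neg]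
      refine (inv_anti₀ (by positivity) this).trans ?_
      rw [inv_le_iff_one_le_mul₀ (by positivity)]
      nlinarith [pow_nonneg h0 3]
    nlinarith [sq_nonneg x]
  · rw [min_of_ge h, if_neg h.not_gt, mul_zero, add_zero, abs_of_nonpos (by linarith)]
    nlinarith [Real.exp_pos (-c * x)]

theorem measurable_ite_lt : Measurable fun x : ℝ => if x < 1 then (1 : ℝ) else 0 :=
  Measurable.ite measurableSet_Iio measurable_const measurable_const

theorem integrable_psi_integrand {c : ℝ} (hc : 0 ≤ c) : Integrable (fun x : ℝ =>
    Real.exp (-c * x) - 1 + c * x * (if x < 1 then 1 else 0)) ψ.jumps := by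
  have := measurable_ite_lt
  exact ψ.integrable_of_le (by fun_prop) _ fun x hx => abs_psi_integrand_le hc hx

theorem integrable_compensated {c : ℝ} (hc : 0 < c) : Integrable (fun x : ℝ =>
    x * (if x < 1 then 1 else 0) - x * Real.exp (-c * x)) ψ.jumps := by
  have := measurable_ite_lt
  exact ψ.integrable_of_le (by fun_prop) _ fun x hx => abs_compensated_le hc hx

theorem integrable_pow_mul_exp {c : ℝ} (hc : 0 < c) {m : ℕ} (hm : 2 ≤ m) :
    Integrable (fun x : ℝ => x ^ m * Real.exp (-c * x)) ψ.jumps :=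
  ψ.integrable_of_le (by fun_prop) _ fun x hx => by
    rw [abs_of_nonneg (by positivity)]
    exact pow_mul_exp_le hc hx hm

/-- The derivative of `ψ` on `(0, ∞)`. -/
noncomputable def psi' (c : ℝ) : ℝ :=
  ψ.α + 2 * ψ.β * c + ∫ x, (x * (if x < 1 then 1 else 0) - x * Real.exp (-c * x)) ∂ψ.jumps

/-- The absolute value of the `m`-th derivative of `ψ` on `(0, ∞)`, for `m ≥ 2`. -/
noncomputable def moment (m : ℕ) (c : ℝ) : ℝ≥0∞ :=
  ∫⁻ x, ENNReal.ofReal (x ^ m * Real.exp (-c * x)) ∂ψ.jumps +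
    if m = 2 then ENNReal.ofReal (2 * ψ.β) else 0

theorem moment_eq {c : ℝ} (hc : 0 < c) {m : ℕ} (hm : 2 ≤ m) : ψ.moment m c = ENNReal.ofReal
    (∫ x, x ^ m * Real.exp (-c * x) ∂ψ.jumps + if m = 2 then 2 * ψ.β else 0) := by
  have hβ := ψ.β_nonneg
  rw [ENNReal.ofReal_add (integral_nonneg_of_ae (ψ.ae_jumps fun x hx => by positivity))
    (by split_ifs <;> positivity), ofReal_integral_eq_lintegral_ofReal
    (ψ.integrable_pow_mul_exp hc hm) (ψ.ae_jumps fun x hx => by positivity), moment]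
  split_ifs <;> simp

theorem moment_ne_top {c : ℝ} (hc : 0 < c) {m : ℕ} (hm : 2 ≤ m) : ψ.moment m c ≠ ∞ := by
  rw [ψ.moment_eq hc hm]; exact ENNReal.ofReal_ne_top

theorem toReal_moment {c : ℝ} (hc : 0 < c) {m : ℕ} (hm : 2 ≤ m) : (ψ.moment m c).toReal =
    ∫ x, x ^ m * Real.exp (-c * x) ∂ψ.jumps + if m = 2 then 2 * ψ.β else 0 := by
  have hβ := ψ.β_nonneg
  rw [ψ.moment_eq hc hm, ENNReal.toReal_ofReal]
  refine add_nonneg (integral_nonneg_of_ae (ψ.ae_jumps fun x hx => ?_)) ?_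
  · simp only [Pi.zero_apply]; positivity
  · split_ifs <;> positivity

theorem hasDerivAt_psi {c : ℝ} (hc : 0 < c) : HasDerivAt ψ (ψ.psi' c) c := by
  have hm := measurable_ite_lt
  have h := (hasDerivAt_integral_of_dominated_loc_of_deriv_le (μ := ψ.jumps) (𝕜 := ℝ)
    (F := fun c x => Real.exp (-c * x) - 1 + c * x * (if x < 1 then 1 else 0))
    (F' := fun c x => x * (if x < 1 then 1 else 0) - x * Real.exp (-c * x))
    -- On the ball of radius c/2 about c one has c/2 < c' < 3c/2, so c' + 1/c' is at most this
    -- constant.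
    (bound := fun x => (3 * c / 2 + 2 / c) * min 1 (x ^ 2)) (x₀ := c)
    (Metric.ball_mem_nhds c (half_pos hc)) (Eventually.of_forall fun c => by fun_prop)
    (ψ.integrable_psi_integrand hc.le) (by fun_prop) (ψ.ae_jumps fun x hx c' hc' => ?_)
    (ψ.integrable_min.const_mul _) (ψ.ae_jumps fun x hx c' _ => ?_)).2
  · have h2 : HasDerivAt (fun c => ψ.α * c + ψ.β * c ^ 2) (ψ.α + 2 * ψ.β * c) c := by
      convert! ((hasDerivAt_id c).const_mul ψ.α).add ((hasDerivAt_pow 2 c).const_mul ψ.β) using 1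
      simp; ring
    exact h2.add h
  · rw [Metric.mem_ball, Real.dist_eq, abs_lt] at hc'
    have hc'' : 0 < c' := by linarith
    refine (abs_compensated_le hc'' hx).trans ?_
    have : 1 / c' ≤ 2 / c := by
      rw [div_le_div_iff₀ hc'' hc]; linarith
    gcongr
    linarith
  · have h1 : HasDerivAt (fun c : ℝ => -c * x) (-1 * x) c' := ((hasDerivAt_id c').neg).mul_const x
    have h2 := ((hasDerivAt_id c').mul_const x).mul_const (if x < 1 then (1 : ℝ) else 0)
    convert! (h1.exp.sub_const 1).add h2 using 1
    ring

theorem hasDerivAt_psi' {c : ℝ} (hc : 0 < c) :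
    HasDerivAt ψ.psi' (ψ.moment 2 c).toReal c := by
  have hm := measurable_ite_lt
  have h := (hasDerivAt_integral_of_dominated_loc_of_deriv_le (μ := ψ.jumps) (𝕜 := ℝ)
    (F := fun c x => x * (if x < 1 then 1 else 0) - x * Real.exp (-c * x))
    (F' := fun c x => x ^ 2 * Real.exp (-c * x))
    (bound := fun x => (1 + (2).factorial / (c / 2) ^ 2) * min 1 (x ^ 2)) (x₀ := c)
    (Metric.ball_mem_nhds c (half_pos hc)) (Eventually.of_forall fun c => by fun_prop)
    (ψ.integrable_compensated hc) (by fun_prop) (ψ.ae_jumps fun x hx c' hc' => ?_)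
    (ψ.integrable_min.const_mul _) (ψ.ae_jumps fun x hx c' _ => ?_)).2
  · have h2 : HasDerivAt (fun c => ψ.α + 2 * ψ.β * c) (2 * ψ.β) c := by
      convert! ((hasDerivAt_id c).const_mul (2 * ψ.β)).const_add ψ.α using 1
      simp
    rw [ψ.toReal_moment hc le_rfl, add_comm]
    exact h2.add h
  · rw [Metric.mem_ball, Real.dist_eq, abs_lt] at hc'
    rw [Real.norm_of_nonneg (by positivity)]
    refine le_trans ?_ (pow_mul_exp_le (half_pos hc) hx le_rfl)
    gcongr
    linarith
  · have h1 : HasDerivAt (fun c : ℝ => -c * x) (-1 * x) c' := ((hasDerivAt_id c').neg).mul_const x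
    convert! (h1.exp.const_mul x).const_sub (x * if x < 1 then (1 : ℝ) else 0) using 1
    ring

theorem hasDerivAt_moment {c : ℝ} (hc : 0 < c) {m : ℕ} (hm : 2 ≤ m) :
    HasDerivAt (fun c => (ψ.moment m c).toReal) (-(ψ.moment (m + 1) c).toReal) c := by
  have h := (hasDerivAt_integral_of_dominated_loc_of_deriv_le (μ := ψ.jumps) (𝕜 := ℝ)
    (F := fun c x => x ^ m * Real.exp (-c * x))
    (F' := fun c x => -(x ^ (m + 1) * Real.exp (-c * x)))
    (bound := fun x => (1 + (m + 1).factorial / (c / 2) ^ (m + 1)) * min 1 (x ^ 2)) (x₀ := c)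
    (Metric.ball_mem_nhds c (half_pos hc)) (Eventually.of_forall fun c => by fun_prop)
    (ψ.integrable_pow_mul_exp hc hm) (by fun_prop) (ψ.ae_jumps fun x hx c' hc' => ?_)
    (ψ.integrable_min.const_mul _) (ψ.ae_jumps fun x hx c' _ => ?_)).2
  · rw [ψ.toReal_moment hc (by omega), if_neg (by omega), add_zero]
    rw [integral_neg] at h
    refine (h.add_const (if m = 2 then 2 * ψ.β else 0)).congr_of_eventuallyEq ?_
    filter_upwards [lt_mem_nhds hc] with c' hc'
    exact ψ.toReal_moment hc' hm
  · rw [Metric.mem_ball, Real.dist_eq, abs_lt] at hc'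
    rw [norm_neg, Real.norm_of_nonneg (by positivity)]
    refine le_trans ?_ (pow_mul_exp_le (half_pos hc) hx (by omega))
    gcongr
    linarith
  · have h1 : HasDerivAt (fun c : ℝ => -c * x) (-1 * x) c' := ((hasDerivAt_id c').neg).mul_const x
    convert! (h1.exp.const_mul (x ^ m)) using 1
    ring

theorem der_one {c : ℝ} (hc : 0 < c) : ψ.der 1 c = ψ.psi' c := by
  rw [der, iteratedDerivWithin_one]
  exact (ψ.hasDerivAt_psi hc).hasDerivWithinAt.derivWithin ((uniqueDiffOn_Ici 0) c hc.le)

theorem hasDerivAt_der_of_eqOn {k : ℕ} {f : ℝ → ℝ} {c d : ℝ} (hc : 0 < c)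
    (hf : ∀ c, 0 < c → ψ.der k c = f c) (hd : HasDerivAt f d c) : ψ.der (k + 1) c = d := by
  rw [der, iteratedDerivWithin_succ]
  have : HasDerivAt (iteratedDerivWithin k ψ (Ici 0)) d c := by
    refine hd.congr_of_eventuallyEq ?_
    filter_upwards [lt_mem_nhds hc] with c' hc'
    exact hf c' hc'
  exact this.hasDerivWithinAt.derivWithin ((uniqueDiffOn_Ici 0) c hc.le)

theorem der_eq {m : ℕ} (hm : 2 ≤ m) {c : ℝ} (hc : 0 < c) :
    ψ.der m c = (-1) ^ m * (ψ.moment m c).toReal := by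
  induction m, hm using Nat.le_induction generalizing c with
  | base =>
    rw [ψ.hasDerivAt_der_of_eqOn hc (fun c hc => ψ.der_one hc) (ψ.hasDerivAt_psi' hc)]
    simp
  | succ m hm ih =>
    rw [ψ.hasDerivAt_der_of_eqOn hc (fun c hc => ih hc)
      ((ψ.hasDerivAt_moment hc hm).const_mul ((-1) ^ m))]
    ring

theorem abs_der {m : ℕ} (hm : 2 ≤ m) {c : ℝ} (hc : 0 < c) :
    |ψ.der m c| = (ψ.moment m c).toReal := by
  rw [ψ.der_eq hm hc, abs_mul, abs_pow, abs_neg, abs_one, one_pow, one_mul,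
    abs_of_nonneg ENNReal.toReal_nonneg]

theorem ofReal_abs_der {m : ℕ} (hm : 2 ≤ m) {c : ℝ} (hc : 0 < c) :
    ENNReal.ofReal |ψ.der m c| = ψ.moment m c := by
  rw [ψ.abs_der hm hc, ENNReal.ofReal_toReal (ψ.moment_ne_top hc hm)]

/-! ### Taylor expansions -/

theorem hasSum_exp_tail (c s x : ℝ) (n : ℕ) :
    HasSum (fun i : ℕ => x ^ (i + n) * Real.exp (-c * x) * (s ^ (i + n) / (i + n).factorial))
      (Real.exp (-(c - s) * x) -
        ∑ i ∈ Finset.range n, x ^ i * Real.exp (-c * x) * (s ^ i / i.factorial)) := by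
  rw [hasSum_nat_add_iff' (f := fun i : ℕ =>
    x ^ i * Real.exp (-c * x) * (s ^ i / i.factorial)) n]
  have h := (NormedSpace.expSeries_div_hasSum_exp (s * x)).mul_left (Real.exp (-c * x))
  rw [← Real.exp_eq_exp_ℝ, ← Real.exp_add] at h
  convert! h using 1
  · ext i; rw [mul_pow]; ring
  · congr 1; ring

/-- Expanding e^{-(c-s)x} as e^{-cx} times the series of e^{sx} produces nonnegative terms, so sum
and integral commute without any integrability. This is why Taylor expansions of ψ to the left hold
in `ℝ≥0∞`. -/
theorem lintegral_tail {c s : ℝ} (hs : 0 ≤ s) (m n : ℕ) :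
    ∫⁻ x, ENNReal.ofReal (x ^ m * (Real.exp (-(c - s) * x) -
      ∑ i ∈ Finset.range n, x ^ i * Real.exp (-c * x) * (s ^ i / i.factorial))) ∂ψ.jumps =
    ∑' i : ℕ, (∫⁻ x, ENNReal.ofReal (x ^ (m + (i + n)) * Real.exp (-c * x)) ∂ψ.jumps) *
      ENNReal.ofReal (s ^ (i + n) / (i + n).factorial) := by
  have h1 : ∀ i : ℕ, (∫⁻ x, ENNReal.ofReal (x ^ (m + (i + n)) * Real.exp (-c * x)) ∂ψ.jumps) *
      ENNReal.ofReal (s ^ (i + n) / (i + n).factorial) = ∫⁻ x, ENNReal.ofReal (x ^ m *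
        (x ^ (i + n) * Real.exp (-c * x) * (s ^ (i + n) / (i + n).factorial))) ∂ψ.jumps := by
    intro i
    rw [← lintegral_mul_const _ (by fun_prop)]
    refine lintegral_congr_ae (ψ.ae_jumps fun x hx => ?_)
    simp only
    rw [← ENNReal.ofReal_mul (by positivity)]
    congr 1
    ring
  simp_rw [h1]
  rw [← lintegral_tsum fun i => by fun_prop]
  refine lintegral_congr_ae (ψ.ae_jumps fun x hx => ?_)
  have h := (hasSum_exp_tail c s x n).mul_left (x ^ m)
  simp only
  rw [← h.tsum_eq, ENNReal.ofReal_tsum_of_nonneg (fun i => by positivity) h.summable]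

/-- Nothing has to be finite: both sides may be infinite, as can happen when c - s = 0. -/
theorem moment_taylor {c s : ℝ} (hs : 0 ≤ s) {m : ℕ} (hm : 2 ≤ m) : ψ.moment m (c - s) =
    ∑' i : ℕ, ψ.moment (m + i) c * ENNReal.ofReal (s ^ i / i.factorial) := by
  have h := ψ.lintegral_tail (c := c) hs m 0
  simp only [Finset.range_zero, Finset.sum_empty, sub_zero, add_zero] at h
  simp only [moment, add_mul]
  rw [h, ENNReal.tsum_add]
  congr 1
  rw [tsum_eq_single 0 fun i hi => by rw [if_neg (by omega), zero_mul]]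
  simp

/-- The linear part is taken to the left side and the remaining terms are nonnegative by the
alternation of signs. The case s = c is allowed, since ψ⁻¹(0) may be 0. -/
theorem psi_taylor {c s : ℝ} (hc : 0 < c) (hs : 0 ≤ s) (hsc : s ≤ c) :
    0 ≤ ψ (c - s) - ψ c + s * ψ.psi' c ∧
    ENNReal.ofReal (ψ (c - s) - ψ c + s * ψ.psi' c) =
      ∑' i : ℕ, ψ.moment (i + 2) c * ENNReal.ofReal (s ^ (i + 2) / (i + 2).factorial) := by
  have hβ := ψ.β_nonneg
  have h := ψ.lintegral_tail (c := c) hs 0 2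
  have i1 := ψ.integrable_psi_integrand (sub_nonneg.2 hsc)
  have i2 := ψ.integrable_psi_integrand hc.le
  have i3 := (ψ.integrable_compensated hc).const_mul s
  have e : ψ (c - s) - ψ c + s * ψ.psi' c = (∫ x, (x ^ 0 * (Real.exp (-(c - s) * x) -
      ∑ i ∈ Finset.range 2, x ^ i * Real.exp (-c * x) * (s ^ i / i.factorial))) ∂ψ.jumps) +
        ψ.β * s ^ 2 := by
    have : ∀ x : ℝ, x ^ 0 * (Real.exp (-(c - s) * x) -
      ∑ i ∈ Finset.range 2, x ^ i * Real.exp (-c * x) * (s ^ i / i.factorial)) =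
      ((Real.exp (-(c - s) * x) - 1 + (c - s) * x * (if x < 1 then 1 else 0)) -
      (Real.exp (-c * x) - 1 + c * x * (if x < 1 then 1 else 0))) +
      s * (x * (if x < 1 then 1 else 0) - x * Real.exp (-c * x)) := fun x => by
      simp [Finset.sum_range_succ]; split_ifs <;> ring
    simp_rw [this]
    have e2 := integral_add (i1.sub i2) i3
    simp only [Pi.sub_apply] at e2
    rw [e2, integral_sub i1 i2, integral_const_mul]
    simp only [psi, psi']
    ring
  have hnn : ∀ x : ℝ, 0 < x → 0 ≤ x ^ 0 * (Real.exp (-(c - s) * x) -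
      ∑ i ∈ Finset.range 2, x ^ i * Real.exp (-c * x) * (s ^ i / i.factorial)) := fun x hx => by
    rw [← (hasSum_exp_tail c s x 2).tsum_eq]
    exact mul_nonneg (by positivity) (tsum_nonneg fun i => by positivity)
  have hint : Integrable (fun x : ℝ => x ^ 0 * (Real.exp (-(c - s) * x) -
      ∑ i ∈ Finset.range 2, x ^ i * Real.exp (-c * x) * (s ^ i / i.factorial))) ψ.jumps := by
    refine ((i1.sub i2).add i3).congr (Eventually.of_forall fun x => ?_)
    simp [Finset.sum_range_succ]; split_ifs <;> ring
  have hnn' := integral_nonneg_of_ae (ψ.ae_jumps hnn)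
  refine ⟨by rw [e]; positivity, ?_⟩
  rw [e, ENNReal.ofReal_add hnn' (by positivity), ofReal_integral_eq_lintegral_ofReal hint
    (ψ.ae_jumps hnn), h]
  simp only [moment, add_mul, ENNReal.tsum_add, zero_add]
  congr 1
  rw [tsum_eq_single 0 fun i hi => by rw [if_neg (by omega), zero_mul]]
  rw [zero_add, if_pos rfl, ← ENNReal.ofReal_mul (by positivity)]
  congr 1
  simp [Nat.factorial]
  ring

theorem psi'_taylor {c s : ℝ} (hs : 0 ≤ s) (hsc : s < c) : 0 ≤ ψ.psi' c - ψ.psi' (c - s) ∧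
    ENNReal.ofReal (ψ.psi' c - ψ.psi' (c - s)) =
      ∑' i : ℕ, ψ.moment (i + 2) c * ENNReal.ofReal (s ^ (i + 1) / (i + 1).factorial) := by
  have hβ := ψ.β_nonneg
  have hc : 0 < c := hs.trans_lt hsc
  have h := ψ.lintegral_tail (c := c) hs 1 1
  have i1 := ψ.integrable_compensated (sub_pos.2 hsc)
  have i2 := ψ.integrable_compensated hc
  have e1 : ∀ x : ℝ, x ^ 1 * (Real.exp (-(c - s) * x) -
      ∑ i ∈ Finset.range 1, x ^ i * Real.exp (-c * x) * (s ^ i / i.factorial)) =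
      (x * (if x < 1 then 1 else 0) - x * Real.exp (-c * x)) -
      (x * (if x < 1 then 1 else 0) - x * Real.exp (-(c - s) * x)) := fun x => by
    simp; ring
  have e : ψ.psi' c - ψ.psi' (c - s) = (∫ x, (x ^ 1 * (Real.exp (-(c - s) * x) -
      ∑ i ∈ Finset.range 1, x ^ i * Real.exp (-c * x) * (s ^ i / i.factorial))) ∂ψ.jumps) +
        2 * ψ.β * s := by
    simp_rw [e1]
    rw [integral_sub i2 i1]
    simp only [psi']
    ring
  have hnn : ∀ x : ℝ, 0 < x → 0 ≤ x ^ 1 * (Real.exp (-(c - s) * x) -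
      ∑ i ∈ Finset.range 1, x ^ i * Real.exp (-c * x) * (s ^ i / i.factorial)) := fun x hx => by
    rw [← (hasSum_exp_tail c s x 1).tsum_eq]
    exact mul_nonneg (by positivity) (tsum_nonneg fun i => by positivity)
  have hint : Integrable (fun x : ℝ => x ^ 1 * (Real.exp (-(c - s) * x) -
      ∑ i ∈ Finset.range 1, x ^ i * Real.exp (-c * x) * (s ^ i / i.factorial))) ψ.jumps := by
    simp_rw [e1]
    exact i2.sub i1
  have hnn' := integral_nonneg_of_ae (ψ.ae_jumps hnn)
  refine ⟨by rw [e]; positivity, ?_⟩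
  rw [e, ENNReal.ofReal_add hnn' (by positivity), ofReal_integral_eq_lintegral_ofReal hint
    (ψ.ae_jumps hnn), h]
  simp only [moment, add_mul, ENNReal.tsum_add]
  congr 1
  · refine tsum_congr fun i => ?_
    rw [show 1 + (i + 1) = i + 2 by ring]
  · rw [tsum_eq_single 0 fun i hi => by rw [if_neg (by omega), zero_mul]]
    rw [zero_add, if_pos rfl, ← ENNReal.ofReal_mul (by positivity)]
    congr 1
    simp

end BranchingMechanism

end LevyForest

namespace LevyForest

namespace BranchingMechanism

variable {ψ : BranchingMechanism}

/-! ### The inverse of a branching mechanism -/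

theorem psi_zero (ψ : BranchingMechanism) : ψ 0 = 0 := by simp [psi]

theorem psi'_mono {c c' : ℝ} (hc : 0 < c) (h : c ≤ c') : ψ.psi' c ≤ ψ.psi' c' := by
  have := (ψ.psi'_taylor (c := c') (s := c' - c) (by linarith) (by linarith)).1
  rw [sub_sub_cancel] at this
  linarith

theorem continuousOn_psi (hm : DifferentiableWithinAt ℝ ψ (Ici 0) 0) : ContinuousOn ψ (Ici 0) := by
  intro c hc
  rcases (mem_Ici.1 hc).eq_or_lt with rfl | hc
  · exact hm.continuousWithinAt
  · exact (ψ.hasDerivAt_psi hc).continuousAt.continuousWithinAt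

theorem convexOn_psi (hm : DifferentiableWithinAt ℝ ψ (Ici 0) 0) : ConvexOn ℝ (Ici 0) ψ := by
  refine MonotoneOn.convexOn_of_deriv (convex_Ici 0) (continuousOn_psi hm) ?_ ?_ <;>
    rw [interior_Ici]
  · exact fun c hc => (ψ.hasDerivAt_psi hc).differentiableAt.differentiableWithinAt
  · intro c hc c' hc' h
    rw [(ψ.hasDerivAt_psi hc).deriv, (ψ.hasDerivAt_psi hc').deriv]
    exact psi'_mono hc h

theorem le_psi (hm : DifferentiableWithinAt ℝ ψ (Ici 0) 0) {c c' : ℝ} (hc : 0 < c) (h : c ≤ c') :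
    c' / c * ψ c ≤ ψ c' := by
  have hc' : 0 < c' := hc.trans_le h
  have := (convexOn_psi hm).2 (self_mem_Ici (a := (0 : ℝ))) (mem_Ici.2 hc'.le)
    (show 0 ≤ 1 - c / c' by rw [sub_nonneg, div_le_one hc']; exact h)
    (show 0 ≤ c / c' by positivity) (by ring)
  simp only [smul_eq_mul, mul_zero, zero_add, psi_zero] at this
  rw [div_mul_cancel₀ _ hc'.ne'] at this
  rw [div_mul_eq_mul_div, div_le_iff₀ hc]
  rw [div_mul_eq_mul_div, le_div_iff₀ hc'] at this
  linarith

/-- By convexity and ψ(0) = 0 the function grows at least linearly beyond a point where it is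
positive. So the set of roots is nonempty, closed and bounded and contains its supremum; a value at
most x beyond it would give a further root by the intermediate value theorem. -/
theorem inv_spec (hψ : ∃ c : ℝ, 0 < c ∧ 0 < ψ c) (hm : DifferentiableWithinAt ℝ ψ (Ici 0) 0)
    {x : ℝ} (hx : 0 ≤ x) : 0 ≤ ψ.inv x ∧ ψ (ψ.inv x) = x ∧ ∀ c, ψ.inv x < c → x < ψ c := by
  obtain ⟨c₁, hc₁, hpos⟩ := hψ
  have hlarge : ∀ c, c₁ * (x / ψ c₁ + 1) ≤ c → x < ψ c := fun c hc => by
    have h1 : 0 ≤ x / ψ c₁ := by positivity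
    refine lt_of_lt_of_le ?_ (le_psi hm hc₁ (by nlinarith))
    have h2 : x / ψ c₁ + 1 ≤ c / c₁ := by rw [le_div_iff₀ hc₁]; linarith
    calc x < x + ψ c₁ := by linarith
      _ = (x / ψ c₁ + 1) * ψ c₁ := by field_simp
      _ ≤ _ := by gcongr
  set S := {c | 0 ≤ c ∧ ψ c = x} with hS
  have hroot : ∀ a, 0 ≤ a → ψ a ≤ x → ∃ c ∈ S, a ≤ c := fun a ha hax => by
    set b := max a (c₁ * (x / ψ c₁ + 1))
    have := intermediate_value_Icc (le_max_left a (c₁ * (x / ψ c₁ + 1)))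
      ((continuousOn_psi hm).mono (Icc_subset_Ici_self.trans (Ici_subset_Ici.2 ha)))
      ⟨hax, (hlarge b (le_max_right _ _)).le⟩
    obtain ⟨c, hc, hcx⟩ := this
    exact ⟨c, ⟨ha.trans hc.1, hcx⟩, hc.1⟩
  have hbdd : BddAbove S := ⟨c₁ * (x / ψ c₁ + 1), fun c hc => by
    by_contra! h
    exact (hlarge c h.le).ne' hc.2⟩
  have hne : S.Nonempty := by
    obtain ⟨c, hc, -⟩ := hroot 0 le_rfl (by rwa [psi_zero])
    exact ⟨c, hc⟩
  have hclosed : IsClosed S := by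
    have : S = Ici 0 ∩ ψ ⁻¹' {x} := rfl
    rw [this]
    exact (continuousOn_psi hm).preimage_isClosed_of_isClosed isClosed_Ici isClosed_singleton
  have hmem : sSup S ∈ S := hclosed.csSup_mem hne hbdd
  refine ⟨hmem.1, hmem.2, fun c hc => ?_⟩
  by_contra! h
  obtain ⟨c', hc', h'⟩ := hroot c (hmem.1.trans hc.le) h
  exact (le_csSup hbdd hc').not_gt (hc.trans_le h')

theorem inv_lt_inv (hψ : ∃ c : ℝ, 0 < c ∧ 0 < ψ c) (hm : DifferentiableWithinAt ℝ ψ (Ici 0) 0)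
    {x y : ℝ} (hx : 0 ≤ x) (h : x < y) : ψ.inv x < ψ.inv y := by
  obtain ⟨h1, h2, h3⟩ := inv_spec hψ hm hx
  obtain ⟨h1', h2', h3'⟩ := inv_spec hψ hm (hx.trans h.le)
  by_contra! hle
  rcases hle.eq_or_lt with he | hlt
  · rw [he, h2] at h2'; exact h.ne h2'
  · have := h3' _ hlt
    linarith

theorem inv_pos (hψ : ∃ c : ℝ, 0 < c ∧ 0 < ψ c) (hm : DifferentiableWithinAt ℝ ψ (Ici 0) 0)
    {x : ℝ} (hx : 0 < x) : 0 < ψ.inv x :=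
  (inv_spec hψ hm le_rfl).1.trans_lt (inv_lt_inv hψ hm le_rfl hx)

/-- By `psi_taylor` between ψ⁻¹(0) and ψ⁻¹(x), the increment ψ⁻¹(x) - ψ⁻¹(0) times the derivative at
ψ⁻¹(x) is at least x > 0. -/
theorem psi'_inv_pos (hψ : ∃ c : ℝ, 0 < c ∧ 0 < ψ c)
    (hm : DifferentiableWithinAt ℝ ψ (Ici 0) 0) {x : ℝ} (hx : 0 < x) : 0 < ψ.psi' (ψ.inv x) := by
  have h0 := inv_spec hψ hm le_rfl
  have hlt := inv_lt_inv hψ hm le_rfl hx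
  have h := (ψ.psi_taylor (inv_pos hψ hm hx) (s := ψ.inv x - ψ.inv 0) (by linarith)
    (by linarith)).1
  rw [sub_sub_cancel, h0.2.1, (inv_spec hψ hm hx.le).2.1] at h
  by_contra! hneg
  nlinarith

/-! ### Derivatives at the origin -/

/-- The values ψ(c)/c converge to the right derivative at 0 and, by the mean value theorem, are
values of `psi'`; monotonicity of `psi'` does the rest. -/
theorem tendsto_psi'_zero (hm : DifferentiableWithinAt ℝ ψ (Ici 0) 0) :
    Tendsto ψ.psi' (𝓝[>] 0) (𝓝 (ψ.der 1 0)) := by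
  have hd : HasDerivWithinAt ψ (ψ.der 1 0) (Ici 0) 0 := by
    rw [der, iteratedDerivWithin_one]
    exact hm.hasDerivWithinAt
  have hslope : Tendsto (fun c => ψ c / c) (𝓝[>] 0) (𝓝 (ψ.der 1 0)) := by
    have := hasDerivWithinAt_iff_tendsto_slope.1 hd
    rw [Ici_sdiff_left] at this
    refine this.congr fun c => ?_
    rw [slope_def_field, psi_zero, sub_zero, sub_zero]
  have hmvt : ∀ c, 0 < c → ∃ θ ∈ Ioo 0 c, ψ.psi' θ = ψ c / c := fun c hc => by
    obtain ⟨θ, hθ, h⟩ := exists_hasDerivAt_eq_slope ψ ψ.psi' hc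
      ((continuousOn_psi hm).mono Icc_subset_Ici_self) fun x hx => ψ.hasDerivAt_psi hx.1
    exact ⟨θ, hθ, by rw [h, psi_zero, sub_zero, sub_zero]⟩
  have hge : ∀ c, 0 < c → ψ.der 1 0 ≤ ψ.psi' c := fun c hc => by
    refine le_of_tendsto hslope ?_
    filter_upwards [Ioo_mem_nhdsGT hc] with c' hc'
    obtain ⟨θ, hθ, h⟩ := hmvt c' hc'.1
    rw [← h]
    exact psi'_mono hθ.1 (hθ.2.trans hc'.2).le
  refine tendsto_order.2 ⟨fun a ha => ?_, fun a ha => ?_⟩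
  · filter_upwards [self_mem_nhdsWithin] with c hc
    exact ha.trans_le (hge c hc)
  · obtain ⟨c, hc, h0⟩ := (((tendsto_order.1 hslope).2 a ha).and self_mem_nhdsWithin).exists
    obtain ⟨θ, hθ, h⟩ := hmvt c h0
    filter_upwards [Ioo_mem_nhdsGT hθ.1] with c' hc'
    exact (psi'_mono hc'.1 hc'.2.le).trans_lt (h ▸ hc)

/-- Extends `psi'_taylor` to s = c, the case ψ⁻¹(0) = 0, by letting r increase to s. The right
derivative at 0 enters here. -/
theorem der_one_taylor (hm : DifferentiableWithinAt ℝ ψ (Ici 0) 0) {c s : ℝ} (hc : 0 < c)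
    (hs : 0 ≤ s) (hsc : s ≤ c) : 0 ≤ ψ.der 1 c - ψ.der 1 (c - s) ∧
    ENNReal.ofReal (ψ.der 1 c - ψ.der 1 (c - s)) =
      ∑' i : ℕ, ψ.moment (i + 2) c * ENNReal.ofReal (s ^ (i + 1) / (i + 1).factorial) := by
  rcases hsc.lt_or_eq with h | rfl
  · rw [ψ.der_one hc, ψ.der_one (sub_pos.2 h)]
    exact ψ.psi'_taylor hs h
  rw [sub_self, ψ.der_one hc]
  have hlim : Tendsto (fun r => ψ.psi' s - ψ.psi' (s - r)) (𝓝[<] s)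
      (𝓝 (ψ.psi' s - ψ.der 1 0)) := by
    refine tendsto_const_nhds.sub ((tendsto_psi'_zero hm).comp ?_)
    refine tendsto_nhdsWithin_iff.2 ⟨?_, ?_⟩
    · have : Tendsto (fun r => s - r) (𝓝 s) (𝓝 (s - s)) := tendsto_const_nhds.sub tendsto_id
      rw [sub_self] at this
      exact this.mono_left nhdsWithin_le_nhds
    · filter_upwards [self_mem_nhdsWithin] with r hr
      exact sub_pos.2 (mem_Iio.1 hr)
  have hev : ∀ᶠ r in 𝓝[<] s, r ∈ Ioo 0 s := Ioo_mem_nhdsLT hc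
  refine ⟨ge_of_tendsto hlim (hev.mono fun r hr => (ψ.psi'_taylor hr.1.le hr.2).1), ?_⟩
  have hlim' := (ENNReal.continuous_ofReal.tendsto _).comp hlim
  refine le_antisymm (le_of_tendsto hlim' (hev.mono fun r hr => ?_)) ?_
  · rw [Function.comp_apply, (ψ.psi'_taylor hr.1.le hr.2).2]
    refine ENNReal.tsum_le_tsum fun i => mul_le_mul_right (ENNReal.ofReal_le_ofReal ?_) _
    have := hr.1.le
    gcongr
    exact hr.2.le
  · refine ENNReal.tsum_le_of_sum_range_le fun n => ?_
    have hc1 : Tendsto (fun r => ∑ i ∈ Finset.range n, ψ.moment (i + 2) s *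
        ENNReal.ofReal (r ^ (i + 1) / (i + 1).factorial)) (𝓝[<] s) (𝓝 (∑ i ∈ Finset.range n,
          ψ.moment (i + 2) s * ENNReal.ofReal (s ^ (i + 1) / (i + 1).factorial))) := by
      refine tendsto_finsetSum _ fun i _ => ENNReal.Tendsto.const_mul ?_
        (Or.inr (ψ.moment_ne_top hc (by omega)))
      refine (ENNReal.continuous_ofReal.tendsto _).comp (Tendsto.mono_left ?_ nhdsWithin_le_nhds)
      exact ((continuous_pow (i + 1)).div_const _).tendsto s
    refine le_of_tendsto_of_tendsto hc1 hlim' (hev.mono fun r hr => ?_)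
    rw [Function.comp_apply, (ψ.psi'_taylor hr.1.le hr.2).2]
    exact ENNReal.sum_le_tsum _

theorem moment_anti (m : ℕ) {c c' : ℝ} (h : c ≤ c') : ψ.moment m c' ≤ ψ.moment m c := by
  refine add_le_add_left (lintegral_mono_ae (ψ.ae_jumps fun x hx => ?_)) _
  refine ENNReal.ofReal_le_ofReal ?_
  gcongr

theorem tendsto_moment_zero (m : ℕ) : Tendsto (ψ.moment m) (𝓝[>] 0) (𝓝 (ψ.moment m 0)) := by
  have hu : Antitone fun n : ℕ => (1 : ℝ) / (n + 1) := fun n k h => by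
    simp only; gcongr
  have hseq : Tendsto (fun n : ℕ => ψ.moment m (1 / (n + 1))) atTop (𝓝 (ψ.moment m 0)) := by
    refine Tendsto.add_const _ (lintegral_tendsto_of_tendsto_of_monotone
      (fun n => by fun_prop) (ψ.ae_jumps fun x hx n k h => ?_) (ae_of_all _ fun x => ?_))
    · refine ENNReal.ofReal_le_ofReal ?_
      have := hu h
      gcongr
    · have h1 : Continuous fun c : ℝ => ENNReal.ofReal (x ^ m * Real.exp (-c * x)) :=
        ENNReal.continuous_ofReal.comp (by fun_prop)
      exact (h1.tendsto 0).comp tendsto_one_div_add_atTop_nhds_zero_nat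
  refine tendsto_order.2 ⟨fun a ha => ?_, fun a ha => ?_⟩
  · obtain ⟨n, hn⟩ := ((tendsto_order.1 hseq).1 a ha).exists
    filter_upwards [Ioo_mem_nhdsGT (show (0 : ℝ) < 1 / (n + 1) by positivity)] with c hc
    exact hn.trans_le (moment_anti m hc.2.le)
  · filter_upwards [self_mem_nhdsWithin] with c hc
    exact (moment_anti m (le_of_lt hc)).trans_lt ha

/-- On (0, ∞) one has x^m ≤ min(1, x²) + x^l for 2 ≤ m ≤ l. -/
theorem moment_zero_ne_top {m l : ℕ} (hm : 2 ≤ m) (hml : m ≤ l) (h : ψ.moment l 0 ≠ ∞) :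
    ψ.moment m 0 ≠ ∞ := by
  refine ENNReal.add_ne_top.2 ⟨?_, by split_ifs <;> simp [ENNReal.mul_eq_top]⟩
  have h1 : ∫⁻ x, ENNReal.ofReal (x ^ l * Real.exp (-0 * x)) ∂ψ.jumps ≠ ∞ :=
    (ENNReal.add_ne_top.1 h).1
  refine ne_top_of_le_ne_top (ENNReal.add_ne_top.2 ⟨ψ.levy_finite.ne, h1⟩) ?_
  rw [← lintegral_add_left (by fun_prop)]
  refine lintegral_mono_ae (ψ.ae_jumps fun x hx => ?_)
  rw [← ENNReal.ofReal_add (by positivity) (by positivity)]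
  refine ENNReal.ofReal_le_ofReal ?_
  simp only [neg_zero, zero_mul, Real.exp_zero, mul_one]
  rcases lt_or_ge x 1 with h | h
  · rw [min_of_lt hx h]
    have := pow_le_pow_of_le_one hx.le h.le hm
    have : 0 ≤ x ^ l := by positivity
    linarith
  · rw [min_of_ge h]
    have := pow_le_pow_right₀ h hml
    linarith

theorem differentiableAt_der {k : ℕ} (hk : 1 ≤ k) {c : ℝ} (hc : 0 < c) :
    DifferentiableAt ℝ (ψ.der k) c := by
  rcases hk.eq_or_lt with rfl | hk
  · refine ((ψ.hasDerivAt_psi' hc).congr_of_eventuallyEq ?_).differentiableAt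
    filter_upwards [lt_mem_nhds hc] with c' hc' using ψ.der_one hc'
  · refine ((((ψ.hasDerivAt_moment hc hk).const_mul
      ((-1) ^ k))).congr_of_eventuallyEq ?_).differentiableAt
    filter_upwards [lt_mem_nhds hc] with c' hc' using ψ.der_eq hk hc'

/-- If the derivative has a limit at 0 and the function is continuous there, the one-sided
derivative at 0 is that limit. -/
theorem der_succ_zero {k : ℕ} (hk : 1 ≤ k) (h1 : Tendsto (ψ.der k) (𝓝[>] 0) (𝓝 (ψ.der k 0)))
    {e : ℝ} (h2 : Tendsto (ψ.der (k + 1)) (𝓝[>] 0) (𝓝 e)) : ψ.der (k + 1) 0 = e := by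
  have hder : ∀ c, ψ.der (k + 1) c = derivWithin (ψ.der k) (Ici 0) c := fun c => by
    rw [der, iteratedDerivWithin_succ]
    rfl
  rw [hder]
  refine (hasDerivWithinAt_Ici_of_tendsto_deriv (s := Ioi 0)
    (fun c hc => (differentiableAt_der hk hc).differentiableWithinAt) h1 self_mem_nhdsWithin
    ?_).derivWithin ((uniqueDiffOn_Ici 0) 0 self_mem_Ici)
  refine h2.congr' ?_
  filter_upwards [self_mem_nhdsWithin] with c hc
  rw [hder, derivWithin_of_mem_nhds (Ici_mem_nhds hc)]

theorem tendsto_der_zero {m : ℕ} (hm : 2 ≤ m) (h : ψ.moment m 0 ≠ ∞) :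
    Tendsto (ψ.der m) (𝓝[>] 0) (𝓝 ((-1) ^ m * (ψ.moment m 0).toReal)) := by
  refine (((ENNReal.tendsto_toReal h).comp (tendsto_moment_zero m)).const_mul ((-1) ^ m)).congr' ?_
  filter_upwards [self_mem_nhdsWithin] with c hc
  exact (ψ.der_eq hm hc).symm

theorem der_zero_eq (hm : DifferentiableWithinAt ℝ ψ (Ici 0) 0) {l : ℕ} (hl : 2 ≤ l)
    (h : ψ.moment l 0 ≠ ∞) : ψ.der l 0 = (-1) ^ l * (ψ.moment l 0).toReal := by
  induction l, hl using Nat.le_induction with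
  | base =>
    refine der_succ_zero le_rfl ((tendsto_psi'_zero hm).congr' ?_) (tendsto_der_zero le_rfl h)
    filter_upwards [self_mem_nhdsWithin] with c hc using (ψ.der_one hc).symm
  | succ l hl ih =>
    have hl' := moment_zero_ne_top hl l.le_succ h
    refine der_succ_zero (by omega) ?_ (tendsto_der_zero (by omega) h)
    rw [ih hl']
    exact tendsto_der_zero hl hl'

/-- The hypothesis at branching points concerns the limit of the derivative at ψ⁻¹(0), whereas ν
contains the derivative itself. If this point is 0, monotone convergence identifies the limit with
the moment at 0; its finiteness passes to lower orders, and the right derivatives at 0 are obtained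
one after the other. -/
theorem ofReal_abs_der_of_tendsto (hm : DifferentiableWithinAt ℝ ψ (Ici 0) 0) {l : ℕ}
    (hl : 2 ≤ l) {c d : ℝ} (hc : 0 ≤ c) (hd : d ≠ 0) (h : Tendsto (ψ.der l) (𝓝[>] c) (𝓝 d)) :
    ENNReal.ofReal |ψ.der l c| = ψ.moment l c ∧ 0 < |ψ.der l c| := by
  rcases hc.eq_or_lt with rfl | hc
  · have h1 : Tendsto (ψ.moment l) (𝓝[>] 0) (𝓝 (ENNReal.ofReal |d|)) := by
      refine ((ENNReal.continuous_ofReal.tendsto _).comp h.abs).congr' ?_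
      filter_upwards [self_mem_nhdsWithin] with c hc using ψ.ofReal_abs_der hl hc
    have h2 := tendsto_nhds_unique h1 (tendsto_moment_zero l)
    have h3 : ψ.moment l 0 ≠ ∞ := h2 ▸ ENNReal.ofReal_ne_top
    have h4 : |ψ.der l 0| = |d| := by
      rw [der_zero_eq hm hl h3, ← h2, abs_mul, abs_pow, abs_neg, abs_one, one_pow, one_mul,
        ENNReal.toReal_ofReal (abs_nonneg _), abs_abs]
    exact ⟨by rw [h4, h2], by rw [h4]; exact abs_pos.2 hd⟩
  · have h1 : ψ.der l c = d := tendsto_nhds_unique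
      ((differentiableAt_der (by omega) hc).continuousAt.tendsto.mono_left nhdsWithin_le_nhds) h
    exact ⟨ψ.ofReal_abs_der hl hc, h1 ▸ abs_pos.2 hd⟩

end BranchingMechanism

end LevyForest

namespace LevyForest

/-! ### Thinning of the offspring laws -/

theorem lawOfWeights_eq {w : ℕ → ℝ} (h : ∑' k, ENNReal.ofReal (w k) = 1) :
    lawOfWeights w = Measure.sum fun k => ENNReal.ofReal (w k) • Measure.dirac k := if_pos h

instance (w : ℕ → ℝ) : IsProbabilityMeasure (lawOfWeights w) := by
  unfold lawOfWeights
  split_ifs with h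
  · exact ⟨by rw [Measure.sum_apply _ .univ]; simpa using h⟩
  · infer_instance

theorem choose_mul_inv_factorial {B p p' : ℝ} (hB : 0 ≤ B) (hp : 0 ≤ p) (hp' : 0 ≤ p') (i j : ℕ) :
    ENNReal.ofReal (B ^ (i + j) / (i + j).factorial) *
      ((i + j).choose i * (ENNReal.ofReal p ^ i * ENNReal.ofReal p' ^ j)) =
    ENNReal.ofReal ((p * B) ^ i / i.factorial) * ENNReal.ofReal ((p' * B) ^ j / j.factorial) := by
  rw [← ENNReal.ofReal_pow hp, ← ENNReal.ofReal_pow hp', ← ENNReal.ofReal_mul (by positivity),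
    ← ENNReal.ofReal_natCast, ← ENNReal.ofReal_mul (by positivity),
    ← ENNReal.ofReal_mul (by positivity), ← ENNReal.ofReal_mul (by positivity)]
  congr 1
  have h : (((i + j).choose i * i.factorial * j.factorial : ℕ) : ℝ) = (i + j).factorial := by
    rw [← Nat.add_choose_mul_factorial_mul_factorial, Nat.choose_symm_add]
  push_cast at h
  have h1 : (0 : ℝ) < i.factorial := by positivity
  have h2 : (0 : ℝ) < j.factorial := by positivity
  rw [← h]
  have h3 : (0 : ℝ) < (i + j).choose i := by
    exact_mod_cast Nat.choose_pos (Nat.le_add_right i j)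
  field_simp
  ring

open Forest in
-- The computation behind all consistency relations. With B the gap of λ and p the ratio of the
-- gaps, p B is the gap of μ and p' B = ψ⁻¹(λ) - ψ⁻¹(μ), so when d consists of derivatives at ψ⁻¹(λ)
-- the remaining series is a Taylor series towards ψ⁻¹(μ).
theorem thinWeights_eq {w d : ℕ → ℝ≥0∞} {W : ℝ≥0∞} {B p p' : ℝ} (hB : 0 ≤ B) (hp : 0 ≤ p)
    (hp' : 0 ≤ p') (hw : ∀ k, w k = W * d k * ENNReal.ofReal (B ^ k / k.factorial)) (i : ℕ) :
    thinWeights w (ENNReal.ofReal p) (ENNReal.ofReal p') i =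
      W * ENNReal.ofReal ((p * B) ^ i / i.factorial) *
        ∑' j, d (i + j) * ENNReal.ofReal ((p' * B) ^ j / j.factorial) := by
  rw [thinWeights, ← ENNReal.tsum_mul_left]
  refine tsum_congr fun j => ?_
  rw [hw, mul_assoc, choose_mul_inv_factorial hB hp hp']
  ring

open Forest in
theorem thinWeights_poisson (r : ℝ≥0) {p p' : ℝ} (hp : 0 ≤ p) (hp' : 0 ≤ p') (h : p + p' = 1)
    (i : ℕ) : thinWeights (fun k => poissonMeasure r {k}) (ENNReal.ofReal p) (ENNReal.ofReal p') i
      = poissonMeasure (p.toNNReal * r) {i} := by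
  rw [thinWeights_eq (d := fun _ => 1) (W := ENNReal.ofReal (Real.exp (-r))) r.coe_nonneg hp hp'
    (fun k => by
      rw [poissonMeasure_singleton, mul_one, ← ENNReal.ofReal_mul (by positivity),
        mul_div_assoc])]
  have h1 : ∑' j : ℕ, (1 : ℝ≥0∞) * ENNReal.ofReal ((p' * (r : ℝ)) ^ j / j.factorial) =
      ENNReal.ofReal (Real.exp (p' * r)) := by
    have := NormedSpace.expSeries_div_hasSum_exp (p' * (r : ℝ))
    rw [← Real.exp_eq_exp_ℝ] at this
    simp only [one_mul]
    rw [← this.tsum_eq, ENNReal.ofReal_tsum_of_nonneg (fun j => by positivity) this.summable]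
  rw [h1, poissonMeasure_singleton, ← ENNReal.ofReal_mul (by positivity),
    ← ENNReal.ofReal_mul (by positivity), NNReal.coe_mul, Real.coe_toNNReal _ hp]
  congr 1
  rw [mul_right_comm, ← Real.exp_add, show -(r : ℝ) + p' * r = -(p * r) by
    rw [show p' = 1 - p by linarith]; ring]
  ring

namespace BranchingMechanism

open Forest

variable {ψ : BranchingMechanism}

section

variable (ψ)

/-- The increment `ψ⁻¹(λ) - ψ⁻¹(0)`. -/
noncomputable def gap (lam : ℝ) : ℝ := ψ.inv lam - ψ.inv 0

/-- The parameter of the edge lengths. -/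
noncomputable def rate (lam : ℝ) : ℝ := ψ.der 1 (ψ.inv lam)

/-- The density of the Poisson points on the skeleton. -/
noncomputable def density (lam : ℝ) : ℝ := ψ.der 1 (ψ.inv lam) - ψ.der 1 (ψ.inv 0)

/-- The offspring law restricted to numbers `k ≥ 2`. -/
noncomputable def branchWeights (lam : ℝ) (k : ℕ) : ℝ≥0∞ :=
  ENNReal.ofReal (1 / (ψ.rate lam * ψ.gap lam)) *
    (if k < 2 then 0 else ψ.moment k (ψ.inv lam)) *
      ENNReal.ofReal (ψ.gap lam ^ k / k.factorial)

end

theorem gap_pos (hψ : ∃ c : ℝ, 0 < c ∧ 0 < ψ c)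
    (hm : DifferentiableWithinAt ℝ ψ (Ici 0) 0) {lam : ℝ} (h : 0 < lam) : 0 < ψ.gap lam := sub_pos.2 (inv_lt_inv hψ hm le_rfl h)

theorem gap_lt_gap (hψ : ∃ c : ℝ, 0 < c ∧ 0 < ψ c)
    (hm : DifferentiableWithinAt ℝ ψ (Ici 0) 0) {μ lam : ℝ} (hμ : 0 ≤ μ) (h : μ < lam) : ψ.gap μ < ψ.gap lam :=
  sub_lt_sub_right (inv_lt_inv hψ hm hμ h) _

theorem rate_eq (hψ : ∃ c : ℝ, 0 < c ∧ 0 < ψ c)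
    (hm : DifferentiableWithinAt ℝ ψ (Ici 0) 0) {lam : ℝ} (h : 0 < lam) : ψ.rate lam = ψ.psi' (ψ.inv lam) :=
  ψ.der_one (inv_pos hψ hm h)

theorem rate_pos (hψ : ∃ c : ℝ, 0 < c ∧ 0 < ψ c)
    (hm : DifferentiableWithinAt ℝ ψ (Ici 0) 0) {lam : ℝ} (h : 0 < lam) : 0 < ψ.rate lam := by
  rw [rate_eq hψ hm h]; exact psi'_inv_pos hψ hm h

theorem ofReal_xi (hψ : ∃ c : ℝ, 0 < c ∧ 0 < ψ c)
    (hm : DifferentiableWithinAt ℝ ψ (Ici 0) 0) {lam : ℝ} (h : 0 < lam) (k : ℕ) :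
    ENNReal.ofReal (ψ.xi 0 lam (k + 2)) = ψ.branchWeights lam (k + 2) := by
  have hq := rate_pos hψ hm h
  have hb := gap_pos hψ hm h
  rw [branchWeights, if_neg (by omega), ← ψ.ofReal_abs_der (by omega) (inv_pos hψ hm h),
    ← ENNReal.ofReal_mul (by positivity), ← ENNReal.ofReal_mul (by positivity)]
  congr 1
  change _ / ψ.rate lam * (ψ.gap lam ^ (k + 1) / _) = _
  field_simp
  ring

/-- The generating function of the offspring law with the leaf term unthinned: r + ψ(x_λ - r b) /
(ψ'(x_λ) b). At r = 1 it gives the total mass, and its fixed points decide about finiteness of the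
trees. -/
theorem tsum_branchWeights (hψ : ∃ c : ℝ, 0 < c ∧ 0 < ψ c)
    (hm : DifferentiableWithinAt ℝ ψ (Ici 0) 0) {lam : ℝ} (h : 0 < lam) {r : ℝ} (hr : 0 ≤ r) (hr1 : r ≤ 1) :
    ENNReal.ofReal (ψ.xi 0 lam 0) + ∑' k, ψ.branchWeights lam k * ENNReal.ofReal r ^ k =
      ENNReal.ofReal (r + ψ (ψ.inv lam - r * ψ.gap lam) / (ψ.rate lam * ψ.gap lam)) := by
  have hq := rate_pos hψ hm h
  have hb := gap_pos hψ hm h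
  have h0 := (inv_spec hψ hm le_rfl).1
  have hle : r * ψ.gap lam ≤ ψ.inv lam := by
    have : ψ.gap lam ≤ ψ.inv lam := by rw [gap]; linarith
    nlinarith
  have ht := ψ.psi_taylor (inv_pos hψ hm h) (mul_nonneg hr hb.le) hle
  have h1 : ∑' k, ψ.branchWeights lam k * ENNReal.ofReal r ^ k =
      ENNReal.ofReal (1 / (ψ.rate lam * ψ.gap lam)) * ∑' i : ℕ, ψ.moment (i + 2) (ψ.inv lam) *
        ENNReal.ofReal ((r * ψ.gap lam) ^ (i + 2) / (i + 2).factorial) := by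
    rw [← ENNReal.tsum_mul_left,
      ← Summable.sum_add_tsum_nat_add' (k := 2) (f := fun k => ψ.branchWeights lam k * _) ENNReal.summable]
    rw [Finset.sum_eq_zero fun k hk => by
      rw [branchWeights, if_pos (Finset.mem_range.1 hk), mul_zero, zero_mul, zero_mul], zero_add]
    refine tsum_congr fun k => ?_
    rw [branchWeights, if_neg (by omega), mul_assoc, mul_assoc, ← ENNReal.ofReal_pow hr,
      ← ENNReal.ofReal_mul (by positivity), mul_pow]
    congr 3
    ring
  rw [h1, ← ht.2, ← ENNReal.ofReal_mul (by positivity), (inv_spec hψ hm h.le).2.1,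
    ← rate_eq hψ hm h]
  rw [(inv_spec hψ hm h.le).2.1, ← rate_eq hψ hm h] at ht
  change ENNReal.ofReal ((lam - 0) / (ψ.gap lam * ψ.rate lam)) + _ = _
  rw [sub_zero, ← ENNReal.ofReal_add (by positivity) (mul_nonneg (by positivity) ht.1)]
  congr 1
  field_simp
  ring

theorem tsum_xi (hψ : ∃ c : ℝ, 0 < c ∧ 0 < ψ c)
    (hm : DifferentiableWithinAt ℝ ψ (Ici 0) 0) {lam : ℝ} (h : 0 < lam) : ∑' k, ENNReal.ofReal (ψ.xi 0 lam k) = 1 := by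
  have h1 := tsum_branchWeights hψ hm h zero_le_one le_rfl
  rw [one_mul, show ψ.inv lam - ψ.gap lam = ψ.inv 0 by rw [gap]; ring,
    (inv_spec hψ hm le_rfl).2.1, zero_div, add_zero, ENNReal.ofReal_one] at h1
  simp only [one_pow, mul_one] at h1
  rw [← h1, ← Summable.sum_add_tsum_nat_add' (k := 2) ENNReal.summable,
    ← Summable.sum_add_tsum_nat_add' (k := 2) (f := ψ.branchWeights lam) ENNReal.summable]
  simp_rw [ofReal_xi hψ hm h]
  simp [Finset.sum_range_succ, branchWeights, xi]

theorem moment_inv_taylor (hψ : ∃ c : ℝ, 0 < c ∧ 0 < ψ c)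
    (hm : DifferentiableWithinAt ℝ ψ (Ici 0) 0) {μ lam : ℝ} (hμ : 0 ≤ μ) (h : μ ≤ lam) {m : ℕ} (hm2 : 2 ≤ m) :
    ∑' j, ψ.moment (m + j) (ψ.inv lam) *
      ENNReal.ofReal ((ψ.inv lam - ψ.inv μ) ^ j / j.factorial) = ψ.moment m (ψ.inv μ) := by
  have hle : ψ.inv μ ≤ ψ.inv lam := by
    rcases h.eq_or_lt with rfl | h
    · exact le_rfl
    · exact (inv_lt_inv hψ hm hμ h).le
  rw [← ψ.moment_taylor (sub_nonneg.2 hle) hm2, sub_sub_cancel]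

theorem der_one_inv_taylor (hψ : ∃ c : ℝ, 0 < c ∧ 0 < ψ c)
    (hm : DifferentiableWithinAt ℝ ψ (Ici 0) 0) {μ lam : ℝ} (hμ : 0 ≤ μ) (h : μ < lam) :
    0 ≤ ψ.der 1 (ψ.inv lam) - ψ.der 1 (ψ.inv μ) ∧
    ∑' j, ψ.moment (j + 2) (ψ.inv lam) *
      ENNReal.ofReal ((ψ.inv lam - ψ.inv μ) ^ (j + 1) / (j + 1).factorial) =
        ENNReal.ofReal (ψ.der 1 (ψ.inv lam) - ψ.der 1 (ψ.inv μ)) := by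
  have hle := inv_lt_inv hψ hm hμ h
  have := der_one_taylor hm (inv_pos hψ hm (hμ.trans_lt h)) (sub_nonneg.2 hle.le)
    (by linarith [(inv_spec hψ hm hμ).1])
  rw [sub_sub_cancel] at this
  exact ⟨this.1, this.2.symm⟩

/-- The fate of a vertex with at least two children when each child survives with the ratio of the
gaps: it vanishes, becomes a unary point, or stays a branching vertex. In the last two cases the
ratio of the gaps splits off, and the ratio of the rates is the weight of staying; it returns as the
mixing weight of the edge lengths. -/
theorem thinWeights_branchWeights (hψ : ∃ c : ℝ, 0 < c ∧ 0 < ψ c)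
    (hm : DifferentiableWithinAt ℝ ψ (Ici 0) 0) {μ lam : ℝ} (hμ : 0 < μ) (h : μ < lam) (i : ℕ) :
    thinWeights (ψ.branchWeights lam) (ENNReal.ofReal (ψ.gap μ / ψ.gap lam))
      (ENNReal.ofReal (1 - ψ.gap μ / ψ.gap lam)) i =
    if i = 0 then ENNReal.ofReal (1 - ψ.gap μ / ψ.gap lam -
        (lam - μ) / (ψ.rate lam * ψ.gap lam))
    else if i = 1 then ENNReal.ofReal (ψ.gap μ / ψ.gap lam * (1 - ψ.rate μ / ψ.rate lam))
    else ENNReal.ofReal (ψ.gap μ / ψ.gap lam * (ψ.rate μ / ψ.rate lam)) * ψ.branchWeights μ i := by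
  have hlam := hμ.trans h
  have hq := rate_pos hψ hm hlam
  have hqμ := rate_pos hψ hm hμ
  have hb := gap_pos hψ hm hlam
  have hbμ := gap_pos hψ hm hμ
  have hbb := gap_lt_gap hψ hm hμ.le h
  have hp' : 0 ≤ 1 - ψ.gap μ / ψ.gap lam := by
    rw [sub_nonneg, div_le_one hb]; exact hbb.le
  have e1 : ψ.gap μ / ψ.gap lam * ψ.gap lam = ψ.gap μ := div_mul_cancel₀ _ hb.ne'
  have e2 : (1 - ψ.gap μ / ψ.gap lam) * ψ.gap lam = ψ.inv lam - ψ.inv μ := by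
    rw [sub_mul, e1, gap, gap]; ring
  rw [thinWeights_eq (w := ψ.branchWeights lam) (W := ENNReal.ofReal (1 / (ψ.rate lam * ψ.gap lam)))
    (d := fun k => if k < 2 then 0 else ψ.moment k (ψ.inv lam)) hb.le (by positivity) hp'
    (fun k => rfl), e1, e2]
  rcases i with _ | _ | i
  · rw [if_pos rfl, ← Summable.sum_add_tsum_nat_add' (k := 2) ENNReal.summable]
    have ht := ψ.psi_taylor (inv_pos hψ hm hlam) (s := ψ.inv lam - ψ.inv μ)
      (by linarith [inv_lt_inv hψ hm hμ.le h]) (by linarith [inv_pos hψ hm hμ])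
    rw [Finset.sum_eq_zero fun k hk => by
      rw [zero_add, if_pos (Finset.mem_range.1 hk), zero_mul], zero_add]
    simp only [zero_add]
    simp only [show ∀ k : ℕ, ¬ k + 2 < 2 from fun k => by omega, if_false]
    rw [← ht.2, pow_zero, Nat.factorial_zero, Nat.cast_one, div_one, ENNReal.ofReal_one, mul_one,
      ← ENNReal.ofReal_mul (by positivity), sub_sub_cancel, (inv_spec hψ hm hlam.le).2.1,
      (inv_spec hψ hm hμ.le).2.1, ← rate_eq hψ hm hlam, ← e2]
    congr 1
    field_simp
    ring
  · rw [if_neg (by omega), if_pos rfl, ← Summable.sum_add_tsum_nat_add' (k := 1) ENNReal.summable]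
    have ht := der_one_inv_taylor hψ hm hμ.le h
    rw [Finset.sum_eq_zero fun k hk => by
      rw [if_pos (by have := Finset.mem_range.1 hk; omega), zero_mul], zero_add]
    have e3 : ∀ j : ℕ, 0 + 1 + (j + 1) = j + 2 := fun j => by ring
    simp only [e3, show ∀ k : ℕ, ¬ k + 2 < 2 from fun k => by omega, if_false]
    rw [ht.2, zero_add, pow_one, Nat.factorial_one, Nat.cast_one, div_one,
      ← ENNReal.ofReal_mul (by positivity), ← ENNReal.ofReal_mul (by positivity)]
    congr 1
    change 1 / (ψ.rate lam * ψ.gap lam) * ψ.gap μ * (ψ.rate lam - ψ.rate μ) = _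
    field_simp
  · rw [if_neg (by omega), if_neg (by omega)]
    have ht := moment_inv_taylor hψ hm hμ.le h.le (m := i + 1 + 1) (by omega)
    simp only [show ∀ k : ℕ, ¬ i + 1 + 1 + k < 2 from fun k => by omega, if_false]
    rw [ht, branchWeights, if_neg (by omega), mul_right_comm, ← mul_assoc, ← mul_assoc,
      ← ENNReal.ofReal_mul (by positivity)]
    congr 3
    field_simp

theorem ofReal_nu_one (hψ : ∃ c : ℝ, 0 < c ∧ 0 < ψ c)
    (hm : DifferentiableWithinAt ℝ ψ (Ici 0) 0) {lam : ℝ} (h : 0 < lam) (hd : 0 < ψ.density lam) (k : ℕ) :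
    ENNReal.ofReal (ψ.nu 0 lam 1 k) = ENNReal.ofReal (1 / ψ.density lam) *
      (if k = 0 then 0 else ψ.moment (1 + k) (ψ.inv lam)) *
        ENNReal.ofReal (ψ.gap lam ^ k / k.factorial) := by
  have hb := gap_pos hψ hm h
  rw [nu, if_pos rfl]
  split_ifs with hk
  · simp
  · rw [← ψ.ofReal_abs_der (by omega) (inv_pos hψ hm h),
      ← ENNReal.ofReal_mul (by positivity), ← ENNReal.ofReal_mul (by positivity)]
    congr 1
    change _ / ψ.density lam * (ψ.gap lam ^ k / _) = _
    field_simp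

theorem tsum_nu_one (hψ : ∃ c : ℝ, 0 < c ∧ 0 < ψ c)
    (hm : DifferentiableWithinAt ℝ ψ (Ici 0) 0) {lam : ℝ} (h : 0 < lam) (hd : 0 < ψ.density lam) :
    ∑' k, ENNReal.ofReal (ψ.nu 0 lam 1 k) = 1 := by
  simp_rw [ofReal_nu_one hψ hm h hd, mul_assoc]
  rw [ENNReal.tsum_mul_left, ← Summable.sum_add_tsum_nat_add' (k := 1) ENNReal.summable]
  have e3 : ∀ j : ℕ, 1 + (j + 1) = j + 2 := fun j => by ring
  simp only [show ∀ k : ℕ, ¬ k + 1 = 0 from fun k => by omega, if_false, e3]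
  rw [show ψ.gap lam = ψ.inv lam - ψ.inv 0 from rfl, (der_one_inv_taylor hψ hm le_rfl h).2]
  simp only [Finset.range_one, Finset.sum_singleton, if_true, zero_mul, zero_add]
  rw [← ENNReal.ofReal_mul (by positivity)]
  change ENNReal.ofReal (1 / ψ.density lam * ψ.density lam) = 1
  rw [one_div_mul_cancel hd.ne', ENNReal.ofReal_one]

theorem density_nonneg (hψ : ∃ c : ℝ, 0 < c ∧ 0 < ψ c)
    (hm : DifferentiableWithinAt ℝ ψ (Ici 0) 0) {lam : ℝ} (h : 0 < lam) : 0 ≤ ψ.density lam :=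
  (der_one_inv_taylor hψ hm le_rfl h).1

theorem density_le (hψ : ∃ c : ℝ, 0 < c ∧ 0 < ψ c)
    (hm : DifferentiableWithinAt ℝ ψ (Ici 0) 0) {μ lam : ℝ} (hμ : 0 ≤ μ) (h : μ < lam) : ψ.density μ ≤ ψ.density lam := by
  have := (der_one_inv_taylor hψ hm hμ h).1
  simp only [density]
  linarith

/-- If the density of μ vanishes, so does the second moment at ψ⁻¹(μ). Its Taylor expansion at
ψ⁻¹(λ) then forces all moments there to vanish, and with them the density of λ. -/
theorem density_pos (hψ : ∃ c : ℝ, 0 < c ∧ 0 < ψ c)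
    (hm : DifferentiableWithinAt ℝ ψ (Ici 0) 0) {μ lam : ℝ} (hμ : 0 < μ) (h : μ < lam) (hd : 0 < ψ.density lam) :
    0 < ψ.density μ := by
  by_contra! hneg
  have h1 := der_one_inv_taylor hψ hm le_rfl hμ
  have hz : ψ.moment 2 (ψ.inv μ) = 0 := by
    have h2 := h1.2
    rw [show ψ.der 1 (ψ.inv μ) - ψ.der 1 (ψ.inv 0) = ψ.density μ from rfl,
      ENNReal.ofReal_of_nonpos hneg, ENNReal.tsum_eq_zero] at h2
    have hb := gap_pos hψ hm hμ
    refine (mul_eq_zero.1 (h2 0)).resolve_right ?_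
    simpa [gap] using hb
  have h3 := moment_inv_taylor hψ hm hμ.le h.le le_rfl
  rw [hz, ENNReal.tsum_eq_zero] at h3
  have h4 : ∀ j, ψ.moment (j + 2) (ψ.inv lam) = 0 := fun j => by
    refine (mul_eq_zero.1 (add_comm j 2 ▸ h3 j)).resolve_right ?_
    have : 0 < ψ.inv lam - ψ.inv μ := sub_pos.2 (inv_lt_inv hψ hm hμ.le h)
    simp only [ENNReal.ofReal_eq_zero, not_le]
    positivity
  have h5 := (der_one_inv_taylor hψ hm le_rfl (hμ.trans h)).2
  simp only [h4, zero_mul, tsum_zero] at h5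
  exact absurd (ENNReal.ofReal_eq_zero.1 h5.symm) (not_le.2 hd)

/-- The value i = 0 is excluded: it collects the Poisson points that lose all their trees. The
factor is the proportion of Poisson points that remain. -/
theorem thinWeights_nu_one (hψ : ∃ c : ℝ, 0 < c ∧ 0 < ψ c)
    (hm : DifferentiableWithinAt ℝ ψ (Ici 0) 0) {μ lam : ℝ} (hμ : 0 < μ) (h : μ < lam) (hd : 0 < ψ.density lam)
    {i : ℕ} (hi : i ≠ 0) :
    thinWeights (fun k => ENNReal.ofReal (ψ.nu 0 lam 1 k)) (ENNReal.ofReal (ψ.gap μ / ψ.gap lam))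
      (ENNReal.ofReal (1 - ψ.gap μ / ψ.gap lam)) i =
    ENNReal.ofReal (ψ.density μ / ψ.density lam) * ENNReal.ofReal (ψ.nu 0 μ 1 i) := by
  have hlam := hμ.trans h
  have hb := gap_pos hψ hm hlam
  have hbμ := gap_pos hψ hm hμ
  have hbb := gap_lt_gap hψ hm hμ.le h
  have hdμ := density_pos hψ hm hμ h hd
  have hp' : 0 ≤ 1 - ψ.gap μ / ψ.gap lam := by
    rw [sub_nonneg, div_le_one hb]; exact hbb.le
  have e1 : ψ.gap μ / ψ.gap lam * ψ.gap lam = ψ.gap μ := div_mul_cancel₀ _ hb.ne'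
  have e2 : (1 - ψ.gap μ / ψ.gap lam) * ψ.gap lam = ψ.inv lam - ψ.inv μ := by
    rw [sub_mul, e1, gap, gap]; ring
  rw [thinWeights_eq hb.le (by positivity) hp' (ofReal_nu_one hψ hm hlam hd), e1, e2,
    ofReal_nu_one hψ hm hμ hdμ, if_neg hi]
  have ht := moment_inv_taylor hψ hm hμ.le h.le (m := 1 + i) (by omega)
  simp only [show ∀ k : ℕ, ¬ i + k = 0 from fun k => by omega, if_false, ← add_assoc]
  rw [ht, mul_right_comm, ← mul_assoc, ← mul_assoc, ← ENNReal.ofReal_mul (by positivity)]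
  congr 3
  field_simp

theorem tsum_nu (hψ : ∃ c : ℝ, 0 < c ∧ 0 < ψ c)
    (hm : DifferentiableWithinAt ℝ ψ (Ici 0) 0) {lam d : ℝ} {l : ℕ} (h : 0 < lam) (hl : 2 ≤ l) (hd : d ≠ 0)
    (hlim : Tendsto (ψ.der l) (𝓝[>] (ψ.inv 0)) (𝓝 d)) :
    (∑' k, ENNReal.ofReal (ψ.nu 0 lam l k) = 1) ∧ ∀ k, ENNReal.ofReal (ψ.nu 0 lam l k) =
      ENNReal.ofReal (1 / |ψ.der l (ψ.inv 0)|) * ψ.moment (l + k) (ψ.inv lam) *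
        ENNReal.ofReal (ψ.gap lam ^ k / k.factorial) := by
  obtain ⟨h1, h2⟩ := ofReal_abs_der_of_tendsto hm hl (inv_spec hψ hm le_rfl).1 hd hlim
  have hb := gap_pos hψ hm h
  have key : ∀ k, ENNReal.ofReal (ψ.nu 0 lam l k) =
      ENNReal.ofReal (1 / |ψ.der l (ψ.inv 0)|) * ψ.moment (l + k) (ψ.inv lam) *
        ENNReal.ofReal (ψ.gap lam ^ k / k.factorial) := fun k => by
    rw [nu, if_neg (by omega), ← ψ.ofReal_abs_der (by omega) (inv_pos hψ hm h),
      ← ENNReal.ofReal_mul (by positivity), ← ENNReal.ofReal_mul (by positivity)]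
    congr 1
    change _ / _ * (ψ.gap lam ^ k / _) = _
    field_simp
  refine ⟨?_, key⟩
  simp_rw [key, mul_assoc]
  rw [ENNReal.tsum_mul_left, show ψ.gap lam = ψ.inv lam - ψ.inv 0 from rfl,
    moment_inv_taylor hψ hm le_rfl h.le hl, ← h1, ← ENNReal.ofReal_mul (by positivity),
    one_div_mul_cancel h2.ne', ENNReal.ofReal_one]

theorem thinWeights_nu (hψ : ∃ c : ℝ, 0 < c ∧ 0 < ψ c)
    (hm : DifferentiableWithinAt ℝ ψ (Ici 0) 0) {μ lam d : ℝ} {l : ℕ} (hμ : 0 < μ) (h : μ < lam) (hl : 2 ≤ l) (hd : d ≠ 0)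
    (hlim : Tendsto (ψ.der l) (𝓝[>] (ψ.inv 0)) (𝓝 d)) (i : ℕ) :
    thinWeights (fun k => ENNReal.ofReal (ψ.nu 0 lam l k)) (ENNReal.ofReal (ψ.gap μ / ψ.gap lam))
      (ENNReal.ofReal (1 - ψ.gap μ / ψ.gap lam)) i = ENNReal.ofReal (ψ.nu 0 μ l i) := by
  have hlam := hμ.trans h
  have hb := gap_pos hψ hm hlam
  have hbμ := gap_pos hψ hm hμ
  have hbb := gap_lt_gap hψ hm hμ.le h
  have hp' : 0 ≤ 1 - ψ.gap μ / ψ.gap lam := by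
    rw [sub_nonneg, div_le_one hb]; exact hbb.le
  have e1 : ψ.gap μ / ψ.gap lam * ψ.gap lam = ψ.gap μ := div_mul_cancel₀ _ hb.ne'
  have e2 : (1 - ψ.gap μ / ψ.gap lam) * ψ.gap lam = ψ.inv lam - ψ.inv μ := by
    rw [sub_mul, e1, gap, gap]; ring
  rw [thinWeights_eq (d := fun k => ψ.moment (l + k) (ψ.inv lam)) hb.le (by positivity) hp'
    (tsum_nu hψ hm hlam hl hd hlim).2, e1, e2, (tsum_nu hψ hm hμ hl hd hlim).2 i]
  simp_rw [← add_assoc]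
  rw [moment_inv_taylor hψ hm hμ.le h.le (m := l + i) (by omega)]
  ring

end BranchingMechanism

end LevyForest

namespace LevyForest

/-! ### Exponential edge lengths -/

/-- The exponential law on the half line. -/
noncomputable def expLaw (q : ℝ) : Measure ℝ≥0 := (expMeasure q).map Real.toNNReal

theorem isProbabilityMeasure_expLaw {q : ℝ} (hq : 0 < q) : IsProbabilityMeasure (expLaw q) := by
  have := isProbabilityMeasure_expMeasure hq
  exact Measure.isProbabilityMeasure_map (by fun_prop)

theorem measurable_exponentialPDF (q : ℝ) : Measurable (exponentialPDF q) :=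
  (measurable_exponentialPDFReal q).ennreal_ofReal

theorem lintegral_expLaw (q : ℝ) {H : ℝ≥0 → ℝ≥0∞} (hH : Measurable H) :
    ∫⁻ l, H l ∂expLaw q = ∫⁻ x, exponentialPDF q x * H x.toNNReal := by
  rw [expLaw, lintegral_map hH (by fun_prop)]
  exact lintegral_withDensity_eq_lintegral_mul _ (measurable_exponentialPDF q)
    (hH.comp (by fun_prop))

/-- The joint density of X and X + Y for independent exponential X and Y. In x it is proportional to
an exponential density of parameter q - r, so it can be integrated over x ≤ z explicitly. -/
theorem exponentialPDF_mul_exponentialPDF {q r : ℝ} (hr : 0 < r) (hrq : r < q) (x z : ℝ) :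
    ENNReal.ofReal (1 - r / q) * (exponentialPDF q x * exponentialPDF r (z - x)) =
      if x ≤ z then ENNReal.ofReal (r * Real.exp (-(r * z))) * exponentialPDF (q - r) x else 0 := by
  have hq := hr.trans hrq
  rw [exponentialPDF_eq, exponentialPDF_eq, exponentialPDF_eq]
  have h1 : 0 ≤ 1 - r / q := by rw [sub_nonneg, div_le_one hq]; exact hrq.le
  rcases lt_or_ge x 0 with hx | hx
  · simp [hx.not_ge]
  rcases lt_or_ge z x with hz | hz
  · simp [hz.not_ge, sub_nonneg]
  rw [if_pos hx, if_pos (sub_nonneg.2 hz), if_pos hx, if_pos hz,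
    ← ENNReal.ofReal_mul (by positivity), ← ENNReal.ofReal_mul h1,
    ← ENNReal.ofReal_mul (by positivity)]
  congr 1
  have e1 : Real.exp (-(r * (z - x))) = Real.exp (-(r * z)) * Real.exp (r * x) := by
    rw [← Real.exp_add]; ring_nf
  have e2 : Real.exp (-((q - r) * x)) = Real.exp (-(q * x)) * Real.exp (r * x) := by
    rw [← Real.exp_add]; ring_nf
  rw [e1, e2]
  field_simp

/-- An exponential length of parameter r is, with probability r/q, one of parameter q and otherwise
the sum of one of parameter q and an independent one of parameter r. This describes an edge above
which a surviving vertex is either kept or merged with its only child. -/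
theorem lintegral_expLaw_mixture {q r : ℝ} (hr : 0 < r) (hrq : r ≤ q) {H : ℝ≥0 → ℝ≥0∞}
    (hH : Measurable H) : ENNReal.ofReal (r / q) * ∫⁻ l, H l ∂expLaw q +
      ENNReal.ofReal (1 - r / q) * ∫⁻ l, ∫⁻ l', H (l + l') ∂expLaw r ∂expLaw q =
        ∫⁻ l, H l ∂expLaw r := by
  have hq := hr.trans_le hrq
  rcases hrq.eq_or_lt with rfl | hrq
  · simp [div_self hr.ne']
  have hpq := measurable_exponentialPDF q
  have hpr := measurable_exponentialPDF r
  have := isProbabilityMeasure_expLaw hr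
  have hH' : Measurable fun z : ℝ => H z.toNNReal := hH.comp (by fun_prop)
  have hconv : ENNReal.ofReal (1 - r / q) * ∫⁻ l, ∫⁻ l', H (l + l') ∂expLaw r ∂expLaw q =
      ∫⁻ z : ℝ, (∫⁻ x : ℝ, if x ≤ z then
        ENNReal.ofReal (r * Real.exp (-(r * z))) * exponentialPDF (q - r) x else 0) *
          H z.toNNReal := by
    have hm : Measurable fun l : ℝ≥0 => ∫⁻ l', H (l + l') ∂expLaw r :=
      Measurable.lintegral_prod_right' (f := fun p : ℝ≥0 × ℝ≥0 => H (p.1 + p.2))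
        (hH.comp (by fun_prop))
    have hjoint : Measurable fun p : ℝ × ℝ =>
        exponentialPDF q p.1 * (exponentialPDF r (p.2 - p.1) * H p.2.toNNReal) :=
      (hpq.comp measurable_fst).mul ((hpr.comp (by fun_prop)).mul (hH'.comp measurable_snd))
    rw [lintegral_expLaw q hm]
    have h1 : ∀ x : ℝ, exponentialPDF q x * ∫⁻ l', H (x.toNNReal + l') ∂expLaw r =
        ∫⁻ z, exponentialPDF q x * (exponentialPDF r (z - x) * H z.toNNReal) := by
      intro x
      have hz : Measurable fun z : ℝ => exponentialPDF r (z - x) * H z.toNNReal :=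
        (hpr.comp (by fun_prop : Measurable fun z : ℝ => z - x)).mul hH'
      rw [lintegral_expLaw r (H := fun l' => H (x.toNNReal + l')) (hH.comp (by fun_prop)),
        lintegral_const_mul _ hz]
      rcases lt_or_ge x 0 with hx | hx
      · rw [exponentialPDF_of_neg hx, zero_mul, zero_mul]
      congr 1
      rw [← lintegral_sub_right_eq_self (fun y => exponentialPDF r y *
        H (x.toNNReal + y.toNNReal)) x]
      refine lintegral_congr fun z => ?_
      rcases lt_or_ge (z - x) 0 with hz | hz
      · rw [exponentialPDF_of_neg hz, zero_mul, zero_mul]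
      · rw [← Real.toNNReal_add hx hz, add_sub_cancel]
    simp_rw [h1]
    rw [lintegral_lintegral_swap hjoint.aemeasurable, ← lintegral_const_mul _ (by
      exact Measurable.lintegral_prod_left' hjoint)]
    refine lintegral_congr fun z => ?_
    rw [← lintegral_const_mul _ (by fun_prop), ← lintegral_mul_const _ (by
      refine Measurable.ite measurableSet_Iic (by
        have := measurable_exponentialPDF (q - r); fun_prop) measurable_const)]
    refine lintegral_congr fun x => ?_
    rw [← exponentialPDF_mul_exponentialPDF hr hrq]
    ring
  have hinner : ∀ z : ℝ, (∫⁻ x : ℝ, if x ≤ z then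
      ENNReal.ofReal (r * Real.exp (-(r * z))) * exponentialPDF (q - r) x else 0) =
      ENNReal.ofReal (r * Real.exp (-(r * z))) *
        ENNReal.ofReal (if 0 ≤ z then 1 - Real.exp (-((q - r) * z)) else 0) := by
    intro z
    rw [← lintegral_exponentialPDF_eq_antiDeriv (sub_pos.2 hrq),
      ← lintegral_const_mul _ (measurable_exponentialPDF _), ← lintegral_indicator measurableSet_Iic]
    rfl
  rw [hconv, lintegral_expLaw q hH, lintegral_expLaw r hH, ← lintegral_const_mul _ (by fun_prop),
    ← lintegral_add_left (by fun_prop)]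
  refine lintegral_congr fun z => ?_
  rw [hinner, ← mul_assoc, ← add_mul]
  congr 1
  rw [exponentialPDF_eq, exponentialPDF_eq]
  split_ifs with hz
  · have h1 : Real.exp (-((q - r) * z)) ≤ 1 := Real.exp_le_one_iff.2 (by nlinarith)
    rw [← ENNReal.ofReal_mul (by positivity), ← ENNReal.ofReal_mul (by positivity),
      ← ENNReal.ofReal_add (by positivity) (mul_nonneg (by positivity) (by linarith))]
    congr 1
    have e2 : Real.exp (-(q * z)) = Real.exp (-(r * z)) * Real.exp (-((q - r) * z)) := by
      rw [← Real.exp_add]; ring_nf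
    rw [e2]
    field_simp
    ring
  · simp

end LevyForest

namespace LevyForest

/-! ### Pruning -/

/-- The label of a vertex of a forest: a position, the length of an edge, and a colour, which is
finite only for leaves. -/
abbrev Mark (T : Type) : Type := T × ℝ≥0 × ℝ≥0∞

namespace Forest

variable {T : Type}

/-- Merge the edge of the root with that of its child, if there is only one child. -/
def merge : Mark T × Forest (Mark T) → Mark T × Forest (Mark T)
  | (a, cons b c nil) => ((a.1, a.2.1 + b.2.1, b.2.2), c)
  | (a, nil) => (a, nil)
  | (a, cons b c (cons d e r)) => (a, cons b c (cons d e r))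

open Classical in
/-- The forest spanned by the leaves with colour at most `t`. -/
noncomputable def prune (t : ℝ≥0∞) : Forest (Mark T) → Forest (Mark T)
  | nil => nil
  | cons a c r => if a.2.2 ≤ t ∨ prune t c ≠ nil then adjoin (merge (a, prune t c), prune t r)
      else prune t r

/-- The trees with a leaf of colour at most `t`. -/
def keep (t : ℝ≥0∞) : Set (Mark T × Forest (Mark T)) := {x | x.1.2.2 ≤ t ∨ prune t x.2 ≠ nil}

/-- The pruning of a single tree. -/
noncomputable def pruneRoot (t : ℝ≥0∞) (x : Mark T × Forest (Mark T)) : Mark T × Forest (Mark T) :=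
  merge (x.1, prune t x.2)

theorem prune_eq_thin (t : ℝ≥0∞) :
    (prune t : Forest (Mark T) → Forest (Mark T)) = thin (keep t) (pruneRoot t) := by
  funext f
  induction f with
  | nil => rfl
  | cons a c r _ ih =>
    simp only [prune, thin, ih, keep, pruneRoot, Set.mem_ofPred_eq]
    congr

variable [Nonempty T] [MeasurableSpace T]

theorem measurable_merge :
    Measurable (merge : Mark T × Forest (Mark T) → Mark T × Forest (Mark T)) := by
  classical
  have : (merge : Mark T × Forest (Mark T) → _) = fun x => if x.2 = nil then x else
      if rest x.2 = nil then
        ((x.1.1, x.1.2.1 + (label x.2).2.1, (label x.2).2.2), children x.2) else x := by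
    funext x
    rcases x with ⟨a, _ | ⟨b, c, _ | ⟨d, e, r⟩⟩⟩ <;> simp [merge, rest, label, children]
  rw [this]
  have h2 : Measurable fun x : Mark T × Forest (Mark T) => label x.2 :=
    measurable_label.comp measurable_snd
  refine Measurable.ite (measurable_snd measurableSet_nil) measurable_id
    (Measurable.ite ((measurable_rest.comp measurable_snd) measurableSet_nil) ?_ measurable_id)
  have h3 : Measurable fun x : Mark T × Forest (Mark T) => children x.2 :=
    measurable_children.comp measurable_snd
  fun_prop

theorem measurable_prune (t : ℝ≥0∞) :
    Measurable (prune t : Forest (Mark T) → Forest (Mark T)) := by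
  classical
  refine measurable_of_rec (G := fun x : Mark T × (Forest (Mark T) × Forest (Mark T)) ×
    Forest (Mark T) × Forest (Mark T) => if x.1.2.2 ≤ t ∨ x.2.2.1 ≠ nil then
      adjoin (merge (x.1, x.2.2.1), x.2.2.2) else x.2.2.2) ?_ fun a c r => rfl
  have h1 : Measurable fun x : Mark T × (Forest (Mark T) × Forest (Mark T)) ×
    Forest (Mark T) × Forest (Mark T) => x.2.2.1 := by fun_prop
  have h2 : Measurable fun x : Mark T × (Forest (Mark T) × Forest (Mark T)) ×
    Forest (Mark T) × Forest (Mark T) => x.1.2.2 := by fun_prop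
  refine Measurable.ite (MeasurableSet.union (measurableSet_le h2 measurable_const)
    (h1 measurableSet_nil).compl) (measurable_adjoin.comp (Measurable.prodMk
      (measurable_merge.comp (by fun_prop)) (by fun_prop))) (by fun_prop)

theorem measurableSet_keep (t : ℝ≥0∞) :
    MeasurableSet (keep t : Set (Mark T × Forest (Mark T))) :=
  MeasurableSet.union (measurableSet_le
    (by fun_prop : Measurable fun x : Mark T × Forest (Mark T) => x.1.2.2) measurable_const)
    (((measurable_prune t).comp measurable_snd) measurableSet_nil).compl

theorem measurable_pruneRoot (t : ℝ≥0∞) : Measurable (pruneRoot (T := T) t) :=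
  measurable_merge.comp (measurable_fst.prodMk ((measurable_prune t).comp measurable_snd))

variable {A : Type} [Nonempty A] [MeasurableSpace A]

theorem lintegral_iid_one (Q : Measure (A × Forest A)) [SFinite Q] {G : Forest A → ℝ≥0∞}
    (hG : Measurable G) : ∫⁻ f, G f ∂iid Q 1 = ∫⁻ x, G (adjoin (x, nil)) ∂Q := by
  simp only [iid, Measure.prod_dirac]
  rw [Measure.map_map measurable_adjoin (by fun_prop),
    lintegral_map hG (measurable_adjoin.comp (by fun_prop))]
  rfl

theorem lintegral_mix (w : ℕ → ℝ≥0∞) (Q : Measure (A × Forest A)) (G : Forest A → ℝ≥0∞) :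
    ∫⁻ f, G f ∂mix w Q = ∑' k, w k * ∫⁻ f, G f ∂iid Q k := by
  rw [mix, lintegral_sum_measure]
  simp

theorem lintegral_mix_split (w : ℕ → ℝ≥0∞) (Q : Measure (A × Forest A)) [SFinite Q]
    {G : Forest A → ℝ≥0∞} (hG : Measurable G) :
    ∫⁻ f, G f ∂mix w Q = w 0 * G nil + (w 1 * ∫⁻ x, G (adjoin (x, nil)) ∂Q +
      ∑' k, w (k + 2) * ∫⁻ f, G f ∂iid Q (k + 2)) := by
  rw [lintegral_mix, tsum_eq_zero_add' ENNReal.summable, tsum_eq_zero_add' ENNReal.summable,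
    zero_add, lintegral_iid_one Q hG]
  congr 2
  rw [iid, lintegral_dirac' _ hG]

theorem ae_iid_ne_nil (Q : Measure (A × Forest A)) [SFinite Q] (k : ℕ) :
    ∀ᵐ f ∂iid Q (k + 1), f ≠ nil := by
  rw [iid]
  refine (ae_map_iff (p := fun f => f ≠ nil) measurable_adjoin.aemeasurable
    measurableSet_nil.compl).2 ?_
  exact ae_of_all _ fun x => by simp [adjoin]

end Forest

/-! ### The law of the grafted trees -/

section TreeLaw

open Forest

variable {T : Type}

/-- Vertices of Galton-Watson trees: offspring numbers, edge lengths and colouring variables. -/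
abbrev Arr : Type := List ℕ → ℕ × ℝ≥0 × unitInterval

/-- The subtree above the `j`-th child of the root. -/
def Arr.shift (ω : Arr) (j : ℕ) : Arr := fun u => ω (j :: u)

/-- The arrays of trees of height less than `h`. -/
def Arr.short : ℕ → Set Arr
  | 0 => ∅
  | h + 1 => {ω | ∀ j < (ω []).1, ω.shift j ∈ Arr.short h}

/-- The arrays of finite trees. -/
def Arr.finite : Set Arr := ⋃ h, Arr.short h

theorem Arr.short_subset_succ (h : ℕ) : Arr.short h ⊆ Arr.short (h + 1) := by
  induction h with
  | zero => exact empty_subset _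
  | succ h ih => exact fun ω hω j hj => ih (hω j hj)

theorem Arr.monotone_short : Monotone Arr.short := monotone_nat_of_le_succ Arr.short_subset_succ

theorem Arr.mem_finite_iff {ω : Arr} :
    ω ∈ Arr.finite ↔ ∀ j < (ω []).1, ω.shift j ∈ Arr.finite := by
  simp only [Arr.finite, mem_iUnion]
  constructor
  · rintro ⟨_ | h, hω⟩
    · exact absurd hω (by simp [Arr.short])
    · exact fun j hj => ⟨h, hω j hj⟩
  · intro h
    choose! H hH using h
    refine ⟨(Finset.range (ω []).1).sup H + 1, fun j hj => ?_⟩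
    exact Arr.monotone_short (Finset.le_sup (Finset.mem_range.2 hj)) (hH j hj)

/-- The label of a vertex. -/
noncomputable def mark (ρ : T) (lam : ℝ) (v : ℕ × ℝ≥0 × unitInterval) : Mark T :=
  (ρ, v.2.1, if v.1 = 0 then ENNReal.ofReal (lam * v.2.2) else ⊤)

/-- The tree of an array, up to height `h`. -/
noncomputable def readUpTo (ρ : T) (lam : ℝ) : ℕ → Arr → Mark T × Forest (Mark T)
  | 0, ω => (mark ρ lam (ω []), nil)
  | h + 1, ω => (mark ρ lam (ω []), ofSeq (ω []).1 fun j => readUpTo ρ lam h (ω.shift j))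

theorem ofSeq_congr {A : Type} {k : ℕ} {f g : ℕ → A × Forest A} (h : ∀ j < k, f j = g j) :
    ofSeq k f = ofSeq k g := by
  induction k generalizing f g with
  | zero => rfl
  | succ k ih =>
    rw [ofSeq, ofSeq, h 0 k.succ_pos, ih fun j hj => h (j + 1) (by omega)]

theorem readUpTo_succ (ρ : T) (lam : ℝ) {h : ℕ} {ω : Arr} (hω : ω ∈ Arr.short h) :
    readUpTo ρ lam (h + 1) ω = readUpTo ρ lam h ω := by
  induction h generalizing ω with
  | zero => exact absurd hω (by simp [Arr.short])
  | succ h ih =>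
    rw [readUpTo, readUpTo, ofSeq_congr fun j hj => ih (hω j hj)]

theorem readUpTo_eq (ρ : T) (lam : ℝ) {h h' : ℕ} (hh : h ≤ h') {ω : Arr} (hω : ω ∈ Arr.short h) :
    readUpTo ρ lam h' ω = readUpTo ρ lam h ω := by
  induction h', hh using Nat.le_induction with
  | base => rfl
  | succ h' hh ih => rw [readUpTo_succ ρ lam (Arr.monotone_short hh hω), ih]

open Classical in
/-- The tree of an array. (The value for arrays of infinite trees is a convention.) -/
noncomputable def read (ρ : T) (lam : ℝ) (ω : Arr) : Mark T × Forest (Mark T) :=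
  if h : ∃ h, ω ∈ Arr.short h then readUpTo ρ lam h.choose ω else (mark ρ lam (ω []), nil)

theorem read_eq_readUpTo (ρ : T) (lam : ℝ) {h : ℕ} {ω : Arr} (hω : ω ∈ Arr.short h) :
    read ρ lam ω = readUpTo ρ lam h ω := by
  have hex : ∃ h, ω ∈ Arr.short h := ⟨h, hω⟩
  rw [read, dif_pos hex]
  rcases le_total h hex.choose with hle | hle
  · exact readUpTo_eq ρ lam hle hω
  · exact (readUpTo_eq ρ lam hle hex.choose_spec).symm

theorem read_eq (ρ : T) (lam : ℝ) {ω : Arr} (hω : ω ∈ Arr.finite) :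
    read ρ lam ω = (mark ρ lam (ω []), ofSeq (ω []).1 fun j => read ρ lam (ω.shift j)) := by
  obtain ⟨_ | h, hω⟩ := mem_iUnion.1 hω
  · exact absurd hω (by simp [Arr.short])
  · rw [read_eq_readUpTo ρ lam hω, readUpTo, ofSeq_congr fun j hj =>
      (read_eq_readUpTo ρ lam (hω j hj)).symm]

theorem Arr.measurable_shift : Measurable fun (ω : Arr) (j : ℕ) => ω.shift j :=
  measurable_pi_lambda _ fun j => measurable_pi_lambda _ fun u => measurable_pi_apply (j :: u)

theorem measurableSet_forall_shift {B : Set Arr} (hB : MeasurableSet B) :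
    MeasurableSet {ω : Arr | ∀ j < (ω []).1, ω.shift j ∈ B} := by
  simp only [Set.ofPred_forall]
  refine MeasurableSet.iInter fun j => ?_
  have h1 : MeasurableSet {ω : Arr | j < (ω []).1} :=
    measurableSet_lt measurable_const (measurable_fst.comp (measurable_pi_apply []))
  have h2 : MeasurableSet {ω : Arr | ω.shift j ∈ B} :=
    ((measurable_pi_apply j).comp Arr.measurable_shift) hB
  convert! h1.compl.union h2 using 1
  ext ω
  simp [imp_iff_not_or]

theorem Arr.measurableSet_short (h : ℕ) : MeasurableSet (Arr.short h) := by
  induction h with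
  | zero => exact .empty
  | succ h ih => exact measurableSet_forall_shift ih

theorem Arr.measurableSet_finite : MeasurableSet Arr.finite :=
  MeasurableSet.iUnion Arr.measurableSet_short

variable [Nonempty T] [MeasurableSpace T]

theorem measurable_mark (ρ : T) (lam : ℝ) : Measurable (mark ρ lam) := by
  refine measurable_const.prodMk (Measurable.prodMk (by fun_prop) ?_)
  refine Measurable.ite (measurable_fst (measurableSet_singleton 0)) ?_ measurable_const
  exact ENNReal.measurable_ofReal.comp (measurable_const.mul
    (measurable_subtype_coe.comp (measurable_snd.comp measurable_snd)))

theorem measurable_ofSeq_uncurry {A : Type} [Nonempty A] [MeasurableSpace A] :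
    Measurable fun x : ℕ × (ℕ → A × Forest A) => ofSeq x.1 x.2 :=
  measurable_from_prod_countable_right fun k => measurable_ofSeq k

theorem measurable_node {A : Type} [Nonempty A] [MeasurableSpace A] (m : ℕ × ℝ≥0 × unitInterval → A)
    (hm : Measurable m) {g : Arr → A × Forest A} (hg : Measurable g) :
    Measurable fun ω : Arr => (m (ω []), ofSeq (ω []).1 fun j => g (ω.shift j)) := by
  refine (hm.comp (measurable_pi_apply [])).prodMk (measurable_ofSeq_uncurry.comp
    ((measurable_fst.comp (measurable_pi_apply [])).prodMk (measurable_pi_lambda _ fun j => ?_)))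
  exact hg.comp ((measurable_pi_apply j).comp Arr.measurable_shift)

theorem measurable_readUpTo (ρ : T) (lam : ℝ) (h : ℕ) : Measurable (readUpTo ρ lam h) := by
  induction h with
  | zero => exact ((measurable_mark ρ lam).comp (measurable_pi_apply [])).prodMk measurable_const
  | succ h ih => exact measurable_node _ (measurable_mark ρ lam) ih

theorem measurable_read (ρ : T) (lam : ℝ) : Measurable (read ρ lam) := by
  intro s hs
  have : read ρ lam ⁻¹' s = (⋃ h, Arr.short h ∩ readUpTo ρ lam h ⁻¹' s) ∪
      (Arr.finiteᶜ ∩ (fun ω : Arr => (mark ρ lam (ω []), (nil : Forest (Mark T)))) ⁻¹' s) := by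
    ext ω
    by_cases hω : ω ∈ Arr.finite
    · obtain ⟨h, hh⟩ := mem_iUnion.1 hω
      simp only [mem_preimage, mem_union, mem_iUnion, mem_inter_iff, mem_compl_iff, hω,
        not_true_eq_false, false_and, or_false]
      exact ⟨fun h1 => ⟨h, hh, by rwa [← read_eq_readUpTo ρ lam hh]⟩,
        fun ⟨k, hk, h1⟩ => by rwa [read_eq_readUpTo ρ lam hk]⟩
    · have hω' : ¬ ∃ h, ω ∈ Arr.short h := fun h => hω (mem_iUnion.2 h)
      have : ∀ h, ω ∉ Arr.short h := fun h hh => hω' ⟨h, hh⟩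
      simp [hω, read, this]
  rw [this]
  refine (MeasurableSet.iUnion fun h => (Arr.measurableSet_short h).inter
    (measurable_readUpTo ρ lam h hs)).union (Arr.measurableSet_finite.compl.inter ?_)
  exact (((measurable_mark ρ lam).comp (measurable_pi_apply [])).prodMk measurable_const) hs

end TreeLaw

end LevyForest

namespace LevyForest

/-! ### The branching property of the grafted trees -/

section TreeLaw

open Forest

variable {T : Type} [Nonempty T] [MeasurableSpace T] (ψ : BranchingMechanism)

/-- The expectation of a functional of a tree with root edge of length `l` whose subtrees have
law `M`. -/
noncomputable def edgeInt (lam : ℝ) (ρ : T) (M : Measure (Mark T × Forest (Mark T)))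
    (F : Mark T × Forest (Mark T) → ℝ≥0∞) (l : ℝ≥0) : ℝ≥0∞ :=
  ENNReal.ofReal (ψ.xi 0 lam 0) *
      (∫⁻ u : unitInterval, F ((ρ, l, ENNReal.ofReal (lam * u)), nil)) +
    ∫⁻ f, F ((ρ, l, ⊤), f) ∂mix (ψ.branchWeights lam) M

theorem sFinite_mix {A : Type} [Nonempty A] [MeasurableSpace A] (w : ℕ → ℝ≥0∞)
    (Q : Measure (A × Forest A)) [IsFiniteMeasure Q] : SFinite (mix w Q) := by
  unfold mix; infer_instance

theorem measurable_lintegral_leaf (lam : ℝ) (ρ : T) {F : Mark T × Forest (Mark T) → ℝ≥0∞}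
    (hF : Measurable F) : Measurable fun l : ℝ≥0 =>
      ∫⁻ u : unitInterval, F ((ρ, l, ENNReal.ofReal (lam * u)), nil) := by
  refine Measurable.lintegral_prod_right' (f := fun p : ℝ≥0 × unitInterval =>
    F ((ρ, p.1, ENNReal.ofReal (lam * p.2)), nil)) (hF.comp ?_)
  exact (measurable_const.prodMk (measurable_fst.prodMk (ENNReal.measurable_ofReal.comp
    (measurable_const.mul (measurable_subtype_coe.comp measurable_snd))))).prodMk measurable_const

theorem measurable_edgeInt (lam : ℝ) (ρ : T) (M : Measure (Mark T × Forest (Mark T)))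
    [IsFiniteMeasure M] {F : Mark T × Forest (Mark T) → ℝ≥0∞} (hF : Measurable F) :
    Measurable (edgeInt ψ lam ρ M F) := by
  have := sFinite_mix (ψ.branchWeights lam) M
  exact ((measurable_lintegral_leaf lam ρ hF).const_mul _).add
    (Measurable.lintegral_prod_right' (ν := mix (ψ.branchWeights lam) M)
      (f := fun p : ℝ≥0 × Forest (Mark T) => F ((ρ, p.1, ⊤), p.2)) (hF.comp (by fun_prop)))

/-- The law of the array of a grafted tree. -/
noncomputable def arrLaw (lam : ℝ) : Measure Arr :=
  Measure.infinitePi fun _ : List ℕ => vertexLaw ψ 0 lam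

variable {ψ}

theorem isProbabilityMeasure_vertexLaw (hψ : ∃ c : ℝ, 0 < c ∧ 0 < ψ c)
    (hm : DifferentiableWithinAt ℝ ψ (Ici 0) 0) {lam : ℝ} (hlam : 0 < lam) :
    IsProbabilityMeasure (vertexLaw ψ 0 lam) := by
  have := isProbabilityMeasure_expLaw (BranchingMechanism.rate_pos hψ hm hlam)
  exact inferInstanceAs (IsProbabilityMeasure ((lawOfWeights (ψ.xi 0 lam)).prod
    ((expLaw (ψ.rate lam)).prod volume)))

theorem isProbabilityMeasure_arrLaw (hψ : ∃ c : ℝ, 0 < c ∧ 0 < ψ c)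
    (hm : DifferentiableWithinAt ℝ ψ (Ici 0) 0) {lam : ℝ} (hlam : 0 < lam) :
    IsProbabilityMeasure (arrLaw ψ lam) := by
  have := isProbabilityMeasure_vertexLaw hψ hm hlam
  unfold arrLaw; infer_instance

theorem lintegral_vertexLaw (hψ : ∃ c : ℝ, 0 < c ∧ 0 < ψ c)
    (hm : DifferentiableWithinAt ℝ ψ (Ici 0) 0) {lam : ℝ} (hlam : 0 < lam)
    {G : ℕ × ℝ≥0 × unitInterval → ℝ≥0∞} (hG : Measurable G) :
    ∫⁻ v, G v ∂vertexLaw ψ 0 lam = ∑' k, ENNReal.ofReal (ψ.xi 0 lam k) *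
      ∫⁻ l, ∫⁻ u, G (k, l, u) ∂volume ∂expLaw (ψ.rate lam) := by
  have := isProbabilityMeasure_expLaw (BranchingMechanism.rate_pos hψ hm hlam)
  change ∫⁻ v, G v ∂((lawOfWeights (ψ.xi 0 lam)).prod ((expLaw (ψ.rate lam)).prod volume)) = _
  rw [lintegral_prod _ hG.aemeasurable, lawOfWeights_eq (BranchingMechanism.tsum_xi hψ hm hlam),
    lintegral_sum_measure]
  refine tsum_congr fun k => ?_
  rw [lintegral_smul_measure, lintegral_dirac, lintegral_prod _ (by fun_prop), smul_eq_mul]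

/-- The branching property in integrated form, on the event that all subtrees lie in B. The term k =
0 is a leaf with a uniform colour, k = 1 is absent, and for k ≥ 2 the colour is infinite. -/
theorem lintegral_node (hψ : ∃ c : ℝ, 0 < c ∧ 0 < ψ c)
    (hm : DifferentiableWithinAt ℝ ψ (Ici 0) 0) {lam : ℝ} (hlam : 0 < lam) (ρ : T)
    {B : Set Arr} (hB : MeasurableSet B) {g : Arr → Mark T × Forest (Mark T)} (hg : Measurable g)
    {F : Mark T × Forest (Mark T) → ℝ≥0∞} (hF : Measurable F) :
    ∫⁻ ω in {ω : Arr | ∀ j < (ω []).1, ω.shift j ∈ B},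
        F (mark ρ lam (ω []), ofSeq (ω []).1 fun j => g (ω.shift j)) ∂arrLaw ψ lam =
      ∫⁻ l, edgeInt ψ lam ρ (((arrLaw ψ lam).restrict B).map g) F l ∂expLaw (ψ.rate lam) := by
  have hP := isProbabilityMeasure_arrLaw hψ hm hlam
  have hV := isProbabilityMeasure_vertexLaw hψ hm hlam
  have hE := isProbabilityMeasure_expLaw (BranchingMechanism.rate_pos hψ hm hlam)
  set M := ((arrLaw ψ lam).restrict B).map g with hM
  have hMf : IsFiniteMeasure M := by rw [hM]; infer_instance
  set S : Set ((ℕ × ℝ≥0 × unitInterval) × (ℕ → Arr)) := {x | ∀ j < x.1.1, x.2 j ∈ B} with hS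
  set H : (ℕ × ℝ≥0 × unitInterval) × (ℕ → Arr) → ℝ≥0∞ := fun x =>
    F (mark ρ lam x.1, ofSeq x.1.1 fun j => g (x.2 j)) with hH
  have hSm : MeasurableSet S := by
    simp only [hS, Set.ofPred_forall]
    refine MeasurableSet.iInter fun j => ?_
    have h1 : MeasurableSet {x : (ℕ × ℝ≥0 × unitInterval) × (ℕ → Arr) | j < x.1.1} :=
      measurableSet_lt measurable_const (by fun_prop)
    have h2 : MeasurableSet {x : (ℕ × ℝ≥0 × unitInterval) × (ℕ → Arr) | x.2 j ∈ B} :=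
      ((measurable_pi_apply j).comp measurable_snd) hB
    convert! h1.compl.union h2 using 1
    ext ω
    simp [imp_iff_not_or]
  have hHm : Measurable H := by
    refine hF.comp (((measurable_mark ρ lam).comp measurable_fst).prodMk
      (measurable_ofSeq_uncurry.comp ((by fun_prop : Measurable fun x :
        (ℕ × ℝ≥0 × unitInterval) × (ℕ → Arr) => x.1.1).prodMk (measurable_pi_lambda _ fun j => ?_))))
    exact hg.comp ((measurable_pi_apply j).comp measurable_snd)
  have hΦ : Measurable fun ω : Arr => (ω [], fun j => ω.shift j) :=
    (measurable_pi_apply []).prodMk Arr.measurable_shift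
  have hmap : (arrLaw ψ lam).map (fun ω : Arr => (ω [], fun j => ω.shift j)) =
      (vertexLaw ψ 0 lam).prod (Measure.infinitePi fun _ : ℕ => arrLaw ψ lam) :=
    infinitePi_list_map_prod _
  -- For fixed data of the root the subtrees are independent, each restricted to B.
  have hin : ∀ v, ∫⁻ ω', S.indicator H (v, ω') ∂Measure.infinitePi (fun _ : ℕ => arrLaw ψ lam) =
      ∫⁻ f, F (mark ρ lam v, f) ∂iid M v.1 := by
    intro v
    have hms : MeasurableSet {ω' : ℕ → Arr | ∀ j < v.1, ω' j ∈ B} := measurable_prodMk_left hSm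
    have hseq : Measurable fun ω' : ℕ → Arr => ofSeq v.1 fun n => g (ω' n) :=
      (measurable_ofSeq _).comp (measurable_pi_lambda _ fun j => hg.comp (measurable_pi_apply j))
    have hFv : Measurable fun f => F (mark ρ lam v, f) := hF.comp measurable_prodMk_left
    rw [hM, ← map_ofSeq_infinitePi _ hg hB v.1, lintegral_map hFv hseq, ← lintegral_indicator hms]
    rfl
  calc _ = ∫⁻ x in S, H x ∂((arrLaw ψ lam).map fun ω : Arr => (ω [], fun j => ω.shift j)) := by
        rw [setLIntegral_map hSm hHm hΦ]
        rfl
    _ = ∫⁻ v, ∫⁻ f, F (mark ρ lam v, f) ∂iid M v.1 ∂vertexLaw ψ 0 lam := by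
        rw [hmap, ← lintegral_indicator hSm, lintegral_prod _ (hHm.indicator hSm).aemeasurable]
        exact lintegral_congr hin
    _ = ∑' k, ENNReal.ofReal (ψ.xi 0 lam k) * ∫⁻ l, ∫⁻ u : unitInterval,
          ∫⁻ f, F (mark ρ lam (k, l, u), f) ∂iid M k ∂volume ∂expLaw (ψ.rate lam) := by
        refine lintegral_vertexLaw hψ hm hlam (G := fun v =>
          ∫⁻ f, F (mark ρ lam v, f) ∂iid M v.1) (measurable_from_prod_countable_right fun k => ?_)
        refine Measurable.lintegral_prod_right' (ν := iid M k) (f := fun p : (ℝ≥0 × unitInterval) ×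
          Forest (Mark T) => F (mark ρ lam (k, p.1), p.2)) (hF.comp ?_)
        exact ((measurable_mark ρ lam).comp (by fun_prop)).prodMk measurable_snd
    _ = _ := by
        have hA := measurable_lintegral_leaf lam ρ hF
        have hB : ∀ k, Measurable fun l : ℝ≥0 => ∫⁻ f, F ((ρ, l, ⊤), f) ∂iid M k := fun k =>
          Measurable.lintegral_prod_right' (f := fun p : ℝ≥0 × Forest (Mark T) =>
            F ((ρ, p.1, ⊤), p.2)) (hF.comp (by fun_prop))
        have hb0 : ψ.branchWeights lam 0 = 0 := by simp [BranchingMechanism.branchWeights]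
        have hb1 : ψ.branchWeights lam (0 + 1) = 0 := by simp [BranchingMechanism.branchWeights]
        have hR : ∫⁻ l, edgeInt ψ lam ρ M F l ∂expLaw (ψ.rate lam) =
            ENNReal.ofReal (ψ.xi 0 lam 0) * (∫⁻ l, ∫⁻ u : unitInterval,
              F ((ρ, l, ENNReal.ofReal (lam * u)), nil) ∂volume ∂expLaw (ψ.rate lam)) +
            ∑' k, ψ.branchWeights lam k *
              ∫⁻ l, ∫⁻ f, F ((ρ, l, ⊤), f) ∂iid M k ∂expLaw (ψ.rate lam) := by
          simp only [edgeInt, lintegral_mix]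
          rw [lintegral_add_left (hA.const_mul _), lintegral_const_mul _ hA,
            lintegral_tsum fun k => ((hB k).const_mul _).aemeasurable]
          simp_rw [fun k => lintegral_const_mul (μ := expLaw (ψ.rate lam))
            (ψ.branchWeights lam k) (hB k)]
        rw [hR, tsum_eq_zero_add' ENNReal.summable]
        congr 1
        · congr 1
          refine lintegral_congr fun l => lintegral_congr fun u => ?_
          have hFv : Measurable fun f => F (mark ρ lam (0, l, u), f) :=
            hF.comp measurable_prodMk_left
          rw [iid, lintegral_dirac' _ hFv]
          simp [mark]
        · rw [tsum_eq_zero_add' ENNReal.summable, tsum_eq_zero_add' (f := fun k =>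
            ψ.branchWeights lam k * _) ENNReal.summable, tsum_eq_zero_add' (f := fun k =>
            ψ.branchWeights lam (k + 1) * _) ENNReal.summable, hb0, hb1]
          have hxi : ENNReal.ofReal (ψ.xi 0 lam (0 + 1)) = 0 := by simp [BranchingMechanism.xi]
          rw [hxi]
          simp only [zero_mul, zero_add]
          refine tsum_congr fun k => ?_
          rw [BranchingMechanism.ofReal_xi hψ hm hlam]
          congr 1
          refine lintegral_congr fun l => ?_
          simp [mark]

end TreeLaw

end LevyForest

namespace LevyForest

/-! ### Finiteness of the grafted trees and the law of a pruned tree -/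

section TreeLaw

open Forest

variable {T : Type} [Nonempty T] [MeasurableSpace T] {ψ : BranchingMechanism}

/-- The law of a grafted tree on the event that its array lies in `B`. -/
noncomputable def treeLawOn (ψ : BranchingMechanism) (lam : ℝ) (ρ : T) (B : Set Arr) :
    Measure (Mark T × Forest (Mark T)) := ((arrLaw ψ lam).restrict B).map (read ρ lam)

theorem lintegral_treeLawOn (hψ : ∃ c : ℝ, 0 < c ∧ 0 < ψ c)
    (hm : DifferentiableWithinAt ℝ ψ (Ici 0) 0) {lam : ℝ} (hlam : 0 < lam) (ρ : T)
    {B B' : Set Arr} (hB : MeasurableSet B) (hB' : B' = {ω : Arr | ∀ j < (ω []).1, ω.shift j ∈ B})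
    (hfin : B' ⊆ Arr.finite)
    {F : Mark T × Forest (Mark T) → ℝ≥0∞} (hF : Measurable F) :
    ∫⁻ x, F x ∂treeLawOn ψ lam ρ B' =
      ∫⁻ l, edgeInt ψ lam ρ (treeLawOn ψ lam ρ B) F l ∂expLaw (ψ.rate lam) := by
  have hm' : MeasurableSet B' := hB' ▸ measurableSet_forall_shift hB
  rw [treeLawOn, lintegral_map hF (measurable_read ρ lam), treeLawOn,
    ← lintegral_node hψ hm hlam ρ hB (measurable_read ρ lam) hF, ← hB']
  exact setLIntegral_congr_fun hm' fun ω hω => by rw [read_eq ρ lam (hfin hω)]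

theorem Arr.finite_eq : Arr.finite = {ω : Arr | ∀ j < (ω []).1, ω.shift j ∈ Arr.finite} :=
  Set.ext fun _ => Arr.mem_finite_iff

theorem Arr.short_subset_finite (h : ℕ) : Arr.short h ⊆ Arr.finite := subset_iUnion Arr.short h

theorem treeLawOn_univ (lam : ℝ) (ρ : T) (B : Set Arr) :
    treeLawOn ψ lam ρ B univ = arrLaw ψ lam B := by
  rw [treeLawOn, Measure.map_apply (measurable_read ρ lam) .univ]
  simp

/-- The probability s of finiteness is a fixed point of the generating function, so ψ vanishes at
x_λ - s b. If s < 1, this point exceeds the largest root ψ⁻¹(0), where ψ is positive. -/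
theorem arrLaw_finite (hψ : ∃ c : ℝ, 0 < c ∧ 0 < ψ c)
    (hm : DifferentiableWithinAt ℝ ψ (Ici 0) 0) {lam : ℝ} (hlam : 0 < lam) :
    arrLaw ψ lam Arr.finite = 1 := by
  have hP := isProbabilityMeasure_arrLaw hψ hm hlam
  have hE := isProbabilityMeasure_expLaw (BranchingMechanism.rate_pos hψ hm hlam)
  have hq := BranchingMechanism.rate_pos hψ hm hlam
  have hb := BranchingMechanism.gap_pos hψ hm hlam
  have hle : arrLaw ψ lam Arr.finite ≤ 1 := prob_le_one
  set s := (arrLaw ψ lam Arr.finite).toReal with hs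
  have hs0 : 0 ≤ s := ENNReal.toReal_nonneg
  have hs1 : s ≤ 1 := by
    rw [hs]; exact ENNReal.toReal_le_of_le_ofReal zero_le_one (by simpa using hle)
  have hofs : ENNReal.ofReal s = arrLaw ψ lam Arr.finite :=
    ENNReal.ofReal_toReal (ne_top_of_le_ne_top ENNReal.one_ne_top hle)
  -- The fixed-point equation results from integrating the constant 1; the marks are irrelevant, so
  -- the one-point space serves for T.
  have hfix := lintegral_treeLawOn hψ hm hlam () Arr.measurableSet_finite Arr.finite_eq
    subset_rfl (F := fun _ => 1) measurable_const
  have hfin : IsFiniteMeasure (treeLawOn ψ lam () Arr.finite) := by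
    unfold treeLawOn; infer_instance
  simp only [lintegral_const, one_mul, edgeInt, measure_univ, mul_one, treeLawOn_univ,
    mix_univ] at hfix
  rw [← hofs, BranchingMechanism.tsum_branchWeights hψ hm hlam hs0 hs1] at hfix
  by_contra hne
  have hlt : s < 1 := hs1.lt_of_ne fun h => hne (by rw [← hofs, h, ENNReal.ofReal_one])
  have hpos : 0 < ψ (ψ.inv lam - s * ψ.gap lam) := by
    refine (BranchingMechanism.inv_spec hψ hm le_rfl).2.2 _ ?_
    have : ψ.inv lam - ψ.gap lam = ψ.inv 0 := by simp [BranchingMechanism.gap]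
    nlinarith
  have hdiv : 0 < ψ (ψ.inv lam - s * ψ.gap lam) / (ψ.rate lam * ψ.gap lam) := by positivity
  have := (ENNReal.ofReal_eq_ofReal_iff hs0 (by positivity)).1 hfix
  linarith

theorem ae_arrLaw_finite (hψ : ∃ c : ℝ, 0 < c ∧ 0 < ψ c)
    (hm : DifferentiableWithinAt ℝ ψ (Ici 0) 0) {lam : ℝ} (hlam : 0 < lam) :
    ∀ᵐ ω ∂arrLaw ψ lam, ω ∈ Arr.finite := by
  have hP := isProbabilityMeasure_arrLaw hψ hm hlam
  exact (mem_ae_iff_prob_eq_one Arr.measurableSet_finite).2 (arrLaw_finite hψ hm hlam)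

/-- The law of a grafted tree. -/
noncomputable def treeLaw (ψ : BranchingMechanism) (lam : ℝ) (ρ : T) :
    Measure (Mark T × Forest (Mark T)) := (arrLaw ψ lam).map (read ρ lam)

theorem isProbabilityMeasure_treeLaw (hψ : ∃ c : ℝ, 0 < c ∧ 0 < ψ c)
    (hm : DifferentiableWithinAt ℝ ψ (Ici 0) 0) {lam : ℝ} (hlam : 0 < lam) (ρ : T) :
    IsProbabilityMeasure (treeLaw ψ lam ρ) := by
  have hP := isProbabilityMeasure_arrLaw hψ hm hlam
  exact Measure.isProbabilityMeasure_map (measurable_read ρ lam).aemeasurable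

theorem treeLawOn_finite (hψ : ∃ c : ℝ, 0 < c ∧ 0 < ψ c)
    (hm : DifferentiableWithinAt ℝ ψ (Ici 0) 0) {lam : ℝ} (hlam : 0 < lam) (ρ : T) :
    treeLawOn ψ lam ρ Arr.finite = treeLaw ψ lam ρ := by
  rw [treeLawOn, Measure.restrict_eq_self_of_ae_mem (ae_arrLaw_finite hψ hm hlam), treeLaw]

theorem lintegral_treeLaw (hψ : ∃ c : ℝ, 0 < c ∧ 0 < ψ c)
    (hm : DifferentiableWithinAt ℝ ψ (Ici 0) 0) {lam : ℝ} (hlam : 0 < lam) (ρ : T)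
    {F : Mark T × Forest (Mark T) → ℝ≥0∞} (hF : Measurable F) :
    ∫⁻ x, F x ∂treeLaw ψ lam ρ =
      ∫⁻ l, edgeInt ψ lam ρ (treeLaw ψ lam ρ) F l ∂expLaw (ψ.rate lam) := by
  have := lintegral_treeLawOn hψ hm hlam ρ Arr.measurableSet_finite Arr.finite_eq subset_rfl hF
  rwa [treeLawOn_finite hψ hm hlam] at this

/-- The substitution u = (μ/λ) v. A colour λU conditioned to be at most μ is again distributed as
μU, so retained leaves have the colours of level μ. -/
theorem lintegral_unitInterval_le {μ lam : ℝ} (hμ : 0 < μ) (h : μ < lam) {H : ℝ≥0∞ → ℝ≥0∞}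
    (hH : Measurable H) :
    ∫⁻ u : unitInterval, {c | c ≤ ENNReal.ofReal μ}.indicator H (ENNReal.ofReal (lam * u)) =
      ENNReal.ofReal (μ / lam) * ∫⁻ u : unitInterval, H (ENNReal.ofReal (μ * u)) := by
  have hlam := hμ.trans h
  have ha : 0 < μ / lam := by positivity
  have hmul : Measurable fun v : ℝ => μ / lam * v := by fun_prop
  have hG : Measurable ((Icc 0 (μ / lam)).indicator fun u : ℝ => H (ENNReal.ofReal (lam * u))) :=
    (hH.comp (by fun_prop)).indicator measurableSet_Icc
  have hsub : ∀ G : ℝ → ℝ≥0∞, ∫⁻ u : unitInterval, G u = ∫⁻ u in Icc (0 : ℝ) 1, G u :=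
    fun G => lintegral_subtype_comap measurableSet_Icc G
  rw [hsub fun u => {c | c ≤ ENNReal.ofReal μ}.indicator H (ENNReal.ofReal (lam * u)),
    hsub fun u => H (ENNReal.ofReal (μ * u))]
  have h1 := Real.smul_map_volume_mul_left ha.ne'
  rw [abs_of_pos ha] at h1
  calc _ = ∫⁻ u, (Icc 0 (μ / lam)).indicator (fun u : ℝ => H (ENNReal.ofReal (lam * u))) u := by
        rw [← lintegral_indicator measurableSet_Icc]
        refine lintegral_congr fun u => ?_
        have hle : μ / lam ≤ 1 := by rw [div_le_one hlam]; exact h.le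
        by_cases hu : u ∈ Icc 0 (μ / lam)
        · rw [indicator_of_mem hu, indicator_of_mem (show u ∈ Icc (0 : ℝ) 1 from ⟨hu.1, hu.2.trans hle⟩),
            indicator_of_mem]
          have := (le_div_iff₀ hlam).1 hu.2
          exact ENNReal.ofReal_le_ofReal (by linarith)
        · rw [indicator_of_notMem hu]
          by_cases hu' : u ∈ Icc (0 : ℝ) 1
          · rw [indicator_of_mem hu', indicator_of_notMem]
            intro hc
            have := (ENNReal.ofReal_le_ofReal_iff hμ.le).1 hc
            exact hu ⟨hu'.1, (le_div_iff₀ hlam).2 (by linarith)⟩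
          · rw [indicator_of_notMem hu']
    _ = _ := by
        conv_lhs => rw [← h1]
        rw [lintegral_smul_measure, lintegral_map hG hmul, smul_eq_mul,
          ← lintegral_indicator measurableSet_Icc]
        congr 1
        refine lintegral_congr fun v => ?_
        have hiff : μ / lam * v ∈ Icc 0 (μ / lam) ↔ v ∈ Icc (0 : ℝ) 1 := by
          constructor
          · rintro ⟨h1, h2⟩
            exact ⟨by by_contra! hv; nlinarith, by by_contra! hv; nlinarith⟩
          · rintro ⟨h1, h2⟩
            exact ⟨by positivity, by nlinarith⟩
        by_cases hv : v ∈ Icc (0 : ℝ) 1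
        · rw [indicator_of_mem hv, indicator_of_mem (hiff.2 hv)]
          congr 2
          field_simp
        · rw [indicator_of_notMem hv, indicator_of_notMem (mt hiff.1 hv)]

theorem lintegral_unitInterval_gt {μ lam : ℝ} (hμ : 0 < μ) (h : μ < lam) :
    ∫⁻ u : unitInterval, {c | c ≤ ENNReal.ofReal μ}ᶜ.indicator 1 (ENNReal.ofReal (lam * u)) =
      ENNReal.ofReal (1 - μ / lam) := by
  have h1 := lintegral_unitInterval_le hμ h (H := 1) measurable_one
  have hmeas : MeasurableSet {u : unitInterval | ENNReal.ofReal (lam * u) ≤ ENNReal.ofReal μ} :=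
    measurableSet_le (by fun_prop) measurable_const
  have h2 : volume {u : unitInterval | ENNReal.ofReal (lam * u) ≤ ENNReal.ofReal μ} =
      ENNReal.ofReal (μ / lam) := by
    rw [← lintegral_indicator_one hmeas]
    simpa [indicator] using h1
  have hlam := hμ.trans h
  rw [ENNReal.ofReal_sub _ (by positivity), ENNReal.ofReal_one, ← h2,
    ← prob_compl_eq_one_sub hmeas, ← lintegral_indicator_one hmeas.compl]
  rfl

theorem ae_iid_rest_ne_nil {A : Type} [Nonempty A] [MeasurableSpace A] (Q : Measure (A × Forest A))
    [IsFiniteMeasure Q] (k : ℕ) : ∀ᵐ f ∂iid Q (k + 2), f ≠ nil ∧ rest f ≠ nil := by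
  rw [iid]
  refine (ae_map_iff (p := fun f => f ≠ nil ∧ rest f ≠ nil) measurable_adjoin.aemeasurable
    (measurableSet_nil.compl.inter (measurable_rest measurableSet_nil).compl)).2 ?_
  have := (Measure.quasiMeasurePreserving_snd (μ := Q) (ν := iid Q (k + 1))).ae
    (ae_iid_ne_nil Q k)
  filter_upwards [this] with x hx
  exact ⟨by simp [adjoin], by simpa [adjoin, rest] using hx⟩

theorem rate_le (hψ : ∃ c : ℝ, 0 < c ∧ 0 < ψ c)
    (hm : DifferentiableWithinAt ℝ ψ (Ici 0) 0) {μ lam : ℝ} (hμ : 0 < μ) (h : μ < lam) :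
    ψ.rate μ ≤ ψ.rate lam := by
  have := BranchingMechanism.density_le hψ hm hμ.le h
  simp only [BranchingMechanism.density] at this
  simp only [BranchingMechanism.rate]
  linarith

/-- One step of the induction on the height, with M a bound-satisfying law of the subtrees. A
surviving root is a black leaf, keeps at least two children, or keeps one child and merges with it;
the last case produces the integral over l + l'. -/
theorem lintegral_edge_prune (hψ : ∃ c : ℝ, 0 < c ∧ 0 < ψ c)
    (hm : DifferentiableWithinAt ℝ ψ (Ici 0) 0) {μ lam : ℝ} (hμ : 0 < μ) (h : μ < lam) (ρ : T)
    {M : Measure (Mark T × Forest (Mark T))} [IsFiniteMeasure M]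
    (h1 : (M.restrict (keep (ENNReal.ofReal μ))).map (pruneRoot (ENNReal.ofReal μ)) ≤
      ENNReal.ofReal (ψ.gap μ / ψ.gap lam) • treeLaw ψ μ ρ)
    (h2 : M (keep (ENNReal.ofReal μ))ᶜ ≤ ENNReal.ofReal (1 - ψ.gap μ / ψ.gap lam))
    {F : Mark T × Forest (Mark T) → ℝ≥0∞} (hF : Measurable F) (l : ℝ≥0) :
    edgeInt ψ lam ρ M
      ((keep (ENNReal.ofReal μ)).indicator fun x => F (pruneRoot (ENNReal.ofReal μ) x)) l ≤
    ENNReal.ofReal (ψ.gap μ / ψ.gap lam) *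
      (ENNReal.ofReal (ψ.rate μ / ψ.rate lam) * edgeInt ψ μ ρ (treeLaw ψ μ ρ) F l +
        ENNReal.ofReal (1 - ψ.rate μ / ψ.rate lam) *
          ∫⁻ l', edgeInt ψ μ ρ (treeLaw ψ μ ρ) F (l + l') ∂expLaw (ψ.rate μ)) := by
  have hlam := hμ.trans h
  have hq := BranchingMechanism.rate_pos hψ hm hlam
  have hr := BranchingMechanism.rate_pos hψ hm hμ
  have hb := BranchingMechanism.gap_pos hψ hm hlam
  have hbμ := BranchingMechanism.gap_pos hψ hm hμ
  have hQ := isProbabilityMeasure_treeLaw hψ hm hμ ρ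
  have hk := measurableSet_keep (T := T) (ENNReal.ofReal μ)
  have hp := measurable_pruneRoot (T := T) (ENNReal.ofReal μ)
  set t := ENNReal.ofReal μ with ht
  set Q := treeLaw ψ μ ρ with hQdef
  -- Here ξ_{0,λ}(0) μ/λ = (ratio of gaps) (ratio of rates) ξ_{0,μ}(0), and both colours are
  -- uniform.
  have hleaf : ENNReal.ofReal (ψ.xi 0 lam 0) * (∫⁻ u : unitInterval,
      (keep t).indicator (fun x => F (pruneRoot t x)) ((ρ, l, ENNReal.ofReal (lam * u)), nil)) =
      ENNReal.ofReal (ψ.gap μ / ψ.gap lam) * (ENNReal.ofReal (ψ.rate μ / ψ.rate lam) *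
        (ENNReal.ofReal (ψ.xi 0 μ 0) *
          ∫⁻ u : unitInterval, F ((ρ, l, ENNReal.ofReal (μ * u)), nil))) := by
    have e : ∀ u : unitInterval, (keep t).indicator (fun x => F (pruneRoot t x))
        ((ρ, l, ENNReal.ofReal (lam * u)), nil) =
        {c | c ≤ t}.indicator (fun c => F ((ρ, l, c), nil)) (ENNReal.ofReal (lam * u)) := by
      intro u
      simp [indicator, keep, prune, pruneRoot, merge]
    simp_rw [e]
    rw [lintegral_unitInterval_le hμ h (H := fun c => F ((ρ, l, c), nil)) (hF.comp (by fun_prop)),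
      ← mul_assoc, ← mul_assoc, ← mul_assoc, ← ENNReal.ofReal_mul' (by positivity),
      ← ENNReal.ofReal_mul (by positivity), ← ENNReal.ofReal_mul (by positivity)]
    congr 2
    change (lam - 0) / (ψ.gap lam * ψ.rate lam) * (μ / lam) =
      ψ.gap μ / ψ.gap lam * (ψ.rate μ / ψ.rate lam) * ((μ - 0) / (ψ.gap μ * ψ.rate μ))
    field_simp
    ring
  classical
  -- An interior vertex has infinite colour, so it disappears as soon as no child survives; this is
  -- the value 0.
  set G : Forest (Mark T) → ℝ≥0∞ := fun f => if f = nil then 0 else F (merge ((ρ, l, ⊤), f)) with hG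
  have hGm : Measurable G := Measurable.ite measurableSet_nil measurable_const
    (hF.comp (measurable_merge.comp measurable_prodMk_left))
  have hinner : ∫⁻ f, (keep t).indicator (fun x => F (pruneRoot t x)) ((ρ, l, ⊤), f)
        ∂mix (ψ.branchWeights lam) M ≤
      ENNReal.ofReal (ψ.gap μ / ψ.gap lam) * (ENNReal.ofReal (ψ.rate μ / ψ.rate lam) *
        (∫⁻ f, F ((ρ, l, ⊤), f) ∂mix (ψ.branchWeights μ) Q) +
        ENNReal.ofReal (1 - ψ.rate μ / ψ.rate lam) *
          ∫⁻ l', edgeInt ψ μ ρ Q F (l + l') ∂expLaw (ψ.rate μ)) := by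
    have e : ∀ f, (keep t).indicator (fun x => F (pruneRoot t x)) ((ρ, l, ⊤), f) =
        G (prune t f) := by
      intro f
      simp [indicator, keep, pruneRoot, hG, ht]
    simp_rw [e]
    rw [← lintegral_map hGm (measurable_prune t), prune_eq_thin]
    refine (lintegral_mono' (mix_map_thin_le hk hp h1 h2 _) le_rfl).trans_eq ?_
    rw [lintegral_mix_split _ _ hGm]
    have hx : ∀ x, G (adjoin (x, nil)) = F ((ρ, l + x.1.2.1, x.1.2.2), x.2) := fun x => by
      simp [hG, adjoin, merge]
    have hx2 : ∀ k, ∫⁻ f, G f ∂iid Q (k + 2) = ∫⁻ f, F ((ρ, l, ⊤), f) ∂iid Q (k + 2) := fun k => by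
      refine lintegral_congr_ae ?_
      filter_upwards [ae_iid_rest_ne_nil Q k] with f hf
      rcases f with _ | ⟨a, c, _ | ⟨d, e, r⟩⟩
      · exact absurd rfl hf.1
      · exact absurd rfl hf.2
      · simp [hG, merge]
    simp_rw [hx, hx2]
    -- The single surviving child is resolved into its edge and its subtrees, so that its edge
    -- length is added to l.
    rw [lintegral_treeLaw hψ hm hμ ρ (F := fun x : Mark T × Forest (Mark T) =>
      F ((ρ, l + x.1.2.1, x.1.2.2), x.2)) (hF.comp (by fun_prop)), lintegral_mix]
    simp_rw [BranchingMechanism.thinWeights_branchWeights hψ hm hμ h]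
    rw [← Summable.sum_add_tsum_nat_add' (k := 2) (f := fun k => ψ.branchWeights μ k * _)
      ENNReal.summable]
    have hb0 : ψ.branchWeights μ 0 = 0 := by simp [BranchingMechanism.branchWeights]
    have hb1 : ψ.branchWeights μ 1 = 0 := by simp [BranchingMechanism.branchWeights]
    have hG0 : G nil = 0 := by simp [hG]
    rw [Finset.sum_range_succ, Finset.sum_range_one, hb0, hb1, hG0, zero_mul, zero_mul, mul_zero,
      zero_add, zero_add, zero_add, if_neg one_ne_zero, if_true,
      ENNReal.ofReal_mul (by positivity), mul_assoc, mul_add, add_comm]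
    congr 1
    simp only [show ∀ k : ℕ, ¬ k + 2 = 0 from fun k => by omega,
      show ∀ k : ℕ, ¬ k + 2 = 1 from fun k => by omega, if_false]
    rw [← ENNReal.tsum_mul_left, ← ENNReal.tsum_mul_left]
    refine tsum_congr fun k => ?_
    rw [ENNReal.ofReal_mul (by positivity)]
    ring
  refine (add_le_add hleaf.le hinner).trans_eq ?_
  simp only [edgeInt]
  ring

/-- A tree is dropped if it is a leaf of colour above μ or if all subtrees of its root are dropped.
The quantity 1 - b_μ / b_λ is a fixed point of the resulting recursion, so the bound reproduces
itself. -/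
theorem edge_prune_compl (hψ : ∃ c : ℝ, 0 < c ∧ 0 < ψ c)
    (hm : DifferentiableWithinAt ℝ ψ (Ici 0) 0) {μ lam : ℝ} (hμ : 0 < μ) (h : μ < lam) (ρ : T)
    {M : Measure (Mark T × Forest (Mark T))} [IsFiniteMeasure M]
    (h1 : (M.restrict (keep (ENNReal.ofReal μ))).map (pruneRoot (ENNReal.ofReal μ)) ≤
      ENNReal.ofReal (ψ.gap μ / ψ.gap lam) • treeLaw ψ μ ρ)
    (h2 : M (keep (ENNReal.ofReal μ))ᶜ ≤ ENNReal.ofReal (1 - ψ.gap μ / ψ.gap lam)) (l : ℝ≥0) :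
    edgeInt ψ lam ρ M ((keep (ENNReal.ofReal μ))ᶜ.indicator 1) l ≤
      ENNReal.ofReal (1 - ψ.gap μ / ψ.gap lam) := by
  have hlam := hμ.trans h
  have hq := BranchingMechanism.rate_pos hψ hm hlam
  have hb := BranchingMechanism.gap_pos hψ hm hlam
  have hQ := isProbabilityMeasure_treeLaw hψ hm hμ ρ
  have hk := measurableSet_keep (T := T) (ENNReal.ofReal μ)
  have hp := measurable_pruneRoot (T := T) (ENNReal.ofReal μ)
  set t := ENNReal.ofReal μ with ht
  set Q := treeLaw ψ μ ρ with hQdef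
  -- The weight of an interior vertex losing all its children; its sign is that of the remainder in
  -- `psi_taylor`.
  have hpos : 0 ≤ 1 - ψ.gap μ / ψ.gap lam - (lam - μ) / (ψ.rate lam * ψ.gap lam) := by
    have h1 := (ψ.psi_taylor (BranchingMechanism.inv_pos hψ hm hlam)
      (s := ψ.inv lam - ψ.inv μ) (by linarith [BranchingMechanism.inv_lt_inv hψ hm hμ.le h])
      (by linarith [BranchingMechanism.inv_pos hψ hm hμ])).1
    rw [sub_sub_cancel, (BranchingMechanism.inv_spec hψ hm hlam.le).2.1,
      (BranchingMechanism.inv_spec hψ hm hμ.le).2.1, ← BranchingMechanism.rate_eq hψ hm hlam] at h1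
    have e : 1 - ψ.gap μ / ψ.gap lam - (lam - μ) / (ψ.rate lam * ψ.gap lam) =
        (μ - lam + (ψ.gap lam - ψ.gap μ) * ψ.rate lam) / (ψ.rate lam * ψ.gap lam) := by
      field_simp
      ring
    rw [e]
    refine div_nonneg ?_ (by positivity)
    simpa [BranchingMechanism.gap] using h1
  have hleaf : ENNReal.ofReal (ψ.xi 0 lam 0) * (∫⁻ u : unitInterval,
      (keep t)ᶜ.indicator 1 (((ρ, l, ENNReal.ofReal (lam * u)), nil) : Mark T × Forest (Mark T))) =
      ENNReal.ofReal ((lam - μ) / (ψ.rate lam * ψ.gap lam)) := by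
    have e : ∀ u : unitInterval, (keep t)ᶜ.indicator (1 : Mark T × Forest (Mark T) → ℝ≥0∞)
        ((ρ, l, ENNReal.ofReal (lam * u)), nil) =
        {c | c ≤ t}ᶜ.indicator 1 (ENNReal.ofReal (lam * u)) := by
      intro u
      simp [indicator, keep, prune]
    simp_rw [e]
    rw [lintegral_unitInterval_gt hμ h, ← ENNReal.ofReal_mul' (by
      rw [sub_nonneg, div_le_one hlam]; exact h.le)]
    congr 1
    change (lam - 0) / (ψ.gap lam * ψ.rate lam) * (1 - μ / lam) = _
    field_simp
    ring
  have hGm : Measurable ({f : Forest (Mark T) | f = nil}.indicator (1 : Forest (Mark T) → ℝ≥0∞)) :=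
    measurable_one.indicator measurableSet_nil
  have hinner : ∫⁻ f, (keep t)ᶜ.indicator (1 : Mark T × Forest (Mark T) → ℝ≥0∞) ((ρ, l, ⊤), f)
        ∂mix (ψ.branchWeights lam) M ≤
      ENNReal.ofReal (1 - ψ.gap μ / ψ.gap lam - (lam - μ) / (ψ.rate lam * ψ.gap lam)) := by
    have e : ∀ f, (keep t)ᶜ.indicator (1 : Mark T × Forest (Mark T) → ℝ≥0∞) ((ρ, l, ⊤), f) =
        {f : Forest (Mark T) | f = nil}.indicator 1 (prune t f) := by
      intro f
      have hiff : (((ρ, l, ⊤), f) : Mark T × Forest (Mark T)) ∈ (keep t)ᶜ ↔ prune t f = nil := by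
        rw [mem_compl_iff]
        simp [keep, ht]
      by_cases hf : prune t f = nil
      · rw [indicator_of_mem (hiff.2 hf), indicator_of_mem (show _ ∈ {f | f = nil} from hf)]
        rfl
      · rw [indicator_of_notMem (mt hiff.1 hf), indicator_of_notMem (show _ ∉ {f | f = nil} from hf)]
    simp_rw [e]
    rw [← lintegral_map hGm (measurable_prune t), prune_eq_thin]
    refine (lintegral_mono' (mix_map_thin_le hk hp h1 h2 _) le_rfl).trans_eq ?_
    rw [lintegral_mix_split _ _ hGm]
    have hx : ∀ x : Mark T × Forest (Mark T),
        {f : Forest (Mark T) | f = nil}.indicator (1 : Forest (Mark T) → ℝ≥0∞) (adjoin (x, nil)) = 0 := fun x => by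
      simp [adjoin]
    have hx2 : ∀ k, ∫⁻ f, {f : Forest (Mark T) | f = nil}.indicator (1 : Forest (Mark T) → ℝ≥0∞) f
        ∂iid Q (k + 2) = 0 := fun k => by
      rw [← lintegral_zero]
      refine lintegral_congr_ae ?_
      filter_upwards [ae_iid_rest_ne_nil Q k] with f hf
      simp [hf.1]
    simp_rw [hx, hx2]
    rw [BranchingMechanism.thinWeights_branchWeights hψ hm hμ h]
    simp
  refine (add_le_add hleaf.le hinner).trans_eq ?_
  rw [← ENNReal.ofReal_add (div_nonneg (by linarith) (by positivity)) hpos]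
  congr 1
  ring

/-- Induction on the height, starting from the zero measure at height 0. The random choice between
keeping and merging recombines the edge lengths to the exponential law of level μ, by
`lintegral_expLaw_mixture`. -/
theorem treeLawOn_short_prune (hψ : ∃ c : ℝ, 0 < c ∧ 0 < ψ c)
    (hm : DifferentiableWithinAt ℝ ψ (Ici 0) 0) {μ lam : ℝ} (hμ : 0 < μ) (h : μ < lam) (ρ : T)
    (n : ℕ) :
    ((treeLawOn ψ lam ρ (Arr.short n)).restrict (keep (ENNReal.ofReal μ))).map
        (pruneRoot (ENNReal.ofReal μ)) ≤
      ENNReal.ofReal (ψ.gap μ / ψ.gap lam) • treeLaw ψ μ ρ ∧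
    treeLawOn ψ lam ρ (Arr.short n) (keep (ENNReal.ofReal μ))ᶜ ≤
      ENNReal.ofReal (1 - ψ.gap μ / ψ.gap lam) := by
  have hlam := hμ.trans h
  have hP := isProbabilityMeasure_arrLaw hψ hm hlam
  have hE := isProbabilityMeasure_expLaw (BranchingMechanism.rate_pos hψ hm hlam)
  have hk := measurableSet_keep (T := T) (ENNReal.ofReal μ)
  have hp := measurable_pruneRoot (T := T) (ENNReal.ofReal μ)
  have hQ := isProbabilityMeasure_treeLaw hψ hm hμ ρ
  induction n with
  | zero =>
    have h0 : treeLawOn ψ lam ρ (Arr.short 0) = 0 := by simp [Arr.short, treeLawOn]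
    rw [h0]
    simp only [Measure.restrict_zero, Measure.map_zero, Measure.coe_zero, Pi.zero_apply]
    exact ⟨Measure.zero_le _, zero_le⟩
  | succ n ih =>
    have hfin : IsFiniteMeasure (treeLawOn ψ lam ρ (Arr.short n)) := by
      unfold treeLawOn; infer_instance
    refine ⟨Measure.le_iff.2 fun s hs => ?_, ?_⟩
    · have hs' : Measurable (s.indicator (1 : Mark T × Forest (Mark T) → ℝ≥0∞)) :=
        measurable_one.indicator hs
      have e : ((treeLawOn ψ lam ρ (Arr.short (n + 1))).restrict (keep (ENNReal.ofReal μ))).map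
          (pruneRoot (ENNReal.ofReal μ)) s = ∫⁻ x, (keep (ENNReal.ofReal μ)).indicator
            (fun x => s.indicator 1 (pruneRoot (ENNReal.ofReal μ) x))
              x ∂treeLawOn ψ lam ρ (Arr.short (n + 1)) := by
        rw [← lintegral_indicator_one hs, lintegral_map hs' hp, lintegral_indicator hk]
      rw [e, lintegral_treeLawOn hψ hm hlam ρ (B' := Arr.short (n + 1))
        (Arr.measurableSet_short n) rfl
        (Arr.short_subset_finite (n + 1)) (F := (keep (ENNReal.ofReal μ)).indicator
          fun x => s.indicator 1 (pruneRoot (ENNReal.ofReal μ) x)) ((hs'.comp hp).indicator hk)]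
      refine (lintegral_mono fun l => lintegral_edge_prune hψ hm hμ h ρ ih.1 ih.2 hs' l).trans_eq ?_
      have hr := BranchingMechanism.rate_pos hψ hm hμ
      have hme := measurable_edgeInt ψ μ ρ (treeLaw ψ μ ρ) hs'
      have hme2 : Measurable fun l : ℝ≥0 => ∫⁻ l', edgeInt ψ μ ρ (treeLaw ψ μ ρ)
          (s.indicator 1) (l + l') ∂expLaw (ψ.rate μ) := by
        have := isProbabilityMeasure_expLaw hr
        exact Measurable.lintegral_prod_right' (ν := expLaw (ψ.rate μ)) (f := fun p : ℝ≥0 × ℝ≥0 =>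
          edgeInt ψ μ ρ (treeLaw ψ μ ρ) (s.indicator 1) (p.1 + p.2)) (hme.comp (by fun_prop))
      have hme3 : Measurable fun l : ℝ≥0 => ENNReal.ofReal (ψ.rate μ / ψ.rate lam) *
          edgeInt ψ μ ρ (treeLaw ψ μ ρ) (s.indicator 1) l +
            ENNReal.ofReal (1 - ψ.rate μ / ψ.rate lam) * ∫⁻ l', edgeInt ψ μ ρ (treeLaw ψ μ ρ)
              (s.indicator 1) (l + l') ∂expLaw (ψ.rate μ) :=
        (hme.const_mul _).add (hme2.const_mul _)
      rw [lintegral_const_mul _ hme3,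
        lintegral_add_left (hme.const_mul _), lintegral_const_mul _ hme,
        lintegral_const_mul _ hme2, lintegral_expLaw_mixture hr
          (rate_le hψ hm hμ h) hme, ← lintegral_treeLaw hψ hm hμ ρ hs',
        lintegral_indicator_one hs]
      rfl
    · rw [← lintegral_indicator_one hk.compl, lintegral_treeLawOn hψ hm hlam ρ
        (B' := Arr.short (n + 1)) (Arr.measurableSet_short n) rfl (Arr.short_subset_finite (n + 1))
        (measurable_one.indicator hk.compl)]
      refine (lintegral_mono fun l => edge_prune_compl hψ hm hμ h ρ ih.1 ih.2 l).trans_eq ?_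
      simp

/-- Almost every tree is finite, so its law is the increasing limit of the laws on trees of bounded
height, and the bounds pass to the limit. -/
theorem treeLaw_prune (hψ : ∃ c : ℝ, 0 < c ∧ 0 < ψ c)
    (hm : DifferentiableWithinAt ℝ ψ (Ici 0) 0) {μ lam : ℝ} (hμ : 0 < μ) (h : μ < lam) (ρ : T) :
    ((treeLaw ψ lam ρ).restrict (keep (ENNReal.ofReal μ))).map (pruneRoot (ENNReal.ofReal μ)) ≤
      ENNReal.ofReal (ψ.gap μ / ψ.gap lam) • treeLaw ψ μ ρ ∧
    treeLaw ψ lam ρ (keep (ENNReal.ofReal μ))ᶜ ≤ ENNReal.ofReal (1 - ψ.gap μ / ψ.gap lam) := by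
  have hlam := hμ.trans h
  have hk := measurableSet_keep (T := T) (ENNReal.ofReal μ)
  have hp := measurable_pruneRoot (T := T) (ENNReal.ofReal μ)
  have hsup : ∀ s, MeasurableSet s → treeLaw ψ lam ρ s =
      ⨆ n, treeLawOn ψ lam ρ (Arr.short n) s := by
    intro s hs
    have hs' := measurable_read ρ lam hs
    rw [← treeLawOn_finite hψ hm hlam, treeLawOn, Measure.map_apply (measurable_read ρ lam) hs,
      Measure.restrict_apply hs', Arr.finite, inter_iUnion, Monotone.measure_iUnion]
    · refine iSup_congr fun n => ?_
      rw [treeLawOn, Measure.map_apply (measurable_read ρ lam) hs, Measure.restrict_apply hs']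
    · exact fun m n hmn => inter_subset_inter_right _ (Arr.monotone_short hmn)
  constructor
  · refine Measure.le_iff.2 fun s hs => ?_
    rw [Measure.map_apply hp hs, Measure.restrict_apply (hp hs), hsup _ ((hp hs).inter hk)]
    refine iSup_le fun n => ?_
    rw [← Measure.restrict_apply (hp hs), ← Measure.map_apply hp hs]
    exact (treeLawOn_short_prune hψ hm hμ h ρ n).1 s
  · rw [hsup _ hk.compl]
    exact iSup_le fun n => (treeLawOn_short_prune hψ hm hμ h ρ n).2

end TreeLaw

end LevyForest

namespace LevyForest

/-! ### The law of the pruned forest of a site -/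

namespace Forest

variable {A : Type} [Nonempty A] [MeasurableSpace A]

theorem tsum_thinWeights (w : ℕ → ℝ≥0∞) {p p' : ℝ≥0∞} (h : p + p' = 1) :
    ∑' i, thinWeights w p p' i = ∑' k, w k := by
  calc _ = ∑' x : ℕ × ℕ, w (x.1 + x.2) * ((x.1 + x.2).choose x.1 * (p ^ x.1 * p' ^ x.2)) :=
        (ENNReal.tsum_prod (f := fun i j => w (i + j) * ((i + j).choose i * (p ^ i * p' ^ j)))).symm
    _ = _ := by
        rw [← Finset.HasAntidiagonal.sigmaAntidiagonalEquivProd.tsum_eq, ENNReal.tsum_sigma']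
        refine tsum_congr fun k => ?_
        rw [tsum_fintype]
        have : ∀ b : Finset.HasAntidiagonal.antidiagonal k,
            w ((b : ℕ × ℕ).1 + (b : ℕ × ℕ).2) * (((b : ℕ × ℕ).1 + (b : ℕ × ℕ).2).choose
              (b : ℕ × ℕ).1 * (p ^ (b : ℕ × ℕ).1 * p' ^ (b : ℕ × ℕ).2)) =
            w k * (k.choose (b : ℕ × ℕ).1 * (p ^ (b : ℕ × ℕ).1 * p' ^ (b : ℕ × ℕ).2)) := by
          rintro ⟨b, hb⟩
          rw [Finset.HasAntidiagonal.mem_antidiagonal] at hb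
          simp only [hb]
        refine (Finset.sum_congr rfl fun b _ => this b).trans ?_
        rw [Finset.sum_coe_sort (Finset.HasAntidiagonal.antidiagonal k) fun b : ℕ × ℕ =>
          w k * (k.choose b.1 * (p ^ b.1 * p' ^ b.2)), ← Finset.mul_sum]
        have h1 := (Commute.all p p').add_pow' k
        simp only [nsmul_eq_mul] at h1
        rw [← h1, h, one_pow, mul_one]

theorem isProbabilityMeasure_mix {w : ℕ → ℝ≥0∞} (hw : ∑' k, w k = 1)
    (Q : Measure (A × Forest A)) [IsProbabilityMeasure Q] : IsProbabilityMeasure (mix w Q) :=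
  ⟨by simp [mix_univ, hw]⟩

/-- When p + p' = 1 both sides are probability measures, so the inequality of `mix_map_thin_le` is
an equality. -/
theorem mix_map_thin_eq {Q Q' : Measure (A × Forest A)} [IsProbabilityMeasure Q]
    [IsProbabilityMeasure Q'] {K : Set (A × Forest A)} {g : A × Forest A → A × Forest A}
    (hK : MeasurableSet K) (hg : Measurable g) {p p' : ℝ≥0∞}
    (h1 : (Q.restrict K).map g ≤ p • Q') (h2 : Q Kᶜ ≤ p') (h : p + p' = 1) {w : ℕ → ℝ≥0∞}
    (hw : ∑' k, w k = 1) : (mix w Q).map (thin K g) = mix (thinWeights w p p') Q' := by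
  have := isProbabilityMeasure_mix hw Q
  have := isProbabilityMeasure_mix ((tsum_thinWeights w h).trans hw) Q'
  have := Measure.isProbabilityMeasure_map (μ := mix w Q) (measurable_thin hK hg).aemeasurable
  exact Measure.eq_of_le_of_isProbabilityMeasure (mix_map_thin_le hK hg h1 h2 w)

theorem map_ofSeq_prod {X : Type*} [MeasurableSpace X] (N : Measure ℕ) [IsProbabilityMeasure N]
    (R : Measure X) [IsProbabilityMeasure R] {g : X → A × Forest A} (hg : Measurable g) :
    (N.prod (Measure.infinitePi fun _ : ℕ => R)).map (fun x => ofSeq x.1 fun n => g (x.2 n)) =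
      mix (fun k => N {k}) (R.map g) := by
  have hm : ∀ k, Measurable fun x : ℕ → X => ofSeq k fun n => g (x n) := fun k =>
    (measurable_ofSeq k).comp (measurable_pi_lambda _ fun n => hg.comp (measurable_pi_apply n))
  have hm' : Measurable fun x : ℕ × (ℕ → X) => ofSeq x.1 fun n => g (x.2 n) :=
    measurable_from_prod_countable_right hm
  refine Measure.ext_of_lintegral _ fun F hF => ?_
  have hFm : Measurable fun x : ℕ × (ℕ → X) => F (ofSeq x.1 fun n => g (x.2 n)) := hF.comp hm'
  rw [lintegral_map hF hm', lintegral_prod _ hFm.aemeasurable, lintegral_mix,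
    lintegral_countable']
  refine tsum_congr fun k => ?_
  have := map_ofSeq_infinitePi R hg .univ k
  simp only [mem_univ, implies_true, Set.ofPred_true, Measure.restrict_univ] at this
  rw [← this, lintegral_map hF (hm k), mul_comm]

theorem mix_apply_of_nil_notMem {w : ℕ → ℝ≥0∞} {Q : Measure (A × Forest A)} {s : Set (Forest A)}
    (hs : MeasurableSet s) (h : nil ∉ s) : mix w Q s = ∑' k, w (k + 1) * iid Q (k + 1) s := by
  rw [mix, Measure.sum_apply _ hs, tsum_eq_zero_add' ENNReal.summable]
  simp [iid, h, Measure.dirac_apply' _ hs]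

theorem mix_nil (w : ℕ → ℝ≥0∞) (Q : Measure (A × Forest A)) [IsFiniteMeasure Q] :
    mix w Q {f | f = nil} = w 0 := by
  rw [mix, Measure.sum_apply _ measurableSet_nil, tsum_eq_zero_add' ENNReal.summable]
  have : ∀ k, iid Q (k + 1) {f | f = nil} = 0 := fun k => by
    have := ae_iid_ne_nil Q k
    rw [ae_iff] at this
    simpa using this
  simp only [Measure.smul_apply, this, smul_eq_mul, mul_zero, tsum_zero, add_zero]
  simp [iid]

theorem tsum_singleton_eq_one (N : Measure ℕ) [IsProbabilityMeasure N] : ∑' k, N {k} = 1 := by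
  have := lintegral_countable' (μ := N) fun _ => 1
  simpa using this.symm

end Forest

section SiteLaws

open Forest BranchingMechanism

variable {T : Type} [Nonempty T] [MeasurableSpace T] {ψ : BranchingMechanism}
  {μ lam : ℝ}

theorem gap_ratio_add (hψ : ∃ c : ℝ, 0 < c ∧ 0 < ψ c)
    (hm : DifferentiableWithinAt ℝ ψ (Ici 0) 0) (hμ : 0 < μ) (h : μ < lam) :
    ENNReal.ofReal (ψ.gap μ / ψ.gap lam) + ENNReal.ofReal (1 - ψ.gap μ / ψ.gap lam) = 1 := by
  have hb := gap_pos hψ hm (hμ.trans h)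
  have hbμ := gap_pos hψ hm hμ
  rw [← ENNReal.ofReal_add (by positivity)
    (by rw [sub_nonneg, div_le_one hb]; exact (gap_lt_gap hψ hm hμ.le h).le)]
  simp

theorem mix_prune (hψ : ∃ c : ℝ, 0 < c ∧ 0 < ψ c)
    (hm : DifferentiableWithinAt ℝ ψ (Ici 0) 0) (hμ : 0 < μ) (h : μ < lam) (ρ : T) {w : ℕ → ℝ≥0∞}
    (hw : ∑' k, w k = 1) :
    (mix w (treeLaw ψ lam ρ)).map (prune (ENNReal.ofReal μ)) =
      mix (thinWeights w (ENNReal.ofReal (ψ.gap μ / ψ.gap lam))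
        (ENNReal.ofReal (1 - ψ.gap μ / ψ.gap lam))) (treeLaw ψ μ ρ) := by
  have := isProbabilityMeasure_treeLaw hψ hm hμ ρ
  have := isProbabilityMeasure_treeLaw hψ hm (hμ.trans h) ρ
  rw [prune_eq_thin]
  exact mix_map_thin_eq (measurableSet_keep _) (measurable_pruneRoot _)
    (treeLaw_prune hψ hm hμ h ρ).1 (treeLaw_prune hψ hm hμ h ρ).2 (gap_ratio_add hψ hm hμ h) hw

theorem mix_prune_poisson (hψ : ∃ c : ℝ, 0 < c ∧ 0 < ψ c)
    (hm : DifferentiableWithinAt ℝ ψ (Ici 0) 0) (hμ : 0 < μ) (h : μ < lam) (ρ : T) (a : ℝ≥0) :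
    (mix (fun k => poissonMeasure (a * (ψ.inv lam - ψ.inv 0).toNNReal) {k})
        (treeLaw ψ lam ρ)).map (prune (ENNReal.ofReal μ)) =
      mix (fun k => poissonMeasure (a * (ψ.inv μ - ψ.inv 0).toNNReal) {k}) (treeLaw ψ μ ρ) := by
  have hb := gap_pos hψ hm (hμ.trans h)
  have hbμ := gap_pos hψ hm hμ
  have hle : ψ.gap μ / ψ.gap lam ≤ 1 := by
    rw [div_le_one hb]; exact (gap_lt_gap hψ hm hμ.le h).le
  rw [mix_prune hψ hm hμ h ρ (tsum_singleton_eq_one _)]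
  congr 1
  funext k
  rw [thinWeights_poisson _ (by positivity) (by linarith) (by ring)]
  congr 2
  change _ * (a * (ψ.gap lam).toNNReal) = a * (ψ.gap μ).toNNReal
  rw [mul_left_comm, ← Real.toNNReal_mul (by positivity), div_mul_cancel₀ _ hb.ne']

theorem mix_prune_branch (hψ : ∃ c : ℝ, 0 < c ∧ 0 < ψ c)
    (hm : DifferentiableWithinAt ℝ ψ (Ici 0) 0) (hμ : 0 < μ) (h : μ < lam) (ρ : T)
    {d : ℝ} {l : ℕ} (hl : 2 ≤ l) (hd : d ≠ 0) (hlim : Tendsto (ψ.der l) (𝓝[>] (ψ.inv 0)) (𝓝 d)) :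
    (mix (fun k => ENNReal.ofReal (ψ.nu 0 lam l k)) (treeLaw ψ lam ρ)).map
        (prune (ENNReal.ofReal μ)) =
      mix (fun k => ENNReal.ofReal (ψ.nu 0 μ l k)) (treeLaw ψ μ ρ) := by
  rw [mix_prune hψ hm hμ h ρ (tsum_nu hψ hm (hμ.trans h) hl hd hlim).1]
  congr 1
  funext k
  exact thinWeights_nu hψ hm hμ h hl hd hlim k

/-- The law of a site with position law `ν` and its grafted trees. -/
noncomputable def itemLaw (ν : Measure T) (I : Measure (Forest (Mark T))) :
    Measure (Mark T × Forest (Mark T)) :=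
  (ν.prod I).map fun x => ((x.1, 0, ⊤), x.2)

theorem measurable_item :
    Measurable fun x : T × Forest (Mark T) => (((x.1, 0, ⊤), x.2) : Mark T × Forest (Mark T)) := by
  fun_prop

/-- The sites whose trees have a leaf of colour at most `t`. -/
def keepSite (t : ℝ≥0∞) : Set (Mark T × Forest (Mark T)) := {x | prune t x.2 ≠ nil}

/-- The pruning of the trees of a site. -/
noncomputable def pruneSite (t : ℝ≥0∞) (x : Mark T × Forest (Mark T)) :
    Mark T × Forest (Mark T) := (x.1, prune t x.2)

theorem measurableSet_keepSite (t : ℝ≥0∞) :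
    MeasurableSet (keepSite t : Set (Mark T × Forest (Mark T))) :=
  (((measurable_prune t).comp measurable_snd) measurableSet_nil).compl

theorem measurable_pruneSite (t : ℝ≥0∞) :
    Measurable (pruneSite t : Mark T × Forest (Mark T) → _) :=
  measurable_fst.prodMk ((measurable_prune t).comp measurable_snd)

/-- A Poisson point is kept if at least one of its trees survives, which has probability the ratio
of the densities; given this, the number of survivors has law ν₁ of level μ. The position is
independent of the trees and is not affected. -/
theorem mix_prune_sites (hψ : ∃ c : ℝ, 0 < c ∧ 0 < ψ c)
    (hm : DifferentiableWithinAt ℝ ψ (Ici 0) 0) (hμ : 0 < μ) (h : μ < lam) (ρ : T)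
    (hd : 0 < ψ.density lam) (ν : Measure T) [IsProbabilityMeasure ν] {w : ℕ → ℝ≥0∞}
    (hw : ∑' k, w k = 1) :
    (mix w (itemLaw ν (mix (fun k => ENNReal.ofReal (ψ.nu 0 lam 1 k)) (treeLaw ψ lam ρ)))).map
        (thin (keepSite (ENNReal.ofReal μ)) (pruneSite (ENNReal.ofReal μ))) =
      mix (thinWeights w (ENNReal.ofReal (ψ.density μ / ψ.density lam))
        (ENNReal.ofReal (1 - ψ.density μ / ψ.density lam)))
        (itemLaw ν (mix (fun k => ENNReal.ofReal (ψ.nu 0 μ 1 k)) (treeLaw ψ μ ρ))) := by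
  have hlam := hμ.trans h
  have hdμ := density_pos hψ hm hμ h hd
  have hQμ := isProbabilityMeasure_treeLaw hψ hm hμ ρ
  have hQ := isProbabilityMeasure_treeLaw hψ hm hlam ρ
  have s1 := tsum_nu_one hψ hm hlam hd
  have s2 := tsum_nu_one hψ hm hμ hdμ
  have hI := isProbabilityMeasure_mix s1 (treeLaw ψ lam ρ)
  have hIμ := isProbabilityMeasure_mix s2 (treeLaw ψ μ ρ)
  set t := ENNReal.ofReal μ with ht
  set p := ENNReal.ofReal (ψ.density μ / ψ.density lam) with hp
  set w₁ := fun k => ENNReal.ofReal (ψ.nu 0 lam 1 k) with hw₁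
  set w₂ := fun k => ENNReal.ofReal (ψ.nu 0 μ 1 k) with hw₂
  set I := mix w₁ (treeLaw ψ lam ρ) with hIdef
  set Iμ := mix w₂ (treeLaw ψ μ ρ) with hIμdef
  have hw20 : w₂ 0 = 0 := by simp [hw₂, nu]
  have hprune := mix_prune hψ hm hμ h ρ s1
  set W := thinWeights w₁ (ENNReal.ofReal (ψ.gap μ / ψ.gap lam))
    (ENNReal.ofReal (1 - ψ.gap μ / ψ.gap lam)) with hW
  have hWk : ∀ k, W (k + 1) = p * w₂ (k + 1) := fun k =>
    thinWeights_nu_one hψ hm hμ h hd k.succ_ne_zero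
  have hpp : p + ENNReal.ofReal (1 - ψ.density μ / ψ.density lam) = 1 := by
    rw [hp, ← ENNReal.ofReal_add (by positivity) (by
      rw [sub_nonneg, div_le_one hd]; exact density_le hψ hm hμ.le h)]
    simp
  -- The probability of losing all trees is not computed directly; it follows from the total mass,
  -- because ν₁ does not charge 0.
  have hW0 : W 0 + p = 1 := by
    have h1 := (tsum_thinWeights w₁ (gap_ratio_add hψ hm hμ h)).trans s1
    rw [← hW, tsum_eq_zero_add' ENNReal.summable] at h1
    simp_rw [hWk] at h1
    rw [ENNReal.tsum_mul_left] at h1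
    have h2 : ∑' k, w₂ k = 1 := s2
    rw [tsum_eq_zero_add' ENNReal.summable, hw20, zero_add] at h2
    rwa [h2, mul_one] at h1
  have hle : (I.map (prune t)).restrict {f | f = nil}ᶜ ≤ p • Iμ := by
    rw [hprune]
    refine Measure.le_iff.2 fun s hs => ?_
    rw [Measure.restrict_apply hs, mix_apply_of_nil_notMem (hs.inter measurableSet_nil.compl)
      (by simp)]
    simp_rw [hWk, mul_assoc]
    rw [ENNReal.tsum_mul_left, Measure.smul_apply, smul_eq_mul,
      ← mix_apply_of_nil_notMem (hs.inter measurableSet_nil.compl) (by simp)]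
    exact mul_le_mul_right (measure_mono inter_subset_left) _
  have hpm := measurable_prune (T := T) t
  have : IsProbabilityMeasure (itemLaw ν I) :=
    Measure.isProbabilityMeasure_map measurable_item.aemeasurable
  have : IsProbabilityMeasure (itemLaw ν Iμ) :=
    Measure.isProbabilityMeasure_map measurable_item.aemeasurable
  refine mix_map_thin_eq (measurableSet_keepSite t) (measurable_pruneSite t) ?_ ?_ hpp hw
  · have e1 : (fun x : T × Forest (Mark T) =>
        (((x.1, 0, ⊤), x.2) : Mark T × Forest (Mark T))) ⁻¹' (keepSite t) =
        univ ×ˢ (prune t ⁻¹' {f | f = nil}ᶜ) := by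
      ext x
      simp [keepSite]
    rw [itemLaw, Measure.restrict_map measurable_item (measurableSet_keepSite t), e1,
      ← Measure.prod_restrict, Measure.restrict_univ,
      Measure.map_map (measurable_pruneSite t) measurable_item]
    have e2 : pruneSite t ∘ (fun x : T × Forest (Mark T) =>
        (((x.1, 0, ⊤), x.2) : Mark T × Forest (Mark T))) =
        (fun x : T × Forest (Mark T) => (((x.1, 0, ⊤), x.2) : Mark T × Forest (Mark T))) ∘
          Prod.map id (prune t) := rfl
    rw [e2, ← Measure.map_map measurable_item (by fun_prop),
      ← Measure.map_prod_map _ _ measurable_id hpm, Measure.map_id,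
      ← Measure.restrict_map hpm measurableSet_nil.compl]
    refine (Measure.map_mono (Measure.prod_mono le_rfl hle) measurable_item).trans_eq ?_
    rw [Measure.prod_smul_right, Measure.map_smul, itemLaw]
  · rw [itemLaw, Measure.map_apply measurable_item (measurableSet_keepSite t).compl]
    have e1 : (fun x : T × Forest (Mark T) =>
        (((x.1, 0, ⊤), x.2) : Mark T × Forest (Mark T))) ⁻¹' (keepSite t)ᶜ =
        univ ×ˢ (prune t ⁻¹' {f | f = nil}) := by
      ext x
      simp [keepSite]
    rw [e1, Measure.prod_prod, measure_univ, one_mul, ← Measure.map_apply hpm measurableSet_nil,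
      hprune, mix_nil]
    have hpt : p ≠ ⊤ := ENNReal.ofReal_ne_top
    refine le_of_eq ?_
    rw [← ENNReal.add_left_inj hpt, hW0, add_comm, hpp]

end SiteLaws

end LevyForest

namespace LevyForest

/-! ### The grafted forests of the components -/

section Blocks

theorem infinitePi_prod_map_zip {ι A B : Type*} [MeasurableSpace A] [MeasurableSpace B]
    (α : ι → Measure A) (β : ι → Measure B) [∀ i, IsProbabilityMeasure (α i)]
    [∀ i, IsProbabilityMeasure (β i)] :
    ((Measure.infinitePi α).prod (Measure.infinitePi β)).map (fun p i => (p.1 i, p.2 i)) =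
      Measure.infinitePi fun i => (α i).prod (β i) := by
  have h := iIndepFun_prodMk (X := fun i (ω : ι → A) => ω i) (Y := fun i (ω : ι → B) => ω i)
    (fun i => measurable_pi_apply i) (fun i => measurable_pi_apply i)
    (iIndepFun_infinitePi (P := α) (X := fun _ ω => ω) fun _ => measurable_id)
    (iIndepFun_infinitePi (P := β) (X := fun _ ω => ω) fun _ => measurable_id)
  rw [iIndepFun_iff_map_fun_eq_infinitePi_map (by fun_prop)] at h
  rw [h]
  congr 1
  funext i
  have := Measure.map_prod_map (Measure.infinitePi α) (Measure.infinitePi β)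
    (measurable_pi_apply i) (measurable_pi_apply i)
  rw [Measure.infinitePi_map_eval, Measure.infinitePi_map_eval] at this
  exact this.symm

theorem infinitePi_map_block {S X : Type*} [MeasurableSpace X] (V : Measure X)
    [IsProbabilityMeasure V] (s : S) :
    (Measure.infinitePi fun _ : S × ℕ × List ℕ => V).map (fun ω (j : ℕ) (u : List ℕ) => ω (s, j, u))
      = Measure.infinitePi fun _ : ℕ => Measure.infinitePi fun _ : List ℕ => V := by
  rw [← Measure.infinitePi_map_curry (fun (_ : ℕ) (_ : List ℕ) => V),
    ← Measure.map_infinitePi_infinitePi_of_inj (P := fun _ : S × ℕ × List ℕ => V)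
      (f := fun q : ℕ × List ℕ => (s, q)) (fun q q' h => by simpa using h),
    Measure.map_map (by fun_prop) (by fun_prop)]
  rfl

theorem infinitePi_map_blocks {S X : Type*} [MeasurableSpace X] (V : Measure X)
    [IsProbabilityMeasure V] {s : ℕ → S} (hs : Function.Injective s) :
    (Measure.infinitePi fun _ : S × ℕ × List ℕ => V).map
      (fun ω (i : ℕ) (j : ℕ) (u : List ℕ) => ω (s i, j, u)) =
      Measure.infinitePi fun _ : ℕ => Measure.infinitePi fun _ : ℕ =>
        Measure.infinitePi fun _ : List ℕ => V := by
  have h1 := Measure.map_infinitePi_infinitePi_of_inj (P := fun _ : S × ℕ × List ℕ => V)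
    (f := fun q : ℕ × ℕ × List ℕ => (s q.1, q.2)) (fun q q' h => by
      simpa [Prod.ext_iff, hs.eq_iff] using h)
  have h2 := Measure.infinitePi_map_curry (fun (_ : ℕ) (_ : ℕ × List ℕ) => V)
  have h3 := Measure.infinitePi_map_pi (fun _ : ℕ => Measure.infinitePi fun _ : ℕ × List ℕ => V)
    (f := fun _ => MeasurableEquiv.curry ℕ (List ℕ) X) (fun _ => MeasurableEquiv.measurable _)
  rw [Measure.infinitePi_map_curry (fun (_ : ℕ) (_ : List ℕ) => V)] at h3
  have hc : Measurable fun (x : ℕ → ℕ × List ℕ → X) i => MeasurableEquiv.curry ℕ (List ℕ) X (x i) :=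
    measurable_pi_lambda _ fun i => (MeasurableEquiv.measurable _).comp (measurable_pi_apply i)
  rw [← h3, ← h2, ← h1, Measure.map_map hc (by fun_prop),
    Measure.map_map (hc.comp (MeasurableEquiv.measurable _)) (by fun_prop)]
  rfl

end Blocks

section Skeleton

open Forest BranchingMechanism

variable {T : Type} [MetricSpace T] [MeasurableSpace T] [BorelSpace T] {ρ : T}
  {ψ : BranchingMechanism} {a : ℝ≥0} {μ lam : ℝ}

theorem annulus_subset (ρ : T) (n : ℕ) : annulus ρ n ⊆ Metric.closedBall ρ (n + 1) := fun x hx => by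
  rw [Metric.mem_closedBall, dist_comm]; exact hx.2.le

theorem isProbabilityMeasure_pointLaw (hT : IsDiscreteTree T ρ) (n : ℕ) :
    IsProbabilityMeasure (pointLaw ψ μ lam ρ n) := by
  unfold pointLaw
  split_ifs with h
  · infer_instance
  · refine cond_isProbabilityMeasure_of_finite h (ne_top_of_le_ne_top ?_
      (measure_mono (annulus_subset ρ n)))
    exact ENNReal.mul_ne_top ENNReal.ofReal_ne_top (hT.lengthMeasure_closedBall_lt_top _).ne

instance (σ : Site ρ) : IsProbabilityMeasure (siteLaw ψ a μ lam ρ σ) := by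
  cases σ <;> (unfold siteLaw; infer_instance)

theorem isProbabilityMeasure_graftLaw (hψ : ∃ c : ℝ, 0 < c ∧ 0 < ψ c)
    (hm : DifferentiableWithinAt ℝ ψ (Ici 0) 0) (hlam : 0 < lam) (hT : IsDiscreteTree T ρ) :
    IsProbabilityMeasure (graftLaw ψ a 0 lam ρ) := by
  have := isProbabilityMeasure_vertexLaw hψ hm hlam
  have := isProbabilityMeasure_pointLaw (ψ := ψ) (μ := 0) (lam := lam) hT
  unfold graftLaw
  infer_instance

variable [Nonempty T]

/-- The components over which independent forests are grafted: the annuli, the root and the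
branching points. -/
abbrev Comp (ρ : T) : Type := ℕ ⊕ Option (branchPoints ρ)

/-- The component of a site. -/
def Site.comp : Site ρ → Comp ρ
  | .poisson n _ => .inl n
  | .branch σ => .inr (some σ)
  | .root => .inr none

/-- The trees grafted on a site. -/
noncomputable def siteForest (lam : ℝ) (D : GraftData ρ) (s : Site ρ) : Forest (Mark T) :=
  ofSeq (D.2.2.1 s) fun j => read ρ lam fun u => D.2.2.2 (s, j, u)

/-- The trees grafted on a tree, component by component. -/
noncomputable def skeleton (lam : ℝ) (D : GraftData ρ) : Comp ρ → Forest (Mark T)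
  | .inl n => ofSeq (D.1 n) fun i => ((D.2.1 (n, i), 0, ⊤), siteForest lam D (.poisson n i))
  | .inr (some σ) => siteForest lam D (.branch σ)
  | .inr none => siteForest lam D .root

theorem measurable_ofSeq_comp {X A : Type} [Nonempty A] [MeasurableSpace A] [MeasurableSpace X]
    {N : X → ℕ} (hN : Measurable N) {f : X → ℕ → A × Forest A} (hf : ∀ j, Measurable fun x => f x j) :
    Measurable fun x => ofSeq (N x) (f x) :=
  measurable_ofSeq_uncurry.comp (hN.prodMk (measurable_pi_lambda _ hf))

/-- The part of the data that belongs to a component. -/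
abbrev LocalData (ρ : T) (c : Comp ρ) : Type :=
  ({n : ℕ // (Sum.inl n : Comp ρ) = c} → ℕ) × ({p : ℕ × ℕ // (Sum.inl p.1 : Comp ρ) = c} → T) ×
    ({s : Site ρ // s.comp = c} → ℕ) ×
      ({q : Site ρ × ℕ × List ℕ // q.1.comp = c} → ℕ × ℝ≥0 × unitInterval)

/-- The forest of a component, from its data. -/
noncomputable def localForest (lam : ℝ) : ∀ c : Comp ρ, LocalData ρ c → Forest (Mark T)
  | .inl n, x => ofSeq (x.1 ⟨n, rfl⟩) fun i => ((x.2.1 ⟨(n, i), rfl⟩, 0, ⊤),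
      ofSeq (x.2.2.1 ⟨.poisson n i, rfl⟩) fun j => read ρ lam fun u =>
        x.2.2.2 ⟨(.poisson n i, j, u), rfl⟩)
  | .inr (some σ), x => ofSeq (x.2.2.1 ⟨.branch σ, rfl⟩) fun j => read ρ lam fun u =>
        x.2.2.2 ⟨(.branch σ, j, u), rfl⟩
  | .inr none, x => ofSeq (x.2.2.1 ⟨.root, rfl⟩) fun j => read ρ lam fun u =>
        x.2.2.2 ⟨(.root, j, u), rfl⟩

theorem measurable_localForest (lam : ℝ) (c : Comp ρ) :
    Measurable (localForest (ρ := ρ) lam c) := by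
  have hr := measurable_read ρ lam
  rcases c with n | _ | σ
  · refine measurable_ofSeq_comp (by fun_prop) fun i => Measurable.prodMk (by fun_prop)
      (measurable_ofSeq_comp (by fun_prop) fun j => hr.comp (by fun_prop))
  · exact measurable_ofSeq_comp (by fun_prop) fun j => hr.comp (by fun_prop)
  · exact measurable_ofSeq_comp (by fun_prop) fun j => hr.comp (by fun_prop)

/-- The restriction of the data to a component. -/
def toLocal (c : Comp ρ) (D : GraftData ρ) : LocalData ρ c :=
  (fun j => D.1 j, fun j => D.2.1 j, fun j => D.2.2.1 j, fun j => D.2.2.2 j)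

theorem measurable_toLocal (c : Comp ρ) : Measurable (toLocal c) := by
  unfold toLocal; fun_prop

theorem skeleton_eq (lam : ℝ) (D : GraftData ρ) (c : Comp ρ) :
    skeleton lam D c = localForest lam c (toLocal c D) := by
  rcases c with n | _ | σ <;> rfl

theorem measurable_skeleton (lam : ℝ) : Measurable (skeleton lam : GraftData ρ → _) := by
  refine measurable_pi_lambda _ fun c => ?_
  simp_rw [skeleton_eq]
  exact (measurable_localForest lam c).comp (measurable_toLocal c)

/-- Different components read disjoint sets of coordinates of the data, and all coordinates are
independent. -/
theorem map_skeleton (hψ : ∃ c : ℝ, 0 < c ∧ 0 < ψ c)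
    (hm : DifferentiableWithinAt ℝ ψ (Ici 0) 0) (hlam : 0 < lam) (hT : IsDiscreteTree T ρ) :
    (graftLaw ψ a 0 lam ρ).map (skeleton lam) =
      Measure.infinitePi fun c => (graftLaw ψ a 0 lam ρ).map fun D => skeleton lam D c := by
  have hV := isProbabilityMeasure_vertexLaw hψ hm hlam
  have hpt := isProbabilityMeasure_pointLaw (ψ := ψ) (μ := 0) (lam := lam) hT
  have hG := isProbabilityMeasure_graftLaw (a := a) hψ hm hlam hT
  have hms : ∀ c, Measurable fun D : GraftData ρ => skeleton lam D c := fun c =>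
    (measurable_pi_apply c).comp (measurable_skeleton lam)
  have hind : iIndepFun (fun c => toLocal c) (graftLaw ψ a 0 lam ρ) :=
    iIndepFun_prodMk (fun c => by fun_prop) (fun c => by fun_prop) (iIndepFun_fiber _ _)
      (iIndepFun_prodMk (fun c => by fun_prop) (fun c => by fun_prop) (iIndepFun_fiber _ _)
        (iIndepFun_prodMk (fun c => by fun_prop) (fun c => by fun_prop) (iIndepFun_fiber _ _)
          (iIndepFun_fiber _ _)))
  have h := hind.comp (fun c => localForest lam c) (measurable_localForest lam)
  have e : (fun c => localForest lam c ∘ toLocal c) = fun c (D : GraftData ρ) => skeleton lam D c := by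
    funext c D
    exact (skeleton_eq lam D c).symm
  rw [e, iIndepFun_iff_map_fun_eq_infinitePi_map hms] at h
  exact h

theorem map_siteForest (hψ : ∃ c : ℝ, 0 < c ∧ 0 < ψ c)
    (hm : DifferentiableWithinAt ℝ ψ (Ici 0) 0) (hlam : 0 < lam) (hT : IsDiscreteTree T ρ)
    (s : Site ρ) : (graftLaw ψ a 0 lam ρ).map (fun D => siteForest lam D s) =
      mix (fun k => siteLaw ψ a 0 lam ρ s {k}) (treeLaw ψ lam ρ) := by
  have hV := isProbabilityMeasure_vertexLaw hψ hm hlam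
  have hA := isProbabilityMeasure_arrLaw hψ hm hlam
  have hpt := isProbabilityMeasure_pointLaw (ψ := ψ) (μ := 0) (lam := lam) hT
  have h1 : (graftLaw ψ a 0 lam ρ).map (fun D => D.2.2) =
      (Measure.infinitePi (siteLaw ψ a 0 lam ρ)).prod
        (Measure.infinitePi fun _ : Site ρ × ℕ × List ℕ => vertexLaw ψ 0 lam) := by
    change Measure.map (Prod.snd ∘ Prod.snd) _ = _
    rw [← Measure.map_map measurable_snd measurable_snd, graftLaw, Measure.map_snd_prod,
      measure_univ, one_smul, Measure.map_snd_prod, measure_univ, one_smul]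
  have h2 : (graftLaw ψ a 0 lam ρ).map (fun D => (D.2.2.1 s, fun (j : ℕ) (u : List ℕ) =>
      D.2.2.2 (s, j, u))) = (siteLaw ψ a 0 lam ρ s).prod
        (Measure.infinitePi fun _ : ℕ => arrLaw ψ lam) := by
    rw [← Measure.infinitePi_map_eval (siteLaw ψ a 0 lam ρ) s, arrLaw,
      ← infinitePi_map_block (vertexLaw ψ 0 lam) s,
      Measure.map_prod_map _ _ (by fun_prop) (by fun_prop), ← h1,
      Measure.map_map (by fun_prop) (by fun_prop)]
    rfl
  have hseq : Measurable fun x : ℕ × (ℕ → Arr) => ofSeq x.1 fun j => read ρ lam (x.2 j) :=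
    measurable_ofSeq_comp (by fun_prop) fun j => (measurable_read ρ lam).comp (by fun_prop)
  rw [treeLaw, ← map_ofSeq_prod _ _ (measurable_read ρ lam), ← h2,
    Measure.map_map hseq (by fun_prop)]
  rfl

/-- The coordinates belonging to one annulus are zipped into an i.i.d. sequence of triples of a
position, a number of trees and their arrays; `map_ofSeq_prod` then reads them as a Poisson number
of independent items. -/
theorem map_skeleton_annulus (hψ : ∃ c : ℝ, 0 < c ∧ 0 < ψ c)
    (hm : DifferentiableWithinAt ℝ ψ (Ici 0) 0) (hlam : 0 < lam) (hT : IsDiscreteTree T ρ) (n : ℕ) :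
    (graftLaw ψ a 0 lam ρ).map (fun D => skeleton lam D (.inl n)) =
      mix (fun k => poissonMeasure (intensity ψ 0 lam ρ (annulus ρ n)).toNNReal {k})
        (itemLaw (pointLaw ψ 0 lam ρ n)
          (mix (fun k => lawOfWeights (ψ.nu 0 lam 1) {k}) (treeLaw ψ lam ρ))) := by
  have hV := isProbabilityMeasure_vertexLaw hψ hm hlam
  have hA := isProbabilityMeasure_arrLaw hψ hm hlam
  have hpt := isProbabilityMeasure_pointLaw (ψ := ψ) (μ := 0) (lam := lam) hT
  have hr := measurable_read ρ lam
  have hinj : Function.Injective fun i : ℕ => (Site.poisson n i : Site ρ) := fun i j h => by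
    simpa using h
  have h4 := infinitePi_map_blocks (vertexLaw ψ 0 lam) hinj
  have h3 : (Measure.infinitePi (siteLaw ψ a 0 lam ρ)).map (fun ω (i : ℕ) => ω (.poisson n i)) =
      Measure.infinitePi fun _ : ℕ => lawOfWeights (ψ.nu 0 lam 1) :=
    Measure.map_infinitePi_infinitePi_of_inj hinj
  have h2 : (Measure.infinitePi fun p : ℕ × ℕ => pointLaw ψ 0 lam ρ p.1).map
      (fun ω (i : ℕ) => ω (n, i)) = Measure.infinitePi fun _ : ℕ => pointLaw ψ 0 lam ρ n :=
    Measure.map_infinitePi_infinitePi_of_inj (P := fun p : ℕ × ℕ => pointLaw ψ 0 lam ρ p.1)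
      (f := fun i : ℕ => (n, i)) (fun i j h => by simpa using h)
  have h1 := Measure.infinitePi_map_eval
    (fun n : ℕ => poissonMeasure (intensity ψ 0 lam ρ (annulus ρ n)).toNNReal) n
  have z1 := infinitePi_prod_map_zip (fun _ : ℕ => lawOfWeights (ψ.nu 0 lam 1))
    (fun _ : ℕ => Measure.infinitePi fun _ : ℕ => arrLaw ψ lam)
  have z2 := infinitePi_prod_map_zip (fun _ : ℕ => pointLaw ψ 0 lam ρ n) (fun _ : ℕ =>
    (lawOfWeights (ψ.nu 0 lam 1)).prod (Measure.infinitePi fun _ : ℕ => arrLaw ψ lam))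
  have b1 : ((Measure.infinitePi (siteLaw ψ a 0 lam ρ)).prod
      (Measure.infinitePi fun _ : Site ρ × ℕ × List ℕ => vertexLaw ψ 0 lam)).map
      (fun x (i : ℕ) => (x.1 (.poisson n i), fun (j : ℕ) (u : List ℕ) => x.2 (.poisson n i, j, u))) =
      Measure.infinitePi fun _ : ℕ => (lawOfWeights (ψ.nu 0 lam 1)).prod
        (Measure.infinitePi fun _ : ℕ => arrLaw ψ lam) := by
    rw [← z1]
    change _ = Measure.map _ (Measure.prod _ (Measure.infinitePi fun _ : ℕ =>
      Measure.infinitePi fun _ : ℕ => Measure.infinitePi fun _ : List ℕ => vertexLaw ψ 0 lam))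
    rw [← h4, ← h3, Measure.map_prod_map _ _ (by fun_prop) (by fun_prop),
      Measure.map_map (by fun_prop) (by fun_prop)]
    rfl
  have b2 : ((Measure.infinitePi fun p : ℕ × ℕ => pointLaw ψ 0 lam ρ p.1).prod
      ((Measure.infinitePi (siteLaw ψ a 0 lam ρ)).prod
      (Measure.infinitePi fun _ : Site ρ × ℕ × List ℕ => vertexLaw ψ 0 lam))).map
      (fun x (i : ℕ) => (x.1 (n, i), x.2.1 (.poisson n i),
        fun (j : ℕ) (u : List ℕ) => x.2.2 (.poisson n i, j, u))) =
      Measure.infinitePi fun _ : ℕ => (pointLaw ψ 0 lam ρ n).prod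
        ((lawOfWeights (ψ.nu 0 lam 1)).prod (Measure.infinitePi fun _ : ℕ => arrLaw ψ lam)) := by
    rw [← z2, ← b1, ← h2, Measure.map_prod_map _ _ (by fun_prop) (by fun_prop),
      Measure.map_map (by fun_prop) (by fun_prop)]
    rfl
  have hlaw : (graftLaw ψ a 0 lam ρ).map (fun D => (D.1 n, fun i : ℕ => (D.2.1 (n, i),
      (D.2.2.1 (.poisson n i), fun (j : ℕ) (u : List ℕ) => D.2.2.2 (.poisson n i, j, u))))) =
      (poissonMeasure (intensity ψ 0 lam ρ (annulus ρ n)).toNNReal).prod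
        (Measure.infinitePi fun _ : ℕ => (pointLaw ψ 0 lam ρ n).prod
          ((lawOfWeights (ψ.nu 0 lam 1)).prod (Measure.infinitePi fun _ : ℕ => arrLaw ψ lam))) := by
    rw [← b2, ← h1, Measure.map_prod_map _ _ (by fun_prop) (by fun_prop)]
    rfl
  have hitem : Measurable fun x : T × ℕ × (ℕ → Arr) =>
      (((x.1, 0, ⊤), ofSeq x.2.1 fun j => read ρ lam (x.2.2 j)) : Mark T × Forest (Mark T)) :=
    Measurable.prodMk (by fun_prop)
      (measurable_ofSeq_comp (by fun_prop) fun j => hr.comp (by fun_prop))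
  have hseq : Measurable fun x : ℕ × (ℕ → Arr) => ofSeq x.1 fun j => read ρ lam (x.2 j) :=
    measurable_ofSeq_comp (by fun_prop) fun j => hr.comp (by fun_prop)
  have hmap : ((pointLaw ψ 0 lam ρ n).prod ((lawOfWeights (ψ.nu 0 lam 1)).prod
      (Measure.infinitePi fun _ : ℕ => arrLaw ψ lam))).map (fun x =>
      (((x.1, 0, ⊤), ofSeq x.2.1 fun j => read ρ lam (x.2.2 j)) : Mark T × Forest (Mark T))) =
      itemLaw (pointLaw ψ 0 lam ρ n)
          (mix (fun k => lawOfWeights (ψ.nu 0 lam 1) {k}) (treeLaw ψ lam ρ)) := by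
    have h := Measure.map_prod_map (pointLaw ψ 0 lam ρ n) ((lawOfWeights (ψ.nu 0 lam 1)).prod
      (Measure.infinitePi fun _ : ℕ => arrLaw ψ lam)) measurable_id hseq
    rw [itemLaw, treeLaw, ← map_ofSeq_prod _ _ hr, ← Measure.map_id (μ := pointLaw ψ 0 lam ρ n), h,
      Measure.map_id, Measure.map_map measurable_item (by fun_prop)]
    rfl
  have hall : Measurable fun x : ℕ × (ℕ → T × ℕ × (ℕ → Arr)) => ofSeq x.1 fun i =>
      ((((x.2 i).1, 0, ⊤), ofSeq (x.2 i).2.1 fun j => read ρ lam ((x.2 i).2.2 j)) :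
        Mark T × Forest (Mark T)) :=
    measurable_ofSeq_comp (by fun_prop) fun j => hitem.comp (by fun_prop)
  rw [← hmap, ← map_ofSeq_prod _ _ hitem, ← hlaw, Measure.map_map hall (by fun_prop)]
  rfl

/-- Prune the forests of all components. -/
noncomputable def pruneAll (t : ℝ≥0∞) (S : Comp ρ → Forest (Mark T)) : Comp ρ → Forest (Mark T)
  | .inl n => thin (keepSite t) (pruneSite t) (S (.inl n))
  | .inr o => prune t (S (.inr o))

/-- The pruning of the forest of one component. -/
noncomputable def pruneComp (t : ℝ≥0∞) : Comp ρ → Forest (Mark T) → Forest (Mark T)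
  | .inl _ => thin (keepSite t) (pruneSite t)
  | .inr _ => prune t

theorem pruneAll_apply (t : ℝ≥0∞) (S : Comp ρ → Forest (Mark T)) (c : Comp ρ) :
    pruneAll t S c = pruneComp t c (S c) := by cases c <;> rfl

theorem measurable_pruneComp (t : ℝ≥0∞) (c : Comp ρ) : Measurable (pruneComp t c) := by
  cases c
  · exact measurable_thin (measurableSet_keepSite t) (measurable_pruneSite t)
  · exact measurable_prune t

theorem lawOfWeights_singleton {w : ℕ → ℝ} (h : ∑' k, ENNReal.ofReal (w k) = 1) (k : ℕ) :
    lawOfWeights w {k} = ENNReal.ofReal (w k) := by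
  rw [lawOfWeights_eq h, Measure.sum_apply _ (measurableSet_singleton k), tsum_eq_single k]
  · simp
  · intro j hj
    simp [hj]

theorem mix_poisson_zero {A : Type} [Nonempty A] [MeasurableSpace A] (Q : Measure (A × Forest A)) :
    mix (fun k => poissonMeasure 0 {k}) Q = Measure.dirac nil := by
  refine Measure.ext fun s hs => ?_
  rw [mix, Measure.sum_apply _ hs, tsum_eq_single 0]
  · simp [poissonMeasure_singleton, iid]
  · intro k hk
    simp [poissonMeasure_singleton, hk]

theorem intensity_apply (μ lam : ℝ) (s : Set T) :
    intensity ψ μ lam ρ s = ENNReal.ofReal (ψ.der 1 (ψ.inv lam) - ψ.der 1 (ψ.inv μ)) *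
      lengthMeasure ρ s := rfl

/-- The density cancels in the normalization, so the law of a position does not depend on the level.
-/
theorem pointLaw_eq (hT : IsDiscreteTree T ρ) {n : ℕ} (h : 0 < ψ.density lam)
    (h0 : lengthMeasure ρ (annulus ρ n) ≠ 0) :
    pointLaw ψ 0 lam ρ n = ProbabilityTheory.cond (lengthMeasure ρ) (annulus ρ n) := by
  have h1 : ENNReal.ofReal (ψ.der 1 (ψ.inv lam) - ψ.der 1 (ψ.inv 0)) ≠ 0 :=
    (ENNReal.ofReal_pos.2 h).ne'
  have hfin : lengthMeasure ρ (annulus ρ n) ≠ ⊤ :=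
    ne_top_of_le_ne_top (hT.lengthMeasure_closedBall_lt_top _).ne (measure_mono (annulus_subset ρ n))
  rw [pointLaw, if_neg (by rw [intensity_apply]; exact mul_ne_zero h1 h0), ProbabilityTheory.cond,
    ProbabilityTheory.cond, intensity_apply, intensity, Measure.restrict_smul, smul_smul,
    ENNReal.mul_inv (Or.inl h1) (Or.inl ENNReal.ofReal_ne_top), mul_right_comm,
    ENNReal.inv_mul_cancel h1 ENNReal.ofReal_ne_top, one_mul]

/-- Thinning multiplies the parameter of the Poisson number of points by the ratio of the densities,
and the densities are the factors in the two intensities. -/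
theorem map_prune_annulus (hψ : ∃ c : ℝ, 0 < c ∧ 0 < ψ c)
    (hm : DifferentiableWithinAt ℝ ψ (Ici 0) 0) (hμ : 0 < μ) (h : μ < lam)
    (hT : IsDiscreteTree T ρ) (n : ℕ) :
    ((graftLaw ψ a 0 lam ρ).map (fun D => skeleton lam D (.inl n))).map
      (thin (keepSite (ENNReal.ofReal μ)) (pruneSite (ENNReal.ofReal μ))) =
        (graftLaw ψ a 0 μ ρ).map (fun D => skeleton μ D (.inl n)) := by
  have hlam := hμ.trans h
  rw [map_skeleton_annulus hψ hm hlam hT, map_skeleton_annulus hψ hm hμ hT]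
  have hd0 := density_nonneg hψ hm hlam
  have hdμ0 := density_nonneg hψ hm hμ
  have hdle := density_le hψ hm hμ.le h
  have hmt := measurable_thin (measurableSet_keepSite (T := T) (ENNReal.ofReal μ))
    (measurable_pruneSite (ENNReal.ofReal μ))
  -- In this case there are no Poisson points at either level, and the conventional values of
  -- `pointLaw` and of the law with weights ν₁ play no role.
  by_cases h0 : ψ.density lam = 0 ∨ lengthMeasure ρ (annulus ρ n) = 0
  · have e1 : intensity ψ 0 lam ρ (annulus ρ n) = 0 := by
      rw [intensity_apply]
      rcases h0 with h0 | h0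
      · change ENNReal.ofReal (ψ.density lam) * _ = 0
        rw [h0]; simp
      · rw [h0, mul_zero]
    have e2 : intensity ψ 0 μ ρ (annulus ρ n) = 0 := by
      rw [intensity_apply]
      rcases h0 with h0 | h0
      · change ENNReal.ofReal (ψ.density μ) * _ = 0
        rw [show ψ.density μ = 0 by linarith]; simp
      · rw [h0, mul_zero]
    rw [e1, e2, ENNReal.toNNReal_zero, mix_poisson_zero, mix_poisson_zero, Measure.map_dirac' hmt]
    rfl
  · push Not at h0
    have hd : 0 < ψ.density lam := lt_of_le_of_ne hd0 (Ne.symm h0.1)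
    have hdμ := density_pos hψ hm hμ h hd
    have hν := isProbabilityMeasure_pointLaw (ψ := ψ) (μ := 0) (lam := lam) hT n
    simp_rw [lawOfWeights_singleton (tsum_nu_one hψ hm hlam hd),
      lawOfWeights_singleton (tsum_nu_one hψ hm hμ hdμ)]
    rw [mix_prune_sites hψ hm hμ h ρ hd _ (tsum_singleton_eq_one _), pointLaw_eq hT hd h0.2,
      pointLaw_eq hT hdμ h0.2]
    congr 1
    funext k
    have hle : ψ.density μ / ψ.density lam ≤ 1 := by rwa [div_le_one hd]
    rw [thinWeights_poisson _ (by positivity) (by linarith) (by ring), intensity_apply,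
      intensity_apply, ENNReal.toNNReal_mul, ENNReal.toNNReal_mul, ← mul_assoc]
    congr 3
    change _ * (ψ.density lam).toNNReal = (ψ.density μ).toNNReal
    rw [← Real.toNNReal_mul (by positivity), div_mul_cancel₀ _ hd.ne']

/-- The consistency relation on which the construction rests. Pruning acts on each component
separately and the components are independent, so it suffices to treat an annulus, the root and a
branching point. -/
theorem map_skeleton_prune (hψ : ∃ c : ℝ, 0 < c ∧ 0 < ψ c)
    (hm : DifferentiableWithinAt ℝ ψ (Ici 0) 0) (hμ : 0 < μ) (h : μ < lam)
    (hT : IsDiscreteTree T ρ)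
    (hbr : ∀ σ ∈ branchPoints ρ, ∃ d : ℝ, d ≠ 0 ∧
      Tendsto (ψ.der ((degree σ).toNat - 1)) (𝓝[>] (ψ.inv 0)) (𝓝 d)) :
    ((graftLaw ψ a 0 lam ρ).map (skeleton lam)).map (pruneAll (ENNReal.ofReal μ)) =
      (graftLaw ψ a 0 μ ρ).map (skeleton μ) := by
  have hlam := hμ.trans h
  have hG := isProbabilityMeasure_graftLaw (a := a) hψ hm hlam hT
  have hp : ∀ c, IsProbabilityMeasure ((graftLaw ψ a 0 lam ρ).map fun D => skeleton lam D c) :=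
    fun c => Measure.isProbabilityMeasure_map
      ((measurable_pi_apply c).comp (measurable_skeleton lam)).aemeasurable
  rw [map_skeleton hψ hm hlam hT, map_skeleton hψ hm hμ hT]
  have e : (pruneAll (ENNReal.ofReal μ) : (Comp ρ → Forest (Mark T)) → _) =
      fun S c => pruneComp (ENNReal.ofReal μ) c (S c) := by
    funext S c
    exact pruneAll_apply _ S c
  rw [e, Measure.infinitePi_map_pi _ (measurable_pruneComp _)]
  congr 1
  funext c
  rcases c with n | _ | σ
  · exact map_prune_annulus hψ hm hμ h hT n
  · have h1 := map_siteForest (a := a) hψ hm hlam hT Site.root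
    have h2 := map_siteForest (a := a) hψ hm hμ hT Site.root
    change Measure.map (prune _) (Measure.map (fun D => siteForest lam D .root) _) =
      Measure.map (fun D => siteForest μ D .root) _
    rw [h1, h2]
    exact mix_prune_poisson hψ hm hμ h ρ a
  · have h1 := map_siteForest (a := a) hψ hm hlam hT (Site.branch σ)
    have h2 := map_siteForest (a := a) hψ hm hμ hT (Site.branch σ)
    change Measure.map (prune _) (Measure.map (fun D => siteForest lam D (.branch σ)) _) =
      Measure.map (fun D => siteForest μ D (.branch σ)) _
    rw [h1, h2]
    obtain ⟨d, hd, hlim⟩ := hbr σ.1 σ.2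
    -- A branching point has finite degree at least 3, so the truncated subtraction is harmless and
    -- ν_l falls under the case l ≥ 2.
    have hl : 2 ≤ (degree σ.1).toNat - 1 := by
      have h3 := σ.2.2
      rw [← ENat.natCast_toNat (hT.finite_degree σ.1)] at h3
      have : 3 ≤ (degree σ.1).toNat := by exact_mod_cast h3
      omega
    have := mix_prune_branch hψ hm hμ h ρ hl hd hlim
    have e1 := lawOfWeights_singleton (tsum_nu hψ hm hlam hl hd hlim).1
    have e2 := lawOfWeights_singleton (tsum_nu hψ hm hμ hl hd hlim).1
    simp only [siteLaw, e1, e2]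
    exact this

end Skeleton

end LevyForest

namespace LevyForest

/-! ### Almost sure properties of the randomness -/

section AlmostSurely

open BranchingMechanism

theorem Arr.finite_isVertex {ω : Arr} (hω : ω ∈ Arr.finite) :
    {u | IsVertex (fun u => (ω u).1) u}.Finite := by
  obtain ⟨h, hh⟩ := mem_iUnion.1 hω
  clear hω
  induction h generalizing ω with
  | zero => exact absurd hh (by simp [Arr.short])
  | succ h ih =>
    have hfin : ({[]} ∪ ⋃ j ∈ Set.Iio (ω []).1,
        (fun u => j :: u) '' {u | IsVertex (fun u => (ω.shift j u).1) u}).Finite :=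
      (finite_singleton _).union ((finite_Iio _).biUnion fun j hj => (ih (hh j hj)).image _)
    refine hfin.subset fun u hu => ?_
    rcases u with _ | ⟨j, u⟩
    · exact Or.inl rfl
    · have := isVertex_cons.1 hu
      exact Or.inr (mem_iUnion₂.2 ⟨j, this.1, u, this.2, rfl⟩)

theorem expLaw_zero (q : ℝ) : expLaw q {0} = 0 := by
  rw [← lintegral_indicator_one (measurableSet_singleton 0), lintegral_expLaw q
    (measurable_one.indicator (measurableSet_singleton 0)), ← lintegral_zero (μ := (volume : Measure ℝ))]
  refine lintegral_congr_ae ?_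
  have : ∀ᵐ x : ℝ, x ≠ 0 := by
    rw [ae_iff]; simp
  filter_upwards [this] with x hx
  rcases hx.lt_or_gt with h | h
  · simp [exponentialPDF_of_neg h]
  · rw [indicator_of_notMem]
    · simp
    · simpa using h

variable {T : Type} [MetricSpace T] [MeasurableSpace T] [BorelSpace T] {ρ : T}
  {ψ : BranchingMechanism} {a : ℝ≥0} {μ lam : ℝ}

theorem ae_graftLaw_vertex (hψ : ∃ c : ℝ, 0 < c ∧ 0 < ψ c)
    (hm : DifferentiableWithinAt ℝ ψ (Ici 0) 0) (hlam : 0 < lam) (hT : IsDiscreteTree T ρ)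
    {p : (Site ρ × ℕ × List ℕ → ℕ × ℝ≥0 × unitInterval) → Prop}
    (h : ∀ᵐ ω ∂Measure.infinitePi fun _ : Site ρ × ℕ × List ℕ => vertexLaw ψ 0 lam, p ω) :
    ∀ᵐ D ∂graftLaw ψ a 0 lam ρ, p D.2.2.2 := by
  have := isProbabilityMeasure_vertexLaw hψ hm hlam
  have := isProbabilityMeasure_pointLaw (ψ := ψ) (μ := 0) (lam := lam) hT
  unfold graftLaw
  exact Measure.quasiMeasurePreserving_snd.ae (p := fun x : _ × _ × _ => p x.2.2)
    (Measure.quasiMeasurePreserving_snd.ae (p := fun x : _ × _ => p x.2)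
      (Measure.quasiMeasurePreserving_snd.ae h))

theorem ae_position (hψ : ∃ c : ℝ, 0 < c ∧ 0 < ψ c)
    (hm : DifferentiableWithinAt ℝ ψ (Ici 0) 0) (hlam : 0 < lam) (hT : IsDiscreteTree T ρ)
    (n i : ℕ) : ∀ᵐ D ∂graftLaw ψ a 0 lam ρ, i < D.1 n → D.2.1 (n, i) ∈ annulus ρ n := by
  have := isProbabilityMeasure_vertexLaw hψ hm hlam
  have hpt := isProbabilityMeasure_pointLaw (ψ := ψ) (μ := 0) (lam := lam) hT
  -- In an annulus without mass the conventional position may lie elsewhere, but almost surely no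
  -- point is present.
  by_cases h0 : intensity ψ 0 lam ρ (annulus ρ n) = 0
  · have h1 : ∀ᵐ K ∂(Measure.infinitePi fun n : ℕ =>
        poissonMeasure (intensity ψ 0 lam ρ (annulus ρ n)).toNNReal), K n = 0 := by
      refine (measurePreserving_eval_infinitePi (fun n : ℕ =>
        poissonMeasure (intensity ψ 0 lam ρ (annulus ρ n)).toNNReal) n).quasiMeasurePreserving.ae
          (p := fun k : ℕ => k = 0) ?_
      rw [h0, ENNReal.toNNReal_zero, ae_iff, ← lintegral_indicator_one (MeasurableSet.of_discrete),
        lintegral_countable']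
      refine ENNReal.tsum_eq_zero.2 fun k => ?_
      rcases k with _ | k
      · simp
      · simp [poissonMeasure_singleton]
    unfold graftLaw
    filter_upwards [Measure.quasiMeasurePreserving_fst.ae h1] with D hD hi
    rw [hD] at hi
    exact absurd hi (by omega)
  · have hdist : Measurable fun x : T => dist ρ x := (continuous_const.dist continuous_id).measurable
    have hmeas : MeasurableSet (annulus ρ n) :=
      (measurableSet_le measurable_const hdist).inter (measurableSet_lt hdist measurable_const)
    have h1 : ∀ᵐ x ∂(Measure.infinitePi fun p : ℕ × ℕ => pointLaw ψ 0 lam ρ p.1),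
        x (n, i) ∈ annulus ρ n := by
      refine (measurePreserving_eval_infinitePi (fun p : ℕ × ℕ => pointLaw ψ 0 lam ρ p.1)
        (n, i)).quasiMeasurePreserving.ae (p := fun x : T => x ∈ annulus ρ n) ?_
      simp only [pointLaw, if_neg h0]
      exact ae_cond_mem hmeas
    unfold graftLaw
    filter_upwards [Measure.quasiMeasurePreserving_snd.ae (p := fun x : (ℕ × ℕ → T) × _ =>
      x.1 (n, i) ∈ annulus ρ n) (Measure.quasiMeasurePreserving_fst.ae h1)] with D hD _
    exact hD

theorem ae_good (hψ : ∃ c : ℝ, 0 < c ∧ 0 < ψ c)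
    (hm : DifferentiableWithinAt ℝ ψ (Ici 0) 0) (hlam : 0 < lam) (hT : IsDiscreteTree T ρ) :
    ∀ᵐ D ∂graftLaw ψ a 0 lam ρ,
      D.Good ∧ ∀ (σ : Site ρ) (j : ℕ), (fun u => D.2.2.2 (σ, j, u)) ∈ Arr.finite := by
  have hc := hT.countable_site
  have hV := isProbabilityMeasure_vertexLaw hψ hm hlam
  have hE := isProbabilityMeasure_expLaw (rate_pos hψ hm hlam)
  have h1 : ∀ᵐ D ∂graftLaw ψ a 0 lam ρ, ∀ (σ : Site ρ) (j : ℕ),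
      (fun u => D.2.2.2 (σ, j, u)) ∈ Arr.finite := by
    rw [ae_all_iff]
    refine fun σ => ae_all_iff.2 fun j => ?_
    refine ae_graftLaw_vertex hψ hm hlam hT (p := fun ω => (fun u => ω (σ, j, u)) ∈ Arr.finite) ?_
    have h := ae_arrLaw_finite hψ hm hlam
    rw [arrLaw, ← Measure.map_infinitePi_infinitePi_of_inj
      (P := fun _ : Site ρ × ℕ × List ℕ => vertexLaw ψ 0 lam) (f := fun u : List ℕ => (σ, j, u))
      (fun u v h => by simpa using h)] at h
    exact ae_of_ae_map (f := fun (ω : Site ρ × ℕ × List ℕ → ℕ × ℝ≥0 × unitInterval) (u : List ℕ) =>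
      ω (σ, j, u)) (p := fun ω => ω ∈ Arr.finite)
      (measurable_pi_lambda _ fun u => measurable_pi_apply _).aemeasurable h
  have hlen : ∀ᵐ v ∂vertexLaw ψ 0 lam, 0 < v.2.1 := by
    have h : ∀ᵐ l ∂expLaw (ψ.rate lam), 0 < l := by
      rw [ae_iff]
      convert! expLaw_zero (ψ.rate lam) using 2
      ext l
      simp
    exact Measure.quasiMeasurePreserving_snd.ae (p := fun x : ℝ≥0 × unitInterval => 0 < x.1)
      (Measure.quasiMeasurePreserving_fst.ae h)
  have h2 : ∀ᵐ D ∂graftLaw ψ a 0 lam ρ, ∀ q, 0 < (D.2.2.2 q).2.1 := by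
    rw [ae_all_iff]
    exact fun q => ae_graftLaw_vertex hψ hm hlam hT (p := fun ω => 0 < (ω q).2.1)
      ((measurePreserving_eval_infinitePi (fun _ : Site ρ × ℕ × List ℕ => vertexLaw ψ 0 lam)
        q).quasiMeasurePreserving.ae (p := fun v => 0 < v.2.1) hlen)
  have hcol : ∀ c, ∀ᵐ v ∂vertexLaw ψ 0 lam, v.2.2 ≠ c := by
    intro c
    have h : ∀ᵐ u : unitInterval, u ≠ c := by
      rw [ae_iff]; simp
    exact Measure.quasiMeasurePreserving_snd.ae (p := fun x : ℝ≥0 × unitInterval => x.2 ≠ c)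
      (Measure.quasiMeasurePreserving_snd.ae h)
  -- Two colours are independent and their law has no atoms, so they differ almost surely; there are
  -- countably many pairs.
  have h3 : ∀ᵐ D ∂graftLaw ψ a 0 lam ρ, ∀ q q', q ≠ q' → (D.2.2.2 q).2.2 ≠ (D.2.2.2 q').2.2 := by
    rw [ae_all_iff]
    refine fun q => ae_all_iff.2 fun q' => ?_
    by_cases hq : q = q'
    · exact ae_of_all _ fun D h => absurd hq h
    refine (ae_graftLaw_vertex hψ hm hlam hT (p := fun ω => (ω q).2.2 ≠ (ω q').2.2) ?_).mono
      fun D hD _ => hD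
    have hmap := infinitePi_map_prod (fun _ : Site ρ × ℕ × List ℕ => vertexLaw ψ 0 lam) q'
      (f := fun _ : Unit => q) (fun _ _ _ => rfl) (fun _ => hq)
    have hs : MeasurableSet {x : (ℕ × ℝ≥0 × unitInterval) × (Unit → ℕ × ℝ≥0 × unitInterval) |
        (x.2 ()).2.2 ≠ x.1.2.2} :=
      (measurableSet_eq_fun (by fun_prop) (by fun_prop)).compl
    have h : ∀ᵐ x ∂(vertexLaw ψ 0 lam).prod (Measure.infinitePi fun _ : Unit => vertexLaw ψ 0 lam),
        (x.2 ()).2.2 ≠ x.1.2.2 := by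
      rw [Measure.ae_prod_iff_ae_ae hs]
      exact ae_of_all _ fun v => (measurePreserving_eval_infinitePi
        (fun _ : Unit => vertexLaw ψ 0 lam) ()).quasiMeasurePreserving.ae
          (p := fun w => w.2.2 ≠ v.2.2) (hcol _)
    rw [← hmap] at h
    exact ae_of_ae_map (f := fun ω : Site ρ × ℕ × List ℕ → ℕ × ℝ≥0 × unitInterval =>
      (ω q', fun _ : Unit => ω q)) (p := fun x => (x.2 ()).2.2 ≠ x.1.2.2) (by fun_prop) h
  have h4 : ∀ᵐ D ∂graftLaw ψ a 0 lam ρ, ∀ n i, i < D.1 n → D.2.1 (n, i) ∈ annulus ρ n := by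
    rw [ae_all_iff]
    exact fun n => ae_all_iff.2 fun i => ae_position hψ hm hlam hT n i
  filter_upwards [h1, h2, h3, h4] with D h1 h2 h3 h4
  refine ⟨⟨fun σ j => Arr.finite_isVertex (h1 σ j), h2, fun q q' h => by
    by_contra hne
    exact h3 q q' hne h, h4⟩, h1⟩

end AlmostSurely

end LevyForest

namespace LevyForest

/-! ### The points of a marked forest -/

namespace Forest

variable {T A : Type}

/-- The smallest colour of a forest. -/
noncomputable def minColor : Forest (Mark T) → ℝ≥0∞
  | nil => ⊤
  | cons a c r => min (min a.2.2 (minColor c)) (minColor r)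

/-- The smallest colour of a tree. -/
noncomputable def treeMin (x : Mark T × Forest (Mark T)) : ℝ≥0∞ := min x.1.2.2 (minColor x.2)

/-- The paths from the root to the points of an edge with label `e` and of what lies above it. -/
def extend (e : ℝ≥0∞) (l : ℝ≥0) (P : Set (ℝ≥0∞ →₀ ℝ)) : Set (ℝ≥0∞ →₀ ℝ) :=
  {π | ∃ s : ℝ, 0 < s ∧ s ≤ l ∧ π = Finsupp.single e s} ∪
    (fun π => Finsupp.single e (l : ℝ) + π) '' P

open Classical in
/-- The paths from the root to the points of a forest below a leaf of colour at most `t`; the edges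
are labelled by the smallest colour above them. -/
noncomputable def paths (t : ℝ≥0∞) : Forest (Mark T) → Set (ℝ≥0∞ →₀ ℝ)
  | nil => ∅
  | cons a c r => (if min a.2.2 (minColor c) ≤ t then
      extend (min a.2.2 (minColor c)) a.2.1 (paths t c) else ∅) ∪ paths t r

open Classical in
/-- The paths from the root to the points of a tree below a leaf of colour at most `t`. -/
noncomputable def treePaths (t : ℝ≥0∞) (x : Mark T × Forest (Mark T)) : Set (ℝ≥0∞ →₀ ℝ) :=
  if treeMin x ≤ t then extend (treeMin x) x.1.2.1 (paths t x.2) else ∅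

theorem paths_adjoin (t : ℝ≥0∞) (x : Mark T × Forest (Mark T)) (r : Forest (Mark T)) :
    paths t (adjoin (x, r)) = treePaths t x ∪ paths t r := rfl

theorem minColor_adjoin (x : Mark T × Forest (Mark T)) (r : Forest (Mark T)) :
    minColor (adjoin (x, r)) = min (treeMin x) (minColor r) := rfl

theorem paths_ofSeq (t : ℝ≥0∞) (k : ℕ) (g : ℕ → Mark T × Forest (Mark T)) :
    paths t (ofSeq k g) = ⋃ j < k, treePaths t (g j) := by
  induction k generalizing g with
  | zero => simp [ofSeq, paths]
  | succ k ih =>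
    rw [ofSeq, paths_adjoin, ih]
    ext π
    simp only [mem_union, mem_iUnion, exists_prop]
    constructor
    · rintro (h | ⟨j, hj, h⟩)
      · exact ⟨0, k.succ_pos, h⟩
      · exact ⟨j + 1, by omega, h⟩
    · rintro ⟨_ | j, hj, h⟩
      · exact Or.inl h
      · exact Or.inr ⟨j, by omega, h⟩

theorem le_minColor_ofSeq {k : ℕ} {g : ℕ → Mark T × Forest (Mark T)} {t : ℝ≥0∞} :
    t ≤ minColor (ofSeq k g) ↔ ∀ j < k, t ≤ treeMin (g j) := by
  induction k generalizing g with
  | zero => simp [ofSeq, minColor]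
  | succ k ih =>
    rw [ofSeq, minColor_adjoin, le_min_iff, ih]
    constructor
    · rintro ⟨h0, h⟩ (_ | j) hj
      · exact h0
      · exact h j (by omega)
    · exact fun h => ⟨h 0 k.succ_pos, fun j hj => h (j + 1) (by omega)⟩

theorem exists_minColor_ofSeq {k : ℕ} (hk : k ≠ 0) (g : ℕ → Mark T × Forest (Mark T)) :
    ∃ j < k, minColor (ofSeq k g) = treeMin (g j) := by
  induction k generalizing g with
  | zero => exact absurd rfl hk
  | succ k ih =>
    rw [ofSeq, minColor_adjoin]
    rcases le_total (treeMin (g 0)) (minColor (ofSeq k fun n => g (n + 1))) with h | h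
    · exact ⟨0, k.succ_pos, min_eq_left h⟩
    · rcases k with _ | k
      · exact ⟨0, one_pos, min_eq_left (by simp [ofSeq, minColor])⟩
      · obtain ⟨j, hj, h'⟩ := ih k.succ_ne_zero fun n => g (n + 1)
        exact ⟨j + 1, by omega, (min_eq_right h).trans h'⟩

theorem extend_mono (e : ℝ≥0∞) (l : ℝ≥0) {P P' : Set (ℝ≥0∞ →₀ ℝ)} (h : P ⊆ P') :
    extend e l P ⊆ extend e l P' := union_subset_union_right _ (image_mono h)

/-- Two consecutive edges with the same label cannot be told from one long edge; merging edges is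
invisible in the coordinates. -/
theorem extend_extend (e : ℝ≥0∞) (l l' : ℝ≥0) (P : Set (ℝ≥0∞ →₀ ℝ)) :
    extend e l (extend e l' P) = extend e (l + l') P := by
  ext π
  constructor
  · rintro (⟨s, h0, h1, rfl⟩ | ⟨_, ⟨s, h0, h1, rfl⟩ | ⟨π, hπ, rfl⟩, rfl⟩)
    · exact Or.inl ⟨s, h0, by push_cast; linarith [l'.coe_nonneg], rfl⟩
    · refine Or.inl ⟨l + s, by linarith [l.coe_nonneg], by push_cast; linarith, ?_⟩
      exact (Finsupp.single_add e (l : ℝ) s).symm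
    · refine Or.inr ⟨π, hπ, ?_⟩
      simp [Finsupp.single_add, add_assoc]
  · rintro (⟨s, h0, h1, rfl⟩ | ⟨π, hπ, rfl⟩)
    · push_cast at h1
      rcases le_or_gt s l with h | h
      · exact Or.inl ⟨s, h0, h, rfl⟩
      · refine Or.inr ⟨_, Or.inl ⟨s - l, by linarith, by linarith, rfl⟩, ?_⟩
        simp
    · refine Or.inr ⟨_, Or.inr ⟨π, hπ, rfl⟩, ?_⟩
      simp [Finsupp.single_add, add_assoc]

theorem paths_mono {t t' : ℝ≥0∞} (h : t ≤ t') (f : Forest (Mark T)) :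
    paths t f ⊆ paths t' f := by
  induction f with
  | nil => exact empty_subset _
  | cons a c r ihc ihr =>
    refine union_subset_union ?_ ihr
    split_ifs with h1 h2
    · exact extend_mono _ _ ihc
    · exact absurd (h1.trans h) h2
    · exact empty_subset _
    · exact empty_subset _

/-- Only leaves have a finite colour. -/
def WellFormed : Forest (Mark T) → Prop
  | nil => True
  | cons a c r => (c = nil ∨ a.2.2 = ⊤) ∧ WellFormed c ∧ WellFormed r

theorem wellFormed_ofSeq {k : ℕ} {g : ℕ → Mark T × Forest (Mark T)}
    (h : ∀ j < k, ((g j).2 = nil ∨ (g j).1.2.2 = ⊤) ∧ WellFormed (g j).2) :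
    WellFormed (ofSeq k g) := by
  induction k generalizing g with
  | zero => trivial
  | succ k ih =>
    exact ⟨(h 0 k.succ_pos).1, (h 0 k.succ_pos).2, ih fun j hj => h (j + 1) (by omega)⟩

theorem treeMin_merge (a : Mark T) (c : Forest (Mark T)) (h : c = nil ∨ a.2.2 = ⊤) :
    treeMin (merge (a, c)) = treeMin (a, c) := by
  rcases c with _ | ⟨b, c, _ | ⟨d, e, r⟩⟩
  · rfl
  · rcases h with h | h
    · simp at h
    · simp [merge, treeMin, minColor, h]
  · rfl

/-- A vertex of infinite colour with a single child has the same smallest colour above it as the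
child, so the merged edges had equal labels and `extend_extend` applies. -/
theorem treePaths_merge (t : ℝ≥0∞) (a : Mark T) (c : Forest (Mark T)) (h : c = nil ∨ a.2.2 = ⊤) :
    treePaths t (merge (a, c)) = treePaths t (a, c) := by
  rcases c with _ | ⟨b, c, _ | ⟨d, e, r⟩⟩
  · rfl
  · rcases h with h | h
    · simp at h
    · have hm : treeMin (a, cons b c nil) = min b.2.2 (minColor c) := by
        simp [treeMin, minColor, h]
      have hp : paths t (cons b c nil) = if min b.2.2 (minColor c) ≤ t then
          extend (min b.2.2 (minColor c)) b.2.1 (paths t c) else ∅ := by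
        simp [paths]
      rw [treePaths, treePaths, treeMin_merge _ _ (Or.inr h), hm]
      by_cases h1 : min b.2.2 (minColor c) ≤ t
      · rw [if_pos h1, if_pos h1, hp, if_pos h1, extend_extend]
        rfl
      · rw [if_neg h1, if_neg h1]
  · rfl

/-- Only leaves of colour above `lam` are removed, so a smallest colour that is at most `lam`
persists. Otherwise nothing remains, as interior vertices have infinite colour and `lam` is finite.
-/
theorem minColor_prune {lam : ℝ≥0∞} {f : Forest (Mark T)} (hf : WellFormed f) (hlam : lam ≠ ⊤) :
    minColor (prune lam f) = (if minColor f ≤ lam then minColor f else ⊤) ∧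
      (prune lam f = nil ↔ ¬ minColor f ≤ lam) := by
  induction f with
  | nil => simp [minColor, prune, hlam]
  | cons a c r ihc ihr =>
    obtain ⟨h1, h2, h3⟩ := hf
    obtain ⟨ihc, ihc'⟩ := ihc h2
    obtain ⟨ihr, ihr'⟩ := ihr h3
    have key : a.2.2 ≤ lam ∨ prune lam c ≠ nil ↔ treeMin (a, c) ≤ lam := by
      rw [treeMin, min_le_iff, Ne, ihc', not_not]
    simp only [prune, key]
    have hm : minColor (cons a c r) = min (treeMin (a, c)) (minColor r) := rfl
    rw [hm]
    by_cases h : treeMin (a, c) ≤ lam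
    · have hp : prune lam c = nil ∨ a.2.2 = ⊤ := h1.imp (fun h => by rw [h, prune]) id
      rw [if_pos h, minColor_adjoin, treeMin_merge _ _ hp, if_pos (min_le_of_left_le h), ihr]
      refine ⟨?_, by simp [adjoin, min_le_of_left_le h]⟩
      have e : treeMin (a, prune lam c) = treeMin (a, c) := by
        simp only [treeMin, ihc]
        split_ifs with h4
        · rfl
        · simp only [treeMin, min_le_iff, h4, or_false] at h
          rw [min_top_right, min_eq_left (h.trans (not_le.1 h4).le)]
      rw [e]
      split_ifs with h4
      · rfl
      · rw [min_top_right, min_eq_left (h.trans (not_le.1 h4).le)]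
    · rw [if_neg h, ihr, ihr']
      have : min (treeMin (a, c)) (minColor r) ≤ lam ↔ minColor r ≤ lam := by
        simp [h]
      simp only [this, and_true]
      split_ifs with h4
      · exact (min_eq_right (h4.trans (not_le.1 h).le)).symm
      · rfl

/-- An edge below a leaf of colour at most t ≤ `lam` is retained and keeps its label, and merging
does not change the paths. So the points have literally the same coordinates before and after
pruning. -/
theorem paths_prune {t lam : ℝ≥0∞} {f : Forest (Mark T)} (hf : WellFormed f) (hlam : lam ≠ ⊤)
    (ht : t ≤ lam) : paths t (prune lam f) = paths t f := by
  induction f with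
  | nil => rfl
  | cons a c r ihc ihr =>
    obtain ⟨h1, h2, h3⟩ := hf
    have hc := minColor_prune h2 hlam
    have key : a.2.2 ≤ lam ∨ prune lam c ≠ nil ↔ treeMin (a, c) ≤ lam := by
      rw [treeMin, min_le_iff, Ne, hc.2, not_not]
    have hp : paths t (cons a c r) = treePaths t (a, c) ∪ paths t r := rfl
    simp only [prune, key]
    rw [hp]
    by_cases h : treeMin (a, c) ≤ lam
    · have hn : prune lam c = nil ∨ a.2.2 = ⊤ := h1.imp (fun h => by rw [h, prune]) id
      rw [if_pos h, paths_adjoin, treePaths_merge _ _ _ hn, ihr h3]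
      have e : treeMin (a, prune lam c) = treeMin (a, c) := by
        simp only [treeMin, hc.1]
        split_ifs with h4
        · rfl
        · simp only [treeMin, min_le_iff, h4, or_false] at h
          rw [min_top_right, min_eq_left (h.trans (not_le.1 h4).le)]
      simp only [treePaths, e, ihc h2]
    · rw [if_neg h, ihr h3, treePaths, if_neg fun h' => h (h'.trans ht), empty_union]

/-- The trees of a forest. -/
def items : Forest A → Set (A × Forest A)
  | nil => ∅
  | cons a c r => insert (a, c) (items r)

theorem items_thin (K : Set (A × Forest A)) (g : A × Forest A → A × Forest A) (f : Forest A) :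
    items (thin K g f) = g '' (items f ∩ K) := by
  induction f with
  | nil => simp [items, thin]
  | cons a c r _ ih =>
    simp only [thin, items]
    split_ifs with h
    · rw [insert_inter_of_mem h, image_insert_eq, ← ih]; rfl
    · rw [insert_inter_of_notMem h, ih]

theorem items_ofSeq (k : ℕ) (g : ℕ → A × Forest A) : items (ofSeq k g) = {x | ∃ j < k, x = g j} := by
  induction k generalizing g with
  | zero => simp [ofSeq, items]
  | succ k ih =>
    have : items (ofSeq (k + 1) g) = insert (g 0) (items (ofSeq k fun n => g (n + 1))) := rfl
    rw [this, ih]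
    ext x
    constructor
    · rintro (rfl | ⟨j, hj, rfl⟩)
      · exact ⟨0, k.succ_pos, rfl⟩
      · exact ⟨j + 1, by omega, rfl⟩
    · rintro ⟨_ | j, hj, rfl⟩
      · exact Or.inl rfl
      · exact Or.inr ⟨j, by omega, rfl⟩

end Forest

/-! ### The points of a tree with grafted trees -/

section TreeSet

open Forest

variable {T : Type} [MetricSpace T] {ρ : T}

/-- The points of `T` and of the grafted trees below a leaf of colour at most `t`. -/
def treeSet (t : ℝ≥0∞) (S : Comp ρ → Forest (Mark T)) : Set (Ambient T ℝ≥0∞) :=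
  {x | x.path = 0 ∨ (∃ n, ∃ y ∈ items (S (.inl n)), x.point = y.1.1 ∧ x.path ∈ paths t y.2) ∨
    ∃ o : Option (branchPoints ρ), x.point = o.elim ρ (fun σ => σ.1) ∧ x.path ∈ paths t (S (.inr o))}

theorem treeSet_mono {t t' : ℝ≥0∞} (h : t ≤ t') (S : Comp ρ → Forest (Mark T)) :
    treeSet t S ⊆ treeSet t' S := by
  rintro x (h0 | ⟨n, y, hy, h1, h2⟩ | ⟨o, h1, h2⟩)
  · exact Or.inl h0
  · exact Or.inr (Or.inl ⟨n, y, hy, h1, paths_mono h _ h2⟩)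
  · exact Or.inr (Or.inr ⟨o, h1, paths_mono h _ h2⟩)

/-- Only leaves have a finite colour. -/
def AllWellFormed (S : Comp ρ → Forest (Mark T)) : Prop :=
  (∀ n, ∀ y ∈ items (S (.inl n)), WellFormed y.2) ∧ ∀ o, WellFormed (S (.inr o))

/-- Sites that pruning drops have no path at level t ≤ `lam`, and on the others `paths_prune`
applies. Because this is an equality of sets, the trees read off different levels agree as subsets
of the ambient space. -/
theorem treeSet_pruneAll {t lam : ℝ≥0∞} {S : Comp ρ → Forest (Mark T)} (hS : AllWellFormed S)
    (hlam : lam ≠ ⊤) (ht : t ≤ lam) : treeSet t (pruneAll lam S) = treeSet t S := by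
  ext x
  refine or_congr_right (or_congr (exists_congr fun n => ?_) (exists_congr fun o => ?_))
  · simp only [pruneAll, items_thin, pruneSite]
    constructor
    · rintro ⟨_, ⟨y, ⟨hy, hk⟩, rfl⟩, h1, h2⟩
      exact ⟨y, hy, h1, (paths_prune (hS.1 n y hy) hlam ht).subset h2⟩
    · rintro ⟨y, hy, h1, h2⟩
      rw [← paths_prune (hS.1 n y hy) hlam ht] at h2
      refine ⟨_, ⟨y, ⟨hy, fun h => ?_⟩, rfl⟩, h1, h2⟩
      rw [h] at h2
      exact h2
  · simp only [pruneAll, paths_prune (hS.2 o) hlam ht]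

/-! ### The points of the tree of an array -/

theorem wellFormed_read {lam : ℝ} {ω : Arr} (hω : ω ∈ Arr.finite) :
    ((read ρ lam ω).2 = nil ∨ (read ρ lam ω).1.2.2 = ⊤) ∧ WellFormed (read ρ lam ω).2 := by
  obtain ⟨h, hh⟩ := mem_iUnion.1 hω
  induction h generalizing ω with
  | zero => exact absurd hh (by simp [Arr.short])
  | succ h ih =>
    rw [read_eq ρ lam hω]
    refine ⟨?_, wellFormed_ofSeq fun j hj => ih (Arr.mem_finite_iff.1 hω j hj) (hh j hj)⟩
    by_cases h0 : (ω []).1 = 0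
    · exact Or.inl (by simp only [h0, ofSeq])
    · exact Or.inr (by simp [mark, h0])

/-- The subtree above a vertex. -/
def Arr.above (ω : Arr) (u : List ℕ) : Arr := fun v => ω (u ++ v)

theorem Arr.above_finite {ω : Arr} (hω : ω ∈ Arr.finite) {u : List ℕ}
    (hu : IsVertex (fun u => (ω u).1) u) : ω.above u ∈ Arr.finite := by
  induction u generalizing ω with
  | nil => exact hω
  | cons j u ih =>
    obtain ⟨hj, hu⟩ := isVertex_cons.1 hu
    exact ih (ω := ω.shift j) (Arr.mem_finite_iff.1 hω j hj) hu

theorem exists_leaf_treeMin {lam : ℝ} {ω : Arr} (hω : ω ∈ Arr.finite) :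
    ∃ u, IsVertex (fun u => (ω u).1) u ∧ (ω u).1 = 0 ∧
      treeMin (read ρ lam ω) = ENNReal.ofReal (lam * (ω u).2.2) := by
  obtain ⟨h, hh⟩ := mem_iUnion.1 hω
  induction h generalizing ω with
  | zero => exact absurd hh (by simp [Arr.short])
  | succ h ih =>
    rw [read_eq ρ lam hω]
    by_cases h0 : (ω []).1 = 0
    · exact ⟨[], isVertex_nil _, h0, by simp [treeMin, mark, h0, ofSeq, minColor]⟩
    · obtain ⟨j, hj, hj'⟩ := exists_minColor_ofSeq h0 fun j => read ρ lam (ω.shift j)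
      obtain ⟨u, h1, h2, h3⟩ := ih (Arr.mem_finite_iff.1 hω j hj) (hh j hj)
      refine ⟨j :: u, isVertex_cons.2 ⟨hj, h1⟩, h2, Eq.trans ?_ h3⟩
      simp [treeMin, mark, h0, hj']

theorem treeMin_read_le {lam : ℝ} {ω : Arr} (hω : ω ∈ Arr.finite) {u : List ℕ}
    (hu : IsVertex (fun u => (ω u).1) u) (h0 : (ω u).1 = 0) :
    treeMin (read ρ lam ω) ≤ ENNReal.ofReal (lam * (ω u).2.2) := by
  induction u generalizing ω with
  | nil =>
    rw [read_eq ρ lam hω]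
    exact min_le_of_left_le (by simp [mark, h0])
  | cons j u ih =>
    obtain ⟨hj, hu⟩ := isVertex_cons.1 hu
    rw [read_eq ρ lam hω]
    exact min_le_of_right_le ((le_minColor_ofSeq.1 le_rfl j hj).trans
      (ih (ω := ω.shift j) (Arr.mem_finite_iff.1 hω j hj) hu h0))

/-- Identifies the recursively defined paths with the codes of tree points, the label of an edge
being the smallest colour of the subtree above it. -/
theorem treePaths_read {lam : ℝ} {ω : Arr} (hω : ω ∈ Arr.finite) (t : ℝ≥0∞) :
    treePaths t (read ρ lam ω) = {π | ∃ (u : List ℕ) (s : ℝ), IsVertex (fun u => (ω u).1) u ∧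
      0 < s ∧ s ≤ (ω u).2.1 ∧ treeMin (read ρ lam (ω.above u)) ≤ t ∧
      π = code (fun u => treeMin (read ρ lam (ω.above u))) (fun u => (ω u).2.1) u s} := by
  obtain ⟨h, hh⟩ := mem_iUnion.1 hω
  induction h generalizing ω with
  | zero => exact absurd hh (by simp [Arr.short])
  | succ h ih =>
    have e := read_eq ρ lam hω
    have e1 : (read ρ lam ω).1.2.1 = (ω []).2.1 := by rw [e]; rfl
    have e2 : paths t (read ρ lam ω).2 =
        ⋃ j < (ω []).1, treePaths t (read ρ lam (ω.shift j)) := by rw [e, paths_ofSeq]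
    have hmin : ∀ j < (ω []).1, treeMin (read ρ lam ω) ≤ treeMin (read ρ lam (ω.shift j)) :=
      fun j hj => by
        rw [e]
        exact min_le_of_right_le (le_minColor_ofSeq.1 le_rfl j hj)
    rw [treePaths, e1, e2]
    ext π
    constructor
    · intro hπ
      split_ifs at hπ with ht
      · rcases hπ with ⟨s, h0, h1, rfl⟩ | ⟨π, hπ, rfl⟩
        · exact ⟨[], s, isVertex_nil _, h0, h1, ht, rfl⟩
        · obtain ⟨j, hj, hπ⟩ := mem_iUnion₂.1 hπ
          rw [ih (Arr.mem_finite_iff.1 hω j hj) (hh j hj)] at hπ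
          obtain ⟨u, s, hu, h0, h1, h2, rfl⟩ := hπ
          exact ⟨j :: u, s, isVertex_cons.2 ⟨hj, hu⟩, h0, h1, h2, rfl⟩
      · exact hπ.elim
    · rintro ⟨u, s, hu, h0, h1, h2, rfl⟩
      rcases u with _ | ⟨j, u⟩
      · rw [if_pos (show treeMin (read ρ lam ω) ≤ t from h2)]
        exact Or.inl ⟨s, h0, h1, rfl⟩
      · obtain ⟨hj, hu⟩ := isVertex_cons.1 hu
        have hω' := Arr.mem_finite_iff.1 hω j hj
        have hmem : code (fun w => treeMin (read ρ lam ((ω.shift j).above w)))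
            (fun w => (ω.shift j w).2.1) u s ∈ treePaths t (read ρ lam (ω.shift j)) := by
          rw [ih hω' (hh j hj)]
          exact ⟨u, s, hu, h0, h1, h2, rfl⟩
        have ht : treeMin (read ρ lam ω) ≤ t := by
          refine (hmin j hj).trans ?_
          by_contra h'
          rw [treePaths, if_neg h'] at hmem
          exact hmem
        rw [if_pos ht]
        exact Or.inr ⟨_, mem_iUnion₂.2 ⟨j, hj, hmem⟩, rfl⟩

end TreeSet

end LevyForest

namespace LevyForest

/-! ### Black trees as sets of points of the ambient space -/

theorem TreeLike.of_isometryEquiv {X Y : Type} [MetricSpace X] [MetricSpace Y] (hX : TreeLike X)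
    (e : X ≃ᵢ Y) : TreeLike Y where
  four x y z u := by
    simpa only [e.symm.dist_eq] using hX.four (e.symm x) (e.symm y) (e.symm z) (e.symm u)
  mid a b t h0 h1 := by
    obtain ⟨y, h2, h3⟩ := hX.mid (e.symm a) (e.symm b) t h0 (by rwa [e.symm.dist_eq])
    refine ⟨e y, ?_, ?_⟩
    · rw [← e.symm.dist_eq, e.symm_apply_apply, h2]
    · rw [← e.symm.dist_eq, e.symm_apply_apply, h3, e.symm.dist_eq]

theorem isVertex_append {k : List ℕ → ℕ} {u v : List ℕ} :
    IsVertex k (u ++ v) ↔ IsVertex k u ∧ IsVertex (fun w => k (u ++ w)) v := by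
  induction u generalizing k with
  | nil => exact ⟨fun h => ⟨isVertex_nil _, h⟩, fun h => h.2⟩
  | cons a u ih => rw [List.cons_append, isVertex_cons, isVertex_cons, ih, and_assoc]; rfl

namespace GraftData

open Forest

variable {T : Type} [MetricSpace T] {ρ : T}

/-- The array of a grafted tree. -/
def tree (D : GraftData ρ) (p : Site ρ × ℕ) : Arr := fun u => D.2.2.2 (p.1, p.2, u)

/-- The typical realizations of the randomness, with finite grafted trees. -/
structure Fine (D : GraftData ρ) : Prop where
  good : D.Good
  finite : ∀ p, D.tree p ∈ Arr.finite

/-- The smallest colour above a vertex. -/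
noncomputable def minLabel (lam : ℝ) (D : GraftData ρ) (p : Site ρ × ℕ) (u : List ℕ) : ℝ≥0∞ :=
  treeMin (read ρ lam ((D.tree p).above u))

variable {D : GraftData ρ} {lam : ℝ}

theorem Fine.exists_leaf (hD : D.Fine) (p : Site ρ × ℕ) {u : List ℕ}
    (hu : IsVertex (D.offspring p.1 p.2) u) : ∃ v, u <+: v ∧ IsVertex (D.offspring p.1 p.2) v ∧
      D.offspring p.1 p.2 v = 0 ∧
        D.minLabel lam p u = ENNReal.ofReal (lam * D.color p.1 p.2 v) := by
  obtain ⟨v, h1, h2, h3⟩ := exists_leaf_treeMin (ρ := ρ) (lam := lam)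
    (Arr.above_finite (hD.finite p) hu)
  exact ⟨u ++ v, List.prefix_append _ _, isVertex_append.2 ⟨hu, h1⟩, h2, h3⟩

theorem Fine.minLabel_le (hD : D.Fine) (p : Site ρ × ℕ) {u v : List ℕ} (huv : u <+: v)
    (hv : IsVertex (D.offspring p.1 p.2) v) (h0 : D.offspring p.1 p.2 v = 0) :
    D.minLabel lam p u ≤ ENNReal.ofReal (lam * D.color p.1 p.2 v) := by
  obtain ⟨w, rfl⟩ := huv
  obtain ⟨hu, hw⟩ := isVertex_append.1 hv
  exact treeMin_read_le (Arr.above_finite (hD.finite p) hu) hw h0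

theorem Fine.minLabel_le_iff (hD : D.Fine) {s : ℝ} {t : ℝ≥0∞}
    (hst : ∀ c : unitInterval, (c : ℝ) ≤ s ↔ ENNReal.ofReal (lam * c) ≤ t) (p : Site ρ × ℕ)
    {u : List ℕ} (hu : IsVertex (D.offspring p.1 p.2) u) :
    D.minLabel lam p u ≤ t ↔ ∃ v, u <+: v ∧ D.IsBlackLeaf s p v := by
  constructor
  · intro h
    obtain ⟨v, h1, h2, h3, h4⟩ := hD.exists_leaf (lam := lam) p hu
    exact ⟨v, h1, h2, h3, (hst _).2 (h4.symm.trans_le h)⟩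
  · rintro ⟨v, h1, h2, h3, h4⟩
    exact (hD.minLabel_le p h1 h2 h3).trans ((hst _).1 h4)

/-- The label of an edge is λ times the colour of some leaf above it. Colours are distinct, so equal
labels mean a common leaf, and both edges lie on the path to that leaf. -/
theorem Fine.separates (hD : D.Fine) (hlam : 0 < lam) : D.Separates (D.minLabel lam) := by
  have key : ∀ (p q : Index D) (u v : List ℕ), IsVertex (D.offspring p.1.1 p.1.2) u →
      IsVertex (D.offspring q.1.1 q.1.2) v → D.minLabel lam p.1 u = D.minLabel lam q.1 v →
        p = q ∧ (u <+: v ∨ v <+: u) := by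
    intro p q u v hu hv h
    obtain ⟨u', h1, -, -, h2⟩ := hD.exists_leaf (lam := lam) p.1 hu
    obtain ⟨v', h3, -, -, h4⟩ := hD.exists_leaf (lam := lam) q.1 hv
    rw [h2, h4, ENNReal.ofReal_eq_ofReal_iff (mul_nonneg hlam.le (D.color _ _ u').2.1)
      (mul_nonneg hlam.le (D.color _ _ v').2.1)] at h
    have h5 := hD.good.color_inj (a₁ := (p.1.1, p.1.2, u')) (a₂ := (q.1.1, q.1.2, v'))
      (Subtype.ext (mul_left_cancel₀ hlam.ne' h))
    simp only [Prod.mk.injEq] at h5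
    obtain ⟨h6, h7, rfl⟩ := h5
    exact ⟨Subtype.ext (Prod.ext h6 h7), List.prefix_or_prefix_of_prefix h1 h3⟩
  exact ⟨fun p u v hu hv h => (key p p u v hu hv h).2,
    fun p q u v hpq hu hv h => hpq (key p q u v hu hv h).1⟩

theorem mem_treeSet_skeleton (t : ℝ≥0∞) (x : Ambient T ℝ≥0∞) :
    x ∈ treeSet t (skeleton lam D) ↔ x.path = 0 ∨ ∃ p : Index D, x.point = position D p.1.1 ∧
      x.path ∈ treePaths t (read ρ lam (D.tree p.1)) := by
  refine or_congr_right ⟨?_, ?_⟩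
  · rintro (⟨n, y, hy, h1, h2⟩ | ⟨_ | σ, h1, h2⟩)
    · simp only [skeleton, items_ofSeq, Set.mem_ofPred_eq] at hy
      obtain ⟨i, hi, rfl⟩ := hy
      simp only [siteForest, paths_ofSeq, mem_iUnion] at h2
      obtain ⟨j, hj, h2⟩ := h2
      exact ⟨⟨(.poisson n i, j), by simpa [count, hi] using hj⟩, h1, h2⟩
    · simp only [skeleton, siteForest, paths_ofSeq, mem_iUnion] at h2
      obtain ⟨j, hj, h2⟩ := h2
      exact ⟨⟨(.root, j), hj⟩, h1, h2⟩
    · simp only [skeleton, siteForest, paths_ofSeq, mem_iUnion] at h2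
      obtain ⟨j, hj, h2⟩ := h2
      exact ⟨⟨(.branch σ, j), hj⟩, h1, h2⟩
  · rintro ⟨⟨⟨σ, j⟩, hj⟩, h1, h2⟩
    cases σ with
    | poisson n i =>
      simp only [count] at hj
      split_ifs at hj with hi
      · refine Or.inl ⟨n, ((D.2.1 (n, i), 0, ⊤), siteForest lam D (.poisson n i)), ?_, h1, ?_⟩
        · simp only [skeleton, items_ofSeq]
          exact ⟨i, hi, rfl⟩
        · simp only [siteForest, paths_ofSeq, mem_iUnion]
          exact ⟨j, hj, h2⟩
      · simp at hj
    | branch σ =>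
      refine Or.inr ⟨some σ, h1, ?_⟩
      simp only [skeleton, siteForest, paths_ofSeq, mem_iUnion]
      exact ⟨j, hj, h2⟩
    | root =>
      refine Or.inr ⟨none, h1, ?_⟩
      simp only [skeleton, siteForest, paths_ofSeq, mem_iUnion]
      exact ⟨j, hj, h2⟩

theorem Fine.allWellFormed (hD : D.Fine) : AllWellFormed (skeleton lam D) := by
  have h : ∀ σ, WellFormed (siteForest lam D σ) := fun σ =>
    wellFormed_ofSeq fun j _ => wellFormed_read (hD.finite (σ, j))
  refine ⟨fun n y hy => ?_, ?_⟩
  · simp only [skeleton, items_ofSeq, Set.mem_ofPred_eq] at hy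
    obtain ⟨i, -, rfl⟩ := hy
    exact h _
  · rintro (_ | σ) <;> exact h _

theorem Fine.image_embed_black (hT : TreeLike T) (hD : D.Fine) {s : ℝ} {t : ℝ≥0∞}
    (hst : ∀ c : unitInterval, (c : ℝ) ≤ s ↔ ENNReal.ofReal (lam * c) ≤ t) :
    D.embed (D.minLabel lam) '' D.black s = treeSet t (skeleton lam D) := by
  ext x
  rw [mem_treeSet_skeleton]
  constructor
  · rintro ⟨y, hy, rfl⟩
    cases y with
    | base y => exact Or.inl rfl
    | piece p y hne =>
      refine Or.inr ⟨p, rfl, ?_⟩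
      rw [treePaths_read (hD.finite p.1)]
      have hpos : 0 < y.pos := by
        rcases y.mem with h | h
        · exact absurd (TreePoint_eq_root_of_pos h.2) hne
        · exact h.2.1
      exact ⟨y.word, y.pos, y.isVertex, hpos, y.pos_le, (hD.minLabel_le_iff hst p.1 y.isVertex).2
        ((hD.good.mem_black_iff hT p y hne).1 hy), rfl⟩
  · rintro (h | ⟨p, h1, h2⟩)
    · exact ⟨.base x.point, base_mem_black D s _, Ambient.ext rfl h.symm⟩
    · rw [treePaths_read (hD.finite p.1)] at h2
      obtain ⟨u, r, hu, h3, h4, h5, h6⟩ := h2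
      let y : Piece D p := ⟨u, r, Or.inr ⟨hu, h3, h4⟩⟩
      have hy : y ≠ TreePoint.root := fun h => h3.ne' (congrArg TreePoint.pos h)
      exact ⟨.piece p y hy, (hD.good.mem_black_iff hT p y hy).2
        ((hD.minLabel_le_iff hst p.1 hu).1 h5), Ambient.ext h1.symm h6.symm⟩

theorem Fine.exists_isometryEquiv (hT : TreeLike T) (hD : D.Fine) (hlam : 0 < lam) {s : ℝ}
    {t : ℝ≥0∞} (hst : ∀ c : unitInterval, (c : ℝ) ≤ s ↔ ENNReal.ofReal (lam * c) ≤ t) :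
    ∃ e : D.black s ≃ᵢ treeSet t (skeleton lam D),
      (e ⟨Graft.base ρ, base_mem_black D s ρ⟩ : Ambient T ℝ≥0∞) = ⟨ρ, 0⟩ := by
  have h := hD.image_embed_black hT hst
  have hi := (hD.separates hlam).isometry_embed
  refine ⟨IsometryEquiv.mk (Equiv.ofBijective
    (fun x => ⟨D.embed (D.minLabel lam) x.1, h ▸ mem_image_of_mem _ x.2⟩) ⟨?_, ?_⟩)
    (Isometry.of_dist_eq fun x y => hi.dist_eq x.1 y.1), rfl⟩
  · intro x y hxy
    exact Subtype.ext (hi.injective (congrArg Subtype.val hxy))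
  · rintro ⟨x, hx⟩
    rw [← h] at hx
    obtain ⟨y, hy, rfl⟩ := hx
    exact ⟨⟨y, hy⟩, rfl⟩

/-! ### Regularity of the colouring -/

/-- Colours matter only through which leaves are black, and within a given radius finitely many
vertices are involved. The limit realization may carry other colours, which is what left limits
require. -/
theorem Good.tendsto_blackClass (hT : IsDiscreteTree T ρ) {D' : GraftData ρ} (hD' : D'.Good)
    {s : ℝ} (hD : D.Good) {l : Filter ℝ} (h1 : D'.1 = D.1) (h2 : D'.2.1 = D.2.1)
    (h3 : D'.2.2.1 = D.2.2.1)
    (h4 : ∀ q, (D'.2.2.2 q).1 = (D.2.2.2 q).1 ∧ (D'.2.2.2 q).2.1 = (D.2.2.2 q).2.1 ∧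
      ∀ᶠ t in l, ((D'.2.2.2 q).2.2 : ℝ) ≤ t ↔ ((D.2.2.2 q).2.2 : ℝ) ≤ s) :
    Tendsto D'.blackClass l (𝓝 (D.blackClass s)) := by
  intro U hU
  obtain ⟨V, hVU, hV, hmem⟩ := mem_nhds_iff.1 hU
  obtain ⟨ε, hε, hεV⟩ := hV _ hmem
  obtain ⟨R, η, hη, h⟩ := hD.exists_delta_lt hT s hε
  have h5 : ∀ᶠ t in l, ∀ σ ∈ {σ : Site ρ | NearSite D.1 R σ}, ∀ j ∈ Iio (D.2.2.1 σ),
      ∀ u ∈ {u | IsVertex (D.offspring σ j) u},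
        (((D'.2.2.2 (σ, j, u)).2.2 : ℝ) ≤ t ↔ ((D.2.2.2 (σ, j, u)).2.2 : ℝ) ≤ s) :=
    (eventually_all_finite (finite_nearSite hT D.1 R)).2 fun σ _ =>
      (eventually_all_finite (finite_Iio _)).2 fun j _ =>
        (eventually_all_finite (hD.finite_vertices σ j)).2 fun u _ => (h4 (σ, j, u)).2.2
  refine Filter.mem_map.2 ?_
  filter_upwards [h5] with t ht
  refine hVU (hεV _ (h D' t hD' ⟨fun n _ => ?_, fun n _ i _ => ?_, fun σ _ => ?_,
    fun σ hσ j hj u hu => ?_⟩))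
  · simp only [toCode, h1]
  · simp only [toCode, h2, dist_self]; exact hη.le
  · simp only [toCode, h3]
  · refine ⟨(h4 _).1, ?_, ?_⟩
    · simp only [toCode, (h4 _).2.1, sub_self, abs_zero]; exact hη.le
    · simp only [toCode, decide_eq_decide]
      exact ht σ hσ j hj u hu

theorem Good.tendsto_blackClass_right (hT : IsDiscreteTree T ρ) (hD : D.Good) (s : ℝ) :
    Tendsto D.blackClass (𝓝[≥] s) (𝓝 (D.blackClass s)) := by
  refine hD.tendsto_blackClass hT hD rfl rfl rfl fun q => ⟨rfl, rfl, ?_⟩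
  by_cases h : ((D.2.2.2 q).2.2 : ℝ) ≤ s
  · filter_upwards [self_mem_nhdsWithin] with t ht
    exact ⟨fun _ => h, fun _ => h.trans ht⟩
  · filter_upwards [mem_nhdsWithin_of_mem_nhds (Iio_mem_nhds (not_le.1 h))] with t ht
    exact ⟨fun h' => absurd (h'.trans_lt ht) (lt_irrefl _), fun h' => absurd h' h⟩

open Classical in
/-- A recolouring that separates the colours less than `s` from the others. -/
noncomputable def recolor (s : ℝ) (c : unitInterval) : unitInterval :=
  if (c : ℝ) < s then ⟨c / 3, by constructor <;> linarith [c.2.1, c.2.2]⟩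
  else ⟨(c + 2) / 3, by constructor <;> linarith [c.2.1, c.2.2]⟩

theorem recolor_injective (s : ℝ) : Function.Injective (recolor s) := by
  intro c d h
  have h := congrArg Subtype.val h
  unfold recolor at h
  apply Subtype.ext
  split_ifs at h <;> simp only at h <;> linarith [c.2.1, c.2.2, d.2.1, d.2.2]

/-- The two classes of colours are mapped into [0, 1/3] and [2/3, 1], which the level 1/2 separates.
-/
theorem recolor_le (s : ℝ) (c : unitInterval) : (recolor s c : ℝ) ≤ 1 / 2 ↔ (c : ℝ) < s := by
  unfold recolor
  split_ifs with h
  · simp only [h, iff_true]; linarith [c.2.2]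
  · simp only [h, iff_false]; linarith [c.2.1]

/-- The limit is spanned by the leaves of colour strictly below s. Since black means at most a
level, the recolouring presents it as the black tree of another good realization at level 1/2. -/
theorem Good.exists_tendsto_blackClass_left (hT : IsDiscreteTree T ρ) (hD : D.Good) (s : ℝ) :
    ∃ L, Tendsto D.blackClass (𝓝[<] s) (𝓝 L) := by
  let D' : GraftData ρ := (D.1, D.2.1, D.2.2.1, fun q =>
    ((D.2.2.2 q).1, (D.2.2.2 q).2.1, recolor s (D.2.2.2 q).2.2))
  have hD' : D'.Good := ⟨hD.finite_vertices, hD.length_pos,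
    (recolor_injective s).comp hD.color_inj, hD.position_mem⟩
  refine ⟨D'.blackClass (1 / 2), hD.tendsto_blackClass hT hD' rfl rfl rfl fun q => ⟨rfl, rfl, ?_⟩⟩
  simp only [D', recolor_le]
  by_cases h : ((D.2.2.2 q).2.2 : ℝ) < s
  · filter_upwards [mem_nhdsWithin_of_mem_nhds (Ioi_mem_nhds h)] with t ht
    exact ⟨fun _ => h, fun _ => (mem_Ioi.1 ht).le⟩
  · filter_upwards [self_mem_nhdsWithin] with t ht
    exact ⟨fun h' => h'.trans_lt ht, fun h' => absurd h' h⟩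

end GraftData

end LevyForest

namespace LevyForest

/-! ### Couplings -/

section Coupling

theorem compProd_comap_map {X X' Y : Type} [MeasurableSpace X] [MeasurableSpace X']
    [MeasurableSpace Y] (P : Measure X) [IsProbabilityMeasure P] (κ : Kernel Y X')
    [IsMarkovKernel κ] {f : X → Y} (hf : Measurable f) :
    (P ⊗ₘ κ.comap f hf).map (Prod.map f id) = (P.map f) ⊗ₘ κ := by
  have := Measure.isProbabilityMeasure_map (μ := P) hf.aemeasurable
  ext s hs
  rw [Measure.map_apply (hf.prodMap measurable_id) hs,
    Measure.compProd_apply (hf.prodMap measurable_id hs), Measure.compProd_apply hs,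
    lintegral_map (Kernel.measurable_kernel_prodMk_left hs) hf]
  rfl

/-- Given x, draw the second variable from its conditional law under P' given that g takes the value
f x. Measurability of the event in `hE` transfers the almost sure identity. -/
theorem exists_kernel_coupling {X X' Y : Type} [MeasurableSpace X] [MeasurableSpace X']
    [MeasurableSpace Y] [StandardBorelSpace X'] {P : Measure X} {P' : Measure X'}
    [IsProbabilityMeasure P] [IsProbabilityMeasure P'] {f : X → Y} {g : X' → Y} (hf : Measurable f)
    (hg : Measurable g) (h : P.map f = P'.map g)
    (hE : MeasurableSet {x : Y × X' | x.1 = g x.2}) :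
    ∃ κ : Kernel X X', IsMarkovKernel κ ∧ (P ⊗ₘ κ).map Prod.snd = P' ∧
      ∀ᵐ x ∂(P ⊗ₘ κ), f x.1 = g x.2 := by
  have : Nonempty X' := nonempty_of_isProbabilityMeasure P'
  refine ⟨(condDistrib id g P').comap f hf, inferInstance, ?_⟩
  have key := compProd_comap_map P (condDistrib id g P') hf
  rw [h, compProd_map_condDistrib aemeasurable_id] at key
  constructor
  · have h1 := congrArg (Measure.map Prod.snd) key
    rw [Measure.map_map measurable_snd (hf.prodMap measurable_id),
      Measure.map_map measurable_snd (hg.prodMk measurable_id)] at h1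
    exact h1.trans Measure.map_id
  · have h1 : ∀ᵐ x ∂(P'.map fun a => (g a, id a)), x.1 = g x.2 :=
      (ae_map_iff (hg.prodMk measurable_id).aemeasurable hE).2 (ae_of_all _ fun _ => rfl)
    rw [← key] at h1
    exact ae_of_ae_map (hf.prodMap measurable_id).aemeasurable h1

/-- The Markov chain with initial law P 0 and the kernels of `exists_kernel_coupling`; the marginal
laws follow by induction. -/
theorem exists_chain_coupling {X Y : ℕ → Type} [∀ n, MeasurableSpace (X n)]
    [∀ n, MeasurableSpace (Y n)] [∀ n, StandardBorelSpace (X n)] {P : ∀ n, Measure (X n)}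
    [∀ n, IsProbabilityMeasure (P n)] {f : ∀ n, X n → Y n} {g : ∀ n, X (n + 1) → Y n}
    (hf : ∀ n, Measurable (f n)) (hg : ∀ n, Measurable (g n))
    (h : ∀ n, (P n).map (f n) = (P (n + 1)).map (g n))
    (hE : ∀ n, MeasurableSet {x : Y n × X (n + 1) | x.1 = g n x.2}) :
    ∃ Q : Measure (∀ n, X n), IsProbabilityMeasure Q ∧ (∀ n, Q.map (fun ω => ω n) = P n) ∧
      ∀ᵐ ω ∂Q, ∀ n, f n (ω n) = g n (ω (n + 1)) := by
  choose κ hκ hκ1 hκ2 using fun n => exists_kernel_coupling (hf n) (hg n) (h n) (hE n)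
  let e : ∀ n, (∀ i : Finset.Iic n, X i) → X n := fun n x => x ⟨n, Finset.mem_Iic.2 le_rfl⟩
  have he : ∀ n, Measurable (e n) := fun n => measurable_pi_apply _
  let Q := Kernel.trajMeasure (P 0) fun n => (κ n).comap (e n) (he n)
  have hstep : ∀ n, (Q.map fun ω => ω n) ⊗ₘ κ n = Q.map fun ω => (ω n, ω (n + 1)) := by
    intro n
    have h1 : Measurable (Preorder.frestrictLe (π := X) n) := by fun_prop
    have := Measure.isProbabilityMeasure_map (μ := Q) h1.aemeasurable
    have h2 := compProd_comap_map (Q.map (Preorder.frestrictLe n)) (κ n) (he n)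
    rw [Kernel.map_frestrictLe_trajMeasure_compProd_eq_map_trajMeasure,
      Measure.map_map ((he n).prodMap measurable_id) (h1.prodMk (measurable_pi_apply _)),
      Measure.map_map (he n) h1] at h2
    exact h2.symm
  have hmarg : ∀ n, Q.map (fun ω => ω n) = P n := by
    intro n
    induction n with
    | zero =>
      have h0 : Measurable fun ω : ∀ n, X n => ω 0 := measurable_pi_apply 0
      have h1 : Measurable (Preorder.frestrictLe (π := X) 0) := by fun_prop
      have h2 : (fun ω : ∀ n, X n => ω 0) = e 0 ∘ Preorder.frestrictLe 0 := rfl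
      rw [h2, ← Measure.map_map (he 0) h1]
      simp only [Q, Kernel.trajMeasure]
      rw [Measure.map_comp _ _ h1, Kernel.traj_map_frestrictLe, Kernel.partialTraj_self,
        Measure.id_comp]
      exact (Measure.map_map (he 0) (MeasurableEquiv.measurable _)).trans Measure.map_id
    | succ n ih =>
      rw [← hκ1 n, ← ih, hstep, Measure.map_map measurable_snd (by fun_prop)]
      rfl
  refine ⟨Q, inferInstance, hmarg, ae_all_iff.2 fun n => ?_⟩
  have h1 := hκ2 n
  rw [← hmarg n, hstep] at h1
  exact ae_of_ae_map (f := fun ω : ∀ n, X n => (ω n, ω (n + 1)))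
    (p := fun x => f n x.1 = g n x.2) (by fun_prop) h1

end Coupling

end LevyForest

namespace LevyForest

/-! ### Consistent families of trees -/

namespace GraftData

section Trees

variable {T : Type} [MetricSpace T] {ρ : T} {D D' : GraftData ρ} {lam lam' : ℝ}

theorem color_le_iff (hlam : 0 < lam) (μ : ℝ≥0) (c : unitInterval) :
    (c : ℝ) ≤ μ / lam ↔ ENNReal.ofReal (lam * c) ≤ μ := by
  rw [le_div_iff₀ hlam, ENNReal.ofReal_le_iff_le_toReal ENNReal.coe_ne_top, mul_comm]
  rfl

/-- The tree `F_μ`, in the ambient space. -/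
noncomputable def Fine.treeIn (hT : IsDiscreteTree T ρ) (hD : D.Fine) (hlam : 0 < lam) (μ : ℝ≥0) :
    TreeIn (Ambient T ℝ≥0∞) where
  carrier := treeSet μ (skeleton lam D)
  metric := inferInstance
  root := ⟨⟨ρ, 0⟩, Or.inl rfl⟩
  isRealTree := by
    obtain ⟨e, -⟩ := hD.exists_isometryEquiv hT.isRealTree.treeLike hlam (color_le_iff hlam μ)
    exact ((hD.good.treeLike_black hT.isRealTree.treeLike _).of_isometryEquiv e).isRealTree
  proper := by
    obtain ⟨e, -⟩ := hD.exists_isometryEquiv hT.isRealTree.treeLike hlam (color_le_iff hlam μ)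
    have := hD.good.properSpace_black hT (μ / lam)
    exact e.isometry.antilipschitz.properSpace e.continuous e.surjective

theorem Fine.toClass_treeIn (hT : IsDiscreteTree T ρ) (hD : D.Fine) (hlam : 0 < lam) (μ : ℝ≥0) :
    (hD.treeIn hT hlam μ).toClass = D.blackClass (μ / lam) := by
  obtain ⟨e, he⟩ := hD.exists_isometryEquiv hT.isRealTree.treeLike hlam (color_le_iff hlam μ)
  rw [hD.good.blackClass_eq hT]
  exact (Quotient.sound (s := RootedTree.setoid) ⟨e, Subtype.ext he⟩).symm

/-- The class of a black tree is determined by its set of points in the ambient space, whichever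
data and level produced this set. -/
theorem Fine.blackClass_congr (hT : IsDiscreteTree T ρ) (hD : D.Fine) (hD' : D'.Fine)
    (hlam : 0 < lam) (hlam' : 0 < lam') {μ : ℝ≥0}
    (h : treeSet μ (skeleton lam D) = treeSet μ (skeleton lam' D')) :
    D.blackClass (μ / lam) = D'.blackClass (μ / lam') := by
  rw [← hD.toClass_treeIn hT hlam, ← hD'.toClass_treeIn hT hlam']
  simp only [TreeIn.toClass, treeIn]
  generalize_proofs h1 h2 h3 h4 h5 h6
  revert h1 h2 h3
  rw [h]
  intros
  rfl

/-- The realizations at the successive integer levels are obtained from each other by pruning. -/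
def Consistent (ω : ℕ → GraftData ρ) : Prop :=
  ∀ n : ℕ, skeleton (n + 1 : ℝ) (ω n) =
    pruneAll (ENNReal.ofReal (n + 1)) (skeleton ((n + 1 : ℕ) + 1 : ℝ) (ω (n + 1)))

theorem Consistent.treeSet_eq {ω : ℕ → GraftData ρ} (hω : Consistent ω) (hf : ∀ n, (ω n).Fine)
    {μ : ℝ≥0} {k m : ℕ} (hk : μ ≤ k + 1) (hm : μ ≤ m + 1) :
    treeSet μ (skeleton (k + 1 : ℝ) (ω k)) = treeSet μ (skeleton (m + 1 : ℝ) (ω m)) := by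
  wlog hkm : k ≤ m
  · exact (this hω hf hm hk (le_of_not_ge hkm)).symm
  induction m, hkm using Nat.le_induction with
  | base => rfl
  | succ m hkm ih =>
    have h : μ ≤ m + 1 := hk.trans (by gcongr)
    rw [ih h, hω m, treeSet_pruneAll (hf _).allWellFormed ENNReal.ofReal_ne_top]
    rw [ENNReal.ofReal, ENNReal.coe_le_coe]
    refine h.trans (le_of_eq ?_)
    rw [Real.toNNReal_add (by positivity) zero_le_one]
    simp

end Trees

section Law

variable {T : Type} [MetricSpace T] [MeasurableSpace T] [BorelSpace T] {ρ : T}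
  {ψ : BranchingMechanism} {a : ℝ≥0} {lam : ℝ}

/-- Passing to a measurable set of full measure makes every realization fine, so the trees F_μ are
defined everywhere and not just almost surely. -/
theorem exists_fine_measure (hψ : ∃ c : ℝ, 0 < c ∧ 0 < ψ c)
    (hm : DifferentiableWithinAt ℝ ψ (Ici 0) 0) (hlam : 0 < lam) (hT : IsDiscreteTree T ρ) :
    ∃ (G : Set (GraftData ρ)) (P : Measure G), MeasurableSet G ∧ (∀ D ∈ G, D.Fine) ∧
      IsProbabilityMeasure P ∧ P.map Subtype.val = graftLaw ψ a 0 lam ρ := by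
  have : Nonempty T := ⟨ρ⟩
  have hP := isProbabilityMeasure_graftLaw (a := a) hψ hm hlam hT
  have h1 : ∀ᵐ D ∂graftLaw ψ a 0 lam ρ, D.Fine := by
    filter_upwards [ae_good (a := a) hψ hm hlam hT] with D hD
    exact ⟨hD.1, fun p => hD.2 p.1 p.2⟩
  let G := (toMeasurable (graftLaw ψ a 0 lam ρ) {D | ¬ D.Fine})ᶜ
  have hG : MeasurableSet G := (measurableSet_toMeasurable _ _).compl
  have hG1 : ∀ᵐ D ∂graftLaw ψ a 0 lam ρ, D ∈ G := by
    rw [ae_iff]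
    rw [show {D | ¬ D ∈ G} = toMeasurable (graftLaw ψ a 0 lam ρ) {D | ¬ D.Fine} from compl_compl _,
      measure_toMeasurable]
    exact ae_iff.1 h1
  have hmap : ((graftLaw ψ a 0 lam ρ).comap (Subtype.val : G → GraftData ρ)).map Subtype.val =
      graftLaw ψ a 0 lam ρ := by
    rw [map_comap_subtype_coe hG, Measure.restrict_eq_self_of_ae_mem hG1]
  refine ⟨G, (graftLaw ψ a 0 lam ρ).comap Subtype.val, hG, fun D hD => ?_, ⟨?_⟩, hmap⟩
  · by_contra h
    exact hD (subset_toMeasurable _ _ h)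
  · rw [← preimage_univ (f := (Subtype.val : G → GraftData ρ)),
      ← Measure.map_apply measurable_subtype_coe .univ, hmap, measure_univ]

theorem standardBorelSpace_graftData (hT : IsDiscreteTree T ρ) :
    StandardBorelSpace (GraftData ρ) := by
  have := hT.proper
  have := hT.countable_site
  have h1 : StandardBorelSpace T := inferInstance
  have h2 : StandardBorelSpace (ℕ × ℕ → T) := inferInstance
  have h3 : StandardBorelSpace (Site ρ → ℕ) := inferInstance
  have h4 : StandardBorelSpace (ℕ × ℝ≥0 × unitInterval) := inferInstance
  have h5 : StandardBorelSpace (Site ρ × ℕ × List ℕ → ℕ × ℝ≥0 × unitInterval) := inferInstance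
  infer_instance

variable [Nonempty T]

theorem measurable_pruneAll (t : ℝ≥0∞) :
    Measurable (pruneAll t : (Comp ρ → Forest (Mark T)) → _) := by
  refine measurable_pi_lambda _ fun c => ?_
  simp_rw [pruneAll_apply]
  exact (measurable_pruneComp t c).comp (measurable_pi_apply c)

theorem measurableSet_skeleton_eq (hT : IsDiscreteTree T ρ) {X : Type} [MeasurableSpace X]
    {g : X → Comp ρ → Forest (Mark T)} (hg : Measurable g) :
    MeasurableSet {x : (Comp ρ → Forest (Mark T)) × X | x.1 = g x.2} := by
  have := hT.proper
  have := hT.countable_branchPoints.to_subtype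
  simp only [funext_iff, Set.ofPred_forall]
  exact MeasurableSet.iInter fun c => Forest.measurableSet_eq_fun
    ((measurable_pi_apply c).comp measurable_fst)
    ((measurable_pi_apply c).comp (hg.comp measurable_snd))

theorem map_fine_skeleton (hψ : ∃ c : ℝ, 0 < c ∧ 0 < ψ c)
    (hm : DifferentiableWithinAt ℝ ψ (Ici 0) 0) {μ : ℝ} (hμ : 0 < μ) (h : μ < lam)
    (hT : IsDiscreteTree T ρ)
    (hbr : ∀ σ ∈ branchPoints ρ, ∃ d : ℝ, d ≠ 0 ∧
      Tendsto (ψ.der ((degree σ).toNat - 1)) (𝓝[>] (ψ.inv 0)) (𝓝 d))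
    {G G' : Set (GraftData ρ)} {P : Measure G} {P' : Measure G'}
    (hP : P.map Subtype.val = graftLaw ψ a 0 μ ρ) (hP' : P'.map Subtype.val = graftLaw ψ a 0 lam ρ) :
    P.map (fun D => skeleton μ D.1) =
      P'.map fun D => pruneAll (ENNReal.ofReal μ) (skeleton lam D.1) := by
  have h1 := map_skeleton_prune (a := a) hψ hm hμ h hT hbr
  rw [← hP, ← hP', Measure.map_map (measurable_skeleton μ) measurable_subtype_coe,
    Measure.map_map (measurable_skeleton lam) measurable_subtype_coe,
    Measure.map_map (measurable_pruneAll _)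
      ((measurable_skeleton lam).comp measurable_subtype_coe)] at h1
  exact h1.symm

/-- Under the coupling in which the skeleton of level λ is the pruning of that of level λ', the two
families of classes coincide almost surely. A coupling is used because measurability of the classes
was shown in terms of the data, not of the skeleton. -/
theorem map_blackClass_eq (hψ : ∃ c : ℝ, 0 < c ∧ 0 < ψ c)
    (hm : DifferentiableWithinAt ℝ ψ (Ici 0) 0) {lam' : ℝ} {lam : ℝ≥0} (hlam : 0 < lam)
    (h : lam < lam') (hT : IsDiscreteTree T ρ)
    (hbr : ∀ σ ∈ branchPoints ρ, ∃ d : ℝ, d ≠ 0 ∧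
      Tendsto (ψ.der ((degree σ).toNat - 1)) (𝓝[>] (ψ.inv 0)) (𝓝 d))
    {G G' : Set (GraftData ρ)} (hG : ∀ D ∈ G, D.Fine) (hG' : ∀ D ∈ G', D.Fine)
    (hmG' : MeasurableSet G') {P : Measure G} {P' : Measure G'} [IsProbabilityMeasure P]
    [IsProbabilityMeasure P'] (hP : P.map Subtype.val = graftLaw ψ a 0 lam ρ)
    (hP' : P'.map Subtype.val = graftLaw ψ a 0 lam' ρ) :
    P.map (fun D (μ : Icc (0 : ℝ≥0) lam) => D.1.blackClass ((μ : ℝ≥0) / lam)) =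
      P'.map fun D (μ : Icc (0 : ℝ≥0) lam) => D.1.blackClass ((μ : ℝ≥0) / lam') := by
  have hlam0 : (0 : ℝ) < lam := hlam
  have := standardBorelSpace_graftData hT
  have := hmG'.standardBorel
  obtain ⟨κ, hκ, h1, h2⟩ := exists_kernel_coupling (P := P) (P' := P')
    ((measurable_skeleton lam).comp measurable_subtype_coe)
    ((measurable_pruneAll (ENNReal.ofReal lam)).comp
      ((measurable_skeleton lam').comp measurable_subtype_coe))
    (map_fine_skeleton hψ hm hlam0 h hT hbr hP hP')
    (measurableSet_skeleton_eq hT ((measurable_pruneAll (ENNReal.ofReal lam)).comp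
      ((measurable_skeleton lam').comp measurable_subtype_coe)))
  have m1 : Measurable fun (D : G) (μ : Icc (0 : ℝ≥0) lam) => D.1.blackClass ((μ : ℝ≥0) / lam) :=
    measurable_pi_lambda _ fun μ => measurable_blackClass hT _ fun D hD => (hG D hD).good
  have m2 : Measurable fun (D : G') (μ : Icc (0 : ℝ≥0) lam) => D.1.blackClass ((μ : ℝ≥0) / lam') :=
    measurable_pi_lambda _ fun μ => measurable_blackClass hT _ fun D hD => (hG' D hD).good
  have e1 : P = (P ⊗ₘ κ).map Prod.fst := (Measure.fst_compProd P κ).symm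
  conv_lhs => rw [e1]
  rw [← h1, Measure.map_map m1 measurable_fst, Measure.map_map m2 measurable_snd]
  refine Measure.map_congr ?_
  filter_upwards [h2] with x hx
  funext μ
  refine (hG _ x.1.2).blackClass_congr hT (hG' _ x.2.2) hlam0 (hlam0.trans h) ?_
  have hx : skeleton lam x.1.1 = pruneAll (ENNReal.ofReal lam) (skeleton lam' x.2.1) := hx
  rw [hx, treeSet_pruneAll (hG' _ x.2.2).allWellFormed ENNReal.ofReal_ne_top]
  rw [ENNReal.ofReal_coe_nnreal, ENNReal.coe_le_coe]
  exact μ.2.2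

end Law

end GraftData

end LevyForest

theorem mainTheorem6 (ψ : LevyForest.BranchingMechanism)
    (hψ : ∃ c : ℝ, 0 < c ∧ 0 < ψ c)
    (hm : DifferentiableWithinAt ℝ ψ (Ici 0) 0)
    (a : ℝ≥0) (T : Type) [MetricSpace T] [MeasurableSpace T] [BorelSpace T] (ρ : T)
    (hT : LevyForest.IsDiscreteTree T ρ)
    (hbr : ∀ σ ∈ LevyForest.branchPoints ρ, ∃ d : ℝ, d ≠ 0 ∧
      Tendsto (ψ.der ((LevyForest.degree σ).toNat - 1)) (𝓝[>] (ψ.inv 0)) (𝓝 d)) :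
    ∃ (Ω : Type) (_ : MeasurableSpace Ω) (P : Measure Ω) (_ : IsProbabilityMeasure P)
      (E : Type) (r : E) (F : ℝ≥0 → Ω → LevyForest.TreeIn E),
      (∀ lam ω, ((F lam ω).root : E) = r) ∧
      (∀ lam, Measurable fun ω => (F lam ω).toClass) ∧
      (∀ᵐ ω ∂P,
        (∀ μ lam : ℝ≥0, μ ≤ lam → ∃ h : (F μ ω).carrier ⊆ (F lam ω).carrier,
          ∀ x y : (F μ ω).carrier,
            (F μ ω).treeDist x y = (F lam ω).treeDist (Set.inclusion h x) (Set.inclusion h y)) ∧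
        (∀ lam : ℝ≥0,
          ContinuousWithinAt (fun μ => (F μ ω).toClass) (Ici lam) lam ∧
          ∃ L : LevyForest.TreeClass, Tendsto (fun μ => (F μ ω).toClass) (𝓝[<] lam) (𝓝 L))) ∧
      (∀ lam : ℝ≥0, 0 < lam →
        IdentDistrib
          (fun (ω : Ω) (μ : Icc (0 : ℝ≥0) lam) => (F μ ω).toClass)
          (fun (D : LevyForest.GraftData ρ) (μ : Icc (0 : ℝ≥0) lam) =>
            LevyForest.GraftData.blackClass D ((μ : ℝ≥0) / lam))
          P (LevyForest.graftLaw ψ a 0 lam ρ)) := by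
  have : Nonempty T := ⟨ρ⟩
  have hpos : ∀ n : ℕ, (0 : ℝ) < n + 1 := fun n => n.cast_add_one_pos
  have hB := LevyForest.GraftData.standardBorelSpace_graftData hT
  choose G P hmG hG hprob hP using fun n : ℕ =>
    LevyForest.GraftData.exists_fine_measure (a := a) hψ hm (hpos n) hT
  have hS : ∀ n, StandardBorelSpace (G n) := fun n => (hmG n).standardBorel
  have hg : ∀ n : ℕ, Measurable fun D : G (n + 1) => LevyForest.pruneAll (ENNReal.ofReal (n + 1))
      (LevyForest.skeleton ((n + 1 : ℕ) + 1 : ℝ) D.1) := fun n =>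
    (LevyForest.GraftData.measurable_pruneAll _).comp
      ((LevyForest.measurable_skeleton _).comp measurable_subtype_coe)
  -- The n-th term of the chain is a realization of level n + 1, so that all levels are positive.
  obtain ⟨Q, hQ, hQP, hQc⟩ := LevyForest.exists_chain_coupling (P := P)
    (f := fun n D => LevyForest.skeleton (n + 1 : ℝ) D.1)
    (fun n => (LevyForest.measurable_skeleton _).comp measurable_subtype_coe) hg
    (fun n => LevyForest.GraftData.map_fine_skeleton hψ hm (hpos n)
      (by push_cast; linarith) hT hbr (hP n) (hP (n + 1)))
    (fun n => LevyForest.GraftData.measurableSet_skeleton_eq hT (hg n))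
  have hfine : ∀ (ω : ∀ n, G n) (n : ℕ), (ω n).1.Fine := fun ω n => hG n _ (ω n).2
  have hceil : ∀ μ : ℝ≥0, μ ≤ (⌈μ⌉₊ : ℝ≥0) + 1 := fun μ =>
    (Nat.le_ceil μ).trans (le_add_of_nonneg_right zero_le_one)
  -- The realization with index ⌈μ⌉₊ has level ⌈μ⌉₊ + 1, strictly above μ.
  let F : ℝ≥0 → (∀ n, G n) → LevyForest.TreeIn (LevyForest.Ambient T ℝ≥0∞) := fun μ ω =>
    (hfine ω ⌈μ⌉₊).treeIn hT (hpos ⌈μ⌉₊) μ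
  have hF : ∀ (μ : ℝ≥0) ω, (F μ ω).toClass = (ω ⌈μ⌉₊).1.blackClass (μ / (⌈μ⌉₊ + 1)) :=
    fun μ ω => LevyForest.GraftData.Fine.toClass_treeIn hT _ _ _
  -- For a consistent sequence any level above μ gives the same set of points, which yields the
  -- inclusions and the restriction of the metric.
  have hset : ∀ ω : ∀ n, G n, LevyForest.GraftData.Consistent (fun n => (ω n).1) →
      ∀ (μ : ℝ≥0) (m : ℕ), μ ≤ m + 1 →
        (F μ ω).carrier = LevyForest.treeSet μ (LevyForest.skeleton (m + 1 : ℝ) (ω m).1) :=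
    fun ω hω μ m hμ => hω.treeSet_eq (hfine ω) (hceil μ) hμ
  have hclass : ∀ ω : ∀ n, G n, LevyForest.GraftData.Consistent (fun n => (ω n).1) →
      ∀ (μ : ℝ≥0) (m : ℕ), μ ≤ m + 1 →
        (F μ ω).toClass = (ω m).1.blackClass (μ / (m + 1)) := fun ω hω μ m hμ => by
    rw [hF]
    exact (hfine ω _).blackClass_congr hT (hfine ω m) (hpos _) (hpos m) (hset ω hω μ m hμ)
  have hmF : ∀ μ, Measurable fun ω => (F μ ω).toClass := fun μ => by
    simp_rw [hF]
    exact (LevyForest.GraftData.measurable_blackClass hT _ fun D hD => (hG _ D hD).good).comp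
      (measurable_pi_apply _)
  refine ⟨∀ n, G n, inferInstance, Q, hQ, LevyForest.Ambient T ℝ≥0∞, ⟨ρ, 0⟩, F, fun _ _ => rfl,
    hmF, ?_, fun lam hlam => ?_⟩
  · filter_upwards [hQc] with ω hω
    refine ⟨fun μ lam h => ⟨?_, fun x y => rfl⟩, fun lam => ?_⟩
    · rw [hset ω hω μ ⌈lam⌉₊ (h.trans (hceil lam))]
      exact LevyForest.treeSet_mono (ENNReal.coe_le_coe.2 h) _
    -- As this inequality is strict, one realization serves for all μ near `lam`, and the regularity
    -- of its black classes carries over.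
    · have hlt : lam < (⌈lam⌉₊ : ℝ≥0) + 1 := (Nat.le_ceil lam).trans_lt (lt_add_one _)
      have hev : ∀ᶠ μ in 𝓝 lam, (F μ ω).toClass =
          (ω ⌈lam⌉₊).1.blackClass ((μ : ℝ) / (⌈lam⌉₊ + 1)) := by
        filter_upwards [Iio_mem_nhds hlt] with μ hμ
        exact hclass ω hω μ _ (mem_Iio.1 hμ).le
      have hc : Continuous fun μ : ℝ≥0 => (μ : ℝ) / (⌈lam⌉₊ + 1) := by fun_prop
      have hgood := (hfine ω ⌈lam⌉₊).good
      constructor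
      · rw [ContinuousWithinAt, hF]
        refine ((hgood.tendsto_blackClass_right hT _).comp (tendsto_nhdsWithin_iff.2
          ⟨hc.continuousWithinAt, ?_⟩)).congr' ?_
        · filter_upwards [self_mem_nhdsWithin] with μ hμ
          exact div_le_div_of_nonneg_right (NNReal.coe_le_coe.2 hμ) (hpos _).le
        · filter_upwards [mem_nhdsWithin_of_mem_nhds hev] with μ hμ
          exact hμ.symm
      · obtain ⟨L, hL⟩ := hgood.exists_tendsto_blackClass_left hT ((lam : ℝ) / (⌈lam⌉₊ + 1))
        refine ⟨L, (hL.comp (tendsto_nhdsWithin_iff.2 ⟨hc.continuousWithinAt, ?_⟩)).congr' ?_⟩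
        · filter_upwards [self_mem_nhdsWithin] with μ hμ
          exact div_lt_div_of_pos_right (NNReal.coe_lt_coe.2 hμ) (hpos _)
        · filter_upwards [mem_nhdsWithin_of_mem_nhds hev] with μ hμ
          exact hμ.symm
  · obtain ⟨G', P', hmG', hG', hP', hPG⟩ := LevyForest.GraftData.exists_fine_measure (a := a) hψ hm
      (lam := lam) (NNReal.coe_pos.2 hlam) hT
    have hlt : (lam : ℝ) < ⌈lam⌉₊ + 1 := by
      exact_mod_cast (Nat.le_ceil lam).trans_lt (lt_add_one _)
    have m1 : Measurable fun (D : G') (μ : Icc (0 : ℝ≥0) lam) =>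
        D.1.blackClass ((μ : ℝ≥0) / lam) :=
      measurable_pi_lambda _ fun μ =>
        LevyForest.GraftData.measurable_blackClass hT _ fun D hD => (hG' D hD).good
    have m2 : Measurable fun (D : G ⌈lam⌉₊) (μ : Icc (0 : ℝ≥0) lam) =>
        D.1.blackClass ((μ : ℝ≥0) / (⌈lam⌉₊ + 1)) :=
      measurable_pi_lambda _ fun μ =>
        LevyForest.GraftData.measurable_blackClass hT _ fun D hD => (hG _ D hD).good
    -- The black class is known to be measurable only on the set of fine realizations, which has
    -- full measure.
    have m3 : AEMeasurable (fun (D : LevyForest.GraftData ρ) (μ : Icc (0 : ℝ≥0) lam) =>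
        D.blackClass ((μ : ℝ≥0) / lam)) (LevyForest.graftLaw ψ a 0 lam ρ) := by
      rw [← hPG]
      exact (MeasurableEmbedding.subtype_coe hmG').aemeasurable_map_iff.2 m1.aemeasurable
    have m4 : Measurable fun (ω : ∀ n, G n) (μ : Icc (0 : ℝ≥0) lam) => (F μ ω).toClass :=
      measurable_pi_lambda _ fun μ => hmF μ
    have m5 : Measurable fun ω : ∀ n, G n => ω ⌈lam⌉₊ := measurable_pi_apply _
    refine ⟨m4.aemeasurable, m3, ?_⟩
    -- The level ⌈lam⌉₊ + 1, from which F is read up to `lam`, is compared with the level `lam`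
    -- itself.
    have key := LevyForest.GraftData.map_blackClass_eq hψ hm hlam hlt hT hbr hG' (hG _) (hmG _)
      hPG (hP ⌈lam⌉₊)
    rw [← hPG] at m3 ⊢
    rw [AEMeasurable.map_map_of_aemeasurable m3 measurable_subtype_coe.aemeasurable]
    refine Eq.trans ?_ key.symm
    rw [← hQP ⌈lam⌉₊, Measure.map_map m2 m5]
    refine Measure.map_congr ?_
    filter_upwards [hQc] with ω hω
    funext μ
    exact hclass ω hω μ _ (μ.2.2.trans (hceil lam))
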